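/- A planar embedded graph is a finite simple planar graph given together with one of its planar embeddings, i.e. with the counterclockwise cyclic order of the edges around each vertex (the outer face is not fixed); the degree of a face is the length of its boundary walk. A unit-length rectangular drawing is a planar drawing in which every edge is a horizontal or vertical segment of length $1$, every bounded face is the interior of a (non-degenerate) axis-parallel rectangle, and the outer face is the exterior of such a rectangle. The problem URFE asks whether a given planar embedded graph has a unit-length rectangular drawing that preserves the embedding, i.e. in which the counterclockwise order of the edges around each vertex is the prescribed one. **Theorem 5.** There is an algorithm (a program for a random access machine with words of $O(\log n)$ bits, the input being a doubly connected edge list) that solves URFE for every planar embedded graph $G$ with $n$ vertices in $O(n^3)$ time, and that runs in $O(n)$ time if all but at most one face of $G$ have degree at most $6$ (and also whenever $G$ is disconnected). Moreover, if $G$ is not a simple cycle of even length, then in every embedding-preserving unit-length rectangular drawing of $G$ the outer face is the unique face of maximum degree. -/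

import Mathlib

open Filter Topology

/-! ## Planar embedded graphs -/

/-- A planar embedded graph on the vertices `0, …, n - 1`: a finite simple graph together with the
counterclockwise cyclic order of the edges around each vertex (a rotation system) that is planar.
A dart is an edge with a direction; `rot d` is the dart that follows `d` in counterclockwise order
around the start vertex of `d`. The graph may be disconnected, and its outer face is not fixed. -/
structure PlanarEmbeddedGraph (n : ℕ) where
  /-- the underlying simple graph -/
  graph : SimpleGraph (Fin n)
  /-- the next dart, counterclockwise, around the start vertex -/
  rot : Equiv.Perm graph.Dart
  rot_fst : ∀ d, (rot d).fst = d.fst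
  rot_cyclic : ∀ d d', d.fst = d'.fst → rot.SameCycle d d'
  /-- The rotation system is planar: every connected component satisfies Euler's formula
  `V - E + F = 2`. (No component exceeds the value `2`, so this is expressed by the sum over the
  components. Facial walks are the cycles of the permutation `d ↦ rot⁻¹ d.symm`; a component that is
  a single vertex has one face as well, whose boundary walk has no darts.) -/
  euler :
    n + (Nat.card (Quotient (Equiv.Perm.SameCycle.setoid
            ((SimpleGraph.Dart.symm_involutive (G := graph)).toPerm.trans rot.symm)))
          + Nat.card {v : Fin n // ∀ w, ¬ graph.Adj v w})
      = Nat.card graph.edgeSet + 2 * Nat.card graph.ConnectedComponent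

namespace PlanarEmbeddedGraph

variable {n : ℕ} (G : PlanarEmbeddedGraph n)

/-- The dart that follows `d` on the boundary of the face to the left of `d`: at the end vertex of
`d`, it is the first dart in clockwise order after the reversal of `d`. -/
def faceNext : Equiv.Perm G.graph.Dart :=
  (SimpleGraph.Dart.symm_involutive (G := G.graph)).toPerm.trans G.rot.symm

theorem faceNext_apply (d : G.graph.Dart) : G.faceNext d = G.rot.symm d.symm := rfl

/-- The faces of the embedding (as facial walks with at least one edge): every dart `d` lies on the
boundary walk of exactly one face, the one to its left. -/
abbrev Face : Type := Quotient (Equiv.Perm.SameCycle.setoid G.faceNext)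

/-- The face to the left of a dart. -/
def leftFace (d : G.graph.Dart) : G.Face := Quotient.mk _ d

/-- The degree (length) of a face: the number of edges of its boundary walk, an edge that is
traversed in both directions being counted twice. -/
noncomputable def degree (f : G.Face) : ℕ := Nat.card {d : G.graph.Dart // G.leftFace d = f}

/-- The graph is a simple cycle with an even number of vertices. -/
def IsEvenCycle : Prop :=
  3 ≤ n ∧ Even n ∧ Nonempty (G.graph ≃g SimpleGraph.cycleGraph n)

/-! ## Unit-length rectangular drawings

The plane is `ℂ`. All drawings below are rectilinear, so that a drawing is determined by the
positions `p` of the vertices, every edge being the straight-line segment between its ends. -/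

/-- The set of all points of the drawing: the vertices and the edges. -/
def drawn (p : Fin n → ℂ) : Set ℂ :=
  Set.range p ∪ ⋃ d : G.graph.Dart, segment ℝ (p d.fst) (p d.snd)

/-- A face of the drawing: a connected component of the complement of the drawing. -/
def IsRegion (p : Fin n → ℂ) (R : Set ℂ) : Prop :=
  ∃ z ∈ (G.drawn p)ᶜ, R = connectedComponentIn (G.drawn p)ᶜ z

/-- The vector from the start to the end of a dart in the drawing. -/
def vec (p : Fin n → ℂ) (d : G.graph.Dart) : ℂ := p d.snd - p d.fst

/-- `p` is a planar drawing with horizontal and vertical edges, all of unit length. -/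
structure IsUnitLengthRectilinear (p : Fin n → ℂ) : Prop where
  injective : Function.Injective p
  unit_length : ∀ u v, G.graph.Adj u v → ‖p v - p u‖ = 1
  rectilinear : ∀ u v, G.graph.Adj u v → (p u).re = (p v).re ∨ (p u).im = (p v).im
  vertex_edge : ∀ u v w, G.graph.Adj u v → p w ∈ segment ℝ (p u) (p v) → w = u ∨ w = v
  edge_edge : ∀ u v w x, G.graph.Adj u v → G.graph.Adj w x → s(u, v) ≠ s(w, x) →
    segment ℝ (p u) (p v) ∩ segment ℝ (p w) (p x) ⊆ {p u, p v} ∩ {p w, p x}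

/-- Every face of the drawing is drawn as a rectangle: the bounded faces are interiors of
(non-degenerate, axis-parallel) rectangles, the outer face is the exterior of a rectangle. -/
def IsRectangular (p : Fin n → ℂ) : Prop :=
  ∀ R, G.IsRegion p R →
    ∃ a b c d : ℝ, a < b ∧ c < d ∧
      ((Bornology.IsBounded R ∧ R = Set.Ioo a b ×ℂ Set.Ioo c d) ∨
        (¬ Bornology.IsBounded R ∧ R = (Set.Icc a b ×ℂ Set.Icc c d)ᶜ))

/-- The drawing (with horizontal and vertical edges) preserves the embedding: around each vertex,
the counterclockwise order of the darts in the drawing is the one given by `rot`, i.e. `rot d` is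
the first dart met when `d` is turned counterclockwise around its start vertex by one, two, three
or four quarter turns. -/
def PreservesEmbedding (p : Fin n → ℂ) : Prop :=
  ∀ d : G.graph.Dart, ∃ q : ℕ, 1 ≤ q ∧ q ≤ 4 ∧
    G.vec p (G.rot d) = Complex.I ^ q * G.vec p d ∧
    ∀ r : ℕ, 1 ≤ r → r < q →
      ∀ d' : G.graph.Dart, d'.fst = d.fst → G.vec p d' ≠ Complex.I ^ r * G.vec p d

/-- `p` is a unit-length rectangular embedding-preserving drawing of `G`. (A disconnected graph has
no rectangular drawing, so the relative positions of the components play no role here.) -/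
structure IsUnitRectangularDrawing (p : Fin n → ℂ) : Prop where
  unit_rectilinear : G.IsUnitLengthRectilinear p
  rectangular : G.IsRectangular p
  preserves : G.PreservesEmbedding p

/-- `G` is a positive instance of the problem URFE. -/
def URFE : Prop := ∃ p : Fin n → ℂ, G.IsUnitRectangularDrawing p

/-- The face `f` of the embedding is the outer face of the drawing: immediately to the left of each
dart on the boundary walk of `f`, next to its midpoint, there is an unbounded face of the
drawing. -/
def IsOuterFace (p : Fin n → ℂ) (f : G.Face) : Prop :=
  ∀ d : G.graph.Dart, G.leftFace d = f →
    ∃ R, G.IsRegion p R ∧ ¬ Bornology.IsBounded R ∧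
      ∀ᶠ ε : ℝ in 𝓝[>] 0, p d.fst + (1 / 2 + ε * Complex.I) * G.vec p d ∈ R

end PlanarEmbeddedGraph

/-! ## Random access machines -/

/-- The state of a random access machine: registers and arrays of natural numbers. A given program
names only finitely many registers and finitely many arrays. -/
structure RAMState where
  /-- contents of the registers -/
  reg : ℕ → ℕ
  /-- `arr a i` is the entry with index `i` of array `a` -/
  arr : ℕ → ℕ → ℕ

namespace RAMState

/-- Write `x` into register `r`. -/
def setReg (s : RAMState) (r x : ℕ) : RAMState :=
  { s with reg := Function.update s.reg r x }

/-- Write `x` into array `a` at index `i`. -/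
def setArr (s : RAMState) (a i x : ℕ) : RAMState :=
  { s with arr := Function.update s.arr a (Function.update (s.arr a) i x) }

end RAMState

/-- Programs of the random access machine, with registers `r`, `x`, `y` and array names `a`. -/
inductive RAMProg : Type
  | skip : RAMProg
  /-- `r := k` for a constant `k` -/
  | const (r k : ℕ) : RAMProg
  /-- `r := x` -/
  | move (r x : ℕ) : RAMProg
  /-- `r := x + y` -/
  | add (r x y : ℕ) : RAMProg
  /-- `r := max (x - y) 0` -/
  | sub (r x y : ℕ) : RAMProg
  /-- `r := x * y` -/
  | mul (r x y : ℕ) : RAMProg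
  /-- `r := a[x]` -/
  | load (r a x : ℕ) : RAMProg
  /-- `a[x] := y` -/
  | store (a x y : ℕ) : RAMProg
  | seq (P Q : RAMProg) : RAMProg
  /-- if `x < y` then `P` else `Q` -/
  | ite (x y : ℕ) (P Q : RAMProg) : RAMProg
  /-- while `x < y` do `P` -/
  | while (x y : ℕ) (P : RAMProg) : RAMProg

/-- `RAMExec W P s t s'`: on a machine whose words hold the numbers `0, …, W - 1`, the program `P`
started in state `s` halts in state `s'` after exactly `t` steps. Each elementary instruction and
each evaluation of a test is one step. There is no such execution if some instruction produces a
number that does not fit into a word, or if the program does not halt. -/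
inductive RAMExec (W : ℕ) : RAMProg → RAMState → ℕ → RAMState → Prop
  | skip (s) : RAMExec W .skip s 1 s
  | const (s) (r k : ℕ) (h : k < W) : RAMExec W (.const r k) s 1 (s.setReg r k)
  | move (s) (r x : ℕ) : RAMExec W (.move r x) s 1 (s.setReg r (s.reg x))
  | add (s) (r x y : ℕ) (h : s.reg x + s.reg y < W) :
      RAMExec W (.add r x y) s 1 (s.setReg r (s.reg x + s.reg y))
  | sub (s) (r x y : ℕ) : RAMExec W (.sub r x y) s 1 (s.setReg r (s.reg x - s.reg y))
  | mul (s) (r x y : ℕ) (h : s.reg x * s.reg y < W) :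
      RAMExec W (.mul r x y) s 1 (s.setReg r (s.reg x * s.reg y))
  | load (s) (r a x : ℕ) : RAMExec W (.load r a x) s 1 (s.setReg r (s.arr a (s.reg x)))
  | store (s) (a x y : ℕ) : RAMExec W (.store a x y) s 1 (s.setArr a (s.reg x) (s.reg y))
  | seq {P Q s s' s'' t t'} (h : RAMExec W P s t s') (h' : RAMExec W Q s' t' s'') :
      RAMExec W (.seq P Q) s (t + t') s''
  | ite_true {x y P Q s s' t} (h : s.reg x < s.reg y) (h' : RAMExec W P s t s') :
      RAMExec W (.ite x y P Q) s (t + 1) s'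
  | ite_false {x y P Q s s' t} (h : ¬ s.reg x < s.reg y) (h' : RAMExec W Q s t s') :
      RAMExec W (.ite x y P Q) s (t + 1) s'
  | while_true {x y P s s' s'' t t'} (h : s.reg x < s.reg y) (h' : RAMExec W P s t s')
      (h'' : RAMExec W (.while x y P) s' t' s'') :
      RAMExec W (.while x y P) s (t + t' + 1) s''
  | while_false {x y P s} (h : ¬ s.reg x < s.reg y) : RAMExec W (.while x y P) s 1 s

/-- The input state for a planar embedded graph `G` whose darts are numbered `0, …, k - 1` in an
arbitrary way by `e` (a doubly connected edge list): register `0` holds the number `n` of vertices,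
register `1` the number `k` of darts, and for every dart, array `0` holds its start vertex, array
`1` its reversal, and array `2` the next dart in counterclockwise order around its start vertex.
Everything else is zero. -/
def PlanarEmbeddedGraph.input {n k : ℕ} (G : PlanarEmbeddedGraph n) (e : Fin k ≃ G.graph.Dart) :
    RAMState where
  reg r := if r = 0 then n else if r = 1 then k else 0
  arr a i :=
    if h : i < k then
      if a = 0 then ((e ⟨i, h⟩).fst : ℕ)
      else if a = 1 then (e.symm (e ⟨i, h⟩).symm : ℕ)
      else if a = 2 then (e.symm (G.rot (e ⟨i, h⟩)) : ℕ)
      else 0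
    else 0

/-! ## Walks around rectangles -/

/-! Drawings are replaced by a finite object, `RectLayout`: integer coordinates of the vertices and
an integer rectangle for every face, such that each dart is a unit step on the boundary of the
rectangle of the face to its left, counterclockwise for all faces but one and clockwise for that
one, and the degree of a face is the perimeter of its rectangle. The proof consists of an
equivalence between drawings and layouts, a comparison of perimeters, and a program that searches
for a layout.

From a drawing to a layout (`exists_layout`): the region to the left of a dart is also to the left
of the next dart of the facial walk, because one can turn around the common vertex through a wedge
free of edges (`leftRegion_faceNext`). Hence each facial walk runs along the boundary of one
rectangle. The unbounded region is unique and every component has a dart next to it, so every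
component passes through the lower left corner of that rectangle. The graph is therefore connected,
and all coordinates are integers relative to this corner.

From a layout to a drawing (`isUnitRectangularDrawing`): fix a unit cell and add up the signed
crossings of all darts with the ray going down from it. An edge contributes two opposite darts, so
the total is 0. An inner face contributes 1 if its rectangle contains the cell, the outer face -1.
So the inner rectangles tile the outer one (`sum_cellIn`). A dart is determined by its start
position and one cell in the wedge that follows it (`dart_eq_of_covers`), and from this the
injectivity of the positions and the cyclic order at each vertex follow.

The outer face: an inner rectangle is contained in the outer one, so its perimeter is at most as
large. Equality forces the two rectangles to coincide; then there is no other face and the graph is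
the boundary cycle (`isEvenCycle`). In that exceptional case the mirror image of the layout
exchanges the two faces, so a program may always take any face of maximum degree as the outer face
(`exists_outer_eq`).

The algorithm: once the outer face and two of its corners are chosen, all coordinates on the outer
face are known, and the rest is forced by four rules. Reverse a known dart. Fill in the dart between
two opposite known darts. Recognize the lower corners of a face. When both lower corners are known,
the width is known, the degree gives the height, and one can go around the face. The rules reach
every dart (`IsClosed.finished`): an unfinished face with lowest bottom side has both of its lower
corners among known darts. A queue makes this propagation linear. At the end the labels are checked
to be a layout, so nothing about them has to be proved for negative instances.

Running time: the start of a dart at a corner of the outer face has degree 2, and trying all pairs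
of candidates costs cubic time, since at most `4 * n` darts can occur. If at most one face has
degree above 6, then a corner lies next to a face that is a unit square or a domino. Such candidates
are at most one step away from a corner, so a layout has at most 12 of them
(`card_smallCandidates_le`). The program keeps at most 12, and constantly many pairs give linear
time. Disconnected graphs are rejected beforehand by counting with Euler's formula, the only place
where planarity of the rotation system is used.

The machine: `Code` is a language with counting loops only, with functional semantics `ev` and
`cost`. `ramExec` transfers a `Code` program to the random access machine; the only arithmetic that
increases a number adds 1, so the numbers are bounded by the initial bound plus the running time and
fit into words of logarithmic length. -/

/-- The unit segment from `(x, y)` to `(x', y')` lies on the boundary of the rectangle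
`[l, r] × [b, t]` and is directed counterclockwise. -/
def RectEdge {R : Type*} [Add R] [One R] [LE R] (l r b t x y x' y' : R) : Prop :=
  (x' = x + 1 ∧ y' = y ∧ y = b ∧ l ≤ x ∧ x' ≤ r) ∨
  (x' = x ∧ y' = y + 1 ∧ x = r ∧ b ≤ y ∧ y' ≤ t) ∨
  (x = x' + 1 ∧ y' = y ∧ y = t ∧ l ≤ x' ∧ x ≤ r) ∨
  (x' = x ∧ y = y' + 1 ∧ x = l ∧ b ≤ y' ∧ y ≤ t)

/-- The distance of a boundary point from the lower left corner, along the boundary of the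
rectangle `[l, r] × [b, t]` in counterclockwise direction. -/
def rectPos (l r b t x y : ℤ) : ℤ :=
  if y = b ∧ x < r then x - l
  else if x = r ∧ y < t then (r - l) + (y - b)
  else if y = t ∧ l < x then (r - l) + (t - b) + (r - x)
  else 2 * (r - l) + (t - b) + (t - y)

section Walk

variable {α : Type*} {S : Finset α} {s : α → α} {x y x' y' : α → ℤ} {l r b t : ℤ}

theorem rectPos_step {x y x' y' : ℤ} (hl : l < r) (hb : b < t) (h : RectEdge l r b t x y x' y') :
    0 ≤ rectPos l r b t x y ∧ rectPos l r b t x y < 2 * ((r - l) + (t - b)) ∧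
    (rectPos l r b t x' y' = rectPos l r b t x y + 1 ∨
      (rectPos l r b t x' y' = 0 ∧ rectPos l r b t x y = 2 * ((r - l) + (t - b)) - 1)) := by
  unfold rectPos
  rcases h with h | h | h | h <;> split_ifs <;> omega

theorem rectPos_inj {x y x' y' u v u' v' : ℤ} (hl : l < r) (hb : b < t)
    (h : RectEdge l r b t x y x' y') (h' : RectEdge l r b t u v u' v')
    (he : rectPos l r b t x y = rectPos l r b t u v) : x = u ∧ y = v := by
  unfold rectPos at he
  rcases h with h | h | h | h <;> rcases h' with h' | h' | h' | h' <;> split_ifs at he <;> omega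

theorem RectEdge.next_unique {x y x' y' u v : ℤ} (hl : l < r) (hb : b < t)
    (h : RectEdge l r b t x y x' y') (h' : RectEdge l r b t x y u v) : x' = u ∧ y' = v := by
  rcases h with h | h | h | h <;> rcases h' with h' | h' | h' | h' <;> omega

/-- A dart of `S` with maximal position cannot be followed by one with a larger position, so its
successor wraps around to position 0. From there every step increases the position by one. -/
theorem exists_rectPos (hS : S.Nonempty) (hs : ∀ d ∈ S, s d ∈ S) (hl : l < r) (hb : b < t)
    (hx : ∀ d ∈ S, x (s d) = x' d) (hy : ∀ d ∈ S, y (s d) = y' d)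
    (h : ∀ d ∈ S, RectEdge l r b t (x d) (y d) (x' d) (y' d)) {k : ℤ} (hk : 0 ≤ k)
    (hk' : k < 2 * ((r - l) + (t - b))) : ∃ d ∈ S, rectPos l r b t (x d) (y d) = k := by
  have step : ∀ d ∈ S, _ := fun d hd => rectPos_step hl hb (h d hd)
  obtain ⟨m, hm, hmax⟩ := S.exists_max_image (fun d => rectPos l r b t (x d) (y d)) hS
  have h0 : ∃ d ∈ S, rectPos l r b t (x d) (y d) = 0 := by
    refine ⟨s m, hs m hm, ?_⟩
    have h1 := step m hm
    have h2 := hmax (s m) (hs m hm)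
    rw [← hx m hm, ← hy m hm] at h1
    omega
  obtain ⟨j, rfl⟩ := Int.eq_ofNat_of_zero_le hk
  clear hk
  induction j with
  | zero => simpa using h0
  | succ j ih =>
    obtain ⟨d, hd, e⟩ := ih (by push_cast at hk'; omega)
    refine ⟨s d, hs d hd, ?_⟩
    have h1 := step d hd
    rw [← hx d hd, ← hy d hd] at h1
    push_cast at hk' ⊢
    omega

theorem image_rectPos (hS : S.Nonempty) (hs : ∀ d ∈ S, s d ∈ S) (hl : l < r) (hb : b < t)
    (hx : ∀ d ∈ S, x (s d) = x' d) (hy : ∀ d ∈ S, y (s d) = y' d)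
    (h : ∀ d ∈ S, RectEdge l r b t (x d) (y d) (x' d) (y' d)) :
    S.image (fun d => rectPos l r b t (x d) (y d)) = Finset.Ico 0 (2 * ((r - l) + (t - b))) := by
  ext k
  simp only [Finset.mem_image, Finset.mem_Ico]
  constructor
  · rintro ⟨d, hd, rfl⟩
    have := rectPos_step hl hb (h d hd)
    exact ⟨this.1, this.2.1⟩
  · rintro ⟨h1, h2⟩
    exact exists_rectPos hS hs hl hb hx hy h h1 h2

/-- Pigeonhole: the positions fill an interval with as many elements as `S`, so they are pairwise
different. -/
theorem walk_injOn (hS : S.Nonempty) (hs : ∀ d ∈ S, s d ∈ S) (hl : l < r) (hb : b < t)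
    (hx : ∀ d ∈ S, x (s d) = x' d) (hy : ∀ d ∈ S, y (s d) = y' d)
    (h : ∀ d ∈ S, RectEdge l r b t (x d) (y d) (x' d) (y' d))
    (hc : (S.card : ℤ) = 2 * ((r - l) + (t - b))) {d e : α} (hd : d ∈ S) (he : e ∈ S)
    (h1 : x d = x e) (h2 : y d = y e) : d = e := by
  have h3 := image_rectPos hS hs hl hb hx hy h
  have h4 : (S.image (fun d => rectPos l r b t (x d) (y d))).card = S.card := by
    rw [h3, Int.card_Ico]; omega
  exact Finset.card_image_iff.1 h4 hd he (by simp only [h1, h2])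

/-- Converse to `walk_injOn`: if the walk never returns to a point, each of the positions, as many
as the perimeter, is taken exactly once. -/
theorem walk_card (hS : S.Nonempty) (hs : ∀ d ∈ S, s d ∈ S) (hl : l < r) (hb : b < t)
    (hx : ∀ d ∈ S, x (s d) = x' d) (hy : ∀ d ∈ S, y (s d) = y' d)
    (h : ∀ d ∈ S, RectEdge l r b t (x d) (y d) (x' d) (y' d))
    (hi : ∀ d ∈ S, ∀ e ∈ S, x d = x e → y d = y e → d = e) :
    (S.card : ℤ) = 2 * ((r - l) + (t - b)) := by
  have h3 := image_rectPos hS hs hl hb hx hy h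
  have h4 : (S.image (fun d => rectPos l r b t (x d) (y d))).card = S.card := by
    refine Finset.card_image_iff.2 fun d hd e he hde => ?_
    have := rectPos_inj hl hb (h d hd) (h e he) hde
    exact hi d hd e he this.1 this.2
  rw [← h4, h3, Int.card_Ico]; omega

/-- A walk around a rectangle passes along every unit segment of its boundary. -/
theorem exists_rectEdge (hS : S.Nonempty) (hs : ∀ d ∈ S, s d ∈ S) (hl : l < r) (hb : b < t)
    (hx : ∀ d ∈ S, x (s d) = x' d) (hy : ∀ d ∈ S, y (s d) = y' d)
    (h : ∀ d ∈ S, RectEdge l r b t (x d) (y d) (x' d) (y' d)) {u v u' v' : ℤ}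
    (he : RectEdge l r b t u v u' v') :
    ∃ d ∈ S, x d = u ∧ y d = v ∧ x' d = u' ∧ y' d = v' := by
  have h1 := rectPos_step hl hb he
  obtain ⟨d, hd, e⟩ := exists_rectPos hS hs hl hb hx hy h h1.1 h1.2.1
  obtain ⟨rfl, rfl⟩ := rectPos_inj hl hb (h d hd) he e
  have := (h d hd).next_unique hl hb he
  exact ⟨d, hd, rfl, rfl, this.1, this.2⟩

/-- The signed number of crossings of the segment from `(x, y)` to `(x', y')` with the ray that
goes downwards from the centre of the unit cell with lower left corner `(i, j)`. -/
def crossing (i j x y x' y' : ℤ) : ℤ :=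
  (if x' = x + 1 ∧ y' = y ∧ x = i ∧ y ≤ j then 1 else 0) -
    (if x = x' + 1 ∧ y' = y ∧ x' = i ∧ y ≤ j then 1 else 0)

theorem crossing_rev (i j x y x' y' : ℤ) : crossing i j x' y' x y = - crossing i j x y x' y' := by
  unfold crossing
  split_ifs <;> omega

theorem sum_indicator_of_unique {P : α → Prop} [DecidablePred P] {Q : Prop} [Decidable Q]
    (h1 : Q → ∃ d ∈ S, P d) (h2 : ∀ d ∈ S, P d → Q)
    (h3 : ∀ d ∈ S, ∀ e ∈ S, P d → P e → d = e) :
    ∑ d ∈ S, (if P d then (1 : ℤ) else 0) = if Q then 1 else 0 := by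
  classical
  by_cases hQ : Q
  · obtain ⟨d, hd, hP⟩ := h1 hQ
    rw [Finset.sum_eq_single_of_mem d hd]
    · simp [hP, hQ]
    · intro e he hne
      rw [if_neg]
      exact fun hPe => hne (h3 e he d hd hPe hP)
  · rw [if_neg hQ]
    exact Finset.sum_eq_zero fun d hd => if_neg fun hP => hQ (h2 d hd hP)

/-- In the column of the cell, the walk has exactly one step on the bottom side, counted +1 if `b ≤
j`, and one on the top side, counted -1 if `t ≤ j`. The sum is the winding number of the walk around
the cell. -/
theorem sum_crossing (hS : S.Nonempty) (hs : ∀ d ∈ S, s d ∈ S) (hl : l < r) (hb : b < t)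
    (hx : ∀ d ∈ S, x (s d) = x' d) (hy : ∀ d ∈ S, y (s d) = y' d)
    (h : ∀ d ∈ S, RectEdge l r b t (x d) (y d) (x' d) (y' d))
    (hc : (S.card : ℤ) = 2 * ((r - l) + (t - b))) (i j : ℤ) :
    ∑ d ∈ S, crossing i j (x d) (y d) (x' d) (y' d) =
      if l ≤ i ∧ i < r ∧ b ≤ j ∧ j < t then 1 else 0 := by
  classical
  unfold crossing
  rw [Finset.sum_sub_distrib]
  rw [sum_indicator_of_unique (Q := l ≤ i ∧ i < r ∧ b ≤ j),
    sum_indicator_of_unique (Q := l ≤ i ∧ i < r ∧ t ≤ j)]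
  · split_ifs <;> omega
  · intro hQ
    obtain ⟨d, hd, e⟩ := exists_rectEdge hS hs hl hb hx hy h
      (u := i + 1) (v := t) (u' := i) (v' := t) (by unfold RectEdge; omega)
    exact ⟨d, hd, by omega⟩
  · intro d hd hP
    have := h d hd
    unfold RectEdge at this
    omega
  · intro d hd e he h1 h2
    have h3 := h d hd
    have h4 := h e he
    unfold RectEdge at h3 h4
    exact walk_injOn hS hs hl hb hx hy h hc hd he (by omega) (by omega)
  · intro hQ
    obtain ⟨d, hd, e⟩ := exists_rectEdge hS hs hl hb hx hy h
      (u := i) (v := b) (u' := i + 1) (v' := b) (by unfold RectEdge; omega)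
    exact ⟨d, hd, by omega⟩
  · intro d hd hP
    have := h d hd
    unfold RectEdge at this
    omega
  · intro d hd e he h1 h2
    have h3 := h d hd
    have h4 := h e he
    unfold RectEdge at h3 h4
    exact walk_injOn hS hs hl hb hx hy h hc hd he (by omega) (by omega)

end Walk

/-! ## Darts and faces -/

namespace PlanarEmbeddedGraph

variable {n : ℕ} (G : PlanarEmbeddedGraph n)

noncomputable instance fintypeDart : Fintype G.graph.Dart :=
  Fintype.ofInjective (fun d : G.graph.Dart => d.toProd) SimpleGraph.Dart.toProd_injective

open Classical in
noncomputable instance fintypeFace : Fintype G.Face :=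
  Fintype.ofSurjective G.leftFace Quotient.mk_surjective

noncomputable instance decidableEqFace : DecidableEq G.Face := Classical.decEq _

variable {G}

theorem rot_symm_fst (d : G.graph.Dart) : (G.rot.symm d).fst = d.fst := by
  conv_rhs => rw [← G.rot.apply_symm_apply d, G.rot_fst]

theorem faceNext_fst (d : G.graph.Dart) : (G.faceNext d).fst = d.snd := by
  rw [faceNext_apply, rot_symm_fst]; rfl

theorem faceNext_symm_apply (d : G.graph.Dart) : G.faceNext.symm d = (G.rot d).symm := by
  rw [Equiv.symm_apply_eq, faceNext_apply, SimpleGraph.Dart.symm_symm, Equiv.symm_apply_apply]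

theorem rot_faceNext (d : G.graph.Dart) : G.rot (G.faceNext d) = d.symm := by
  rw [faceNext_apply, Equiv.apply_symm_apply]

theorem faceNext_symm_snd (d : G.graph.Dart) : (G.faceNext.symm d).snd = d.fst := by
  rw [faceNext_symm_apply]; exact G.rot_fst d

theorem leftFace_eq_iff {d e : G.graph.Dart} :
    G.leftFace d = G.leftFace e ↔ G.faceNext.SameCycle d e := by
  unfold leftFace
  rw [Quotient.eq]
  rfl

theorem leftFace_faceNext (d : G.graph.Dart) : G.leftFace (G.faceNext d) = G.leftFace d :=
  leftFace_eq_iff.2 (Equiv.Perm.sameCycle_apply_left.2 (Equiv.Perm.SameCycle.refl _ _))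

theorem leftFace_faceNext_symm (d : G.graph.Dart) :
    G.leftFace (G.faceNext.symm d) = G.leftFace d := by
  conv_rhs => rw [← G.faceNext.apply_symm_apply d, leftFace_faceNext]

theorem exists_leftFace (f : G.Face) : ∃ d, G.leftFace d = f := Quotient.mk_surjective f

variable (G) in
/-- The darts on the boundary walk of a face. -/
noncomputable def faceDarts (f : G.Face) : Finset G.graph.Dart :=
  Finset.univ.filter fun d => G.leftFace d = f

@[simp] theorem mem_faceDarts {f : G.Face} {d : G.graph.Dart} :
    d ∈ G.faceDarts f ↔ G.leftFace d = f := by simp [faceDarts]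

theorem faceDarts_nonempty (f : G.Face) : (G.faceDarts f).Nonempty := by
  obtain ⟨d, hd⟩ := exists_leftFace f
  exact ⟨d, mem_faceDarts.2 hd⟩

theorem degree_eq_card (f : G.Face) : G.degree f = (G.faceDarts f).card := by
  unfold degree
  rw [Nat.card_eq_fintype_card, Fintype.card_subtype, faceDarts]

/-! ### Layouts and the tiling of the outer rectangle -/

variable (G) in
/-- Integer coordinates of the vertices and rectangles of the faces such that the boundary walk of
each face except `outer` goes around its rectangle once in counterclockwise direction, and that of
`outer` in clockwise direction. -/
structure RectLayout where
  x : Fin n → ℤ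
  y : Fin n → ℤ
  outer : G.Face
  l : G.Face → ℤ
  r : G.Face → ℤ
  b : G.Face → ℤ
  t : G.Face → ℤ
  l_lt : ∀ f, l f < r f
  b_lt : ∀ f, b f < t f
  inner_edge : ∀ d : G.graph.Dart, G.leftFace d ≠ outer →
    RectEdge (l (G.leftFace d)) (r (G.leftFace d)) (b (G.leftFace d)) (t (G.leftFace d))
      (x d.fst) (y d.fst) (x d.snd) (y d.snd)
  outer_edge : ∀ d : G.graph.Dart, G.leftFace d = outer →
    RectEdge (l outer) (r outer) (b outer) (t outer) (x d.snd) (y d.snd) (x d.fst) (y d.fst)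
  degree_eq : ∀ f, (G.degree f : ℤ) = 2 * ((r f - l f) + (t f - b f))
  exists_dart : ∀ v, ∃ d : G.graph.Dart, d.fst = v

namespace RectLayout

variable (L : G.RectLayout)

/-- The unit cell with lower left corner `(i, j)` lies in the rectangle of the face `f`. -/
def CellIn (f : G.Face) (i j : ℤ) : Prop := L.l f ≤ i ∧ i < L.r f ∧ L.b f ≤ j ∧ j < L.t f

instance (f : G.Face) (i j : ℤ) : Decidable (L.CellIn f i j) := by unfold CellIn; infer_instance

theorem inner_edge' {f : G.Face} (hf : f ≠ L.outer) (d : G.graph.Dart) (hd : d ∈ G.faceDarts f) :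
    RectEdge (L.l f) (L.r f) (L.b f) (L.t f) (L.x d.fst) (L.y d.fst) (L.x d.snd) (L.y d.snd) := by
  have := mem_faceDarts.1 hd
  subst this
  exact L.inner_edge d hf

theorem outer_edge' (d : G.graph.Dart) (hd : d ∈ G.faceDarts L.outer) :
    RectEdge (L.l L.outer) (L.r L.outer) (L.b L.outer) (L.t L.outer)
      (L.x d.snd) (L.y d.snd) (L.x d.fst) (L.y d.fst) :=
  L.outer_edge d (mem_faceDarts.1 hd)

theorem inner_injOn {d e : G.graph.Dart} (hf : G.leftFace d ≠ L.outer)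
    (hde : G.leftFace d = G.leftFace e) (hx : L.x d.fst = L.x e.fst) (hy : L.y d.fst = L.y e.fst) :
    d = e := by
  refine walk_injOn (S := G.faceDarts (G.leftFace d)) (s := G.faceNext) (x := fun d => L.x d.fst)
    (y := fun d => L.y d.fst) (x' := fun d => L.x d.snd) (y' := fun d => L.y d.snd)
    (faceDarts_nonempty _) ?_ (L.l_lt _) (L.b_lt _) ?_ ?_ (L.inner_edge' hf) ?_ ?_ ?_ hx hy
  · intro e he; simpa [leftFace_faceNext] using he
  · intro e he; simp only [faceNext_fst]
  · intro e he; simp only [faceNext_fst]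
  · rw [← degree_eq_card, L.degree_eq]
  · simp
  · simp [hde]

/-- The outer walk is clockwise. Read backwards, with `faceNext.symm` as successor and the ends of
each dart exchanged, it is counterclockwise and the lemmas on walks apply. -/
theorem outer_injOn_snd {d e : G.graph.Dart} (hd : G.leftFace d = L.outer)
    (he : G.leftFace e = L.outer) (hx : L.x d.snd = L.x e.snd) (hy : L.y d.snd = L.y e.snd) :
    d = e := by
  refine walk_injOn (S := G.faceDarts L.outer) (s := G.faceNext.symm) (x := fun d => L.x d.snd)
    (y := fun d => L.y d.snd) (x' := fun d => L.x d.fst) (y' := fun d => L.y d.fst)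
    (faceDarts_nonempty _) ?_ (L.l_lt _) (L.b_lt _) ?_ ?_ L.outer_edge' ?_ ?_ ?_ hx hy
  · intro e he; simpa [leftFace_faceNext_symm] using he
  · intro e he; simp only [faceNext_symm_snd]
  · intro e he; simp only [faceNext_symm_snd]
  · rw [← degree_eq_card, L.degree_eq]
  · simp [hd]
  · simp [he]

theorem outer_injOn {d e : G.graph.Dart} (hd : G.leftFace d = L.outer)
    (he : G.leftFace e = L.outer) (hx : L.x d.fst = L.x e.fst) (hy : L.y d.fst = L.y e.fst) :
    d = e := by
  have := L.outer_injOn_snd (d := G.faceNext.symm d) (e := G.faceNext.symm e)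
    (by rwa [leftFace_faceNext_symm]) (by rwa [leftFace_faceNext_symm])
    (by rwa [faceNext_symm_snd, faceNext_symm_snd]) (by rwa [faceNext_symm_snd, faceNext_symm_snd])
  exact G.faceNext.symm.injective this

theorem injOn {d e : G.graph.Dart} (hde : G.leftFace d = G.leftFace e)
    (hx : L.x d.fst = L.x e.fst) (hy : L.y d.fst = L.y e.fst) : d = e := by
  by_cases h : G.leftFace d = L.outer
  · exact L.outer_injOn h (hde ▸ h) hx hy
  · exact L.inner_injOn h hde hx hy

theorem exists_inner_edge {f : G.Face} (hf : f ≠ L.outer) {u v u' v' : ℤ}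
    (h : RectEdge (L.l f) (L.r f) (L.b f) (L.t f) u v u' v') :
    ∃ d : G.graph.Dart, G.leftFace d = f ∧ L.x d.fst = u ∧ L.y d.fst = v ∧
      L.x d.snd = u' ∧ L.y d.snd = v' := by
  obtain ⟨d, hd, e⟩ := exists_rectEdge (S := G.faceDarts f) (s := G.faceNext)
    (x := fun d => L.x d.fst)
    (y := fun d => L.y d.fst) (x' := fun d => L.x d.snd) (y' := fun d => L.y d.snd)
    (faceDarts_nonempty _) (by intro e he; simpa [leftFace_faceNext] using he)
    (L.l_lt _) (L.b_lt _) (by intro e he; simp only [faceNext_fst])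
    (by intro e he; simp only [faceNext_fst]) (L.inner_edge' hf) h
  exact ⟨d, mem_faceDarts.1 hd, e⟩

theorem exists_outer_edge {u v u' v' : ℤ}
    (h : RectEdge (L.l L.outer) (L.r L.outer) (L.b L.outer) (L.t L.outer) u v u' v') :
    ∃ d : G.graph.Dart, G.leftFace d = L.outer ∧ L.x d.snd = u ∧ L.y d.snd = v ∧
      L.x d.fst = u' ∧ L.y d.fst = v' := by
  obtain ⟨d, hd, e⟩ := exists_rectEdge (S := G.faceDarts L.outer) (s := G.faceNext.symm)
    (x := fun d => L.x d.snd)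
    (y := fun d => L.y d.snd) (x' := fun d => L.x d.fst) (y' := fun d => L.y d.fst)
    (faceDarts_nonempty _) (by intro e he; simpa [leftFace_faceNext_symm] using he)
    (L.l_lt _) (L.b_lt _) (by intro e he; simp only [faceNext_symm_snd])
    (by intro e he; simp only [faceNext_symm_snd]) L.outer_edge' h
  exact ⟨d, mem_faceDarts.1 hd, e⟩

/-- The contribution of a face is the winding number of its walk; the clockwise outer walk has the
opposite sign. -/
theorem sum_crossing_face (f : G.Face) (i j : ℤ) :
    ∑ d ∈ G.faceDarts f, crossing i j (L.x d.fst) (L.y d.fst) (L.x d.snd) (L.y d.snd) =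
      if f = L.outer then - (if L.CellIn f i j then 1 else 0)
      else if L.CellIn f i j then 1 else 0 := by
  split_ifs with hf h h
  all_goals first | subst hf | skip
  · rw [Finset.sum_congr rfl (fun d _ => (crossing_rev i j (L.x d.snd) (L.y d.snd) _ _)),
      Finset.sum_neg_distrib]
    have := sum_crossing (S := G.faceDarts L.outer) (s := G.faceNext.symm)
      (x := fun d => L.x d.snd)
      (y := fun d => L.y d.snd) (x' := fun d => L.x d.fst) (y' := fun d => L.y d.fst)
      (faceDarts_nonempty _) (by intro e he; simpa [leftFace_faceNext_symm] using he)
      (L.l_lt _) (L.b_lt _) (by intro e he; simp only [faceNext_symm_snd])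
      (by intro e he; simp only [faceNext_symm_snd]) L.outer_edge'
      (by rw [← degree_eq_card, L.degree_eq]) i j
    rw [this]
    exact congrArg Neg.neg (if_pos h)
  · rw [Finset.sum_congr rfl (fun d _ => (crossing_rev i j (L.x d.snd) (L.y d.snd) _ _)),
      Finset.sum_neg_distrib]
    have := sum_crossing (S := G.faceDarts L.outer) (s := G.faceNext.symm)
      (x := fun d => L.x d.snd)
      (y := fun d => L.y d.snd) (x' := fun d => L.x d.fst) (y' := fun d => L.y d.fst)
      (faceDarts_nonempty _) (by intro e he; simpa [leftFace_faceNext_symm] using he)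
      (L.l_lt _) (L.b_lt _) (by intro e he; simp only [faceNext_symm_snd])
      (by intro e he; simp only [faceNext_symm_snd]) L.outer_edge'
      (by rw [← degree_eq_card, L.degree_eq]) i j
    rw [this]
    exact congrArg Neg.neg (if_neg h)
  all_goals
    have := sum_crossing (S := G.faceDarts f) (s := G.faceNext)
      (x := fun d => L.x d.fst)
      (y := fun d => L.y d.fst) (x' := fun d => L.x d.snd) (y' := fun d => L.y d.snd)
      (faceDarts_nonempty _) (by intro e he; simpa [leftFace_faceNext] using he)
      (L.l_lt _) (L.b_lt _) (by intro e he; simp only [faceNext_fst])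
      (by intro e he; simp only [faceNext_fst]) (L.inner_edge' hf)
      (by rw [← degree_eq_card, L.degree_eq]) i j
    rw [this]
  · exact if_pos h
  · exact if_neg h

/-- Summed over all darts the crossings cancel, as reversal changes the sign. Grouped by left faces,
the same sum is the number of inner rectangles that contain the cell minus the indicator of the
outer rectangle. This is the tiling property. -/
theorem sum_cellIn (i j : ℤ) :
    ∑ f : G.Face, (if f ≠ L.outer ∧ L.CellIn f i j then 1 else 0) =
      if L.CellIn L.outer i j then 1 else 0 := by
  have h0 : ∑ d : G.graph.Dart, crossing i j (L.x d.fst) (L.y d.fst) (L.x d.snd) (L.y d.snd) = 0 := by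
    have h1 := Function.Bijective.sum_comp (SimpleGraph.Dart.symm_involutive (G := G.graph)).bijective
      (fun d : G.graph.Dart => crossing i j (L.x d.fst) (L.y d.fst) (L.x d.snd) (L.y d.snd))
    have h2 : ∀ d : G.graph.Dart, crossing i j (L.x d.symm.fst) (L.y d.symm.fst)
        (L.x d.symm.snd) (L.y d.symm.snd)
      = - crossing i j (L.x d.fst) (L.y d.fst) (L.x d.snd) (L.y d.snd) :=
      fun d => crossing_rev i j (L.x d.fst) (L.y d.fst) (L.x d.snd) (L.y d.snd)
    simp only [h2, Finset.sum_neg_distrib] at h1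
    omega
  rw [← Finset.sum_fiberwise (s := Finset.univ) (g := fun d => G.leftFace d)] at h0
  have h1 : ∑ f : G.Face, ((if f ≠ L.outer ∧ L.CellIn f i j then (1 : ℤ) else 0) -
      (if f = L.outer then (if L.CellIn L.outer i j then 1 else 0) else 0)) = 0 := by
    refine Eq.trans ?_ h0
    refine Finset.sum_congr rfl fun f _ => ?_
    have := L.sum_crossing_face f i j
    rw [faceDarts] at this
    rw [this]
    by_cases hf : f = L.outer
    · subst hf; simp
    · simp [hf]
  rw [Finset.sum_sub_distrib, Finset.sum_ite_eq' Finset.univ L.outer] at h1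
  have h2 : (∑ f : G.Face, (if f ≠ L.outer ∧ L.CellIn f i j then (1 : ℤ) else 0)) =
      if L.CellIn L.outer i j then 1 else 0 := by
    have := Finset.mem_univ L.outer
    simp only [this, if_true] at h1
    omega
  exact_mod_cast h2

/-- This and the next two lemmas read off the tiling from the count: no inner rectangle leaves the
outer one, no cell is missed, and no cell is covered twice. -/
theorem cellIn_outer {f : G.Face} {i j : ℤ} (h : L.CellIn f i j) : L.CellIn L.outer i j := by
  by_cases hf : f = L.outer
  · exact hf ▸ h
  by_contra hn
  have h1 := L.sum_cellIn i j
  rw [if_neg hn, Finset.sum_eq_zero_iff] at h1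
  simpa [hf, h] using h1 f (Finset.mem_univ f)

theorem exists_cellIn {i j : ℤ} (h : L.CellIn L.outer i j) :
    ∃ f, f ≠ L.outer ∧ L.CellIn f i j := by
  by_contra! hn
  have h1 := L.sum_cellIn i j
  rw [if_pos h, Finset.sum_eq_zero] at h1
  · omega
  · intro f _
    rw [if_neg]
    exact fun hf => hn f hf.1 hf.2

theorem cellIn_unique {f g : G.Face} {i j : ℤ} (hf : f ≠ L.outer) (hg : g ≠ L.outer)
    (h : L.CellIn f i j) (h' : L.CellIn g i j) : f = g := by
  by_contra hne
  have h1 := L.sum_cellIn i j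
  rw [if_pos (L.cellIn_outer h), ← Finset.card_filter, Finset.card_eq_one] at h1
  obtain ⟨a, ha⟩ := h1
  have e1 : f ∈ ({a} : Finset G.Face) := ha ▸ by simp [hf, h]
  have e2 : g ∈ ({a} : Finset G.Face) := ha ▸ by simp [hg, h']
  rw [Finset.mem_singleton] at e1 e2
  exact hne (e1.trans e2.symm)

/-- The unit cell `(i, j)` lies in the part of the plane that belongs to the face `f`. -/
def Covers (f : G.Face) (i j : ℤ) : Prop :=
  (f ≠ L.outer ∧ L.CellIn f i j) ∨ (f = L.outer ∧ ¬ L.CellIn f i j)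

theorem covers_unique {f g : G.Face} {i j : ℤ} (h : L.Covers f i j) (h' : L.Covers g i j) :
    f = g := by
  rcases h with ⟨h1, h2⟩ | ⟨h1, h2⟩ <;> rcases h' with ⟨h3, h4⟩ | ⟨h3, h4⟩
  · exact L.cellIn_unique h1 h3 h2 h4
  · exact absurd (L.cellIn_outer h2) (h3 ▸ h4)
  · exact absurd (L.cellIn_outer h4) (h1 ▸ h2)
  · exact h1.trans h3.symm

/-- A cell determines the face that covers it, and a facial walk visits each point only once. This
lemma turns facts about cells around a point into equalities of darts. -/
theorem dart_eq_of_covers {d e : G.graph.Dart} {i j : ℤ} (h : L.Covers (G.leftFace d) i j)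
    (h' : L.Covers (G.leftFace e) i j) (hx : L.x d.fst = L.x e.fst) (hy : L.y d.fst = L.y e.fst) :
    d = e :=
  L.injOn (L.covers_unique h h') hx hy

end RectLayout

end PlanarEmbeddedGraph

/-! ## From drawings to layouts -/

section Corner

variable {α : Type*} {S : Finset α} {s : Equiv.Perm α} {x y : α → ℝ} {l r b t : ℝ}

/-- At a minimum of `x + y`, the walk must arrive along the left side and leave along the bottom
side. The rectangle has arbitrary real sides here; the lemma shows that its corners are vertices,
whence its coordinates become integers relative to any other vertex of the component. -/
theorem exists_lower_left (hS : S.Nonempty) (hs : ∀ d ∈ S, s d ∈ S) (hs' : ∀ d ∈ S, s.symm d ∈ S)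
    (hl : l < r) (hb : b < t)
    (h : ∀ d ∈ S, RectEdge l r b t (x d) (y d) (x (s d)) (y (s d))) :
    ∃ d ∈ S, x d = l ∧ y d = b := by
  obtain ⟨m, hm, hmin⟩ := S.exists_min_image (fun d => x d + y d) hS
  have h1 := hmin _ (hs m hm)
  have h2 := hmin _ (hs' m hm)
  have h3 := h _ hm
  have h4 := h _ (hs' m hm)
  rw [Equiv.apply_symm_apply] at h4
  refine ⟨m, hm, ?_⟩
  rcases h3 with h3 | h3 | h3 | h3 <;> rcases h4 with h4 | h4 | h4 | h4 <;>
    (constructor <;> linarith)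

theorem exists_upper_right (hS : S.Nonempty) (hs : ∀ d ∈ S, s d ∈ S)
    (hs' : ∀ d ∈ S, s.symm d ∈ S) (hl : l < r) (hb : b < t)
    (h : ∀ d ∈ S, RectEdge l r b t (x d) (y d) (x (s d)) (y (s d))) :
    ∃ d ∈ S, x d = r ∧ y d = t := by
  obtain ⟨m, hm, hmin⟩ := S.exists_max_image (fun d => x d + y d) hS
  have h1 := hmin _ (hs m hm)
  have h2 := hmin _ (hs' m hm)
  have h3 := h _ hm
  have h4 := h _ (hs' m hm)
  rw [Equiv.apply_symm_apply] at h4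
  refine ⟨m, hm, ?_⟩
  rcases h3 with h3 | h3 | h3 | h3 <;> rcases h4 with h4 | h4 | h4 | h4 <;>
    (constructor <;> linarith)

end Corner

theorem isPreconnected_image_reProdIm (c u : ℂ) (a b a' b' : ℝ) :
    IsPreconnected ((fun z => c + z * u) '' (Set.Ioo a b ×ℂ Set.Ioo a' b')) := by
  refine IsPreconnected.image ?_ _ (by fun_prop)
  exact (((convex_Ioo a b).linear_preimage Complex.reLm).inter
    ((convex_Ioo a' b').linear_preimage Complex.imLm)).isPreconnected

namespace PlanarEmbeddedGraph

variable {n : ℕ} {G : PlanarEmbeddedGraph n} {p : Fin n → ℂ}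

theorem vec_symm (d : G.graph.Dart) : G.vec p d.symm = - G.vec p d := by
  simp [vec]

theorem snd_eq (d : G.graph.Dart) : p d.snd = p d.fst + G.vec p d := by
  simp [vec]

namespace IsUnitLengthRectilinear

variable (h : G.IsUnitLengthRectilinear p)
include h

theorem vec_ne_zero (d : G.graph.Dart) : G.vec p d ≠ 0 := by
  intro h0
  have := h.unit_length _ _ d.adj
  unfold vec at h0
  rw [h0] at this
  simp at this

theorem vec_cases (d : G.graph.Dart) : ∃ k : Fin 4, G.vec p d = Complex.I ^ (k : ℕ) := by
  have h1 := h.unit_length _ _ d.adj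
  have h2 := h.rectilinear _ _ d.adj
  have h3 : (G.vec p d).re = 0 ∨ (G.vec p d).im = 0 := by
    unfold vec
    simp only [Complex.sub_re, Complex.sub_im]
    rcases h2 with h2 | h2
    · left; linarith
    · right; linarith
  have h4 : (G.vec p d).re ^ 2 + (G.vec p d).im ^ 2 = 1 := by
    have := Complex.sq_norm (G.vec p d)
    rw [Complex.normSq_apply, show ‖G.vec p d‖ = 1 from h1] at this
    nlinarith
  rcases h3 with h3 | h3
  · rw [h3] at h4
    have : (G.vec p d).im = 1 ∨ (G.vec p d).im = -1 := by
      exact sq_eq_one_iff.1 (by linarith)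
    rcases this with h5 | h5
    · exact ⟨1, by apply Complex.ext <;> simp [h3, h5]⟩
    · exact ⟨3, by apply Complex.ext <;> simp [h3, h5, Complex.I_pow_three]⟩
  · rw [h3] at h4
    have : (G.vec p d).re = 1 ∨ (G.vec p d).re = -1 := by
      exact sq_eq_one_iff.1 (by linarith)
    rcases this with h5 | h5
    · exact ⟨0, by apply Complex.ext <;> simp [h3, h5]⟩
    · exact ⟨2, by apply Complex.ext <;> simp [h3, h5]⟩

theorem vec_eq_I_pow_mul (d e : G.graph.Dart) :
    ∃ k : Fin 4, G.vec p e = Complex.I ^ (k : ℕ) * G.vec p d := by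
  obtain ⟨i, hi⟩ := h.vec_cases d
  obtain ⟨j, hj⟩ := h.vec_cases e
  refine ⟨j - i, ?_⟩
  rw [hi, hj, ← pow_add, Complex.I_pow_eq_pow_mod, Complex.I_pow_eq_pow_mod (_ + _)]
  congr 1
  clear hi hj
  revert i j
  decide

end IsUnitLengthRectilinear

/-! ### Neighbourhoods that are free of edges -/

variable (G p) in
/-- The open rectangle of height `δ` to the left of a dart. -/
def strip (d : G.graph.Dart) (δ : ℝ) : Set ℂ :=
  (fun z => p d.fst + z * G.vec p d) '' (Set.Ioo 0 1 ×ℂ Set.Ioo 0 δ)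

/-- The open half-square of radius `δ` around `c` on the side of the direction `u`. -/
def halfSquare (c u : ℂ) (δ : ℝ) : Set ℂ :=
  (fun z => c + z * u) '' (Set.Ioo 0 δ ×ℂ Set.Ioo (-δ) δ)

/-- A compact set and a disjoint closed set have disjoint thickenings. The factor 2 leaves room for
the bound by the sum of the real and imaginary parts used for small boxes. -/
theorem eventually_disjoint {S K : Set ℂ} (hK : IsCompact K) (hS : IsClosed S) (hKS : Disjoint K S)
    {A : ℝ → Set ℂ} (hA : ∀ δ, 0 < δ → A δ ⊆ Metric.thickening (2 * δ) K) :
    ∀ᶠ δ : ℝ in 𝓝[>] 0, Disjoint (A δ) S := by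
  obtain ⟨ε, hε, h⟩ := hKS.exists_thickenings hK hS
  filter_upwards [Ioo_mem_nhdsGT (show (0 : ℝ) < ε / 2 by linarith)] with δ hδ
  refine h.mono ((hA δ hδ.1).trans (Metric.thickening_mono (by linarith [hδ.2]) _)) ?_
  exact Metric.self_subset_thickening hε _

theorem norm_I_pow_mul_le {u : ℂ} (hu : ‖u‖ = 1) {z : ℂ} {a b : ℝ} (h1 : |z.re| < a)
    (h2 : |z.im| < b) : ‖z * u‖ < a + b := by
  rw [norm_mul, hu, mul_one]
  exact (Complex.norm_le_abs_re_add_abs_im z).trans_lt (by linarith)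

/-- After division by `u` the segment is one of the four unit segments from 0 along the axes, so
that only four explicit cases remain. -/
theorem disjoint_segment_of_mul {c u v : ℂ} {A : Set ℂ} (hu : u ≠ 0)
    (hv : ∃ k : Fin 4, v = Complex.I ^ (k : ℕ) * u)
    (hA : ∀ k : Fin 4, v = Complex.I ^ (k : ℕ) * u → ∀ x : ℝ, 0 ≤ x → x ≤ 1 →
      (x : ℂ) * Complex.I ^ (k : ℕ) ∉ A) :
    Disjoint ((fun z => c + z * u) '' A) (segment ℝ c (c + v)) := by
  rw [Set.disjoint_left]
  rintro _ ⟨z, hz, rfl⟩ hs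
  rw [segment_eq_image'] at hs
  obtain ⟨x, ⟨hx0, hx1⟩, hx⟩ := hs
  obtain ⟨k, hk⟩ := hv
  refine hA k hk x hx0 hx1 ?_
  have : z * u = ((x : ℂ) * Complex.I ^ (k : ℕ)) * u := by
    simp only [add_sub_cancel_left, Complex.real_smul, hk] at hx
    rw [← add_left_cancel hx]; ring
  rwa [← mul_right_cancel₀ hu this]

theorem halfSquare_subset_thickening (c : ℂ) {u : ℂ} (hu : ‖u‖ = 1) {δ : ℝ} :
    halfSquare c u δ ⊆ Metric.thickening (2 * δ) {c} := by
  rintro _ ⟨z, ⟨h1, h2⟩, rfl⟩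
  rw [Metric.mem_thickening_iff]
  refine ⟨c, rfl, ?_⟩
  rw [dist_eq_norm, add_sub_cancel_left, two_mul]
  exact norm_I_pow_mul_le hu (by rw [abs_of_pos h1.1]; exact h1.2) (abs_lt.2 h2)

namespace IsUnitLengthRectilinear

variable (h : G.IsUnitLengthRectilinear p)
include h

theorem norm_vec (d : G.graph.Dart) : ‖G.vec p d‖ = 1 := h.unit_length _ _ d.adj

theorem strip_subset_thickening (d : G.graph.Dart) {δ : ℝ} (hδ : 0 < δ) :
    G.strip p d δ ⊆ Metric.thickening (2 * δ) (segment ℝ (p d.fst) (p d.snd)) := by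
  rintro _ ⟨z, ⟨h1, h2⟩, rfl⟩
  rw [Metric.mem_thickening_iff]
  refine ⟨p d.fst + (z.re : ℂ) * G.vec p d, ?_, ?_⟩
  · rw [segment_eq_image']
    exact ⟨z.re, ⟨h1.1.le, h1.2.le⟩, by simp [vec, Complex.real_smul]⟩
  · rw [dist_eq_norm, add_sub_add_left_eq_sub, ← sub_mul, norm_mul, h.norm_vec, mul_one]
    refine (Complex.norm_le_abs_re_add_abs_im _).trans_lt ?_
    have h3 : 0 < z.im := h2.1
    have h4 : z.im < δ := h2.2
    simp only [Complex.sub_re, Complex.ofReal_re, sub_self, abs_zero, Complex.sub_im,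
      Complex.ofReal_im, sub_zero, zero_add]
    rw [abs_of_pos h3]
    linarith

/-- In coordinates in which `d` goes from 0 to 1, the strip is an open box above the open unit
interval. No axis-parallel segment from either end enters it, whatever the height of the box. -/
theorem strip_disjoint_of_fst {d e : G.graph.Dart} (he : e.fst = d.fst ∨ e.fst = d.snd) (δ : ℝ) :
    Disjoint (G.strip p d δ) (segment ℝ (p e.fst) (p e.snd)) := by
  rw [snd_eq (p := p) e]
  rcases he with he | he
  · rw [he]
    refine disjoint_segment_of_mul (h.vec_ne_zero d) (h.vec_eq_I_pow_mul d e) ?_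
    rintro k - x hx0 hx1 ⟨h1, h2⟩
    fin_cases k <;> simp [Complex.I_pow_three] at h1 h2
  · rw [he, snd_eq (p := p) d]
    -- The same box seen from the end of `d`, shifted by -1.
    have := disjoint_segment_of_mul (c := p d.fst + G.vec p d) (A := Set.Ioo (-1) 0 ×ℂ Set.Ioo 0 δ)
      (h.vec_ne_zero d) (h.vec_eq_I_pow_mul d e) ?_
    · convert this using 1
      unfold strip
      ext w
      constructor
      · rintro ⟨z, ⟨h1, h2⟩, rfl⟩
        refine ⟨z - 1, ⟨?_, by simpa using h2⟩, by ring⟩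
        constructor <;> have := h1.1 <;> have := h1.2 <;> simp <;> linarith
      · rintro ⟨z, ⟨h1, h2⟩, rfl⟩
        refine ⟨z + 1, ⟨?_, by simpa using h2⟩, by ring⟩
        constructor <;> have := h1.1 <;> have := h1.2 <;> simp <;> linarith
    · rintro k - x hx0 hx1 ⟨h1, h2⟩
      fin_cases k <;> simp [Complex.I_pow_three] at h1 h2

/-- Edges that share an end with `d` never meet the strip; all others are at positive distance from
`d` and miss it once it is thin. -/
theorem eventually_strip_disjoint_segment (d e : G.graph.Dart) :
    ∀ᶠ δ : ℝ in 𝓝[>] 0, Disjoint (G.strip p d δ) (segment ℝ (p e.fst) (p e.snd)) := by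
  by_cases h1 : e.fst = d.fst ∨ e.fst = d.snd
  · exact Eventually.of_forall fun δ => h.strip_disjoint_of_fst h1 δ
  by_cases h2 : e.snd = d.fst ∨ e.snd = d.snd
  · refine Eventually.of_forall fun δ => ?_
    rw [segment_symm]
    exact h.strip_disjoint_of_fst (e := e.symm) h2 δ
  refine eventually_disjoint (K := segment ℝ (p d.fst) (p d.snd)) ?_ ?_ ?_
    fun δ hδ => h.strip_subset_thickening d hδ
  · rw [segment_eq_image']
    exact isCompact_Icc.image (by fun_prop)
  · rw [segment_eq_image']
    exact (isCompact_Icc.image (by fun_prop)).isClosed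
  · rw [Set.disjoint_left]
    intro z hz hz'
    push Not at h1 h2
    have hne : s(d.fst, d.snd) ≠ s(e.fst, e.snd) := by
      intro h5
      rw [Sym2.eq_iff] at h5
      rcases h5 with h5 | h5
      · exact h1.1 h5.1.symm
      · exact h1.2 h5.2.symm
    obtain ⟨h3, h4⟩ := h.edge_edge _ _ _ _ d.adj e.adj hne ⟨hz, hz'⟩
    simp only [Set.mem_insert_iff, Set.mem_singleton_iff] at h3 h4
    rcases h3 with rfl | rfl <;> rcases h4 with h4 | h4 <;> have h5 := h.injective h4 <;> tauto

theorem eventually_strip_notMem (d : G.graph.Dart) (w : Fin n) :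
    ∀ᶠ δ : ℝ in 𝓝[>] 0, p w ∉ G.strip p d δ := by
  by_cases hw : w = d.fst ∨ w = d.snd
  · refine Eventually.of_forall fun δ hz => ?_
    rcases hw with rfl | rfl
    · exact Set.disjoint_left.1 (h.strip_disjoint_of_fst (e := d) (Or.inl rfl) δ) hz
        (left_mem_segment _ _ _)
    · exact Set.disjoint_left.1 (h.strip_disjoint_of_fst (e := d) (Or.inl rfl) δ) hz
        (right_mem_segment _ _ _)
  · have := eventually_disjoint (K := segment ℝ (p d.fst) (p d.snd)) (S := {p w})
      (A := fun δ => G.strip p d δ) ?_ isClosed_singleton ?_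
      fun δ hδ => h.strip_subset_thickening d hδ
    · exact this.mono fun δ hδ => by simpa using hδ
    · rw [segment_eq_image']
      exact isCompact_Icc.image (by fun_prop)
    · rw [Set.disjoint_singleton_right]
      exact fun hz => hw (h.vertex_edge _ _ _ d.adj hz)

theorem eventually_strip_subset (d : G.graph.Dart) :
    ∀ᶠ δ : ℝ in 𝓝[>] 0, G.strip p d δ ⊆ (G.drawn p)ᶜ := by
  filter_upwards [eventually_all.2 (h.eventually_strip_disjoint_segment d),
    eventually_all.2 (h.eventually_strip_notMem d)] with δ h1 h2 z hz
  rintro (⟨w, rfl⟩ | hz')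
  · exact h2 w hz
  · obtain ⟨e, he⟩ := Set.mem_iUnion.1 hz'
    exact Set.disjoint_left.1 (h1 e) hz he

theorem halfSquare_disjoint_of_fst {v : Fin n} {u : ℂ} (hu : u ≠ 0) {e : G.graph.Dart}
    (he : e.fst = v) (hk : ∃ k : Fin 4, G.vec p e = Complex.I ^ (k : ℕ) * u)
    (hne : G.vec p e ≠ u) (δ : ℝ) :
    Disjoint (halfSquare (p v) u δ) (segment ℝ (p e.fst) (p e.snd)) := by
  subst he
  rw [snd_eq (p := p) e]
  refine disjoint_segment_of_mul hu hk ?_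
  rintro k hk' x hx0 hx1 ⟨h1, h2⟩
  fin_cases k <;> simp [Complex.I_pow_three] at h1 h2
  · simp at hk'
    exact hne hk'
  · linarith

/-- If no edge leaves `v` in direction `u`, the edges at `v` point in the three other directions and
stay outside the open half-square. Everything else is at positive distance from `v`. -/
theorem eventually_halfSquare_subset {v : Fin n} {u : ℂ} (hu : ‖u‖ = 1)
    (hk : ∀ e : G.graph.Dart, ∃ k : Fin 4, G.vec p e = Complex.I ^ (k : ℕ) * u)
    (hne : ∀ e : G.graph.Dart, e.fst = v → G.vec p e ≠ u) :
    ∀ᶠ δ : ℝ in 𝓝[>] 0, halfSquare (p v) u δ ⊆ (G.drawn p)ᶜ := by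
  have hu0 : u ≠ 0 := by rintro rfl; simp at hu
  have h1 : ∀ e : G.graph.Dart, ∀ᶠ δ : ℝ in 𝓝[>] 0,
      Disjoint (halfSquare (p v) u δ) (segment ℝ (p e.fst) (p e.snd)) := by
    intro e
    by_cases h1 : e.fst = v
    · exact Eventually.of_forall fun δ => h.halfSquare_disjoint_of_fst hu0 h1 (hk e) (hne e h1) δ
    by_cases h2 : e.snd = v
    · refine Eventually.of_forall fun δ => ?_
      rw [segment_symm]
      exact h.halfSquare_disjoint_of_fst (e := e.symm) hu0 h2 (hk _) (hne _ h2) δ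
    refine eventually_disjoint isCompact_singleton ?_ ?_
      fun δ _ => halfSquare_subset_thickening (p v) hu
    · rw [segment_eq_image']
      exact (isCompact_Icc.image (by fun_prop)).isClosed
    · rw [Set.disjoint_singleton_left]
      intro hz
      rcases h.vertex_edge _ _ _ e.adj hz with h3 | h3
      · exact h1 h3.symm
      · exact h2 h3.symm
  have h2 : ∀ w : Fin n, ∀ᶠ δ : ℝ in 𝓝[>] 0, p w ∉ halfSquare (p v) u δ := by
    intro w
    by_cases hw : w = v
    · subst hw
      refine Eventually.of_forall fun δ hz => ?_
      obtain ⟨z, ⟨h3, -⟩, hz⟩ := hz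
      have : z * u = 0 := by simpa using hz
      rcases mul_eq_zero.1 this with rfl | h4
      · simp at h3
      · exact hu0 h4
    · have := eventually_disjoint (K := {p v}) (S := {p w})
        (A := fun δ => halfSquare (p v) u δ) isCompact_singleton isClosed_singleton ?_
        fun δ _ => halfSquare_subset_thickening (p v) hu
      · exact this.mono fun δ hδ => by simpa using hδ
      · rw [Set.disjoint_singleton]
        exact fun hz => hw (h.injective hz.symm)
  filter_upwards [eventually_all.2 h1, eventually_all.2 h2] with δ h1 h2 z hz
  rintro (⟨w, rfl⟩ | hz')
  · exact h2 w hz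
  · obtain ⟨e, he⟩ := Set.mem_iUnion.1 hz'
    exact Set.disjoint_left.1 (h1 e) hz he

end IsUnitLengthRectilinear

end PlanarEmbeddedGraph

/-! ### The region to the left of a dart -/

namespace PlanarEmbeddedGraph

variable {n : ℕ} {G : PlanarEmbeddedGraph n} {p : Fin n → ℂ}

theorem strip_mono (d : G.graph.Dart) {δ ε : ℝ} (h : δ ≤ ε) : G.strip p d δ ⊆ G.strip p d ε := by
  rintro _ ⟨z, ⟨h1, h2⟩, rfl⟩
  exact ⟨z, ⟨h1, h2.1, h2.2.trans_le h⟩, rfl⟩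

theorem mem_strip (d : G.graph.Dart) {δ a b : ℝ} (ha : 0 < a) (ha' : a < 1) (hb : 0 < b)
    (hb' : b < δ) : p d.fst + (a + b * Complex.I) * G.vec p d ∈ G.strip p d δ :=
  ⟨a + b * Complex.I, ⟨by simp [ha, ha'], by simp [hb, hb']⟩, rfl⟩

theorem mem_halfSquare (c u : ℂ) {δ a b : ℝ} (ha : 0 < a) (ha' : a < δ) (hb : -δ < b)
    (hb' : b < δ) : c + (a + b * Complex.I) * u ∈ halfSquare c u δ :=
  ⟨a + b * Complex.I, ⟨by simp [ha, ha'], by simp [hb, hb']⟩, rfl⟩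

theorem IsRegion.mem_of_preconnected {R C : Set ℂ} (hR : G.IsRegion p R) (hC : IsPreconnected C)
    (hU : C ⊆ (G.drawn p)ᶜ) {z w : ℂ} (hz : z ∈ C) (hw : w ∈ C) (hzR : z ∈ R) : w ∈ R := by
  obtain ⟨c, hc, rfl⟩ := hR
  rw [connectedComponentIn_eq hzR]
  exact hC.subset_connectedComponentIn hz hU hw

theorem IsRegion.eq_of_mem {R R' : Set ℂ} (hR : G.IsRegion p R) (hR' : G.IsRegion p R') {z : ℂ}
    (hz : z ∈ R) (hz' : z ∈ R') : R = R' := by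
  obtain ⟨c, hc, rfl⟩ := hR
  obtain ⟨c', hc', rfl⟩ := hR'
  rw [connectedComponentIn_eq hz, connectedComponentIn_eq hz']

theorem IsRegion.subset_compl {R : Set ℂ} (hR : G.IsRegion p R) : R ⊆ (G.drawn p)ᶜ := by
  obtain ⟨c, hc, rfl⟩ := hR
  exact connectedComponentIn_subset _ _

theorem segment_subset_drawn (d : G.graph.Dart) : segment ℝ (p d.fst) (p d.snd) ⊆ G.drawn p :=
  fun _ hz => Or.inr (Set.mem_iUnion.2 ⟨d, hz⟩)

variable (G p) in
/-- The face `R` of the drawing is immediately to the left of the dart `d`. -/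
def LeftRegion (d : G.graph.Dart) (R : Set ℂ) : Prop :=
  G.IsRegion p R ∧ ∀ᶠ δ : ℝ in 𝓝[>] 0, G.strip p d δ ⊆ R

theorem IsUnitLengthRectilinear.exists_leftRegion (h : G.IsUnitLengthRectilinear p)
    (d : G.graph.Dart) : ∃ R, G.LeftRegion p d R := by
  obtain ⟨δ, hδ, hδ0⟩ := ((h.eventually_strip_subset d).and self_mem_nhdsWithin).exists
  replace hδ0 : 0 < δ := hδ0
  have hm := mem_strip (p := p) d (δ := δ) (a := 1 / 2) (b := δ / 2) (by norm_num) (by norm_num)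
    (by linarith) (by linarith)
  refine ⟨_, ⟨_, hδ hm, rfl⟩, ?_⟩
  filter_upwards [Ioc_mem_nhdsGT hδ0] with ε hε
  exact (strip_mono d hε.2).trans
    ((isPreconnected_image_reProdIm _ _ _ _ _ _).subset_connectedComponentIn hm hδ)

/-- Turning counterclockwise from the next dart `e`, the first edge met is the reversal of `d`,
after `q` quarter turns. The half-squares in the `q - 1` free directions in between overlap in
quadrants and connect the strip of `e` with that of `d`. -/
theorem IsUnitLengthRectilinear.leftRegion_faceNext (h : G.IsUnitLengthRectilinear p)
    (hp : G.PreservesEmbedding p) {d : G.graph.Dart} {R : Set ℂ} (hR : G.LeftRegion p d R) :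
    G.LeftRegion p (G.faceNext d) R := by
  obtain ⟨R', hR'⟩ := h.exists_leftRegion (G.faceNext d)
  suffices R = R' from this ▸ hR'
  obtain ⟨q, hq1, hq4, hq, hmin⟩ := hp (G.faceNext d)
  rw [rot_faceNext, vec_symm] at hq
  set e := G.faceNext d with he
  have hfst : e.fst = d.snd := faceNext_fst d
  have hhalf : ∀ r : ℕ, 1 ≤ r → r < q → ∀ᶠ δ : ℝ in 𝓝[>] 0,
      halfSquare (p e.fst) (Complex.I ^ r * G.vec p e) δ ⊆ (G.drawn p)ᶜ := by
    intro r h1 h2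
    refine h.eventually_halfSquare_subset ?_ ?_ (hmin r h1 h2)
    · rw [norm_mul, norm_pow, Complex.norm_I, one_pow, one_mul, h.norm_vec]
    · intro f
      obtain ⟨k, hk⟩ := h.vec_eq_I_pow_mul e f
      -- Adding `4 * r` makes the natural subtraction compute `k - r` modulo 4.
      refine ⟨⟨(k + 4 * r - r) % 4, Nat.mod_lt _ (by norm_num)⟩, ?_⟩
      rw [hk, ← mul_assoc]
      congr 1
      simp only
      rw [← Complex.I_pow_eq_pow_mod, ← pow_add, Complex.I_pow_eq_pow_mod,
        Complex.I_pow_eq_pow_mod (_ - _ + _)]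
      congr 1
      omega
  have hhalf' : ∀ᶠ δ : ℝ in 𝓝[>] 0, ∀ r ∈ Set.Ico 1 q,
      halfSquare (p e.fst) (Complex.I ^ r * G.vec p e) δ ⊆ (G.drawn p)ᶜ :=
    (Set.finite_Ico 1 q).eventually_all.2 fun r hr => hhalf r hr.1 hr.2
  obtain ⟨δ, ⟨⟨h1, h2⟩, h3⟩, h4⟩ := (((hR.2.and hR'.2).and hhalf').and
    (Ioo_mem_nhdsGT (show (0 : ℝ) < 1 by norm_num))).exists
  obtain ⟨hδ0, hδ1⟩ := h4
  set η := δ / 2 with hη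
  -- The point on the diagonal of the quadrant that follows the direction `I ^ r * vec e`.
  -- Consecutive points lie in a common half-square.
  let z : ℕ → ℂ := fun r => p e.fst + (η + η * Complex.I) * (Complex.I ^ r * G.vec p e)
  have hz : ∀ r : ℕ, r < q → z r ∈ R' := by
    intro r
    induction r with
    | zero =>
      intro _
      refine h2 ?_
      simp only [z, pow_zero, one_mul]
      exact mem_strip e (by linarith) (by linarith) (by linarith) (by linarith)
    | succ r ih =>
      intro hr
      refine hR'.1.mem_of_preconnected (isPreconnected_image_reProdIm _ _ _ _ _ _)
        (h3 (r + 1) ⟨by omega, hr⟩) (z := z r) ?_ ?_ (ih (by omega))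
      · change z r ∈ halfSquare (p e.fst) (Complex.I ^ (r + 1) * G.vec p e) δ
        have := mem_halfSquare (p e.fst) (Complex.I ^ (r + 1) * G.vec p e) (δ := δ) (a := η)
          (b := -η) (by linarith) (by linarith) (by linarith) (by linarith)
        convert this using 1
        simp only [z, pow_succ]
        push_cast
        linear_combination ((η : ℂ) * (Complex.I ^ r : ℂ) * G.vec p e) * Complex.I_sq
      · exact mem_halfSquare _ _ (by linarith) (by linarith) (by linarith) (by linarith)
  have hz1 := hz (q - 1) (by omega)
  -- The last quadrant ends at the reversal of `d`, so its diagonal point lies in the strip of `d`,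
  -- at distance `η` before its end.
  have hz2 : z (q - 1) ∈ R := by
    refine h1 ?_
    have := mem_strip (p := p) d (δ := δ) (a := 1 - η) (b := η) (by linarith) (by linarith)
      (by linarith) (by linarith)
    convert this using 1
    simp only [z, hfst, snd_eq (p := p) d]
    have h5 : Complex.I * (Complex.I ^ (q - 1) * G.vec p e) = - G.vec p d := by
      rw [← mul_assoc, ← pow_succ', Nat.sub_add_cancel hq1, hq]
    have h6 : Complex.I ^ (q - 1) * G.vec p e = Complex.I * G.vec p d := by
      linear_combination (-Complex.I) * h5 + (Complex.I ^ (q - 1) * G.vec p e) * Complex.I_sq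
    rw [h6]
    push_cast
    linear_combination (η * G.vec p d) * Complex.I_sq
  exact hR.1.eq_of_mem hR'.1 hz2 hz1

theorem leftRegion_of_leftFace_eq (h : G.IsUnitLengthRectilinear p)
    (hp : G.PreservesEmbedding p) {d e : G.graph.Dart} {R : Set ℂ} (hR : G.LeftRegion p d R)
    (hde : G.leftFace d = G.leftFace e) : G.LeftRegion p e R := by
  obtain ⟨i, -, hi⟩ := (leftFace_eq_iff.1 hde).exists_pow_eq'
  subst hi
  clear hde
  induction i with
  | zero => simpa using hR
  | succ i ih =>
    rw [pow_succ', Equiv.Perm.mul_apply]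
    exact h.leftRegion_faceNext hp ih

theorem LeftRegion.unique {d : G.graph.Dart} {R R' : Set ℂ} (hR : G.LeftRegion p d R)
    (hR' : G.LeftRegion p d R') : R = R' := by
  obtain ⟨δ, ⟨h1, h2⟩, h3⟩ := ((hR.2.and hR'.2).and self_mem_nhdsWithin).exists
  replace h3 : 0 < δ := h3
  have hm := mem_strip (p := p) d (δ := δ) (a := 1 / 2) (b := δ / 2) (by norm_num) (by norm_num)
    (by linarith) (by linarith)
  exact hR.1.eq_of_mem hR'.1 (h1 hm) (h2 hm)

theorem LeftRegion.eventually_mem {d : G.graph.Dart} {R : Set ℂ} (hR : G.LeftRegion p d R) {a : ℝ}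
    (ha : 0 < a) (ha' : a < 1) :
    ∀ᶠ s : ℝ in 𝓝[>] 0, p d.fst + (a + s * Complex.I) * G.vec p d ∈ R := by
  obtain ⟨δ, h1, h3⟩ := (hR.2.and self_mem_nhdsWithin).exists
  filter_upwards [Ioo_mem_nhdsGT (show (0 : ℝ) < δ from h3)] with s hs
  exact h1 (mem_strip d ha ha' hs.1 hs.2)

theorem LeftRegion.exists_forall_mem {d : G.graph.Dart} {R : Set ℂ} (hR : G.LeftRegion p d R) :
    ∃ δ : ℝ, 0 < δ ∧ ∀ a s : ℝ, 0 < a → a < 1 → 0 < s → s < δ →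
      p d.fst + (a + s * Complex.I) * G.vec p d ∈ R := by
  obtain ⟨δ, h1, h3⟩ := (hR.2.and self_mem_nhdsWithin).exists
  exact ⟨δ, h3, fun a s ha ha' hs hs' => h1 (mem_strip d ha ha' hs hs')⟩

theorem LeftRegion.notMem {d : G.graph.Dart} {R : Set ℂ} (hR : G.LeftRegion p d R) {a : ℝ}
    (ha : 0 ≤ a) (ha' : a ≤ 1) : p d.fst + a * G.vec p d ∉ R := by
  intro hm
  refine hR.1.subset_compl hm (segment_subset_drawn d ?_)
  rw [segment_eq_image']
  exact ⟨a, ⟨ha, ha'⟩, by simp [vec, Complex.real_smul]⟩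

/-- A dart pointing east from `(c, y)` with the open box immediately above it: if the midpoint of
the dart is not in the box, it lies on the bottom line. -/
theorem strip_inside {c y l r b t δ : ℝ} (hδ : 0 < δ)
    (h : ∀ a s : ℝ, 0 < a → a < 1 → 0 < s → s < δ →
      (l < c + a ∧ c + a < r) ∧ b < y + s ∧ y + s < t)
    (hn : ¬ ((l < c + 1 / 2 ∧ c + 1 / 2 < r) ∧ b < y ∧ y < t)) : l ≤ c ∧ c + 1 ≤ r ∧ y = b := by
  have h0 := h (1 / 2) (δ / 2) (by norm_num) (by norm_num) (by linarith) (by linarith)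
  refine ⟨?_, ?_, ?_⟩
  · by_contra! hc
    have h1 := h (min (1 / 2) (l - c)) (δ / 2) (lt_min (by norm_num) (by linarith))
      ((min_le_left _ _).trans_lt (by norm_num)) (by linarith) (by linarith)
    linarith [h1.1.1, min_le_right (1 / 2) (l - c)]
  · by_contra! hc
    have h1 := h (1 - min (1 / 2) (c + 1 - r)) (δ / 2)
      (by linarith [min_le_left (1 / 2) (c + 1 - r)])
      (by linarith [lt_min (show (0 : ℝ) < 1 / 2 by norm_num) (sub_pos.2 hc)])
      (by linarith) (by linarith)
    linarith [h1.1.2, min_le_right (1 / 2) (c + 1 - r)]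
  · apply le_antisymm
    · by_contra! hc
      exact hn ⟨h0.1, hc, by linarith [h0.2.2]⟩
    · by_contra! hc
      have h1 := h (1 / 2) (min (δ / 2) (b - y)) (by norm_num) (by norm_num)
        (lt_min (by linarith) (by linarith)) ((min_le_left _ _).trans_lt (by linarith))
      linarith [h1.2.1, min_le_right (δ / 2) (b - y)]

/-- The counterpart for the exterior of a box: the dart lies in the closed box and the points
immediately above do not, so it is on the top line. -/
theorem strip_outside {c y l r b t δ : ℝ} (hδ : 0 < δ)
    (h : ∀ a s : ℝ, 0 < a → a < 1 → 0 < s → s < δ →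
      ¬ ((l ≤ c + a ∧ c + a ≤ r) ∧ b ≤ y + s ∧ y + s ≤ t))
    (hn : ∀ a : ℝ, 0 ≤ a → a ≤ 1 → (l ≤ c + a ∧ c + a ≤ r) ∧ b ≤ y ∧ y ≤ t) :
    l ≤ c ∧ c + 1 ≤ r ∧ y = t := by
  have h0 := hn 0 le_rfl (by norm_num)
  have h1 := hn 1 (by norm_num) le_rfl
  refine ⟨by linarith [h0.1.1], h1.1.2, le_antisymm h0.2.2 ?_⟩
  by_contra! hc
  refine h (1 / 2) (min (δ / 2) (t - y)) (by norm_num) (by norm_num)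
    (lt_min (by linarith) (by linarith)) ((min_le_left _ _).trans_lt (by linarith))
    ⟨⟨by linarith, by linarith⟩, ?_, ?_⟩
  · linarith [lt_min (show 0 < δ / 2 by linarith) (sub_pos.2 hc)]
  · linarith [min_le_right (δ / 2) (t - y)]

/-- The region contains a strip at the dart but no point of the dart. Each direction is rotated to
east, where `strip_inside` applies. -/
theorem IsUnitLengthRectilinear.rectEdge_of_bounded (h : G.IsUnitLengthRectilinear p)
    {d : G.graph.Dart} {R : Set ℂ} (hR : G.LeftRegion p d R) {l r b t : ℝ}
    (hRe : R = Set.Ioo l r ×ℂ Set.Ioo b t) :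
    RectEdge l r b t (p d.fst).re (p d.fst).im (p d.snd).re (p d.snd).im := by
  obtain ⟨δ, hδ, hm⟩ := hR.exists_forall_mem
  have hn := hR.notMem (a := 1 / 2) (by norm_num) (by norm_num)
  obtain ⟨k, hk⟩ := h.vec_cases d
  rw [snd_eq (p := p) d]
  rw [hk] at hn hm ⊢
  subst hRe
  unfold RectEdge
  simp only [Complex.mem_reProdIm, Set.mem_Ioo] at hm hn
  fin_cases k <;> simp only [Complex.I_pow_three, pow_zero, pow_one, Complex.I_sq,
    Complex.add_re, Complex.add_im, Complex.mul_re, Complex.mul_im, Complex.ofReal_re,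
    Complex.ofReal_im, Complex.I_re, Complex.I_im, Complex.one_re, Complex.one_im, Complex.neg_re,
    Complex.neg_im] at hn hm ⊢ <;> ring_nf at hn hm
  · have := strip_inside (c := (p d.fst).re) (y := (p d.fst).im) (l := l) (r := r) (b := b)
      (t := t) hδ (fun a s h1 h2 h3 h4 => hm a s h1 h2 h3 h4) ?_
    · obtain ⟨h6, h7, h8⟩ := this
      left; refine ⟨?_, ?_, ?_, ?_, ?_⟩ <;> first | trivial | linarith
    · intro h5
      refine hn ⟨⟨?_, ?_⟩, ?_, ?_⟩ <;> linarith [h5.1.1, h5.1.2, h5.2.1, h5.2.2]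
  · have := strip_inside (c := (p d.fst).im) (y := - (p d.fst).re) (l := b) (r := t) (b := -r)
      (t := -l) hδ (fun a s h1 h2 h3 h4 => ?_) ?_
    · obtain ⟨h6, h7, h8⟩ := this
      right; left; refine ⟨?_, ?_, ?_, ?_, ?_⟩ <;> first | trivial | linarith
    · have := hm a s h1 h2 h3 h4
      refine ⟨⟨?_, ?_⟩, ?_, ?_⟩ <;> linarith [this.1.1, this.1.2, this.2.1, this.2.2]
    · intro h5
      refine hn ⟨⟨?_, ?_⟩, ?_, ?_⟩ <;> linarith [h5.1.1, h5.1.2, h5.2.1, h5.2.2]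
  · have := strip_inside (c := -(p d.fst).re) (y := - (p d.fst).im) (l := -r) (r := -l) (b := -t)
      (t := -b) hδ (fun a s h1 h2 h3 h4 => ?_) ?_
    · obtain ⟨h6, h7, h8⟩ := this
      right; right; left; refine ⟨?_, ?_, ?_, ?_, ?_⟩ <;> first | trivial | linarith
    · have := hm a s h1 h2 h3 h4
      refine ⟨⟨?_, ?_⟩, ?_, ?_⟩ <;> linarith [this.1.1, this.1.2, this.2.1, this.2.2]
    · intro h5
      refine hn ⟨⟨?_, ?_⟩, ?_, ?_⟩ <;> linarith [h5.1.1, h5.1.2, h5.2.1, h5.2.2]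
  · have := strip_inside (c := -(p d.fst).im) (y := (p d.fst).re) (l := -t) (r := -b) (b := l)
      (t := r) hδ (fun a s h1 h2 h3 h4 => ?_) ?_
    · obtain ⟨h6, h7, h8⟩ := this
      right; right; right; refine ⟨?_, ?_, ?_, ?_, ?_⟩ <;> first | trivial | linarith
    · have := hm a s h1 h2 h3 h4
      refine ⟨⟨?_, ?_⟩, ?_, ?_⟩ <;> linarith [this.1.1, this.1.2, this.2.1, this.2.2]
    · intro h5
      refine hn ⟨⟨?_, ?_⟩, ?_, ?_⟩ <;> linarith [h5.1.1, h5.1.2, h5.2.1, h5.2.2]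

/-- As for bounded regions, but with the rectangle on the right of the dart; therefore the ends are
exchanged. -/
theorem IsUnitLengthRectilinear.rectEdge_of_unbounded (h : G.IsUnitLengthRectilinear p)
    {d : G.graph.Dart} {R : Set ℂ} (hR : G.LeftRegion p d R) {l r b t : ℝ}
    (hRe : R = (Set.Icc l r ×ℂ Set.Icc b t)ᶜ) :
    RectEdge l r b t (p d.snd).re (p d.snd).im (p d.fst).re (p d.fst).im := by
  obtain ⟨δ, hδ, hm⟩ := hR.exists_forall_mem
  have hn := fun a (h1 : 0 ≤ a) h2 => hR.notMem (a := a) h1 h2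
  obtain ⟨k, hk⟩ := h.vec_cases d
  rw [snd_eq (p := p) d]
  rw [hk] at hm ⊢
  simp only [hk] at hn
  subst hRe
  unfold RectEdge
  simp only [Set.mem_compl_iff, Complex.mem_reProdIm, not_not, Set.mem_Icc] at hm hn
  fin_cases k <;> simp only [Complex.I_pow_three, pow_zero, pow_one, Complex.I_sq,
    Complex.add_re, Complex.add_im, Complex.mul_re, Complex.mul_im, Complex.ofReal_re,
    Complex.ofReal_im, Complex.I_re, Complex.I_im, Complex.one_re, Complex.one_im, Complex.neg_re,
    Complex.neg_im] at hn hm ⊢ <;> ring_nf at hn hm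
  · have := strip_outside (c := (p d.fst).re) (y := (p d.fst).im) (l := l) (r := r) (b := b)
      (t := t) hδ (fun a s h1 h2 h3 h4 => hm a s h1 h2 h3 h4) hn
    obtain ⟨h6, h7, h8⟩ := this
    right; right; left; refine ⟨?_, ?_, ?_, ?_, ?_⟩ <;> first | trivial | linarith
  · have := strip_outside (c := (p d.fst).im) (y := - (p d.fst).re) (l := b) (r := t) (b := -r)
      (t := -l) hδ (fun a s h1 h2 h3 h4 h5 => hm a s h1 h2 h3 h4 ?_) (fun a h1 h2 => ?_)
    · obtain ⟨h6, h7, h8⟩ := this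
      right; right; right; refine ⟨?_, ?_, ?_, ?_, ?_⟩ <;> first | trivial | linarith
    · refine ⟨⟨?_, ?_⟩, ?_, ?_⟩ <;> linarith [h5.1.1, h5.1.2, h5.2.1, h5.2.2]
    · have h5 := hn a h1 h2
      refine ⟨⟨?_, ?_⟩, ?_, ?_⟩ <;> linarith [h5.1.1, h5.1.2, h5.2.1, h5.2.2]
  · have := strip_outside (c := -(p d.fst).re) (y := - (p d.fst).im) (l := -r) (r := -l) (b := -t)
      (t := -b) hδ (fun a s h1 h2 h3 h4 h5 => hm a s h1 h2 h3 h4 ?_) (fun a h1 h2 => ?_)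
    · obtain ⟨h6, h7, h8⟩ := this
      left; refine ⟨?_, ?_, ?_, ?_, ?_⟩ <;> first | trivial | linarith
    · refine ⟨⟨?_, ?_⟩, ?_, ?_⟩ <;> linarith [h5.1.1, h5.1.2, h5.2.1, h5.2.2]
    · have h5 := hn a h1 h2
      refine ⟨⟨?_, ?_⟩, ?_, ?_⟩ <;> linarith [h5.1.1, h5.1.2, h5.2.1, h5.2.2]
  · have := strip_outside (c := -(p d.fst).im) (y := (p d.fst).re) (l := -t) (r := -b) (b := l)
      (t := r) hδ (fun a s h1 h2 h3 h4 h5 => hm a s h1 h2 h3 h4 ?_) (fun a h1 h2 => ?_)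
    · obtain ⟨h6, h7, h8⟩ := this
      right; left; refine ⟨?_, ?_, ?_, ?_, ?_⟩ <;> first | trivial | linarith
    · refine ⟨⟨?_, ?_⟩, ?_, ?_⟩ <;> linarith [h5.1.1, h5.1.2, h5.2.1, h5.2.2]
    · have h5 := hn a h1 h2
      refine ⟨⟨?_, ?_⟩, ?_, ?_⟩ <;> linarith [h5.1.1, h5.1.2, h5.2.1, h5.2.2]

end PlanarEmbeddedGraph

/-! ### Components of a rectangular drawing -/

namespace PlanarEmbeddedGraph

variable {n : ℕ} {G : PlanarEmbeddedGraph n} {p : Fin n → ℂ}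

theorem dart_symm_fst (d : G.graph.Dart) : d.symm.fst = d.snd := rfl

theorem dart_symm_snd (d : G.graph.Dart) : d.symm.snd = d.fst := rfl

theorem reachable_of_leftFace_eq {d e : G.graph.Dart} (h : G.leftFace d = G.leftFace e) :
    G.graph.Reachable d.fst e.fst := by
  obtain ⟨i, -, hi⟩ := (leftFace_eq_iff.1 h).exists_pow_eq'
  subst hi
  clear h
  induction i with
  | zero => simp
  | succ i ih =>
    rw [pow_succ', Equiv.Perm.mul_apply, faceNext_fst]
    exact ih.trans (SimpleGraph.Adj.reachable ((G.faceNext ^ i) d).adj)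

theorem IsUnitLengthRectilinear.re_im_cases (h : G.IsUnitLengthRectilinear p) (d : G.graph.Dart) :
    ((p d.snd).re = (p d.fst).re + 1 ∧ (p d.snd).im = (p d.fst).im) ∨
    ((p d.snd).re = (p d.fst).re ∧ (p d.snd).im = (p d.fst).im + 1) ∨
    ((p d.snd).re = (p d.fst).re - 1 ∧ (p d.snd).im = (p d.fst).im) ∨
    ((p d.snd).re = (p d.fst).re ∧ (p d.snd).im = (p d.fst).im - 1) := by
  obtain ⟨k, hk⟩ := h.vec_cases d
  rw [snd_eq (p := p) d, hk]
  fin_cases k <;> simp [Complex.I_pow_three, sub_eq_add_neg]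

theorem IsUnitLengthRectilinear.exists_int (h : G.IsUnitLengthRectilinear p) {v w : Fin n}
    (hvw : G.graph.Reachable v w) :
    ∃ a b : ℤ, (p w).re = (p v).re + a ∧ (p w).im = (p v).im + b := by
  obtain ⟨q⟩ := hvw
  induction q with
  | nil => exact ⟨0, 0, by simp, by simp⟩
  | @cons u v w huv q ih =>
    obtain ⟨a, b, ha, hb⟩ := ih
    have := h.re_im_cases ⟨(u, v), huv⟩
    simp only at this
    rcases this with h1 | h1 | h1 | h1
    · exact ⟨a + 1, b, by push_cast; linarith, by linarith⟩
    · exact ⟨a, b + 1, by linarith, by push_cast; linarith⟩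
    · exact ⟨a - 1, b, by push_cast; linarith, by linarith⟩
    · exact ⟨a, b - 1, by linarith, by push_cast; linarith⟩

namespace IsUnitRectangularDrawing

variable (h : G.IsUnitRectangularDrawing p)
include h

/-- An isolated vertex would be a puncture of one region containing all four diagonal points around
it. An open rectangle containing them is convex and contains the vertex. The exterior of a rectangle
that omits the vertex also omits one of the four points, if they are close. -/
theorem exists_dart (v : Fin n) : ∃ d : G.graph.Dart, d.fst = v := by
  by_contra! hv
  have h1 : ∀ r : Fin 4, ∀ᶠ δ : ℝ in 𝓝[>] 0,
      halfSquare (p v) (Complex.I ^ (r : ℕ)) δ ⊆ (G.drawn p)ᶜ := by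
    intro r
    refine h.unit_rectilinear.eventually_halfSquare_subset (by simp) ?_
      (fun e he => absurd he (hv e))
    intro e
    obtain ⟨k, hk⟩ := h.unit_rectilinear.vec_cases e
    refine ⟨k - r, ?_⟩
    rw [hk, ← pow_add, Complex.I_pow_eq_pow_mod, Complex.I_pow_eq_pow_mod (_ + _)]
    congr 1
    clear hk
    revert k r
    decide
  obtain ⟨δ, h2, hδ⟩ := ((eventually_all.2 h1).and self_mem_nhdsWithin).exists
  replace hδ : 0 < δ := hδ
  let z : ℝ → ℕ → ℂ := fun η r => p v + (η + η * Complex.I) * Complex.I ^ r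
  have hz0 : ∀ η, 0 < η → η < δ → ∀ r : ℕ, z η r ∈ halfSquare (p v) (Complex.I ^ r) δ :=
    fun η h3 h4 r => mem_halfSquare _ _ h3 h4 (by linarith) h4
  have hz1 : ∀ η, 0 < η → η < δ → ∀ r : ℕ, z η r ∈ halfSquare (p v) (Complex.I ^ (r + 1)) δ := by
    intro η h3 h4 r
    have := mem_halfSquare (p v) (Complex.I ^ (r + 1)) h3 h4 (b := -η) (by linarith) (by linarith)
    convert this using 1
    simp only [z, pow_succ]
    push_cast
    linear_combination ((η : ℂ) * (Complex.I ^ r : ℂ)) * Complex.I_sq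
  have hR : G.IsRegion p (connectedComponentIn (G.drawn p)ᶜ (z (δ / 2) 0)) :=
    ⟨_, h2 0 (hz0 _ (by linarith) (by linarith) 0), rfl⟩
  have hzR : ∀ η, 0 < η → η < δ → ∀ r : ℕ, r < 4 →
      z η r ∈ connectedComponentIn (G.drawn p)ᶜ (z (δ / 2) 0) := by
    intro η h3 h4 r
    induction r with
    | zero =>
      intro _
      refine hR.mem_of_preconnected (isPreconnected_image_reProdIm _ _ _ _ _ _) (h2 0)
        (hz0 _ (by linarith) (by linarith) 0) (hz0 η h3 h4 0) (mem_connectedComponentIn ?_)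
      exact h2 0 (hz0 _ (by linarith) (by linarith) 0)
    | succ r ih =>
      intro hr
      exact hR.mem_of_preconnected (isPreconnected_image_reProdIm _ _ _ _ _ _) (h2 ⟨r + 1, hr⟩)
        (hz1 η h3 h4 r) (hz0 η h3 h4 (r + 1)) (ih (by omega))
  have hvR : p v ∉ connectedComponentIn (G.drawn p)ᶜ (z (δ / 2) 0) :=
    fun hm => hR.subset_compl hm (Or.inl ⟨v, rfl⟩)
  obtain ⟨l, r, b, t, hl, hb, ⟨-, he⟩ | ⟨-, he⟩⟩ := h.rectangular _ hR
  · rw [he] at hzR hvR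
    have e0 := hzR (δ / 2) (by linarith) (by linarith) 0 (by norm_num)
    have e2 := hzR (δ / 2) (by linarith) (by linarith) 2 (by norm_num)
    refine hvR ?_
    simp [z, Complex.mem_reProdIm] at e0 e2 ⊢
    refine ⟨⟨?_, ?_⟩, ?_, ?_⟩ <;> linarith
  · rw [he] at hzR hvR
    -- With `η` at most half of either side length, one of the four diagonal points stays in the
    -- closed rectangle together with the vertex.
    obtain ⟨η, h3, h4, h5, h6⟩ : ∃ η : ℝ, 0 < η ∧ η < δ ∧ 2 * η ≤ r - l ∧ 2 * η ≤ t - b := by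
      refine ⟨min (δ / 2) (min ((r - l) / 2) ((t - b) / 2)), ?_, ?_, ?_, ?_⟩
      · exact lt_min (by linarith) (lt_min (by linarith) (by linarith))
      · exact (min_le_left _ _).trans_lt (by linarith)
      · have := (min_le_right (δ / 2) (min ((r - l) / 2) ((t - b) / 2))).trans (min_le_left _ _)
        linarith
      · have := (min_le_right (δ / 2) (min ((r - l) / 2) ((t - b) / 2))).trans (min_le_right _ _)
        linarith
    have e0 := hzR η h3 h4 0 (by norm_num)
    have e1 := hzR η h3 h4 1 (by norm_num)
    have e2 := hzR η h3 h4 2 (by norm_num)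
    have e3 := hzR η h3 h4 3 (by norm_num)
    simp only [Set.mem_compl_iff, not_not, Complex.mem_reProdIm, Set.mem_Icc] at hvR e0 e1 e2 e3
    simp [z, Complex.I_pow_three] at e0 e1 e2 e3
    obtain ⟨⟨f1, f2⟩, f3, f4⟩ := hvR
    rcases le_total (p v).re ((l + r) / 2) with g1 | g1 <;>
      rcases le_total (p v).im ((b + t) / 2) with g2 | g2
    · linarith [e0 (by linarith) (by linarith) (by linarith)]
    · linarith [e3 (by linarith) (by linarith) (by linarith)]
    · linarith [e1 (by linarith) (by linarith) (by linarith)]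
    · linarith [e2 (by linarith) (by linarith) (by linarith)]

theorem exists_rect (d : G.graph.Dart) : ∃ (R : Set ℂ) (l r b t : ℝ), l < r ∧ b < t ∧
    (∀ e, G.leftFace e = G.leftFace d → G.LeftRegion p e R) ∧
    ((Bornology.IsBounded R ∧ ∀ e, G.leftFace e = G.leftFace d →
        RectEdge l r b t (p e.fst).re (p e.fst).im (p e.snd).re (p e.snd).im) ∨
      (¬ Bornology.IsBounded R ∧ R = (Set.Icc l r ×ℂ Set.Icc b t)ᶜ ∧
        ∀ e, G.leftFace e = G.leftFace d →
        RectEdge l r b t (p e.snd).re (p e.snd).im (p e.fst).re (p e.fst).im)) := by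
  obtain ⟨R, hR⟩ := h.unit_rectilinear.exists_leftRegion d
  have hR' : ∀ e, G.leftFace e = G.leftFace d → G.LeftRegion p e R := fun e he =>
    leftRegion_of_leftFace_eq h.unit_rectilinear h.preserves hR he.symm
  obtain ⟨l, r, b, t, hl, hb, ⟨h1, he⟩ | ⟨h1, he⟩⟩ := h.rectangular _ hR.1
  · exact ⟨R, l, r, b, t, hl, hb, hR', Or.inl ⟨h1, fun e hed =>
      h.unit_rectilinear.rectEdge_of_bounded (hR' e hed) he⟩⟩
  · exact ⟨R, l, r, b, t, hl, hb, hR', Or.inr ⟨h1, he, fun e hed =>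
      h.unit_rectilinear.rectEdge_of_unbounded (hR' e hed) he⟩⟩

/-- At a vertex of the component with minimal `re + im`, darts go only east or north. If the regions
at all of its darts were bounded rectangles, every dart `d` there would go east and `rot d` north;
applied to `rot d` as well, this is a contradiction. -/
theorem exists_unbounded (v : Fin n) : ∃ (d : G.graph.Dart) (R : Set ℂ),
    G.graph.Reachable v d.fst ∧ G.LeftRegion p d R ∧ ¬ Bornology.IsBounded R := by
  classical
  obtain ⟨w, hw, hmin⟩ := (Finset.univ.filter fun w => G.graph.Reachable v w).exists_min_image
    (fun w => (p w).re + (p w).im) ⟨v, by simp⟩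
  rw [Finset.mem_filter_univ] at hw
  have hdir : ∀ d : G.graph.Dart, d.fst = w →
      ((p d.snd).re = (p w).re + 1 ∧ (p d.snd).im = (p w).im) ∨
      ((p d.snd).re = (p w).re ∧ (p d.snd).im = (p w).im + 1) := by
    rintro d rfl
    have h1 := hmin d.snd (by simpa using hw.trans d.adj.reachable)
    rcases h.unit_rectilinear.re_im_cases d with h2 | h2 | h2 | h2
    · exact Or.inl h2
    · exact Or.inr h2
    · linarith
    · linarith
  by_contra! hcon
  have hin : ∀ d : G.graph.Dart, d.fst = w →
      ((p d.snd).re = (p w).re + 1 ∧ (p d.snd).im = (p w).im) ∧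
      ((p (G.rot d).snd).re = (p w).re ∧ (p (G.rot d).snd).im = (p w).im + 1) := by
    intro d hd
    obtain ⟨R, l, r, b, t, hl, hb, hR, ⟨h1, h2⟩ | ⟨h1, -⟩⟩ := h.exists_rect d
    · have h3 := h2 d rfl
      have h4 := h2 _ (leftFace_faceNext_symm d)
      rw [faceNext_symm_snd, faceNext_symm_apply, dart_symm_fst] at h4
      have h5 := hdir d hd
      have h6 := hdir (G.rot d) ((G.rot_fst d).trans hd)
      rw [hd] at h3 h4
      unfold RectEdge at h3 h4
      rcases h5 with h5 | h5 <;> rcases h6 with h6 | h6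
      · exfalso
        rcases h3 with h3 | h3 | h3 | h3 <;> rcases h4 with h4 | h4 | h4 | h4 <;> linarith
      · exact ⟨h5, h6⟩
      · exfalso
        rcases h3 with h3 | h3 | h3 | h3 <;> rcases h4 with h4 | h4 | h4 | h4 <;> linarith
      · exfalso
        rcases h3 with h3 | h3 | h3 | h3 <;> rcases h4 with h4 | h4 | h4 | h4 <;> linarith
    · exact absurd (hcon d R (hd ▸ hw) (hR d rfl)) h1
  obtain ⟨d, hd⟩ := h.exists_dart w
  have h1 := hin d hd
  have h2 := hin (G.rot d) ((G.rot_fst d).trans hd)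
  linarith [h1.2.1, h2.1.1]

end IsUnitRectangularDrawing

end PlanarEmbeddedGraph

theorem RectEdge.of_real {u v : ℝ} {l r b t x y x' y' : ℤ}
    (h : RectEdge (u + l) (u + r) (v + b) (v + t) (u + x) (v + y) (u + x') (v + y')) :
    RectEdge l r b t x y x' y' := by
  have e1 : ∀ {w : ℝ} {i j : ℤ}, w + (i : ℝ) = w + j → i = j := fun {w i j} h => by
    exact_mod_cast add_left_cancel h
  have e2 : ∀ {w : ℝ} {i j : ℤ}, w + (i : ℝ) = w + j + 1 → i = j + 1 := fun {w i j} h => by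
    have : (i : ℝ) = j + 1 := by linarith
    exact_mod_cast this
  have e3 : ∀ {w : ℝ} {i j : ℤ}, w + (i : ℝ) ≤ w + j → i ≤ j := fun {w i j} h => by
    have : (i : ℝ) ≤ j := by linarith
    exact_mod_cast this
  rcases h with ⟨h1, h2, h3, h4, h5⟩ | ⟨h1, h2, h3, h4, h5⟩ | ⟨h1, h2, h3, h4, h5⟩ |
    ⟨h1, h2, h3, h4, h5⟩
  · exact Or.inl ⟨e2 h1, e1 h2, e1 h3, e3 h4, e3 h5⟩
  · exact Or.inr (Or.inl ⟨e1 h1, e2 h2, e1 h3, e3 h4, e3 h5⟩)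
  · exact Or.inr (Or.inr (Or.inl ⟨e2 h1, e1 h2, e1 h3, e3 h4, e3 h5⟩))
  · exact Or.inr (Or.inr (Or.inr ⟨e1 h1, e2 h2, e1 h3, e3 h4, e3 h5⟩))

/-! ### The layout of a drawing -/

namespace PlanarEmbeddedGraph

variable {n : ℕ} {G : PlanarEmbeddedGraph n} {p : Fin n → ℂ}

theorem dart_ext {d e : G.graph.Dart} (h1 : d.fst = e.fst) (h2 : d.snd = e.snd) : d = e :=
  SimpleGraph.Dart.ext _ _ (Prod.ext h1 h2)

/-- Without vertices the whole plane is a region, which is neither a rectangle nor the exterior of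
one. -/
theorem IsUnitRectangularDrawing.nonempty (h : G.IsUnitRectangularDrawing p) :
    Nonempty (Fin n) := by
  by_contra hn
  rw [not_nonempty_iff] at hn
  have hd : G.drawn p = ∅ := by
    unfold drawn
    simp only [Set.range_eq_empty, Set.empty_union, Set.iUnion_eq_empty]
    exact fun d => (hn.false d.fst).elim
  have hR : G.IsRegion p Set.univ := by
    refine ⟨0, by simp [hd], ?_⟩
    rw [hd, Set.compl_empty, connectedComponentIn_univ]
    exact (PreconnectedSpace.connectedComponent_eq_univ _).symm
  obtain ⟨l, r, b, t, hl, hb, ⟨h1, he⟩ | ⟨h1, he⟩⟩ := h.rectangular _ hR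
  · have : (⟨l, b⟩ : ℂ) ∈ Set.univ := trivial
    rw [he, Complex.mem_reProdIm] at this
    simp at this
  · have : (⟨l, b⟩ : ℂ) ∈ Set.univ := trivial
    rw [he, Set.mem_compl_iff, Complex.mem_reProdIm] at this
    simp at this
    linarith [this hl.le]

/-- The exteriors of two rectangles meet far to the right, so a rectangular drawing has only one
unbounded region. -/
theorem unbounded_compl_unique {R R' : Set ℂ} (hR : G.IsRegion p R) (hR' : G.IsRegion p R')
    {l r b t l' r' b' t' : ℝ} (h : R = (Set.Icc l r ×ℂ Set.Icc b t)ᶜ)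
    (h' : R' = (Set.Icc l' r' ×ℂ Set.Icc b' t')ᶜ) : R = R' := by
  refine hR.eq_of_mem hR' (z := ⟨max r r' + 1, 0⟩) ?_ ?_
  · rw [h, Set.mem_compl_iff, Complex.mem_reProdIm]
    simp only [Set.mem_Icc, not_and]
    rintro ⟨-, h1⟩
    linarith [le_max_left r r']
  · rw [h', Set.mem_compl_iff, Complex.mem_reProdIm]
    simp only [Set.mem_Icc, not_and]
    rintro ⟨-, h1⟩
    linarith [le_max_right r r']

/-- A unit-length rectangular drawing is connected and it gives rise to a layout with the same
outer face. -/
theorem IsUnitRectangularDrawing.exists_layout (h : G.IsUnitRectangularDrawing p) :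
    G.graph.Connected ∧ ∃ L : G.RectLayout, ∀ f, G.IsOuterFace p f ↔ f = L.outer := by
  obtain ⟨v0⟩ := h.nonempty
  have hU := h.unit_rectilinear
  obtain ⟨d0, R0, -, hd0, hR0⟩ := h.exists_unbounded v0
  obtain ⟨l0, r0, b0, t0, hl0, hb0, he0⟩ : ∃ l r b t : ℝ, l < r ∧ b < t ∧
      R0 = (Set.Icc l r ×ℂ Set.Icc b t)ᶜ := by
    obtain ⟨l, r, b, t, hl, hb, ⟨h1, -⟩ | ⟨-, h1⟩⟩ := h.rectangular R0 hd0.1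
    · exact absurd h1 hR0
    · exact ⟨l, r, b, t, hl, hb, h1⟩
  have huniq : ∀ R, G.IsRegion p R → ¬ Bornology.IsBounded R → R = R0 := by
    intro R hR hRb
    obtain ⟨l, r, b, t, hl, hb, ⟨h1, -⟩ | ⟨-, h1⟩⟩ := h.rectangular R hR
    · exact absurd h1 hRb
    · exact unbounded_compl_unique hR hd0.1 h1 he0
  have hedge : ∀ d, G.LeftRegion p d R0 →
      RectEdge l0 r0 b0 t0 (p d.snd).re (p d.snd).im (p d.fst).re (p d.fst).im :=
    fun d hd => hU.rectEdge_of_unbounded hd he0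
  have hface : ∀ {d e R}, G.LeftRegion p d R → G.leftFace d = G.leftFace e →
      G.LeftRegion p e R := fun hd hde => leftRegion_of_leftFace_eq hU h.preserves hd hde
  -- Every facial walk along the unbounded region `R0` passes through the lower left corner of its
  -- rectangle.
  have hcorner : ∀ d, G.LeftRegion p d R0 → ∃ e, G.leftFace e = G.leftFace d ∧
      (p e.snd).re = l0 ∧ (p e.snd).im = b0 := by
    intro d hd
    obtain ⟨e, he, h1, h2⟩ := exists_lower_left (S := G.faceDarts (G.leftFace d))
      (s := G.faceNext.symm) (x := fun e => (p e.snd).re) (y := fun e => (p e.snd).im)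
      (faceDarts_nonempty _) (fun e he => by simpa [leftFace_faceNext_symm] using he)
      (fun e he => by simpa [leftFace_faceNext] using he) hl0 hb0 (by
        intro e he
        simp only [faceNext_symm_snd]
        exact hedge e (hface hd (mem_faceDarts.1 he).symm))
    exact ⟨e, mem_faceDarts.1 he, h1, h2⟩
  obtain ⟨e0, he0f, he0x, he0y⟩ := hcorner d0 hd0
  have hcv : ∀ d, G.LeftRegion p d R0 → ∃ e, G.leftFace e = G.leftFace d ∧ e.snd = e0.snd := by
    intro d hd
    obtain ⟨e, he, h1, h2⟩ := hcorner d hd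
    exact ⟨e, he, h.unit_rectilinear.injective
      (Complex.ext (h1.trans he0x.symm) (h2.trans he0y.symm))⟩
  -- Each component has a dart next to the unbounded region and so contains the vertex at this
  -- corner.
  have hreach : ∀ v, G.graph.Reachable e0.snd v := by
    intro v
    obtain ⟨d, R, hv, hd, hR⟩ := h.exists_unbounded v
    have := huniq R hd.1 hR
    subst this
    obtain ⟨e, he, hev⟩ := hcv d hd
    rw [← hev]
    exact (e.adj.reachable.symm.trans (reachable_of_leftFace_eq he)).trans hv.symm
  have hconn : G.graph.Connected := by
    have : Nonempty (Fin n) := ⟨v0⟩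
    exact ⟨fun v w => (hreach v).symm.trans (hreach w)⟩
  refine ⟨hconn, ?_⟩
  -- Two walks along `R0` both contain a dart ending at the corner. The boundary leaves only one
  -- possible such dart, so the walks belong to the same face.
  have houter : ∀ d, G.LeftRegion p d R0 → G.leftFace d = G.leftFace d0 := by
    intro d hd
    obtain ⟨e, he, hev⟩ := hcv d hd
    have h1 := hedge e (hface hd he.symm)
    have h2 := hedge e0 (hface hd0 he0f.symm)
    rw [hev] at h1
    have h3 : p e.fst = p e0.fst := by
      unfold RectEdge at h1 h2
      apply Complex.ext <;> rcases h1 with h1 | h1 | h1 | h1 <;>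
        rcases h2 with h2 | h2 | h2 | h2 <;> linarith
    rw [← he, ← he0f, dart_ext (hU.injective h3) hev]
  -- The vertex at the corner becomes the origin.
  choose x y hx hy using fun v => hU.exists_int (hreach v)
  rw [he0x] at hx
  rw [he0y] at hy
  have hrect : ∀ f : G.Face, ∃ l r b t : ℤ, l < r ∧ b < t ∧
      (f ≠ G.leftFace d0 → ∀ d, G.leftFace d = f →
        RectEdge l r b t (x d.fst) (y d.fst) (x d.snd) (y d.snd)) ∧
      (f = G.leftFace d0 → ∀ d, G.leftFace d = f →
        RectEdge l r b t (x d.snd) (y d.snd) (x d.fst) (y d.fst)) := by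
    intro f
    obtain ⟨d, rfl⟩ := exists_leftFace f
    obtain ⟨R, l, r, b, t, hl, hb, hR, ⟨h1, h2⟩ | ⟨h1, h2, h3⟩⟩ := h.exists_rect d
    · have hne : G.leftFace d ≠ G.leftFace d0 := by
        intro hf
        have := (hR d0 hf.symm).unique hd0
        exact hR0 (this ▸ h1)
      have hmem : ∀ e ∈ G.faceDarts (G.leftFace d), RectEdge l r b t (p e.fst).re (p e.fst).im
          (p (G.faceNext e).fst).re (p (G.faceNext e).fst).im := by
        intro e he
        rw [faceNext_fst]
        exact h2 e (mem_faceDarts.1 he)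
      obtain ⟨e1, -, h3, h4⟩ := exists_lower_left (S := G.faceDarts (G.leftFace d))
        (s := G.faceNext) (x := fun e => (p e.fst).re) (y := fun e => (p e.fst).im)
        (faceDarts_nonempty _) (fun e he => by simpa [leftFace_faceNext] using he)
        (fun e he => by simpa [leftFace_faceNext_symm] using he) hl hb hmem
      obtain ⟨e2, -, h5, h6⟩ := exists_upper_right (S := G.faceDarts (G.leftFace d))
        (s := G.faceNext) (x := fun e => (p e.fst).re) (y := fun e => (p e.fst).im)
        (faceDarts_nonempty _) (fun e he => by simpa [leftFace_faceNext] using he)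
        (fun e he => by simpa [leftFace_faceNext_symm] using he) hl hb hmem
      simp only [hx, hy] at h3 h4 h5 h6 h2
      refine ⟨x e1.fst, x e2.fst, y e1.fst, y e2.fst, ?_, ?_, fun _ e he => ?_,
        fun hf => absurd hf hne⟩
      · have : (x e1.fst : ℝ) < x e2.fst := by linarith
        exact_mod_cast this
      · have : (y e1.fst : ℝ) < y e2.fst := by linarith
        exact_mod_cast this
      · refine RectEdge.of_real (u := l0) (v := b0) ?_
        rw [h3, h4, h5, h6]
        exact h2 e he
    · have hRR := huniq R (hR d rfl).1 h1
      subst hRR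
      have hf := houter d (hR d rfl)
      have hmem : ∀ e ∈ G.faceDarts (G.leftFace d), RectEdge l r b t (p e.snd).re (p e.snd).im
          (p (G.faceNext.symm e).snd).re (p (G.faceNext.symm e).snd).im := by
        intro e he
        rw [faceNext_symm_snd]
        exact h3 e (mem_faceDarts.1 he)
      obtain ⟨e1, -, h4, h5⟩ := exists_lower_left (S := G.faceDarts (G.leftFace d))
        (s := G.faceNext.symm) (x := fun e => (p e.snd).re) (y := fun e => (p e.snd).im)
        (faceDarts_nonempty _) (fun e he => by simpa [leftFace_faceNext_symm] using he)
        (fun e he => by simpa [leftFace_faceNext] using he) hl hb hmem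
      obtain ⟨e2, -, h6, h7⟩ := exists_upper_right (S := G.faceDarts (G.leftFace d))
        (s := G.faceNext.symm) (x := fun e => (p e.snd).re) (y := fun e => (p e.snd).im)
        (faceDarts_nonempty _) (fun e he => by simpa [leftFace_faceNext_symm] using he)
        (fun e he => by simpa [leftFace_faceNext] using he) hl hb hmem
      simp only [hx, hy] at h4 h5 h6 h7 h3
      refine ⟨x e1.snd, x e2.snd, y e1.snd, y e2.snd, ?_, ?_, fun hne => absurd hf hne,
        fun _ e he => ?_⟩
      · have : (x e1.snd : ℝ) < x e2.snd := by linarith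
        exact_mod_cast this
      · have : (y e1.snd : ℝ) < y e2.snd := by linarith
        exact_mod_cast this
      · refine RectEdge.of_real (u := l0) (v := b0) ?_
        rw [h4, h5, h6, h7]
        exact h3 e he
  choose l r b t hl hb hin hout using hrect
  have hinj : ∀ {v w}, x v = x w → y v = y w → v = w := by
    intro v w h1 h2
    refine hU.injective (Complex.ext ?_ ?_)
    · rw [hx, hx, h1]
    · rw [hy, hy, h2]
  refine ⟨⟨x, y, G.leftFace d0, l, r, b, t, hl, hb, fun d hd => hin _ hd d rfl,
    fun d hd => hout _ rfl d hd, ?_, h.exists_dart⟩, ?_⟩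
  · intro f
    -- The degree is the perimeter because different darts of a walk start at different points:
    -- equal starts have equal ends on a rectangle, and positions determine vertices.
    rw [degree_eq_card]
    by_cases hf : f = G.leftFace d0
    · refine walk_card (s := G.faceNext.symm) (x := fun d => x d.snd)
        (y := fun d => y d.snd) (x' := fun d => x d.fst) (y' := fun d => y d.fst)
        (faceDarts_nonempty _) (fun e he => by simpa [leftFace_faceNext_symm] using he)
        (hl f) (hb f) (fun e _ => by simp only [faceNext_symm_snd])
        (fun e _ => by simp only [faceNext_symm_snd])
        (fun e he => hout f hf e (mem_faceDarts.1 he)) ?_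
      intro d hd e he h1 h2
      have h3 := hout f hf d (mem_faceDarts.1 hd)
      have h4 := hout f hf e (mem_faceDarts.1 he)
      rw [← h1, ← h2] at h4
      have h5 := h3.next_unique (hl f) (hb f) h4
      exact dart_ext (hinj h5.1 h5.2) (hinj h1 h2)
    · refine walk_card (s := G.faceNext) (x := fun d => x d.fst)
        (y := fun d => y d.fst) (x' := fun d => x d.snd) (y' := fun d => y d.snd)
        (faceDarts_nonempty _) (fun e he => by simpa [leftFace_faceNext] using he)
        (hl f) (hb f) (fun e _ => by simp only [faceNext_fst])
        (fun e _ => by simp only [faceNext_fst])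
        (fun e he => hin f hf e (mem_faceDarts.1 he)) ?_
      intro d hd e he h1 h2
      have h3 := hin f hf d (mem_faceDarts.1 hd)
      have h4 := hin f hf e (mem_faceDarts.1 he)
      rw [← h1, ← h2] at h4
      have h5 := h3.next_unique (hl f) (hb f) h4
      exact dart_ext (hinj h1 h2) (hinj h5.1 h5.2)
  · intro f
    simp only
    constructor
    · intro hf
      obtain ⟨d, rfl⟩ := exists_leftFace f
      obtain ⟨R, hR, hRb, hev⟩ := hf d rfl
      obtain ⟨R', hR'⟩ := hU.exists_leftRegion d
      obtain ⟨s, h1, h2⟩ := (hev.and (hR'.eventually_mem (a := 1 / 2) (by norm_num)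
        (by norm_num))).exists
      push_cast at h2
      have h3 := hR.eq_of_mem hR'.1 h1 h2
      subst h3
      have h4 := huniq R hR hRb
      subst h4
      exact houter d hR'
    · rintro rfl d hd
      have h1 := hface hd0 hd.symm
      refine ⟨R0, h1.1, hR0, ?_⟩
      have := h1.eventually_mem (a := 1 / 2) (by norm_num) (by norm_num)
      push_cast at this
      exact this

end PlanarEmbeddedGraph

/-! ## From layouts to drawings -/

/-- The horizontal component of the direction with number `k` (east, north, west, south). -/
def dirX (k : ℕ) : ℤ := if k = 0 then 1 else if k = 2 then -1 else 0

/-- The vertical component of the direction with number `k`. -/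
def dirY (k : ℕ) : ℤ := if k = 1 then 1 else if k = 3 then -1 else 0

/-- The offset of the unit cell in the quadrant that follows the direction `k`. -/
def quadX (k : ℕ) : ℤ := if k = 0 ∨ k = 3 then 0 else -1

/-- The offset of the unit cell in the quadrant that follows the direction `k`. -/
def quadY (k : ℕ) : ℤ := if k = 0 ∨ k = 1 then 0 else -1

/-- The right end of the interval belongs to the last cell, where the floor would be one too large.
-/
theorem exists_int_cell {l r : ℤ} {u : ℝ} (hlr : l < r) (h1 : (l : ℝ) ≤ u) (h2 : u ≤ r) :
    ∃ i : ℤ, l ≤ i ∧ i < r ∧ (i : ℝ) ≤ u ∧ u ≤ i + 1 := by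
  rcases h2.lt_or_eq with h2 | h2
  · exact ⟨⌊u⌋, Int.le_floor.2 h1, by exact_mod_cast (Int.floor_le u).trans_lt h2,
      Int.floor_le u, (Int.lt_floor_add_one u).le⟩
  · refine ⟨r - 1, by omega, by omega, ?_, ?_⟩ <;> push_cast <;> linarith

/-- The exterior is the union of four open half-planes, taken in an order in which each one meets
the union of the previous ones. -/
theorem isPreconnected_compl_rectangle {l r b t : ℝ} :
    IsPreconnected ((Set.Icc l r ×ℂ Set.Icc b t)ᶜ) := by
  have h1 : IsPreconnected {z : ℂ | z.re < l} :=
    ((convex_Iio l).linear_preimage Complex.reLm).isPreconnected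
  have h2 : IsPreconnected {z : ℂ | z.im < b} :=
    ((convex_Iio b).linear_preimage Complex.imLm).isPreconnected
  have h3 : IsPreconnected {z : ℂ | r < z.re} :=
    ((convex_Ioi r).linear_preimage Complex.reLm).isPreconnected
  have h4 : IsPreconnected {z : ℂ | t < z.im} :=
    ((convex_Ioi t).linear_preimage Complex.imLm).isPreconnected
  have h5 := ((h1.union ⟨l - 1, b - 1⟩ (by simp) (by simp) h2).union ⟨r + 1, b - 1⟩ (by simp)
    (by simp) h3).union ⟨r + 1, t + 1⟩ (by simp) (by simp) h4
  convert h5 using 1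
  ext z
  simp only [Set.mem_compl_iff, Complex.mem_reProdIm, Set.mem_Icc, Set.mem_union, Set.mem_ofPred_eq,
    not_and_or, not_le]
  tauto

theorem not_isBounded_compl_rectangle {l r b t : ℝ} :
    ¬ Bornology.IsBounded ((Set.Icc l r ×ℂ Set.Icc b t)ᶜ) := by
  intro h
  have h2 : Bornology.IsBounded (Set.Icc l r ×ℂ Set.Icc b t) :=
    (Metric.isBounded_Icc l r).reProdIm (Metric.isBounded_Icc b t)
  have := h.union h2
  rw [Set.compl_union_self] at this
  exact NormedSpace.unbounded_univ ℝ ℂ this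

namespace PlanarEmbeddedGraph

variable {n : ℕ} {G : PlanarEmbeddedGraph n}

namespace RectLayout

variable (L : G.RectLayout)

theorem exists_dir (d : G.graph.Dart) :
    ∃ k < 4, L.x d.snd = L.x d.fst + dirX k ∧ L.y d.snd = L.y d.fst + dirY k := by
  have : ∃ l r b t, RectEdge l r b t (L.x d.fst) (L.y d.fst) (L.x d.snd) (L.y d.snd) ∨
      RectEdge l r b t (L.x d.snd) (L.y d.snd) (L.x d.fst) (L.y d.fst) := by
    by_cases h : G.leftFace d = L.outer
    · exact ⟨_, _, _, _, Or.inr (L.outer_edge d h)⟩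
    · exact ⟨_, _, _, _, Or.inl (L.inner_edge d h)⟩
  obtain ⟨l, r, b, t, h | h⟩ := this
  · rcases h with h | h | h | h
    · exact ⟨0, by norm_num, by simp [dirX, h.1], by simp [dirY, h.2.1]⟩
    · exact ⟨1, by norm_num, by simp [dirX, h.1], by simp [dirY, h.2.1]⟩
    · exact ⟨2, by norm_num, by simp [dirX]; omega, by simp [dirY]; omega⟩
    · exact ⟨3, by norm_num, by simp [dirX]; omega, by simp [dirY]; omega⟩
  · rcases h with h | h | h | h
    · exact ⟨2, by norm_num, by simp [dirX]; omega, by simp [dirY]; omega⟩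
    · exact ⟨3, by norm_num, by simp [dirX]; omega, by simp [dirY]; omega⟩
    · exact ⟨0, by norm_num, by simp [dirX]; omega, by simp [dirY]; omega⟩
    · exact ⟨1, by norm_num, by simp [dirX]; omega, by simp [dirY]; omega⟩

/-- The direction of a dart: east, north, west, south. -/
noncomputable def dir (d : G.graph.Dart) : ℕ := (L.exists_dir d).choose

theorem dir_lt (d : G.graph.Dart) : L.dir d < 4 := (L.exists_dir d).choose_spec.1

theorem x_snd (d : G.graph.Dart) : L.x d.snd = L.x d.fst + dirX (L.dir d) :=
  (L.exists_dir d).choose_spec.2.1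

theorem y_snd (d : G.graph.Dart) : L.y d.snd = L.y d.fst + dirY (L.dir d) :=
  (L.exists_dir d).choose_spec.2.2

theorem dir_symm (d : G.graph.Dart) : L.dir d.symm = (L.dir d + 2) % 4 := by
  have h1 := L.x_snd d
  have h2 := L.y_snd d
  have h3 := L.x_snd d.symm
  have h4 := L.y_snd d.symm
  rw [dart_symm_fst, dart_symm_snd] at h3 h4
  have h5 := L.dir_lt d
  have h6 := L.dir_lt d.symm
  rw [h1] at h3
  rw [h2] at h4
  generalize L.dir d.symm = j at *
  generalize L.dir d = k at *
  interval_cases k <;> interval_cases j <;> simp [dirX, dirY] at h3 h4 ⊢ <;> omega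

theorem rectEdge_dir {l r b t x y : ℤ} {k : ℕ} (hk : k < 4) :
    RectEdge l r b t x y (x + dirX k) (y + dirY k) ↔
      (k = 0 ∧ y = b ∧ l ≤ x ∧ x + 1 ≤ r) ∨ (k = 1 ∧ x = r ∧ b ≤ y ∧ y + 1 ≤ t) ∨
      (k = 2 ∧ y = t ∧ l + 1 ≤ x ∧ x ≤ r) ∨ (k = 3 ∧ x = l ∧ b + 1 ≤ y ∧ y ≤ t) := by
  unfold RectEdge
  interval_cases k <;> simp [dirX, dirY] <;> omega

theorem rectEdge_dir_rev {l r b t x y : ℤ} {k : ℕ} (hk : k < 4) :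
    RectEdge l r b t (x + dirX k) (y + dirY k) x y ↔
      (k = 2 ∧ y = b ∧ l ≤ x - 1 ∧ x ≤ r) ∨ (k = 3 ∧ x = r ∧ b ≤ y - 1 ∧ y ≤ t) ∨
      (k = 0 ∧ y = t ∧ l ≤ x ∧ x + 1 ≤ r) ∨ (k = 1 ∧ x = l ∧ b ≤ y ∧ y + 1 ≤ t) := by
  unfold RectEdge
  interval_cases k <;> simp [dirX, dirY] <;> omega

theorem inner_edge_dir {d : G.graph.Dart} {f : G.Face} (hd : G.leftFace d = f) (hf : f ≠ L.outer) :
    (L.dir d = 0 ∧ L.y d.fst = L.b f ∧ L.l f ≤ L.x d.fst ∧ L.x d.fst + 1 ≤ L.r f) ∨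
    (L.dir d = 1 ∧ L.x d.fst = L.r f ∧ L.b f ≤ L.y d.fst ∧ L.y d.fst + 1 ≤ L.t f) ∨
    (L.dir d = 2 ∧ L.y d.fst = L.t f ∧ L.l f + 1 ≤ L.x d.fst ∧ L.x d.fst ≤ L.r f) ∨
    (L.dir d = 3 ∧ L.x d.fst = L.l f ∧ L.b f + 1 ≤ L.y d.fst ∧ L.y d.fst ≤ L.t f) := by
  subst hd
  have := L.inner_edge d hf
  rwa [L.x_snd, L.y_snd, rectEdge_dir (L.dir_lt d)] at this

theorem outer_edge_dir {d : G.graph.Dart} (hd : G.leftFace d = L.outer) :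
    (L.dir d = 2 ∧ L.y d.fst = L.b L.outer ∧ L.l L.outer ≤ L.x d.fst - 1 ∧
      L.x d.fst ≤ L.r L.outer) ∨
    (L.dir d = 3 ∧ L.x d.fst = L.r L.outer ∧ L.b L.outer ≤ L.y d.fst - 1 ∧
      L.y d.fst ≤ L.t L.outer) ∨
    (L.dir d = 0 ∧ L.y d.fst = L.t L.outer ∧ L.l L.outer ≤ L.x d.fst ∧
      L.x d.fst + 1 ≤ L.r L.outer) ∨
    (L.dir d = 1 ∧ L.x d.fst = L.l L.outer ∧ L.b L.outer ≤ L.y d.fst ∧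
      L.y d.fst + 1 ≤ L.t L.outer) := by
  have := L.outer_edge d hd
  rwa [L.x_snd, L.y_snd, rectEdge_dir_rev (L.dir_lt d)] at this

theorem leftFace_symm_rot (d : G.graph.Dart) : G.leftFace (G.rot d).symm = G.leftFace d := by
  rw [← faceNext_symm_apply, leftFace_faceNext_symm]

theorem x_rot (d : G.graph.Dart) : L.x (G.rot d).fst = L.x d.fst := by rw [G.rot_fst]

theorem y_rot (d : G.graph.Dart) : L.y (G.rot d).fst = L.y d.fst := by rw [G.rot_fst]

/-- The wedge between a dart and the next one around its start vertex. -/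
theorem exists_wedge (d : G.graph.Dart) : ∃ q, 1 ≤ q ∧ q ≤ 3 ∧
    L.dir (G.rot d) = (L.dir d + q) % 4 ∧ ∀ j < q, L.Covers (G.leftFace d)
      (L.x d.fst + quadX ((L.dir d + j) % 4)) (L.y d.fst + quadY ((L.dir d + j) % 4)) := by
  have hx := L.x_snd (G.rot d)
  have hy := L.y_snd (G.rot d)
  have h2 : (L.dir (G.rot d).symm) = _ := L.dir_symm (G.rot d)
  have h5 := L.dir_lt d
  have h6 := L.dir_lt (G.rot d)
  have hl := L.l_lt (G.leftFace d)
  have hb := L.b_lt (G.leftFace d)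
  -- `d` leaves the vertex, and the reversal of `rot d` arrives, on the walk of the same face.
  -- Clockwise around the outer rectangle the wedge is straight or reflex, two or three quadrants;
  -- counterclockwise around an inner one it has one or two.
  by_cases h : G.leftFace d = L.outer
  · have h1 := L.outer_edge_dir h
    have h3 := L.outer_edge_dir ((leftFace_symm_rot d).trans h)
    simp only [dart_symm_fst] at h3
    rw [hx, hy, x_rot, y_rot, h2] at h3
    simp only [h] at hl hb ⊢
    simp only [Covers, CellIn, ne_eq, not_true_eq_false, false_and, true_and, false_or]
    generalize L.dir (G.rot d) = j at *
    generalize L.dir d = k at *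
    interval_cases k <;> interval_cases j <;>
      simp [dirX, dirY] at h1 h3 ⊢ <;>
      first
        | (exfalso; omega)
        | (refine ⟨2, by norm_num, by norm_num, rfl, fun i hi => ?_⟩
           interval_cases i <;> simp [quadX, quadY] <;> omega)
        | (refine ⟨3, by norm_num, by norm_num, rfl, fun i hi => ?_⟩
           interval_cases i <;> simp [quadX, quadY] <;> omega)
  · have h1 := L.inner_edge_dir rfl h
    have h3 := L.inner_edge_dir (leftFace_symm_rot d) h
    simp only [dart_symm_fst] at h3
    rw [hx, hy, x_rot, y_rot, h2] at h3
    simp only [Covers, CellIn, ne_eq, h, not_false_eq_true, false_and, true_and, or_false]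
    generalize L.dir (G.rot d) = j at *
    generalize L.dir d = k at *
    interval_cases k <;> interval_cases j <;>
      simp [dirX, dirY] at h1 h3 ⊢ <;>
      first
        | (exfalso; omega)
        | (refine ⟨1, by norm_num, by norm_num, rfl, fun i hi => ?_⟩
           interval_cases i <;> simp [quadX, quadY] <;> omega)
        | (refine ⟨2, by norm_num, by norm_num, rfl, fun i hi => ?_⟩
           interval_cases i <;> simp [quadX, quadY] <;> omega)

theorem covers_left (d : G.graph.Dart) : L.Covers (G.leftFace d)
    (L.x d.fst + quadX (L.dir d)) (L.y d.fst + quadY (L.dir d)) := by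
  obtain ⟨q, h1, -, -, h2⟩ := L.exists_wedge d
  have := h2 0 h1
  rwa [add_zero, Nat.mod_eq_of_lt (L.dir_lt d)] at this

/-- Each of the four cells at a vertex belongs to the wedge of a dart at this vertex. -/
theorem exists_covers_quad (v : Fin n) {k : ℕ} (hk : k < 4) :
    ∃ d : G.graph.Dart, d.fst = v ∧ L.Covers (G.leftFace d) (L.x v + quadX k) (L.y v + quadY k) := by
  -- Induction on the number `m` of quarter turns from `d` to the quadrant: either the wedge of `d`
  -- reaches it, or `rot d` is closer by the size of the wedge.
  have key : ∀ m : ℕ, ∀ d : G.graph.Dart, d.fst = v → (k + 4 - L.dir d) % 4 = m →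
      ∃ e : G.graph.Dart, e.fst = v ∧
        L.Covers (G.leftFace e) (L.x v + quadX k) (L.y v + quadY k) := by
    intro m
    induction m using Nat.strong_induction_on with
    | _ m ih =>
      intro d hd hm
      obtain ⟨q, h1, h2, h3, h4⟩ := L.exists_wedge d
      have h5 := L.dir_lt d
      by_cases hq : m < q
      · refine ⟨d, hd, ?_⟩
        have := h4 m hq
        rwa [hd, show (L.dir d + m) % 4 = k by omega] at this
      · exact ih (m - q) (by omega) (G.rot d) ((G.rot_fst d).trans hd) (by omega)
  obtain ⟨d, hd⟩ := L.exists_dart v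
  exact key _ d hd rfl

/-- If two vertices had the same position, the cell to the left of a dart at the first would lie in
the wedge of a dart at the second. The two darts cover a common cell and coincide. -/
theorem vertex_injective {v w : Fin n} (hx : L.x v = L.x w) (hy : L.y v = L.y w) : v = w := by
  obtain ⟨d, rfl⟩ := L.exists_dart v
  obtain ⟨e, rfl, he⟩ := L.exists_covers_quad w (L.dir_lt d)
  rw [← hx, ← hy] at he
  rw [L.dart_eq_of_covers (L.covers_left d) he hx hy]

/-- A dart inside the wedge of `d` would have on its left a cell that belongs to this wedge, and so
would be `d` itself. -/
theorem dir_ne_of_between {d e : G.graph.Dart} (hde : e.fst = d.fst) {q j : ℕ}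
    (hq : L.dir (G.rot d) = (L.dir d + q) % 4) (hq3 : q ≤ 3) (hj : 1 ≤ j) (hjq : j < q) :
    L.dir e ≠ (L.dir d + j) % 4 := by
  intro h
  obtain ⟨q', h1, h2, h3, h4⟩ := L.exists_wedge d
  have h5 := L.dir_lt d
  have : q' = q := by omega
  subst this
  have h6 := L.covers_left e
  rw [h, hde] at h6
  have := L.dart_eq_of_covers h6 (h4 j hjq) (by rw [hde]) (by rw [hde])
  subst this
  omega

/-- A dart is determined by its start vertex and its direction. -/
theorem dart_eq_of_dir {d e : G.graph.Dart} (h : d.fst = e.fst) (hdir : L.dir d = L.dir e) :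
    d = e := by
  refine dart_ext h (L.vertex_injective ?_ ?_)
  · rw [L.x_snd, L.x_snd, h, hdir]
  · rw [L.y_snd, L.y_snd, h, hdir]

/-- The positions of the vertices in the plane. -/
def point (v : Fin n) : ℂ := ⟨L.x v, L.y v⟩

theorem vec_point (d : G.graph.Dart) : G.vec L.point d = Complex.I ^ L.dir d := by
  have h := L.dir_lt d
  unfold vec point
  rw [L.x_snd, L.y_snd]
  generalize L.dir d = k at *
  interval_cases k <;> apply Complex.ext <;> simp [dirX, dirY, Complex.I_pow_three]

theorem I_pow_inj {a b : ℕ} (ha : a < 4) (hb : b < 4) (h : Complex.I ^ a = Complex.I ^ b) :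
    a = b := by
  rw [Complex.ext_iff] at h
  interval_cases a <;> interval_cases b <;> simp [Complex.I_pow_three] at h ⊢ <;> norm_num at h

theorem preservesEmbedding : G.PreservesEmbedding L.point := by
  intro d
  obtain ⟨q, h1, h2, h3, h4⟩ := L.exists_wedge d
  refine ⟨q, h1, by omega, ?_, ?_⟩
  · rw [L.vec_point, L.vec_point, h3, ← Complex.I_pow_eq_pow_mod, ← pow_add, add_comm]
  · intro j hj hjq e he hv
    rw [L.vec_point, L.vec_point, ← pow_add, Complex.I_pow_eq_pow_mod (_ + _)] at hv
    have := I_pow_inj (L.dir_lt e) (Nat.mod_lt _ (by norm_num)) hv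
    exact L.dir_ne_of_between he h3 h2 hj hjq (by rw [this, add_comm])

/-- Coordinates of the lower or left end of an edge. -/
theorem segment_cases (d : G.graph.Dart) : ∃ i j : ℤ,
    (((L.dir d = 0 ∨ L.dir d = 2) ∧ (∀ z ∈ segment ℝ (L.point d.fst) (L.point d.snd),
        z.im = j ∧ (i : ℝ) ≤ z.re ∧ z.re ≤ i + 1) ∧
      ((L.point d.fst = ⟨i, j⟩ ∧ L.point d.snd = ⟨i + 1, j⟩) ∨
        (L.point d.snd = ⟨i, j⟩ ∧ L.point d.fst = ⟨i + 1, j⟩))) ∨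
    ((L.dir d = 1 ∨ L.dir d = 3) ∧ (∀ z ∈ segment ℝ (L.point d.fst) (L.point d.snd),
        z.re = i ∧ (j : ℝ) ≤ z.im ∧ z.im ≤ j + 1) ∧
      ((L.point d.fst = ⟨i, j⟩ ∧ L.point d.snd = ⟨i, j + 1⟩) ∨
        (L.point d.snd = ⟨i, j⟩ ∧ L.point d.fst = ⟨i, j + 1⟩)))) := by
  have h := L.dir_lt d
  have hx := L.x_snd d
  have hy := L.y_snd d
  unfold point
  simp only [hx, hy, segment_eq_image']
  refine ⟨min (L.x d.fst) (L.x d.snd), min (L.y d.fst) (L.y d.snd), ?_⟩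
  rw [hx, hy]
  generalize L.dir d = k at *
  interval_cases k
  · left
    refine ⟨by simp, ?_, by simp [dirX, dirY]⟩
    rintro _ ⟨a, ⟨h1, h2⟩, rfl⟩
    simp [dirX, dirY, h1, h2]
  · right
    refine ⟨by simp, ?_, by simp [dirX, dirY]⟩
    rintro _ ⟨a, ⟨h1, h2⟩, rfl⟩
    simp [dirX, dirY, h1, h2]
  · left
    refine ⟨by simp, ?_, by simp [dirX, dirY]⟩
    rintro _ ⟨a, ⟨h1, h2⟩, rfl⟩
    simp [dirX, dirY, h1]
    linarith
  · right
    refine ⟨by simp, ?_, by simp [dirX, dirY]⟩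
    rintro _ ⟨a, ⟨h1, h2⟩, rfl⟩
    simp [dirX, dirY, h1]
    linarith

theorem point_injective : Function.Injective L.point := by
  intro v w h
  have h1 := congrArg Complex.re h
  have h2 := congrArg Complex.im h
  simp only [point] at h1 h2
  exact L.vertex_injective (by exact_mod_cast h1) (by exact_mod_cast h2)

end RectLayout

end PlanarEmbeddedGraph

namespace PlanarEmbeddedGraph

variable {n : ℕ} {G : PlanarEmbeddedGraph n}

namespace RectLayout

variable (L : G.RectLayout)

/-- Edges are unit segments between neighbouring lattice points. Two different ones meet only in
lattice points, which are ends of both, and vertices with equal positions are equal. -/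
theorem isUnitLengthRectilinear : G.IsUnitLengthRectilinear L.point where
  injective := L.point_injective
  unit_length u v huv := by
    have := L.vec_point ⟨(u, v), huv⟩
    simp only [vec] at this
    rw [this, norm_pow, Complex.norm_I, one_pow]
  rectilinear u v huv := by
    obtain ⟨i, j, ⟨-, -, h⟩ | ⟨-, -, h⟩⟩ := L.segment_cases ⟨(u, v), huv⟩
    · right; rcases h with ⟨h1, h2⟩ | ⟨h1, h2⟩ <;> simp only at h1 h2 <;> rw [h1, h2]
    · left; rcases h with ⟨h1, h2⟩ | ⟨h1, h2⟩ <;> simp only at h1 h2 <;> rw [h1, h2]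
  vertex_edge u v w huv hw := by
    have : L.point w = L.point u ∨ L.point w = L.point v := by
      obtain ⟨i, j, ⟨-, h, h'⟩ | ⟨-, h, h'⟩⟩ := L.segment_cases ⟨(u, v), huv⟩
      · obtain ⟨h1, h2, h3⟩ := h _ hw
        simp only [point] at h1 h2 h3
        have h1 : L.y w = j := by exact_mod_cast h1
        have h2 : i ≤ L.x w := by exact_mod_cast h2
        have h3 : L.x w ≤ i + 1 := by exact_mod_cast h3
        have h4 : L.point w = ⟨i, j⟩ ∨ L.point w = ⟨i + 1, j⟩ := by
          obtain h5 | h5 : L.x w = i ∨ L.x w = i + 1 := by omega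
          · left; simp [point, h1, h5]
          · right; simp [point, h1, h5]
        simp only at h'
        rcases h' with ⟨e1, e2⟩ | ⟨e1, e2⟩ <;> rw [e1, e2] <;> tauto
      · obtain ⟨h1, h2, h3⟩ := h _ hw
        simp only [point] at h1 h2 h3
        have h1 : L.x w = i := by exact_mod_cast h1
        have h2 : j ≤ L.y w := by exact_mod_cast h2
        have h3 : L.y w ≤ j + 1 := by exact_mod_cast h3
        have h4 : L.point w = ⟨i, j⟩ ∨ L.point w = ⟨i, j + 1⟩ := by
          obtain h5 | h5 : L.y w = j ∨ L.y w = j + 1 := by omega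
          · left; simp [point, h1, h5]
          · right; simp [point, h1, h5]
        simp only at h'
        rcases h' with ⟨e1, e2⟩ | ⟨e1, e2⟩ <;> rw [e1, e2] <;> tauto
    exact this.imp (fun h => L.point_injective h) (fun h => L.point_injective h)
  edge_edge u v w x huv hwx hne := by
    rintro z ⟨hz, hz'⟩
    have same : ∀ {a b : ℂ}, (L.point u = a ∧ L.point v = b) ∨ (L.point v = a ∧ L.point u = b) →
        (L.point w = a ∧ L.point x = b) ∨ (L.point x = a ∧ L.point w = b) → False := by
      intro a b h1 h2
      refine hne (Sym2.eq_iff.2 ?_)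
      rcases h1 with ⟨h1, h1'⟩ | ⟨h1, h1'⟩ <;> rcases h2 with ⟨h2, h2'⟩ | ⟨h2, h2'⟩
      · exact Or.inl ⟨L.point_injective (h1.trans h2.symm), L.point_injective (h1'.trans h2'.symm)⟩
      · exact Or.inr ⟨L.point_injective (h1.trans h2.symm), L.point_injective (h1'.trans h2'.symm)⟩
      · exact Or.inr ⟨L.point_injective (h1'.trans h2'.symm), L.point_injective (h1.trans h2.symm)⟩
      · exact Or.inl ⟨L.point_injective (h1'.trans h2'.symm), L.point_injective (h1.trans h2.symm)⟩
    have ends : ∀ {u v : Fin n} {a b : ℂ}, (L.point u = a ∧ L.point v = b) ∨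
        (L.point v = a ∧ L.point u = b) → (z = a ∨ z = b) → z ∈ ({L.point u, L.point v} : Set ℂ) := by
      rintro u v a b (⟨rfl, rfl⟩ | ⟨rfl, rfl⟩) (rfl | rfl) <;> simp
    obtain ⟨i, j, hij⟩ := L.segment_cases ⟨(u, v), huv⟩
    obtain ⟨i', j', hij'⟩ := L.segment_cases ⟨(w, x), hwx⟩
    simp only at hij hij'
    rcases hij with ⟨-, h1, h2⟩ | ⟨-, h1, h2⟩ <;> rcases hij' with ⟨-, h3, h4⟩ | ⟨-, h3, h4⟩ <;>
      obtain ⟨e1, e2, e3⟩ := h1 _ hz <;> obtain ⟨e4, e5, e6⟩ := h3 _ hz'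
    · have hj : j = j' := by exact_mod_cast e1.symm.trans e4
      subst hj
      have f1 : i ≤ i' + 1 := by exact_mod_cast e2.trans e6
      have f2 : i' ≤ i + 1 := by exact_mod_cast e5.trans e3
      obtain h5 | h5 | h5 : i = i' ∨ i = i' + 1 ∨ i' = i + 1 := by omega
      · subst h5; exact (same h2 h4).elim
      · subst h5; push_cast at e2 e3
        have hre : z.re = i' + 1 := by linarith
        exact ⟨ends h2 (Or.inl (Complex.ext (by simp [hre]) e1)),
          ends h4 (Or.inr (Complex.ext (by simp [hre]) e1))⟩
      · subst h5; push_cast at e5 e6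
        have hre : z.re = i + 1 := by linarith
        exact ⟨ends h2 (Or.inr (Complex.ext (by simp [hre]) e1)),
          ends h4 (Or.inl (Complex.ext (by simp [hre]) e1))⟩
    · have f1 : i ≤ i' := by rw [e4] at e2; exact_mod_cast e2
      have f2 : i' ≤ i + 1 := by rw [e4] at e3; exact_mod_cast e3
      have f3 : j' ≤ j := by rw [e1] at e5; exact_mod_cast e5
      have f4 : j ≤ j' + 1 := by rw [e1] at e6; exact_mod_cast e6
      refine ⟨ends h2 ?_, ends h4 ?_⟩
      · obtain h5 | h5 : i' = i ∨ i' = i + 1 := by omega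
        · exact Or.inl (Complex.ext (by simp [e4, h5]) e1)
        · exact Or.inr (Complex.ext (by simp [e4, h5]) e1)
      · obtain h5 | h5 : j = j' ∨ j = j' + 1 := by omega
        · exact Or.inl (Complex.ext e4 (by simp [e1, h5]))
        · exact Or.inr (Complex.ext e4 (by simp [e1, h5]))
    · have f1 : i' ≤ i := by rw [e1] at e5; exact_mod_cast e5
      have f2 : i ≤ i' + 1 := by rw [e1] at e6; exact_mod_cast e6
      have f3 : j ≤ j' := by rw [e4] at e2; exact_mod_cast e2
      have f4 : j' ≤ j + 1 := by rw [e4] at e3; exact_mod_cast e3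
      refine ⟨ends h2 ?_, ends h4 ?_⟩
      · obtain h5 | h5 : j' = j ∨ j' = j + 1 := by omega
        · exact Or.inl (Complex.ext e1 (by simp [e4, h5]))
        · exact Or.inr (Complex.ext e1 (by simp [e4, h5]))
      · obtain h5 | h5 : i = i' ∨ i = i' + 1 := by omega
        · exact Or.inl (Complex.ext (by simp [e1, h5]) e4)
        · exact Or.inr (Complex.ext (by simp [e1, h5]) e4)
    · have hj : i = i' := by exact_mod_cast e1.symm.trans e4
      subst hj
      have f1 : j ≤ j' + 1 := by exact_mod_cast e2.trans e6
      have f2 : j' ≤ j + 1 := by exact_mod_cast e5.trans e3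
      obtain h5 | h5 | h5 : j = j' ∨ j = j' + 1 ∨ j' = j + 1 := by omega
      · subst h5; exact (same h2 h4).elim
      · subst h5; push_cast at e2 e3
        have hre : z.im = j' + 1 := by linarith
        exact ⟨ends h2 (Or.inl (Complex.ext e1 (by simp [hre]))),
          ends h4 (Or.inr (Complex.ext e1 (by simp [hre])))⟩
      · subst h5; push_cast at e5 e6
        have hre : z.im = j + 1 := by linarith
        exact ⟨ends h2 (Or.inr (Complex.ext e1 (by simp [hre]))),
          ends h4 (Or.inl (Complex.ext e1 (by simp [hre])))⟩

/-! ### The regions of the drawing of a layout -/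

/-- The part of the plane that belongs to the face `f`. -/
def area (f : G.Face) : Set ℂ :=
  if f = L.outer then (Set.Icc (L.l f : ℝ) (L.r f) ×ℂ Set.Icc (L.b f : ℝ) (L.t f))ᶜ
  else Set.Ioo (L.l f : ℝ) (L.r f) ×ℂ Set.Ioo (L.b f : ℝ) (L.t f)

theorem isOpen_area (f : G.Face) : IsOpen (L.area f) := by
  unfold area
  split_ifs
  · exact (isClosed_Icc.reProdIm isClosed_Icc).isOpen_compl
  · exact isOpen_Ioo.reProdIm isOpen_Ioo

theorem isPreconnected_area (f : G.Face) : IsPreconnected (L.area f) := by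
  unfold area
  split_ifs
  · exact isPreconnected_compl_rectangle
  · exact (((convex_Ioo _ _).linear_preimage Complex.reLm).inter
      ((convex_Ioo _ _).linear_preimage Complex.imLm)).isPreconnected

theorem cellIn_of_mem {f : G.Face} {z : ℂ}
    (hz : z ∈ Set.Ioo (L.l f : ℝ) (L.r f) ×ℂ Set.Ioo (L.b f : ℝ) (L.t f)) :
    L.CellIn f ⌊z.re⌋ ⌊z.im⌋ := by
  obtain ⟨⟨h1, h2⟩, h3, h4⟩ := hz
  exact ⟨Int.le_floor.2 h1.le, Int.floor_lt.2 h2, Int.le_floor.2 h3.le, Int.floor_lt.2 h4⟩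

/-- It is enough to look at the lower left and the upper right cell of the inner rectangle. -/
theorem inner_le (f : G.Face) : L.l L.outer ≤ L.l f ∧ L.r f ≤ L.r L.outer ∧
    L.b L.outer ≤ L.b f ∧ L.t f ≤ L.t L.outer := by
  have h1 := L.l_lt f
  have h2 := L.b_lt f
  have h3 : L.CellIn L.outer (L.l f) (L.b f) := L.cellIn_outer ⟨le_rfl, h1, le_rfl, h2⟩
  have h4 : L.CellIn L.outer (L.r f - 1) (L.t f - 1) :=
    L.cellIn_outer (f := f) ⟨by omega, by omega, by omega, by omega⟩
  unfold CellIn at h3 h4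
  omega

theorem area_disjoint {f g : G.Face} {z : ℂ} (hf : z ∈ L.area f) (hg : z ∈ L.area g) : f = g := by
  have key : ∀ {f : G.Face}, z ∈ Set.Ioo (L.l f : ℝ) (L.r f) ×ℂ Set.Ioo (L.b f : ℝ) (L.t f) →
      z ∉ (Set.Icc (L.l L.outer : ℝ) (L.r L.outer) ×ℂ Set.Icc (L.b L.outer : ℝ) (L.t L.outer))ᶜ := by
    intro f hz hn
    refine hn ?_
    obtain ⟨⟨h1, h2⟩, h3, h4⟩ := hz
    obtain ⟨h5, h6, h7, h8⟩ := L.inner_le f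
    have h5' : (L.l L.outer : ℝ) ≤ L.l f := by exact_mod_cast h5
    have h6' : (L.r f : ℝ) ≤ L.r L.outer := by exact_mod_cast h6
    have h7' : (L.b L.outer : ℝ) ≤ L.b f := by exact_mod_cast h7
    have h8' : (L.t f : ℝ) ≤ L.t L.outer := by exact_mod_cast h8
    exact ⟨⟨by linarith, by linarith⟩, by linarith, by linarith⟩
  unfold area at hf hg
  split_ifs at hf hg with h1 h2 h2
  · exact h1.trans h2.symm
  · subst h1; exact absurd hf (key hg)
  · subst h2; exact absurd hg (key hf)
  · exact L.cellIn_unique h1 h2 (L.cellIn_of_mem hf) (L.cellIn_of_mem hg)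

theorem drawn_eq : G.drawn L.point =
    ⋃ d : G.graph.Dart, segment ℝ (L.point d.fst) (L.point d.snd) := by
  unfold drawn
  refine Set.union_eq_right.2 ?_
  rintro _ ⟨v, rfl⟩
  obtain ⟨d, rfl⟩ := L.exists_dart v
  exact Set.mem_iUnion.2 ⟨d, left_mem_segment _ _ _⟩

theorem segment_dir (d : G.graph.Dart) {z : ℂ}
    (hz : z ∈ segment ℝ (L.point d.fst) (L.point d.snd)) :
    (L.dir d = 0 ∧ z.im = L.y d.fst ∧ (L.x d.fst : ℝ) ≤ z.re ∧ z.re ≤ (L.x d.fst + 1 : ℤ)) ∨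
    (L.dir d = 1 ∧ z.re = L.x d.fst ∧ (L.y d.fst : ℝ) ≤ z.im ∧ z.im ≤ (L.y d.fst + 1 : ℤ)) ∨
    (L.dir d = 2 ∧ z.im = L.y d.fst ∧ ((L.x d.fst - 1 : ℤ) : ℝ) ≤ z.re ∧ z.re ≤ L.x d.fst) ∨
    (L.dir d = 3 ∧ z.re = L.x d.fst ∧ ((L.y d.fst - 1 : ℤ) : ℝ) ≤ z.im ∧ z.im ≤ L.y d.fst) := by
  have h := L.dir_lt d
  unfold point at hz
  rw [L.x_snd, L.y_snd, segment_eq_image'] at hz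
  obtain ⟨a, ⟨h1, h2⟩, rfl⟩ := hz
  generalize L.dir d = k at *
  interval_cases k <;> simp [dirX, dirY, h1, h2] <;> linarith

/-- If an edge had a point in the open area of a face, the cell to the left of the edge would belong
to this face. Then the edge is on the walk of the face, hence on the boundary of its rectangle and
not in the area. -/
theorem area_subset (f : G.Face) : L.area f ⊆ (G.drawn L.point)ᶜ := by
  intro z hz hzd
  rw [drawn_eq, Set.mem_iUnion] at hzd
  obtain ⟨d, hd⟩ := hzd
  have hs := L.segment_dir d hd
  have hleft := L.covers_left d
  unfold area at hz
  split_ifs at hz with hf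
  · subst hf
    simp only [Set.mem_compl_iff, Complex.mem_reProdIm, Set.mem_Icc] at hz
    have hlb := L.l_lt L.outer
    have hbt := L.b_lt L.outer
    have cast : ∀ {i j : ℤ}, i ≤ j → (i : ℝ) ≤ j := fun h => by exact_mod_cast h
    rcases hs with ⟨h0, h1, h2, h3⟩ | ⟨h0, h1, h2, h3⟩ | ⟨h0, h1, h2, h3⟩ | ⟨h0, h1, h2, h3⟩
    · have hn : ¬ (L.l L.outer ≤ L.x d.fst ∧ L.x d.fst + 1 ≤ L.r L.outer ∧
          L.b L.outer ≤ L.y d.fst ∧ L.y d.fst ≤ L.t L.outer) := by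
        rintro ⟨g1, g2, g3, g4⟩
        exact hz ⟨⟨(cast g1).trans h2, h3.trans (cast g2)⟩, h1 ▸ cast g3, h1 ▸ cast g4⟩
      have hcov : L.Covers L.outer (L.x d.fst + quadX (L.dir d)) (L.y d.fst + quadY (L.dir d)) := by
        refine Or.inr ⟨rfl, ?_⟩
        rw [h0]; unfold CellIn quadX quadY; simp; omega
      have := L.outer_edge_dir (L.covers_unique hleft hcov)
      omega
    · have hn : ¬ (L.l L.outer ≤ L.x d.fst ∧ L.x d.fst ≤ L.r L.outer ∧
          L.b L.outer ≤ L.y d.fst ∧ L.y d.fst + 1 ≤ L.t L.outer) := by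
        rintro ⟨g1, g2, g3, g4⟩
        exact hz ⟨⟨h1 ▸ cast g1, h1 ▸ cast g2⟩, (cast g3).trans h2, h3.trans (cast g4)⟩
      have hcov : L.Covers L.outer (L.x d.fst + quadX (L.dir d)) (L.y d.fst + quadY (L.dir d)) := by
        refine Or.inr ⟨rfl, ?_⟩
        rw [h0]; unfold CellIn quadX quadY; simp; omega
      have := L.outer_edge_dir (L.covers_unique hleft hcov)
      omega
    · have hn : ¬ (L.l L.outer ≤ L.x d.fst - 1 ∧ L.x d.fst ≤ L.r L.outer ∧
          L.b L.outer ≤ L.y d.fst ∧ L.y d.fst ≤ L.t L.outer) := by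
        rintro ⟨g1, g2, g3, g4⟩
        exact hz ⟨⟨(cast g1).trans h2, h3.trans (cast g2)⟩, h1 ▸ cast g3, h1 ▸ cast g4⟩
      have hcov : L.Covers L.outer (L.x d.fst + quadX (L.dir d)) (L.y d.fst + quadY (L.dir d)) := by
        refine Or.inr ⟨rfl, ?_⟩
        rw [h0]; unfold CellIn quadX quadY; simp; omega
      have := L.outer_edge_dir (L.covers_unique hleft hcov)
      omega
    · have hn : ¬ (L.l L.outer ≤ L.x d.fst ∧ L.x d.fst ≤ L.r L.outer ∧
          L.b L.outer ≤ L.y d.fst - 1 ∧ L.y d.fst ≤ L.t L.outer) := by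
        rintro ⟨g1, g2, g3, g4⟩
        exact hz ⟨⟨h1 ▸ cast g1, h1 ▸ cast g2⟩, (cast g3).trans h2, h3.trans (cast g4)⟩
      have hcov : L.Covers L.outer (L.x d.fst + quadX (L.dir d)) (L.y d.fst + quadY (L.dir d)) := by
        refine Or.inr ⟨rfl, ?_⟩
        rw [h0]; unfold CellIn quadX quadY; simp; omega
      have := L.outer_edge_dir (L.covers_unique hleft hcov)
      omega
  · simp only [Complex.mem_reProdIm, Set.mem_Ioo] at hz
    obtain ⟨⟨g1, g2⟩, g3, g4⟩ := hz
    have cast : ∀ {i j : ℤ}, (i : ℝ) < j → i < j := fun h => by exact_mod_cast h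
    have hlb := L.l_lt f
    have hbt := L.b_lt f
    rcases hs with ⟨h0, h1, h2, h3⟩ | ⟨h0, h1, h2, h3⟩ | ⟨h0, h1, h2, h3⟩ | ⟨h0, h1, h2, h3⟩
    · rw [h1] at g3 g4
      have f1 := cast (g1.trans_le h3)
      have f2 := cast (h2.trans_lt g2)
      have f3 := cast g3
      have f4 := cast g4
      have hcov : L.Covers f (L.x d.fst + quadX (L.dir d)) (L.y d.fst + quadY (L.dir d)) := by
        refine Or.inl ⟨hf, ?_⟩
        rw [h0]; unfold CellIn quadX quadY; simp; omega
      have := L.inner_edge_dir (L.covers_unique hleft hcov) hf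
      omega
    · rw [h1] at g1 g2
      have f1 := cast (g3.trans_le h3)
      have f2 := cast (h2.trans_lt g4)
      have f3 := cast g1
      have f4 := cast g2
      have hcov : L.Covers f (L.x d.fst + quadX (L.dir d)) (L.y d.fst + quadY (L.dir d)) := by
        refine Or.inl ⟨hf, ?_⟩
        rw [h0]; unfold CellIn quadX quadY; simp; omega
      have := L.inner_edge_dir (L.covers_unique hleft hcov) hf
      omega
    · rw [h1] at g3 g4
      have f1 := cast (g1.trans_le h3)
      have f2 := cast (h2.trans_lt g2)
      have f3 := cast g3
      have f4 := cast g4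
      have hcov : L.Covers f (L.x d.fst + quadX (L.dir d)) (L.y d.fst + quadY (L.dir d)) := by
        refine Or.inl ⟨hf, ?_⟩
        rw [h0]; unfold CellIn quadX quadY; simp; omega
      have := L.inner_edge_dir (L.covers_unique hleft hcov) hf
      omega
    · rw [h1] at g1 g2
      have f1 := cast (g3.trans_le h3)
      have f2 := cast (h2.trans_lt g4)
      have f3 := cast g1
      have f4 := cast g2
      have hcov : L.Covers f (L.x d.fst + quadX (L.dir d)) (L.y d.fst + quadY (L.dir d)) := by
        refine Or.inl ⟨hf, ?_⟩
        rw [h0]; unfold CellIn quadX quadY; simp; omega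
      have := L.inner_edge_dir (L.covers_unique hleft hcov) hf
      omega

theorem mem_segment_horizontal {i j : ℤ} {z : ℂ} (h : z.im = j) (h1 : (i : ℝ) ≤ z.re)
    (h2 : z.re ≤ i + 1) {v w : Fin n} (hv : L.x v = i) (hv' : L.y v = j) (hw : L.x w = i + 1)
    (hw' : L.y w = j) : z ∈ segment ℝ (L.point v) (L.point w) := by
  rw [segment_eq_image']
  refine ⟨z.re - i, ⟨by linarith, by linarith⟩, ?_⟩
  apply Complex.ext <;> simp [point, hv, hv', hw, hw', h]

theorem mem_segment_vertical {i j : ℤ} {z : ℂ} (h : z.re = i) (h1 : (j : ℝ) ≤ z.im)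
    (h2 : z.im ≤ j + 1) {v w : Fin n} (hv : L.x v = i) (hv' : L.y v = j) (hw : L.x w = i)
    (hw' : L.y w = j + 1) : z ∈ segment ℝ (L.point v) (L.point w) := by
  rw [segment_eq_image']
  refine ⟨z.im - j, ⟨by linarith, by linarith⟩, ?_⟩
  apply Complex.ext <;> simp [point, hv, hv', hw, hw', h]

/-- A point of the outer rectangle lies in a closed cell of some inner rectangle. Every unit segment
on the boundary of that rectangle is an edge, so a point off the drawing is in the interior. -/
theorem exists_area {z : ℂ} (hz : z ∈ (G.drawn L.point)ᶜ) : ∃ f, z ∈ L.area f := by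
  by_cases h0 : z ∈ L.area L.outer
  · exact ⟨_, h0⟩
  have hd : ∀ d : G.graph.Dart, z ∉ segment ℝ (L.point d.fst) (L.point d.snd) :=
    fun d hd => hz (segment_subset_drawn d hd)
  have h1 := h0
  simp only [area, if_true, Set.mem_compl_iff, not_not, Complex.mem_reProdIm, Set.mem_Icc] at h1
  obtain ⟨⟨h1, h2⟩, h3, h4⟩ := h1
  obtain ⟨i, hi1, hi2, hi3, hi4⟩ := exists_int_cell (L.l_lt _) h1 h2
  obtain ⟨j, hj1, hj2, hj3, hj4⟩ := exists_int_cell (L.b_lt _) h3 h4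
  obtain ⟨f, hf, g1, g2, g3, g4⟩ := L.exists_cellIn (i := i) (j := j) ⟨hi1, hi2, hj1, hj2⟩
  have g1' : (L.l f : ℝ) ≤ i := by exact_mod_cast g1
  have g2' : (i : ℝ) + 1 ≤ L.r f := by exact_mod_cast g2
  have g3' : (L.b f : ℝ) ≤ j := by exact_mod_cast g3
  have g4' : (j : ℝ) + 1 ≤ L.t f := by exact_mod_cast g4
  refine ⟨f, ?_⟩
  rw [area, if_neg hf]
  refine ⟨⟨lt_of_le_of_ne (by linarith) ?_, lt_of_le_of_ne (by linarith) ?_⟩,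
    lt_of_le_of_ne (by linarith) ?_, lt_of_le_of_ne (by linarith) ?_⟩
  · intro e
    obtain ⟨d, -, e1, e2, e3, e4⟩ := L.exists_inner_edge hf (u := L.l f) (v := j + 1)
      (u' := L.l f) (v' := j) (by unfold RectEdge; omega)
    refine hd d ?_
    rw [segment_symm]
    exact L.mem_segment_vertical e.symm hj3 hj4 e3 e4 e1 e2
  · intro e
    obtain ⟨d, -, e1, e2, e3, e4⟩ := L.exists_inner_edge hf (u := L.r f) (v := j)
      (u' := L.r f) (v' := j + 1) (by unfold RectEdge; omega)
    exact hd d (L.mem_segment_vertical e hj3 hj4 e1 e2 e3 e4)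
  · intro e
    obtain ⟨d, -, e1, e2, e3, e4⟩ := L.exists_inner_edge hf (u := i) (v := L.b f)
      (u' := i + 1) (v' := L.b f) (by unfold RectEdge; omega)
    exact hd d (L.mem_segment_horizontal e.symm hi3 hi4 e1 e2 e3 e4)
  · intro e
    obtain ⟨d, -, e1, e2, e3, e4⟩ := L.exists_inner_edge hf (u := i + 1) (v := L.t f)
      (u' := i) (v' := L.t f) (by unfold RectEdge; omega)
    refine hd d ?_
    rw [segment_symm]
    exact L.mem_segment_horizontal e hi3 hi4 e3 e4 e1 e2

/-- The areas are open, connected and pairwise disjoint, and they exhaust the complement of the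
drawing; so they are its components. -/
theorem connectedComponentIn_eq_area {f : G.Face} {z : ℂ} (hz : z ∈ L.area f) :
    connectedComponentIn (G.drawn L.point)ᶜ z = L.area f := by
  apply Set.Subset.antisymm
  · refine isPreconnected_connectedComponentIn.subset_left_of_subset_union (L.isOpen_area f)
      (isOpen_biUnion fun g (_ : g ≠ f) => L.isOpen_area g) ?_ ?_ ?_
    · rw [Set.disjoint_left]
      intro w hw hw'
      obtain ⟨g, hg, hwg⟩ := Set.mem_iUnion₂.1 hw'
      exact hg (L.area_disjoint hwg hw)
    · intro w hw
      obtain ⟨g, hg⟩ := L.exists_area (connectedComponentIn_subset _ _ hw)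
      by_cases h : g = f
      · exact Or.inl (h ▸ hg)
      · exact Or.inr (Set.mem_iUnion₂.2 ⟨g, h, hg⟩)
    · exact ⟨z, mem_connectedComponentIn (L.area_subset f hz), hz⟩
  · exact (L.isPreconnected_area f).subset_connectedComponentIn hz (L.area_subset f)

theorem isRectangular : G.IsRectangular L.point := by
  rintro _ ⟨z, hz, rfl⟩
  obtain ⟨f, hf⟩ := L.exists_area hz
  rw [L.connectedComponentIn_eq_area hf]
  refine ⟨L.l f, L.r f, L.b f, L.t f, by exact_mod_cast L.l_lt f, by exact_mod_cast L.b_lt f, ?_⟩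
  unfold area
  split_ifs with h
  · exact Or.inr ⟨not_isBounded_compl_rectangle, rfl⟩
  · exact Or.inl ⟨(Metric.isBounded_Ioo _ _).reProdIm (Metric.isBounded_Ioo _ _), rfl⟩

/-- A layout gives a unit-length rectangular drawing. -/
theorem isUnitRectangularDrawing : G.IsUnitRectangularDrawing L.point :=
  ⟨L.isUnitLengthRectilinear, L.isRectangular, L.preservesEmbedding⟩

end RectLayout

theorem urfe_iff_nonempty_rectLayout : G.URFE ↔ Nonempty G.RectLayout := by
  constructor
  · rintro ⟨p, hp⟩
    exact ⟨hp.exists_layout.2.choose⟩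
  · rintro ⟨L⟩
    exact ⟨_, L.isUnitRectangularDrawing⟩

end PlanarEmbeddedGraph

/-! ## The outer face has maximum degree -/

theorem RectEdge.mirror {l r b t x y x' y' : ℤ} (h : RectEdge l r b t x y x' y') :
    RectEdge (-r) (-l) b t (-x') y' (-x) y := by
  unfold RectEdge at *; omega

theorem RectEdge.translate {l r b t x y x' y' : ℤ} (a c : ℤ) (h : RectEdge l r b t x y x' y') :
    RectEdge (l + a) (r + a) (b + c) (t + c) (x + a) (y + c) (x' + a) (y' + c) := by
  unfold RectEdge at *; omega

namespace PlanarEmbeddedGraph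

variable {n : ℕ} {G : PlanarEmbeddedGraph n}

namespace RectLayout

variable (L : G.RectLayout)

/-- A rectangle inside another one with at least the same perimeter is equal to it. -/
theorem rect_eq_of_degree_le {f : G.Face} (h : G.degree L.outer ≤ G.degree f) :
    L.l f = L.l L.outer ∧ L.r f = L.r L.outer ∧ L.b f = L.b L.outer ∧ L.t f = L.t L.outer := by
  have h1 := L.inner_le f
  have h2 := L.degree_eq f
  have h3 := L.degree_eq L.outer
  omega

/-- The inner face `f` fills the outer rectangle, which leaves no cell for a third face. -/
theorem eq_or_eq_of_degree_le {f : G.Face} (hf : f ≠ L.outer)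
    (h : G.degree L.outer ≤ G.degree f) (g : G.Face) : g = f ∨ g = L.outer := by
  by_cases hg : g = L.outer
  · exact Or.inr hg
  left
  have h1 := L.rect_eq_of_degree_le h
  have h2 : L.CellIn g (L.l g) (L.b g) := ⟨le_rfl, L.l_lt g, le_rfl, L.b_lt g⟩
  have h3 := L.cellIn_outer h2
  refine L.cellIn_unique hg hf h2 ?_
  unfold CellIn at h3 ⊢
  omega

/-- The mirror image of a layout with only one inner face, with the roles of the faces exchanged. -/
def mirror {f : G.Face} (hf : f ≠ L.outer) (h : G.degree L.outer ≤ G.degree f) : G.RectLayout where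
  x v := - L.x v
  y := L.y
  outer := f
  l g := - L.r g
  r g := - L.l g
  b := L.b
  t := L.t
  l_lt g := by have := L.l_lt g; omega
  b_lt := L.b_lt
  inner_edge d hd := by
    have h1 := (L.eq_or_eq_of_degree_le hf h _).resolve_left hd
    rw [h1]
    exact (L.outer_edge d h1).mirror
  outer_edge d hd := (L.inner_edge' hf d (mem_faceDarts.2 hd)).mirror
  degree_eq g := (L.degree_eq g).trans (by ring)
  exists_dart := L.exists_dart

/-- The layout moved by a vector. -/
def translate (a c : ℤ) : G.RectLayout where
  x v := L.x v + a
  y v := L.y v + c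
  outer := L.outer
  l g := L.l g + a
  r g := L.r g + a
  b g := L.b g + c
  t g := L.t g + c
  l_lt g := by have := L.l_lt g; omega
  b_lt g := by have := L.b_lt g; omega
  inner_edge d hd := (L.inner_edge d hd).translate a c
  outer_edge d hd := (L.outer_edge d hd).translate a c
  degree_eq g := (L.degree_eq g).trans (by ring)
  exists_dart := L.exists_dart

/-- A face of maximum degree that is not the outer one is the only inner face, and mirroring makes
it the outer one. Translation to the origin makes all coordinates natural numbers, as the registers
of the machine require. -/
theorem exists_outer_eq (L : G.RectLayout) {f : G.Face} (hf : ∀ g, G.degree g ≤ G.degree f) :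
    ∃ L' : G.RectLayout, L'.outer = f ∧ L'.l f = 0 ∧ L'.b f = 0 := by
  have : ∃ L' : G.RectLayout, L'.outer = f := by
    by_cases h : f = L.outer
    · exact ⟨L, h.symm⟩
    · exact ⟨L.mirror h (hf _), rfl⟩
  obtain ⟨L', h⟩ := this
  exact ⟨L'.translate (- L'.l f) (- L'.b f), h, by simp [translate], by simp [translate]⟩

/-- The walk around `f` visits every vertex exactly once and every edge has `f` on one side. So the
iterates of `faceNext` number the vertices cyclically, and their number is the perimeter, which is
even. -/
theorem isEvenCycle {f : G.Face} (hf : f ≠ L.outer) (h : G.degree L.outer ≤ G.degree f) :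
    G.IsEvenCycle := by
  have hface := L.eq_or_eq_of_degree_le hf h
  obtain ⟨hl, hr, hb, ht⟩ := L.rect_eq_of_degree_le h
  have hfst : ∀ d e : G.graph.Dart, G.leftFace d = f → G.leftFace e = f → d.fst = e.fst → d = e :=
    fun d e hd he hde => L.injOn (hd.trans he.symm) (by rw [hde]) (by rw [hde])
  have hlf := L.l_lt f
  have hbf := L.b_lt f
  have hsurj : ∀ v, ∃ d : G.graph.Dart, G.leftFace d = f ∧ d.fst = v := by
    intro v
    obtain ⟨d, rfl⟩ := L.exists_dart v
    by_cases hd : G.leftFace d = f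
    · exact ⟨d, hd, rfl⟩
    have hd' := L.outer_edge_dir ((hface _).resolve_left hd)
    -- Even a vertex at a corner of the outer rectangle has a cell of this rectangle next to it. The
    -- dart whose wedge covers that cell has an inner face on its left, which can only be `f`.
    have hk : ∃ k < 4, L.CellIn L.outer (L.x d.fst + quadX k) (L.y d.fst + quadY k) := by
      unfold CellIn
      by_cases h1 : L.x d.fst < L.r f <;> by_cases h2 : L.y d.fst < L.t f
      · exact ⟨0, by norm_num, by simp [quadX, quadY]; omega⟩
      · exact ⟨3, by norm_num, by simp [quadX, quadY]; omega⟩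
      · exact ⟨1, by norm_num, by simp [quadX, quadY]; omega⟩
      · exact ⟨2, by norm_num, by simp [quadX, quadY]; omega⟩
    obtain ⟨k, hk, hc⟩ := hk
    obtain ⟨e, he, hcov⟩ := L.exists_covers_quad d.fst hk
    refine ⟨e, (hface _).resolve_right fun h' => ?_, he⟩
    rcases hcov with ⟨h1, -⟩ | ⟨-, h1⟩
    · exact h1 h'
    · exact h1 (h' ▸ hc)
  have hn : (G.faceDarts f).card = n := by
    rw [Finset.card_bij (t := Finset.univ) (fun d _ => d.fst) (fun _ _ => Finset.mem_univ _)
      (fun d hd e he => hfst d e (mem_faceDarts.1 hd) (mem_faceDarts.1 he)) ?_]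
    · simp
    · intro v _
      obtain ⟨d, h1, h2⟩ := hsurj v
      exact ⟨d, mem_faceDarts.2 h1, h2⟩
  have hdeg := L.degree_eq f
  rw [degree_eq_card, hn] at hdeg
  obtain ⟨d0, hd0⟩ := exists_leftFace f
  have hpow : ∀ i : ℕ, G.leftFace ((G.faceNext ^ i) d0) = f := fun i =>
    (leftFace_eq_iff.2 (Equiv.Perm.sameCycle_pow_left.2 (Equiv.Perm.SameCycle.refl _ _))).trans hd0
  have hex : ∀ d : G.graph.Dart, G.leftFace d = f → ∃ i < n, (G.faceNext ^ i) d0 = d := by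
    classical
    intro d hd
    have hs := leftFace_eq_iff.1 (hd0.trans hd.symm)
    by_cases hfix : G.faceNext d0 = d0
    · refine ⟨0, by omega, ?_⟩
      exact (hs.eq_of_left hfix)
    obtain ⟨i, hi, h2⟩ := hs.exists_pow_eq_of_mem_support (by simpa using hfix)
    refine ⟨i, hi.trans_le (le_trans ?_ hn.le), h2⟩
    refine Finset.card_le_card fun e he => mem_faceDarts.2 ?_
    have := (Equiv.Perm.mem_support_cycleOf_iff.1 he).1
    exact (leftFace_eq_iff.2 this).symm.trans hd0
  have : NeZero n := ⟨by omega⟩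
  let φ : Fin n → Fin n := fun i => ((G.faceNext ^ (i : ℕ)) d0).fst
  have hφs : Function.Surjective φ := by
    intro v
    obtain ⟨d, h1, rfl⟩ := hsurj v
    obtain ⟨i, hi, rfl⟩ := hex d h1
    exact ⟨⟨i, hi⟩, rfl⟩
  have hφ : Function.Bijective φ := Finite.injective_iff_bijective.1
    (Finite.injective_iff_surjective.2 hφs)
  have hinj : ∀ i < n, ∀ j < n, (G.faceNext ^ i) d0 = (G.faceNext ^ j) d0 → i = j := by
    intro i hi j hj hij
    have : φ ⟨i, hi⟩ = φ ⟨j, hj⟩ := by simp only [φ, hij]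
    simpa using hφ.1 this
  -- The first `n` iterates are pairwise different and exhaust the walk, so the next one must be the
  -- first again.
  have hper : (G.faceNext ^ n) d0 = d0 := by
    obtain ⟨i, hi, h2⟩ := hex _ (hpow n)
    rcases Nat.eq_zero_or_pos i with rfl | hi0
    · simpa using h2.symm
    have h3 : (G.faceNext ^ i) ((G.faceNext ^ (n - i)) d0) = (G.faceNext ^ i) d0 := by
      rw [← Equiv.Perm.mul_apply, ← pow_add, Nat.add_sub_cancel' hi.le, h2]
    have := hinj (n - i) (by omega) 0 (by omega) (by simpa using (G.faceNext ^ i).injective h3)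
    omega
  have hsucc : ∀ i : Fin n, ((G.faceNext ^ (i : ℕ)) d0).snd = φ (i + 1) := by
    intro i
    rw [← faceNext_fst, ← Equiv.Perm.mul_apply, ← pow_succ']
    simp only [φ]
    have : ((i + 1 : Fin n) : ℕ) = (i + 1) % n := by
      rw [Fin.val_add, Fin.val_one', Nat.add_mod_mod]
    rw [this]
    rcases (show (i : ℕ) + 1 ≤ n by omega).lt_or_eq with h1 | h1
    · rw [Nat.mod_eq_of_lt h1]
    · rw [h1, Nat.mod_self, hper, pow_zero, Equiv.Perm.one_apply]
  have hadj : ∀ i j : Fin n, G.graph.Adj (φ i) (φ j) ↔ j = i + 1 ∨ i = j + 1 := by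
    have half : ∀ d : G.graph.Dart, G.leftFace d = f → ∀ i j : Fin n, d.fst = φ i → d.snd = φ j →
        j = i + 1 := by
      intro d hd i j h1 h2
      have : d = (G.faceNext ^ (i : ℕ)) d0 := hfst _ _ hd (hpow _) h1
      rw [this, hsucc] at h2
      exact (hφ.1 h2).symm
    intro i j
    constructor
    · intro hij
      obtain ⟨d, hi, hj⟩ : ∃ d : G.graph.Dart, d.fst = φ i ∧ d.snd = φ j :=
        ⟨⟨(φ i, φ j), hij⟩, rfl, rfl⟩
      by_cases hd : G.leftFace d = f
      · exact Or.inl (half d hd i j hi hj)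
      by_cases hd' : G.leftFace d.symm = f
      · exact Or.inr (half d.symm hd' j i hj hi)
      -- With the outer face on both sides, the edge would be directed clockwise both ways.
      exfalso
      have h1 := L.outer_edge_dir ((hface _).resolve_left hd)
      have h2 := L.outer_edge_dir ((hface _).resolve_left hd')
      have h3 := L.dir_symm d
      have h4 := L.x_snd d
      have h5 := L.y_snd d
      simp only [dart_symm_fst] at h2
      rcases h1 with ⟨h1, h6⟩ | ⟨h1, h6⟩ | ⟨h1, h6⟩ | ⟨h1, h6⟩ <;> rw [h1] at h3 h4 h5 <;>
        simp [dirX, dirY] at h3 h4 h5 <;> omega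
    · rintro (rfl | rfl)
      · exact hsucc i ▸ ((G.faceNext ^ (i : ℕ)) d0).adj
      · exact hsucc j ▸ ((G.faceNext ^ (j : ℕ)) d0).adj.symm
  refine ⟨by omega, ⟨n / 2, by omega⟩, ⟨RelIso.symm ⟨Equiv.ofBijective φ hφ, ?_⟩⟩⟩
  intro i j
  rw [Equiv.ofBijective_apply, Equiv.ofBijective_apply, hadj, SimpleGraph.cycleGraph_adj']
  have h1 : ∀ a : Fin n, (a : ℕ) = 1 ↔ a = 1 := by
    intro a
    rw [Fin.ext_iff, Fin.val_one', Nat.mod_eq_of_lt (by omega)]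
  rw [h1, h1, sub_eq_iff_eq_add, sub_eq_iff_eq_add, add_comm 1 i, add_comm 1 j]
  tauto

end RectLayout

theorem IsUnitRectangularDrawing.isEvenCycle_or {p : Fin n → ℂ} (h : G.IsUnitRectangularDrawing p) :
    G.IsEvenCycle ∨ ∃ f : G.Face, (∀ g : G.Face, G.IsOuterFace p g ↔ g = f) ∧
      ∀ g : G.Face, g ≠ f → G.degree g < G.degree f := by
  obtain ⟨-, L, hL⟩ := h.exists_layout
  by_cases hc : G.IsEvenCycle
  · exact Or.inl hc
  · refine Or.inr ⟨L.outer, hL, fun g hg => ?_⟩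
    by_contra hlt
    exact hc (L.isEvenCycle hg (not_lt.1 hlt))

end PlanarEmbeddedGraph

/-! ## Programs with counting loops -/

notation "rOne" => (2 : ℕ)

/-- Programs of the random access machine in which every loop is a counting loop and every addition
adds `1`, which is kept in the register `rOne`. -/
inductive Code : Type
  | skip : Code
  | const (r k : ℕ) : Code
  | move (r x : ℕ) : Code
  | inc (r x : ℕ) : Code
  | sub (r x y : ℕ) : Code
  | load (r a x : ℕ) : Code
  | store (a x y : ℕ) : Code
  | seq (P Q : Code) : Code
  | ite (x y : ℕ) (P Q : Code) : Code
  /-- for `x` from `0` to `y - 1` do `B` -/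
  | loop (x y : ℕ) (B : Code) : Code

infixr:60 " ;; " => Code.seq

namespace Code

/-- The program for the random access machine. -/
def compile : Code → RAMProg
  | skip => .skip
  | const r k => .const r k
  | move r x => .move r x
  | inc r x => .add r x rOne
  | sub r x y => .sub r x y
  | load r a x => .load r a x
  | store a x y => .store a x y
  | seq P Q => .seq P.compile Q.compile
  | ite x y P Q => .ite x y P.compile Q.compile
  | loop x y B => .seq (.const x 0) (.while x y (.seq B.compile (.add x x rOne)))

/-- Apply `f 0`, `f 1`, …, `f (N - 1)` in this order. -/
def iter {σ : Type*} (f : ℕ → σ → σ) (s : σ) : ℕ → σ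
  | 0 => s
  | N + 1 => f N (iter f s N)

/-- The state after the execution of the program. -/
def ev : Code → RAMState → RAMState
  | skip, s => s
  | const r k, s => s.setReg r k
  | move r x, s => s.setReg r (s.reg x)
  | inc r x, s => s.setReg r (s.reg x + 1)
  | sub r x y, s => s.setReg r (s.reg x - s.reg y)
  | load r a x, s => s.setReg r (s.arr a (s.reg x))
  | store a x y, s => s.setArr a (s.reg x) (s.reg y)
  | seq P Q, s => Q.ev (P.ev s)
  | ite x y P Q, s => if s.reg x < s.reg y then P.ev s else Q.ev s
  | loop x y B, s =>
      (iter (fun j s' => B.ev (s'.setReg x j)) s (s.reg y)).setReg x (s.reg y)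

/-- The number of steps. -/
def cost : Code → RAMState → ℕ
  | seq P Q, s => P.cost s + Q.cost (P.ev s)
  | ite x y P Q, s => (if s.reg x < s.reg y then P.cost s else Q.cost s) + 1
  | loop x y B, s => ∑ j ∈ Finset.range (s.reg y),
      (B.cost ((iter (fun j s' => B.ev (s'.setReg x j)) s j).setReg x j) + 2) + 2
  | _, _ => 1

/-- Does the program contain an instruction that writes the register `q`? -/
def writes : Code → ℕ → Bool
  | const r _, q => r == q
  | move r _, q => r == q
  | inc r _, q => r == q
  | sub r _ _, q => r == q
  | load r _ _, q => r == q
  | seq P Q, q => P.writes q || Q.writes q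
  | ite _ _ P Q, q => P.writes q || Q.writes q
  | loop x _ B, q => x == q || B.writes q
  | _, _ => false

/-- Does the program contain an instruction that writes the array `b`? -/
def writesArr : Code → ℕ → Bool
  | store a _ _, b => a == b
  | seq P Q, b => P.writesArr b || Q.writesArr b
  | ite _ _ P Q, b => P.writesArr b || Q.writesArr b
  | loop _ _ B, b => B.writesArr b
  | _, _ => false

/-- The loops do not change their counters and bounds. -/
def wellFormed : Code → Bool
  | seq P Q => P.wellFormed && Q.wellFormed
  | ite _ _ P Q => P.wellFormed && Q.wellFormed
  | loop x y B => x != y && !B.writes x && !B.writes y && B.wellFormed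
  | _ => true

/-- The largest constant in the program. -/
def maxConst : Code → ℕ
  | const _ k => k
  | seq P Q => max P.maxConst Q.maxConst
  | ite _ _ P Q => max P.maxConst Q.maxConst
  | loop _ _ B => B.maxConst
  | _ => 0

/-- A bound for the number of steps if the registers `y` that bound loops hold at most `f y`. -/
def costBound (f : ℕ → ℕ) : Code → ℕ
  | seq P Q => P.costBound f + Q.costBound f
  | ite _ _ P Q => max (P.costBound f) (Q.costBound f) + 1
  | loop _ y B => f y * (B.costBound f + 2) + 2
  | _ => 1

/-- Does the register `q` bound a loop of the program? -/
def bounds : Code → ℕ → Bool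
  | seq P Q, q => P.bounds q || Q.bounds q
  | ite _ _ P Q, q => P.bounds q || Q.bounds q
  | loop _ y B, q => y == q || B.bounds q
  | _, _ => false

theorem iter_induction {σ : Type*} {f : ℕ → σ → σ} {s : σ} (I : ℕ → σ → Prop) {N : ℕ} (h0 : I 0 s)
    (h : ∀ j < N, ∀ s', I j s' → I (j + 1) (f j s')) : I N (iter f s N) := by
  have : ∀ j ≤ N, I j (iter f s j) := by
    intro j
    induction j with
    | zero => exact fun _ => h0
    | succ j ih => exact fun hj => h j hj _ (ih (by omega))
  exact this N le_rfl

@[simp] theorem setReg_reg (s : RAMState) (r x q : ℕ) :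
    (s.setReg r x).reg q = if q = r then x else s.reg q := by
  simp [RAMState.setReg, Function.update_apply]

@[simp] theorem setReg_arr (s : RAMState) (r x : ℕ) : (s.setReg r x).arr = s.arr := rfl

@[simp] theorem setArr_reg (s : RAMState) (a i x : ℕ) : (s.setArr a i x).reg = s.reg := rfl

theorem setArr_arr (s : RAMState) (a i x b : ℕ) :
    (s.setArr a i x).arr b = if b = a then Function.update (s.arr a) i x else s.arr b := by
  simp [RAMState.setArr, Function.update_apply]

@[simp] theorem setArr_arr_apply (s : RAMState) (a i x b j : ℕ) :
    (s.setArr a i x).arr b j = if b = a ∧ j = i then x else s.arr b j := by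
  rw [setArr_arr]
  by_cases h : b = a <;> simp [h, Function.update_apply]

theorem ev_reg {P : Code} {q : ℕ} (h : P.writes q = false) (s : RAMState) :
    (P.ev s).reg q = s.reg q := by
  induction P generalizing s with
  | seq P Q hP hQ =>
    simp only [writes, Bool.or_eq_false_iff] at h
    rw [ev, hQ h.2, hP h.1]
  | ite x y P Q hP hQ =>
    simp only [writes, Bool.or_eq_false_iff] at h
    rw [ev]; split_ifs
    · exact hP h.1 s
    · exact hQ h.2 s
  | loop x y B hB =>
    simp only [writes, Bool.or_eq_false_iff, beq_eq_false_iff_ne] at h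
    rw [ev, setReg_reg, if_neg h.1.symm]
    refine iter_induction (fun _ (s' : RAMState) => s'.reg q = s.reg q) rfl fun j _ s' hs' => ?_
    rw [hB h.2, setReg_reg, if_neg h.1.symm, hs']
  | skip => rfl
  | store a x y => rfl
  | _ =>
    simp only [writes, beq_eq_false_iff_ne] at h
    rw [ev, setReg_reg, if_neg h.symm]

theorem ev_arr {P : Code} {b : ℕ} (h : P.writesArr b = false) (s : RAMState) :
    (P.ev s).arr b = s.arr b := by
  induction P generalizing s with
  | seq P Q hP hQ =>
    simp only [writesArr, Bool.or_eq_false_iff] at h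
    rw [ev, hQ h.2, hP h.1]
  | ite x y P Q hP hQ =>
    simp only [writesArr, Bool.or_eq_false_iff] at h
    rw [ev]; split_ifs
    · exact hP h.1 s
    · exact hQ h.2 s
  | loop x y B hB =>
    simp only [writesArr] at h
    rw [ev, setReg_arr]
    refine iter_induction (fun _ (s' : RAMState) => s'.arr b = s.arr b) rfl fun j _ s' hs' => ?_
    rw [hB h, setReg_arr, hs']
  | store a x y =>
    simp only [writesArr, beq_eq_false_iff_ne] at h
    rw [ev, setArr_arr, if_neg h.symm]
  | _ => simp [ev]

/-- Registers that bound loops are never written, so their initial values bound the number of rounds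
wherever the loop occurs. -/
theorem cost_le {P : Code} {f : ℕ → ℕ} {s : RAMState}
    (hb : ∀ y, P.bounds y = true → s.reg y ≤ f y ∧ P.writes y = false) :
    P.cost s ≤ P.costBound f := by
  induction P generalizing s with
  | seq P Q hP hQ =>
    simp only [bounds, writes, Bool.or_eq_true, Bool.or_eq_false_iff] at hb
    rw [cost, costBound]
    refine add_le_add (hP fun y hy => ?_) (hQ fun y hy => ?_)
    · have := hb y (Or.inl hy); tauto
    · have := hb y (Or.inr hy)
      rw [ev_reg this.2.1]; tauto
  | ite x y P Q hP hQ =>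
    simp only [bounds, writes, Bool.or_eq_true, Bool.or_eq_false_iff] at hb
    rw [cost, costBound]
    refine Nat.add_le_add_right ?_ _
    split_ifs
    · exact (hP fun y hy => by have := hb y (Or.inl hy); tauto).trans (le_max_left _ _)
    · exact (hQ fun y hy => by have := hb y (Or.inr hy); tauto).trans (le_max_right _ _)
  | loop x y B hB =>
    simp only [bounds, writes, Bool.or_eq_true, Bool.or_eq_false_iff, beq_iff_eq,
      beq_eq_false_iff_ne] at hb
    rw [cost, costBound]
    refine Nat.add_le_add_right ?_ _
    refine (Finset.sum_le_card_nsmul _ _ (B.costBound f + 2) fun j hj => ?_).trans ?_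
    · refine Nat.add_le_add_right (hB fun z hz => ?_) _
      have h1 := hb z (Or.inr hz)
      refine ⟨?_, h1.2.2⟩
      rw [setReg_reg, if_neg h1.2.1.symm]
      refine le_trans (le_of_eq ?_) h1.1
      refine iter_induction (fun _ (s' : RAMState) => s'.reg z = s.reg z) rfl fun j _ s' hs' => ?_
      rw [ev_reg h1.2.2, setReg_reg, if_neg h1.2.1.symm, hs']
    · rw [Finset.card_range, smul_eq_mul]
      exact Nat.mul_le_mul_right _ (hb y (Or.inl rfl)).1
  | _ => simp [cost, costBound]

/-- All registers and arrays hold numbers up to `M`. -/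
def Bounded (M : ℕ) (s : RAMState) : Prop := (∀ r, s.reg r ≤ M) ∧ ∀ a i, s.arr a i ≤ M

theorem Bounded.mono {M M' : ℕ} {s : RAMState} (h : Bounded M s) (hM : M ≤ M') : Bounded M' s :=
  ⟨fun r => (h.1 r).trans hM, fun a i => (h.2 a i).trans hM⟩

theorem Bounded.setReg {M : ℕ} {s : RAMState} (h : Bounded M s) {r x : ℕ} (hx : x ≤ M) :
    Bounded M (s.setReg r x) := by
  refine ⟨fun q => ?_, h.2⟩
  rw [setReg_reg]
  split_ifs
  · exact hx
  · exact h.1 q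

theorem Bounded.setArr {M : ℕ} {s : RAMState} (h : Bounded M s) {a i x : ℕ} (hx : x ≤ M) :
    Bounded M (s.setArr a i x) := by
  refine ⟨h.1, fun b j => ?_⟩
  rw [setArr_arr_apply]
  split_ifs
  · exact hx
  · exact h.2 b j

/-- Values are copied, decreased, increased by one, or set to constants up to `M`. After `t` steps
all numbers are therefore at most `M + t`, and no instruction overflows if `M` plus the total time
is less than `W`. -/
theorem ramExec {P : Code} {s : RAMState} {M W : ℕ} (hwf : P.wellFormed = true)
    (hone : P.writes rOne = false) (h1 : s.reg rOne = 1) (hs : Bounded M s) (hM : P.maxConst ≤ M)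
    (hW : M + P.cost s < W) :
    RAMExec W P.compile s (P.cost s) (P.ev s) ∧ Bounded (M + P.cost s) (P.ev s) := by
  induction P generalizing s M with
  | skip => exact ⟨.skip _, hs.mono (by omega)⟩
  | const r k =>
    simp only [maxConst] at hM
    exact ⟨.const _ _ _ (by omega), (hs.setReg hM).mono (by omega)⟩
  | move r x => exact ⟨.move _ _ _, (hs.setReg (hs.1 x)).mono (by omega)⟩
  | inc r x =>
    have := hs.1 x
    simp only [cost] at hW
    refine ⟨?_, (hs.mono (M' := M + 1) (by omega)).setReg (by omega)⟩
    have := RAMExec.add (W := W) s r x rOne (by omega)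
    rwa [h1] at this
  | sub r x y =>
    refine ⟨.sub _ _ _ _, (hs.setReg ?_).mono (by omega)⟩
    exact (Nat.sub_le _ _).trans (hs.1 x)
  | load r a x => exact ⟨.load _ _ _ _, (hs.setReg (hs.2 a _)).mono (by omega)⟩
  | store a x y => exact ⟨.store _ _ _ _, (hs.setArr (hs.1 y)).mono (by omega)⟩
  | seq P Q hP hQ =>
    simp only [wellFormed, Bool.and_eq_true, writes, Bool.or_eq_false_iff, maxConst, max_le_iff,
      cost] at hwf hone hM hW
    obtain ⟨h2, h3⟩ := hP hwf.1 hone.1 h1 hs hM.1 (by omega)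
    obtain ⟨h4, h5⟩ := hQ hwf.2 hone.2 (by rw [ev_reg hone.1, h1]) h3 (by omega) (by omega)
    exact ⟨.seq h2 h4, h5.mono (by rw [cost]; omega)⟩
  | ite x y P Q hP hQ =>
    simp only [wellFormed, Bool.and_eq_true, writes, Bool.or_eq_false_iff, maxConst, max_le_iff,
      cost] at hwf hone hM hW
    rw [cost, ev, compile]
    by_cases hxy : s.reg x < s.reg y
    · rw [if_pos hxy] at hW
      rw [if_pos hxy, if_pos hxy]
      obtain ⟨h2, h3⟩ := hP hwf.1 hone.1 h1 hs hM.1 (by omega)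
      exact ⟨.ite_true hxy h2, h3.mono (by omega)⟩
    · rw [if_neg hxy] at hW
      rw [if_neg hxy, if_neg hxy]
      obtain ⟨h2, h3⟩ := hQ hwf.2 hone.2 h1 hs hM.2 (by omega)
      exact ⟨.ite_false hxy h2, h3.mono (by omega)⟩
  | loop x y B hB =>
    simp only [wellFormed, Bool.and_eq_true, writes, Bool.or_eq_false_iff, maxConst, bne_iff_ne,
      Bool.not_eq_true', beq_eq_false_iff_ne] at hwf hone hM
    obtain ⟨⟨⟨hxy, hx⟩, hy⟩, hB'⟩ := hwf
    rw [cost] at hW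
    rw [cost, ev, compile]
    set S : ℕ → RAMState := iter (fun j s' => B.ev (s'.setReg x j)) s with hS
    set N := s.reg y with hN
    have hSy : ∀ j, (S j).reg y = N := fun j =>
      iter_induction (fun _ (s' : RAMState) => s'.reg y = N) rfl fun j _ s' hs' => by
        rw [ev_reg hy, setReg_reg, if_neg hxy.symm, hs']
    have hSo : ∀ j, (S j).reg rOne = 1 := fun j =>
      iter_induction (fun _ (s' : RAMState) => s'.reg rOne = 1) h1 fun j _ s' hs' => by
        rw [ev_reg hone.2, setReg_reg, if_neg hone.1.symm, hs']
    have hNM : N ≤ M := hs.1 y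
    -- A round costs the body, the increment of the counter and the test; the remaining 2 steps are
    -- the initialization and the last test.
    let c : ℕ → ℕ := fun j => B.cost ((S j).setReg x j) + 2
    change M + (∑ j ∈ Finset.range N, c j + 2) < W at hW
    change RAMExec W _ s (∑ j ∈ Finset.range N, c j + 2) ((S N).setReg x N) ∧
      Bounded (M + (∑ j ∈ Finset.range N, c j + 2)) ((S N).setReg x N)
    have hsum : ∀ j < N, ∑ i ∈ Finset.range j, c i + c j ≤ ∑ i ∈ Finset.range N, c i := by
      intro j hj
      rw [← Finset.sum_range_succ]
      exact Finset.sum_le_sum_of_subset (by simpa using hj)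
    have hSB : ∀ j ≤ N, Bounded (M + ∑ i ∈ Finset.range j, c i) (S j) := by
      intro j
      induction j with
      | zero => exact fun _ => hs.mono (by omega)
      | succ j ih =>
        intro hj
        have h2 := (ih (by omega)).setReg (r := x) (x := j) (by omega)
        have h3 := hsum j hj
        have h4 : c j = B.cost ((S j).setReg x j) + 2 := rfl
        have := (hB hB' hone.2 (by rw [setReg_reg, if_neg hone.1.symm, hSo]) h2 (by omega)
          (by omega)).2
        refine this.mono ?_
        rw [Finset.sum_range_succ, h4]; omega
    -- Induction on the number `m` of rounds that remain. As the body changes neither the counter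
    -- nor the bound, round `j` begins with the counter equal to `j`.
    have key : ∀ m j, j + m = N → RAMExec W (.while x y (.seq B.compile (.add x x rOne)))
        ((S j).setReg x j) (∑ i ∈ Finset.Ico j N, c i + 1) ((S N).setReg x N) := by
      intro m
      induction m with
      | zero =>
        intro j hj
        obtain rfl : j = N := by omega
        rw [Finset.Ico_self, Finset.sum_empty]
        exact .while_false (by simp [hxy.symm, hSy])
      | succ m ih =>
        intro j hj
        have h2 := (hSB j (by omega)).setReg (r := x) (x := j) (by omega)
        have h3 := hsum j (by omega)
        have h4 : c j = B.cost ((S j).setReg x j) + 2 := rfl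
        have h5 := (hB hB' hone.2 (by rw [setReg_reg, if_neg hone.1.symm, hSo]) h2 (by omega)
          (by omega)).1
        have h6 : (S (j + 1)).reg x = j := by
          change (B.ev ((S j).setReg x j)).reg x = j
          rw [ev_reg hx, setReg_reg, if_pos rfl]
        have h7 := RAMExec.add (W := W) (S (j + 1)) x x rOne (by rw [h6, hSo]; omega)
        rw [h6, hSo] at h7
        have h8 := RAMExec.while_true (x := x) (y := y) (by simp [hxy.symm, hSy]; try omega)
          (RAMExec.seq h5 h7) (ih (j + 1) (by omega))
        convert h8 using 1
        rw [← Finset.add_sum_Ioo_eq_sum_Ico (by omega), h4]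
        have : Finset.Ioo j N = Finset.Ico (j + 1) N := by ext; simp
        rw [this]; omega
    refine ⟨?_, ((hSB N le_rfl).mono (by omega)).setReg (by omega)⟩
    have := RAMExec.seq (RAMExec.const (W := W) s x 0 (by omega)) (key N 0 (by omega))
    convert this using 1
    rw [Finset.range_eq_Ico]; omega

/-- Tests. -/
inductive Test : Type
  | lt (x y : ℕ) : Test
  | le (x y : ℕ) : Test
  | eq (x y : ℕ) : Test

/-- The truth of a test in a state. -/
def Test.holds : Test → RAMState → Prop
  | lt x y, s => s.reg x < s.reg y
  | le x y, s => s.reg x ≤ s.reg y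
  | eq x y, s => s.reg x = s.reg y

@[simp] theorem Test.holds_lt (x y : ℕ) (s : RAMState) :
    (Test.lt x y).holds s ↔ s.reg x < s.reg y := Iff.rfl

@[simp] theorem Test.holds_le (x y : ℕ) (s : RAMState) :
    (Test.le x y).holds s ↔ s.reg x ≤ s.reg y := Iff.rfl

@[simp] theorem Test.holds_eq (x y : ℕ) (s : RAMState) :
    (Test.eq x y).holds s ↔ s.reg x = s.reg y := Iff.rfl

/-- Do `P` if all the tests are passed. -/
def guard : List Test → Code → Code
  | [], P => P
  | .lt x y :: l, P => ite x y (guard l P) skip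
  | .le x y :: l, P => ite y x skip (guard l P)
  | .eq x y :: l, P => ite x y skip (ite y x skip (guard l P))

open Classical in
theorem ev_guard (l : List Test) (P : Code) (s : RAMState) :
    (guard l P).ev s = if ∀ c ∈ l, c.holds s then P.ev s else s := by
  induction l with
  | nil => simp [guard]
  | cons c l ih =>
    refine Eq.trans ?_ (if_congr List.forall_mem_cons.symm rfl rfl)
    rw [ite_and, ← ih]
    cases c with
    | lt x y => simp only [guard, ev, Test.holds_lt]
    | le x y =>
      by_cases h : s.reg y < s.reg x
      · simp only [guard, ev, Test.holds_le, if_pos h, if_neg (not_le.2 h)]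
      · simp only [guard, ev, Test.holds_le, if_neg h, if_pos (not_lt.1 h)]
    | eq x y =>
      by_cases h : s.reg x < s.reg y
      · simp only [guard, ev, Test.holds_eq, if_pos h, if_neg h.ne]
      · by_cases h' : s.reg y < s.reg x
        · simp only [guard, ev, Test.holds_eq, if_neg h, if_pos h', if_neg h'.ne']
        · simp only [guard, ev, Test.holds_eq, if_neg h, if_neg h',
            if_pos (show s.reg x = s.reg y by omega)]

end Code

/-! ## How a layout is determined by the outer face -/

namespace PlanarEmbeddedGraph

variable {n : ℕ} {G : PlanarEmbeddedGraph n}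

namespace RectLayout

variable (L : G.RectLayout)

/-- Around an inner face one turns left exactly at the corners. This is the computation by which the
program goes around a face. -/
theorem dir_faceNext {d : G.graph.Dart} {f : G.Face} (hd : G.leftFace d = f) (hf : f ≠ L.outer) :
    L.dir (G.faceNext d) =
      if L.dir d = 0 then (if L.x d.fst + 1 = L.r f then 1 else 0)
      else if L.dir d = 1 then (if L.y d.fst + 1 = L.t f then 2 else 1)
      else if L.dir d = 2 then (if L.x d.fst - 1 = L.l f then 3 else 2)
      else (if L.y d.fst - 1 = L.b f then 0 else 3) := by
  have h1 := L.inner_edge_dir hd hf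
  have h2 := L.inner_edge_dir ((leftFace_faceNext d).trans hd) hf
  rw [faceNext_fst, L.x_snd, L.y_snd] at h2
  have hl := L.l_lt f
  have hb := L.b_lt f
  rcases h1 with ⟨h1, h3⟩ | ⟨h1, h3⟩ | ⟨h1, h3⟩ | ⟨h1, h3⟩ <;> rw [h1] at h2 ⊢ <;>
    simp only [dirX, dirY] at h2 ⊢ <;> norm_num at h2 ⊢ <;> split_ifs <;> omega

/-- Around the outer face one turns right at the corners, since its walk is clockwise. -/
theorem dir_faceNext_outer {d : G.graph.Dart} (hd : G.leftFace d = L.outer) :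
    L.dir (G.faceNext d) =
      if L.dir d = 0 then (if L.x d.fst + 1 = L.r L.outer then 3 else 0)
      else if L.dir d = 1 then (if L.y d.fst + 1 = L.t L.outer then 0 else 1)
      else if L.dir d = 2 then (if L.x d.fst - 1 = L.l L.outer then 1 else 2)
      else (if L.y d.fst - 1 = L.b L.outer then 2 else 3) := by
  have h1 := L.outer_edge_dir hd
  have h2 := L.outer_edge_dir ((leftFace_faceNext d).trans hd)
  rw [faceNext_fst, L.x_snd, L.y_snd] at h2
  have hl := L.l_lt L.outer
  have hb := L.b_lt L.outer
  rcases h1 with ⟨h1, h3⟩ | ⟨h1, h3⟩ | ⟨h1, h3⟩ | ⟨h1, h3⟩ <;> rw [h1] at h2 ⊢ <;>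
    simp only [dirX, dirY] at h2 ⊢ <;> norm_num at h2 ⊢ <;> split_ifs <;> omega

/-- An edge with the outer face on both sides would be directed clockwise in both directions. -/
theorem leftFace_symm_ne_outer {d : G.graph.Dart} (hd : G.leftFace d = L.outer) :
    G.leftFace d.symm ≠ L.outer := by
  intro hd'
  have h1 := L.outer_edge_dir hd
  have h2 := L.outer_edge_dir hd'
  have h3 := L.dir_symm d
  have hl := L.l_lt L.outer
  have hb := L.b_lt L.outer
  simp only [dart_symm_fst] at h2
  rw [L.x_snd, L.y_snd, h3] at h2
  rcases h1 with ⟨h1, h6⟩ | ⟨h1, h6⟩ | ⟨h1, h6⟩ | ⟨h1, h6⟩ <;> rw [h1] at h2 <;>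
    simp only [dirX, dirY] at h2 <;> norm_num at h2 <;> omega

theorem rot_ne_self (L : G.RectLayout) (d : G.graph.Dart) : G.rot d ≠ d := by
  intro h
  obtain ⟨q, h1, h2, h3, -⟩ := L.exists_wedge d
  rw [h] at h3
  have := L.dir_lt d
  omega

/-- Two consecutive wedges that add up to a half turn modulo 4 have one quadrant each, or three
each. The second case is impossible because the wedges would overlap. So the direction of the dart
in between is forced. -/
theorem dir_rot_of_opposite {d : G.graph.Dart} (h : L.dir (G.rot (G.rot d)) = (L.dir d + 2) % 4) :
    L.dir (G.rot d) = (L.dir d + 1) % 4 := by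
  obtain ⟨q, h1, h2, h3, h4⟩ := L.exists_wedge d
  obtain ⟨q', h1', h2', h3', h4'⟩ := L.exists_wedge (G.rot d)
  have hd := L.dir_lt d
  have hq : q = 1 ∨ q = 3 ∧ q' = 3 := by omega
  rcases hq with rfl | ⟨rfl, rfl⟩
  · exact h3
  · exfalso
    have h5 := h4 0 (by omega)
    have h6 := h4' 1 (by omega)
    rw [h3, G.rot_fst, show ((L.dir d + 3) % 4 + 1) % 4 = (L.dir d + 0) % 4 by omega] at h6
    exact L.rot_ne_self d (L.dart_eq_of_covers h6 h5 (L.x_rot d) (L.y_rot d))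

/-- A wedge of three quadrants leaves a single quadrant for the next one, which therefore ends at
`d` again: the vertex has degree 2. -/
theorem rot_rot_of_reflex {d : G.graph.Dart} (h : L.dir (G.rot d) = (L.dir d + 3) % 4) :
    G.rot (G.rot d) = d := by
  obtain ⟨q, h1, h2, h3, h4⟩ := L.exists_wedge d
  obtain ⟨q', h1', h2', h3', h4'⟩ := L.exists_wedge (G.rot d)
  have hd := L.dir_lt d
  obtain rfl : q = 3 := by omega
  have hq : q' = 1 := by
    by_contra hne
    have h5 := h4 0 (by omega)
    have h6 := h4' 1 (by omega)
    rw [h3, G.rot_fst, show ((L.dir d + 3) % 4 + 1) % 4 = (L.dir d + 0) % 4 by omega] at h6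
    exact L.rot_ne_self d (L.dart_eq_of_covers h6 h5 (L.x_rot d) (L.y_rot d))
  exact L.dart_eq_of_dir (by rw [G.rot_fst, G.rot_fst]) (by omega)

/-- South followed by east is a left turn. The outer walk has only right turns, so this is the lower
left corner of an inner rectangle. -/
theorem corner_left {d : G.graph.Dart} (h : L.dir d = 0) (h' : L.dir (G.faceNext.symm d) = 3) :
    G.leftFace d ≠ L.outer ∧ L.x d.fst = L.l (G.leftFace d) ∧ L.y d.fst = L.b (G.leftFace d) := by
  have h2 : (G.faceNext.symm d).snd = d.fst := faceNext_symm_snd d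
  have h3 := L.x_snd (G.faceNext.symm d)
  have h4 := L.y_snd (G.faceNext.symm d)
  rw [h', h2] at h3 h4
  simp only [dirX, dirY] at h3 h4
  by_cases hf : G.leftFace d = L.outer
  · have h5 := L.outer_edge_dir hf
    have h6 := L.outer_edge_dir ((leftFace_faceNext_symm d).trans hf)
    have hb := L.b_lt L.outer
    norm_num at h3 h4
    omega
  · have h5 := L.inner_edge_dir rfl hf
    have h6 := L.inner_edge_dir (leftFace_faceNext_symm d) hf
    norm_num at h3 h4
    exact ⟨hf, by omega, by omega⟩

theorem corner_right {d : G.graph.Dart} (h : L.dir d = 1) (h' : L.dir (G.faceNext.symm d) = 0) :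
    G.leftFace d ≠ L.outer ∧ L.x d.fst = L.r (G.leftFace d) := by
  have h2 : (G.faceNext.symm d).snd = d.fst := faceNext_symm_snd d
  have h3 := L.x_snd (G.faceNext.symm d)
  have h4 := L.y_snd (G.faceNext.symm d)
  rw [h', h2] at h3 h4
  simp only [dirX, dirY] at h3 h4
  by_cases hf : G.leftFace d = L.outer
  · have h5 := L.outer_edge_dir hf
    have h6 := L.outer_edge_dir ((leftFace_faceNext_symm d).trans hf)
    have hb := L.l_lt L.outer
    norm_num at h3 h4
    omega
  · have h5 := L.inner_edge_dir rfl hf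
    norm_num at h3 h4
    exact ⟨hf, by omega⟩

/-- Darts that are found by following the edges of known faces. -/
structure IsClosed (K B : G.graph.Dart → Prop) (FA FB : G.Face → Prop) : Prop where
  outer : ∀ d, G.leftFace d = L.outer → K d
  symm : ∀ d, K d → K d.symm
  between : ∀ d, K d → K (G.rot (G.rot d)) → L.dir (G.rot (G.rot d)) = (L.dir d + 2) % 4 →
    K (G.rot d)
  left : ∀ d, K d → L.dir d = 0 → K (G.faceNext.symm d) → L.dir (G.faceNext.symm d) = 3 →
    FA (G.leftFace d)
  right : ∀ d, K d → L.dir d = 1 → K (G.faceNext.symm d) → L.dir (G.faceNext.symm d) = 0 →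
    FB (G.leftFace d)
  start : ∀ f, FA f → FB f → ∃ d, G.leftFace d = f ∧ B d
  next : ∀ d, B d → B (G.faceNext d)
  known : ∀ d, B d → K d

/-- Consider an unfinished inner face `f` with lowest bottom side. All darts of the outer face and
of faces that begin lower are known. They suffice to recognize both lower corners of `f`; then the
walk around `f` starts, and it reaches all its darts, so `f` is finished after all. -/
theorem IsClosed.finished {K B : G.graph.Dart → Prop} {FA FB : G.Face → Prop}
    (h : L.IsClosed K B FA FB) {f : G.Face} (hf : f ≠ L.outer) :
    FA f ∧ FB f ∧ ∀ d, G.leftFace d = f → B d := by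
  by_contra hcon
  obtain ⟨f, ⟨hf, hbad⟩, hmin⟩ := Set.exists_min_image
    {f : G.Face | f ≠ L.outer ∧ ¬ (FA f ∧ FB f ∧ ∀ d, G.leftFace d = f → B d)} L.b
    (Set.toFinite _) ⟨f, hf, hcon⟩
  refine hbad ?_
  have hlow : ∀ d, G.leftFace d = L.outer ∨ L.b (G.leftFace d) < L.b f → K d := by
    intro d hd
    by_cases ho : G.leftFace d = L.outer
    · exact h.outer d ho
    by_contra hK
    have := hmin (G.leftFace d) ⟨ho, fun hall => hK (h.known _ (hall.2.2 d rfl))⟩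
    have := hd.resolve_left ho
    omega
  -- A dart going west has its left face below it; this face is the outer one or begins below the
  -- line.
  have hlow' : ∀ d, L.dir d = 2 → L.y d.fst = L.b f → K d := by
    intro d hd hy
    refine hlow d ?_
    by_cases ho : G.leftFace d = L.outer
    · exact Or.inl ho
    have h1 := L.inner_edge_dir rfl ho
    have h2 := L.b_lt (G.leftFace d)
    right; omega
  have heast : ∀ d, L.dir d = 0 → L.y d.fst = L.b f → K d := by
    intro d hd hy
    have h2 : L.dir d.symm = _ := L.dir_symm d
    have := h.symm _ (hlow' d.symm (by omega) (by
      rw [dart_symm_fst, L.y_snd, hd, hy]; simp [dirY]))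
    rwa [SimpleGraph.Dart.symm_symm] at this
  have hlf := L.l_lt f
  have hbf := L.b_lt f
  have hA : FA f := by
    obtain ⟨d, hdf, hx, hy, hx', hy'⟩ := L.exists_inner_edge hf (u := L.l f) (v := L.b f)
      (u' := L.l f + 1) (v' := L.b f) (by unfold RectEdge; omega)
    have hd0 : L.dir d = 0 := by
      have := L.inner_edge_dir hdf hf
      have h3 := L.x_snd d
      have h4 := L.dir_lt d
      generalize L.dir d = j at *
      interval_cases j <;> simp [dirX] at h3 ⊢ <;> omega
    have hp : L.dir (G.faceNext.symm d) = 3 := by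
      have h1 := L.inner_edge_dir ((leftFace_faceNext_symm d).trans hdf) hf
      have h3 := L.x_snd (G.faceNext.symm d)
      have h4 := L.y_snd (G.faceNext.symm d)
      have h5 := L.dir_lt (G.faceNext.symm d)
      rw [faceNext_symm_snd] at h3 h4
      generalize L.dir (G.faceNext.symm d) = j at *
      interval_cases j <;> simp [dirX, dirY] at h1 h3 h4 ⊢ <;> omega
    have hr : L.dir (G.rot d) = 1 := by
      rw [faceNext_symm_apply] at hp
      have h2 : L.dir (G.rot d).symm = _ := L.dir_symm _
      have h3 := L.dir_lt (G.rot d)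
      omega
    -- The dart going north from the lower left corner of `f`. Either it has a dart going west as
    -- next one and lies between two known opposite darts, or its wedge contains the cell to the
    -- south-west, so that its left face is the outer one or begins lower.
    have hKr : K (G.rot d) := by
      obtain ⟨q, h1, h2, h3, h4⟩ := L.exists_wedge (G.rot d)
      by_cases hq : q = 1
      · subst hq
        refine h.between d (heast d hd0 hy) (hlow' _ (by omega) ?_) (by omega)
        rw [G.rot_fst, G.rot_fst, hy]
      · have h5 := h4 1 (by omega)
        refine hlow _ ?_
        rcases h5 with ⟨h5, h6⟩ | ⟨h5, -⟩
        · unfold CellIn at h6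
          rw [hr, G.rot_fst] at h6
          simp [quadX, quadY] at h6
          omega
        · exact Or.inl h5
    rw [← hdf]
    refine h.left d (heast d hd0 hy) hd0 ?_ hp
    rw [faceNext_symm_apply]
    exact h.symm _ hKr
  have hB : FB f := by
    obtain ⟨d, hdf, hx, hy, hx', hy'⟩ := L.exists_inner_edge hf (u := L.r f) (v := L.b f)
      (u' := L.r f) (v' := L.b f + 1) (by unfold RectEdge; omega)
    have hd1 : L.dir d = 1 := by
      have := L.inner_edge_dir hdf hf
      have h3 := L.y_snd d
      have h4 := L.dir_lt d
      generalize L.dir d = j at *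
      interval_cases j <;> simp [dirY] at h3 ⊢ <;> omega
    have hp : L.dir (G.faceNext.symm d) = 0 := by
      have h1 := L.inner_edge_dir ((leftFace_faceNext_symm d).trans hdf) hf
      have h3 := L.x_snd (G.faceNext.symm d)
      have h4 := L.y_snd (G.faceNext.symm d)
      have h5 := L.dir_lt (G.faceNext.symm d)
      rw [faceNext_symm_snd] at h3 h4
      generalize L.dir (G.faceNext.symm d) = j at *
      interval_cases j <;> simp [dirX, dirY] at h1 h3 h4 ⊢ <;> omega
    have hr : L.dir (G.rot d) = 2 := by
      rw [faceNext_symm_apply] at hp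
      have h2 : L.dir (G.rot d).symm = _ := L.dir_symm _
      have h3 := L.dir_lt (G.rot d)
      omega
    have hKp : K (G.faceNext.symm d) := by
      rw [faceNext_symm_apply]
      exact h.symm _ (hlow' _ hr (by rw [G.rot_fst, hy]))
    rw [← hdf]
    refine h.right d ?_ hd1 hKp hp
    -- `u` is the dart before the one going north from the lower right corner. Either `u` goes east
    -- and the rule for opposite darts applies, or its wedge contains the cell to the south-east, so
    -- that its left face is known, including the reversal of `rot u`.
    obtain ⟨u, rfl⟩ := G.rot.surjective d
    rw [G.rot_fst] at hx hy
    obtain ⟨q, h1, h2, h3, h4⟩ := L.exists_wedge u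
    have hu := L.dir_lt u
    have hsymm : L.dir u.symm = _ := L.dir_symm u
    by_cases hq : q = 1
    · subst hq
      have hu0 : L.dir u = 0 := by omega
      refine h.between u (heast u hu0 hy) (hlow' _ hr ?_) (by omega)
      rw [G.rot_fst, G.rot_fst, hy]
    · have h5 : L.Covers (G.leftFace u) (L.x u.fst + quadX 3) (L.y u.fst + quadY 3) := by
        have h5 := h4 (q - 2) (by omega)
        rwa [show (L.dir u + (q - 2)) % 4 = 3 by omega] at h5
      have h7 : K (G.rot u).symm := by
        refine hlow _ ?_
        rw [leftFace_symm_rot]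
        rcases h5 with ⟨h5, h6⟩ | ⟨h5, -⟩
        · unfold CellIn at h6
          simp [quadX, quadY] at h6
          omega
        · exact Or.inl h5
      have := h.symm _ h7
      rwa [SimpleGraph.Dart.symm_symm] at this
  refine ⟨hA, hB, fun d hd => ?_⟩
  obtain ⟨e, he, hBe⟩ := h.start f hA hB
  obtain ⟨i, -, hi⟩ := (leftFace_eq_iff.1 (he.trans hd.symm)).exists_pow_eq' 
  rw [← hi]
  clear hi
  induction i with
  | zero => simpa using hBe
  | succ i ih => rw [pow_succ', Equiv.Perm.mul_apply]; exact h.next _ ih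

theorem IsClosed.all_known {K B : G.graph.Dart → Prop} {FA FB : G.Face → Prop}
    (h : L.IsClosed K B FA FB) (d : G.graph.Dart) : K d := by
  by_cases hd : G.leftFace d = L.outer
  · exact h.outer d hd
  · exact h.known _ ((h.finished L hd).2.2 d rfl)

/-- At most one dart leaves a vertex in each of the four directions. This lets the program reject
graphs with more than `4 * n` darts at once. -/
theorem card_dart_le (L : G.RectLayout) : Fintype.card G.graph.Dart ≤ 4 * n := by
  have h : Function.Injective fun d : G.graph.Dart =>
      (((⟨L.dir d, L.dir_lt d⟩ : Fin 4), d.fst) : Fin 4 × Fin n) := by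
    intro d e hde
    simp only [Prod.mk.injEq, Fin.mk.injEq] at hde
    exact L.dart_eq_of_dir hde.2 hde.1
  simpa using Fintype.card_le_of_injective _ h

/-! ### Corners of the outer face and candidates for them -/

/-- A vertex on a side of the rectangle of a face, but not at a corner. -/
def InSide (g : G.Face) (v : Fin n) : Prop :=
  (L.l g < L.x v ∧ L.x v < L.r g) ∨ (L.b g < L.y v ∧ L.y v < L.t g)

theorem faceNext_symm_eq (d : G.graph.Dart) : G.faceNext d.symm = G.rot.symm d := by
  rw [faceNext_apply, SimpleGraph.Dart.symm_symm]

/-- The vertex is inside a side of the inner face across `d` which lies on the outer boundary. Both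
faces run straight through it, and their wedges leave no room for another edge. -/
theorem rot_rot_of_inSide {d : G.graph.Dart} (hd : G.leftFace d = L.outer)
    (h : L.InSide (G.leftFace d.symm) d.fst) :
    G.rot (G.rot d) = d ∧ L.dir (G.faceNext.symm d) = L.dir d := by
  have hg := L.leftFace_symm_ne_outer hd
  have h1 := L.inner_edge_dir rfl hg
  have h2 := L.dir_faceNext rfl hg
  have h3 := L.outer_edge_dir hd
  have h4 := L.inner_le (G.leftFace d.symm)
  have h5 := L.outer_edge_dir ((leftFace_faceNext_symm d).trans hd)
  have h6 := L.x_snd (G.faceNext.symm d)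
  have h7 := L.y_snd (G.faceNext.symm d)
  have h8 : L.dir d.symm = _ := L.dir_symm d
  have h10 := L.x_snd d
  have h11 := L.y_snd d
  have hl := L.l_lt L.outer
  have hb := L.b_lt L.outer
  rw [faceNext_symm_snd] at h6 h7
  rw [faceNext_symm_eq] at h2
  rw [dart_symm_fst] at h1 h2
  unfold InSide at h
  have key : L.dir (G.rot.symm d) = L.dir d.symm ∧ L.dir (G.faceNext.symm d) = L.dir d := by
    generalize L.dir (G.faceNext.symm d) = p at *
    generalize L.dir (G.rot.symm d) = p' at *
    rw [h8] at h1 h2 ⊢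
    rcases h3 with ⟨h3, h9⟩ | ⟨h3, h9⟩ | ⟨h3, h9⟩ | ⟨h3, h9⟩ <;> rw [h3] at h1 h2 h10 h11 ⊢ <;>
      rcases h5 with ⟨rfl, h5⟩ | ⟨rfl, h5⟩ | ⟨rfl, h5⟩ | ⟨rfl, h5⟩ <;>
      simp only [dirX, dirY] at h6 h7 h10 h11 <;> norm_num at h1 h2 h6 h7 h10 h11 ⊢ <;>
      (try split_ifs at h2) <;> omega
  refine ⟨?_, key.2⟩
  have h12 : L.dir (G.faceNext.symm d).symm = _ := L.dir_symm _
  rw [faceNext_symm_apply, SimpleGraph.Dart.symm_symm, ← faceNext_symm_apply] at h12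
  have : G.rot d = G.rot.symm d := by
    refine L.dart_eq_of_dir (by rw [G.rot_fst, rot_symm_fst]) ?_
    rw [h12, key.1, key.2, h8]
  rw [this, Equiv.apply_symm_apply]

theorem rot_rot_faceNext_of_inSide {d : G.graph.Dart} (hd : G.leftFace d = L.outer)
    (h : L.InSide (G.leftFace d.symm) d.snd) :
    G.rot (G.rot (G.faceNext d)) = G.faceNext d := by
  have hg := L.leftFace_symm_ne_outer hd
  have h1 := L.inner_edge_dir rfl hg
  have h2 := L.inner_edge_dir (leftFace_faceNext_symm d.symm) hg
  have h3 := L.outer_edge_dir hd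
  have h4 := L.inner_le (G.leftFace d.symm)
  have h5 := L.dir_faceNext_outer hd
  have h6 := L.x_snd (G.faceNext.symm d.symm)
  have h7 := L.y_snd (G.faceNext.symm d.symm)
  have h8 : L.dir d.symm = _ := L.dir_symm d
  have h10 := L.x_snd d
  have h11 := L.y_snd d
  have hlg := L.l_lt (G.leftFace d.symm)
  have hbg := L.b_lt (G.leftFace d.symm)
  have hl := L.l_lt L.outer
  have hb := L.b_lt L.outer
  rw [faceNext_symm_snd] at h6 h7
  rw [dart_symm_fst] at h1 h6 h7
  unfold InSide at h
  have key : L.dir (G.faceNext.symm d.symm) = L.dir d.symm ∧ L.dir (G.faceNext d) = L.dir d := by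
    generalize L.dir (G.faceNext.symm d.symm) = p at *
    generalize L.dir (G.faceNext d) = p' at *
    rw [h8] at h1 ⊢
    rcases h3 with ⟨h3, h9⟩ | ⟨h3, h9⟩ | ⟨h3, h9⟩ | ⟨h3, h9⟩ <;> rw [h3] at h1 h5 h10 h11 ⊢ <;>
      rcases h2 with ⟨rfl, h2⟩ | ⟨rfl, h2⟩ | ⟨rfl, h2⟩ | ⟨rfl, h2⟩ <;>
      simp only [dirX, dirY] at h6 h7 h10 h11 <;> norm_num at h1 h5 h6 h7 h10 h11 ⊢ <;>
      (try split_ifs at h5) <;> omega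
  have h12 : L.dir (G.faceNext.symm d.symm).symm = _ := L.dir_symm _
  rw [faceNext_symm_apply, SimpleGraph.Dart.symm_symm, ← faceNext_symm_apply] at h12
  rw [rot_faceNext]
  refine L.dart_eq_of_dir ?_ ?_
  · rw [G.rot_fst, faceNext_fst]; rfl
  · have := L.dir_lt d
    rw [h12, key.1, key.2, h8]
    omega

/-- A dart at a corner of the outer face. -/
def IsCorner (d : G.graph.Dart) : Prop :=
  G.leftFace d = L.outer ∧ L.dir (G.faceNext.symm d) ≠ L.dir d

theorem IsCorner.dir_prev {d : G.graph.Dart} (h : L.IsCorner d) :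
    L.dir (G.faceNext.symm d) = (L.dir d + 1) % 4 := by
  have h1 := L.dir_faceNext_outer ((leftFace_faceNext_symm d).trans h.1)
  have h2 := h.2
  have h3 := L.dir_lt (G.faceNext.symm d)
  rw [Equiv.apply_symm_apply] at h1
  split_ifs at h1 <;> omega

theorem IsCorner.dir_rot {d : G.graph.Dart} (h : L.IsCorner d) :
    L.dir (G.rot d) = (L.dir d + 3) % 4 := by
  have h1 := h.dir_prev
  have h2 := L.dir_symm (G.faceNext.symm d)
  rw [faceNext_symm_apply, SimpleGraph.Dart.symm_symm, ← faceNext_symm_apply] at h2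
  omega

theorem IsCorner.rot_rot {d : G.graph.Dart} (h : L.IsCorner d) : G.rot (G.rot d) = d :=
  L.rot_rot_of_reflex h.dir_rot

theorem IsCorner.position {d : G.graph.Dart} (h : L.IsCorner d) :
    (L.dir d = 0 ∧ L.x d.fst = L.l L.outer ∧ L.y d.fst = L.t L.outer) ∨
    (L.dir d = 1 ∧ L.x d.fst = L.l L.outer ∧ L.y d.fst = L.b L.outer) ∨
    (L.dir d = 2 ∧ L.x d.fst = L.r L.outer ∧ L.y d.fst = L.b L.outer) ∨
    (L.dir d = 3 ∧ L.x d.fst = L.r L.outer ∧ L.y d.fst = L.t L.outer) := by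
  have h1 := h.dir_prev
  have h2 := L.outer_edge_dir h.1
  have h3 := L.outer_edge_dir ((leftFace_faceNext_symm d).trans h.1)
  have h4 := L.x_snd (G.faceNext.symm d)
  have h5 := L.y_snd (G.faceNext.symm d)
  rw [faceNext_symm_snd, h1] at h4 h5
  rw [h1] at h3
  rcases h2 with ⟨h2, h6⟩ | ⟨h2, h6⟩ | ⟨h2, h6⟩ | ⟨h2, h6⟩ <;> rw [h2] at h3 h4 h5 ⊢ <;>
    simp only [dirX, dirY] at h4 h5 <;> norm_num at h3 h4 h5 ⊢ <;> omega

/-- The direction of the dart tells which of the four corners it starts at. -/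
theorem card_corners_le (S : Finset G.graph.Dart) (hS : ∀ d ∈ S, L.IsCorner d) : S.card ≤ 4 := by
  rw [← Finset.card_range 4]
  refine Finset.card_le_card_of_injOn L.dir (fun d _ => by simpa using L.dir_lt d) ?_
  intro d hd e he hde
  have h1 := (hS d hd).position
  have h2 := (hS e he).position
  exact L.injOn ((hS d hd).1.trans (hS e he).1.symm) (by omega) (by omega)

/-- A dart of the outer face that may be at a corner, next to a face of degree at most `6`. -/
def _root_.PlanarEmbeddedGraph.IsSmallCandidate (f0 : G.Face) (d : G.graph.Dart) : Prop :=
  G.leftFace d = f0 ∧ G.rot (G.rot d) = d ∧ G.degree (G.leftFace d.symm) / 2 ≤ 3 ∧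
    (G.degree (G.leftFace d.symm) / 2 < 3 ∨ G.rot (G.rot (G.faceNext d)) = G.faceNext d ∨
      G.rot (G.rot (G.faceNext.symm d)) = G.faceNext.symm d)

/-- If the inner face at the corner has half-perimeter 3, it is a domino with its long side on the
outer boundary, starting at the corner. The middle of that side is a neighbour of the corner and has
degree 2. -/
theorem IsCorner.candidate {d : G.graph.Dart} (h : L.IsCorner d) :
    3 < G.degree (G.leftFace d.symm) / 2 ∨ IsSmallCandidate L.outer d := by
  by_cases h3 : 3 < G.degree (G.leftFace d.symm) / 2
  · exact Or.inl h3
  refine Or.inr ⟨h.1, h.rot_rot, not_lt.1 h3, ?_⟩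
  by_cases h4 : G.degree (G.leftFace d.symm) / 2 < 3
  · exact Or.inl h4
  right
  have h5 := L.degree_eq (G.leftFace d.symm)
  have h6 := L.l_lt (G.leftFace d.symm)
  have h7 := L.b_lt (G.leftFace d.symm)
  have hd : L.dir d.symm = _ := L.dir_symm d
  have hg := L.leftFace_symm_ne_outer h.1
  have h8 := L.inner_edge_dir rfl hg
  have h9 := L.dir_faceNext rfl hg
  have hp : G.leftFace (G.faceNext.symm d) = L.outer := (leftFace_faceNext_symm d).trans h.1
  have hface : G.leftFace (G.faceNext.symm d).symm = G.leftFace d.symm := by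
    rw [faceNext_symm_apply, SimpleGraph.Dart.symm_symm, ← leftFace_symm_rot (G.rot d), h.rot_rot]
  have h10 := L.inner_edge_dir hface hg
  have h11 := L.dir_symm (G.faceNext.symm d)
  have h12 := h.dir_prev
  have h13 := L.x_snd d
  have h14 := L.y_snd d
  have h15 := L.x_snd (G.faceNext.symm d)
  have h16 := L.y_snd (G.faceNext.symm d)
  rw [dart_symm_fst] at h8 h10
  rw [faceNext_symm_snd] at h10 h15 h16
  -- One of the two sides that meet at the corner has length 2; its midpoint is the end of `d` or
  -- the start of the dart before `d`.
  have key : L.InSide (G.leftFace d.symm) d.snd ∨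
      L.InSide (G.leftFace (G.faceNext.symm d).symm) (G.faceNext.symm d).fst := by
    rw [hface]
    unfold InSide
    have hlt := L.dir_lt d
    rw [h12] at h11 h15 h16
    rw [h11] at h10
    rw [hd] at h8
    generalize L.dir d = k at *
    interval_cases k <;> simp only [dirX, dirY] at h13 h14 h15 h16 <;>
      norm_num at h8 h10 h13 h14 h15 h16 <;> omega
  rcases key with key | key
  · exact Or.inl (L.rot_rot_faceNext_of_inSide h.1 key)
  · exact Or.inr (L.rot_rot_of_inSide hp key).1

/-- Converse up to one step. If the walk is straight at the start of `d`, this vertex is in the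
middle of the long side of a domino on the outer boundary. A neighbour of degree 2 is then a corner
of the domino, and the outer face turns there too. -/
theorem isCorner_of_isSmallCandidate {d : G.graph.Dart} (h : IsSmallCandidate L.outer d) :
    L.IsCorner d ∨ L.IsCorner (G.faceNext d) ∨ L.IsCorner (G.faceNext.symm d) := by
  obtain ⟨ho, hrr, h3, hsmall⟩ := h
  by_cases hc : L.dir (G.faceNext.symm d) ≠ L.dir d
  · exact Or.inl ⟨ho, hc⟩
  rw [not_not] at hc
  right
  have hg := L.leftFace_symm_ne_outer ho
  have h5 := L.degree_eq (G.leftFace d.symm)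
  have h6 := L.l_lt (G.leftFace d.symm)
  have h7 := L.b_lt (G.leftFace d.symm)
  have hd : L.dir d.symm = _ := L.dir_symm d
  have hp : G.leftFace (G.faceNext.symm d) = L.outer := (leftFace_faceNext_symm d).trans ho
  have hrd : G.rot d = (G.faceNext.symm d).symm := by
    rw [faceNext_symm_apply, SimpleGraph.Dart.symm_symm]
  have hface : G.leftFace (G.faceNext.symm d).symm = G.leftFace d.symm := by
    rw [← hrd, ← leftFace_symm_rot (G.rot d), hrr]
  have hlt := L.dir_lt d
  have hp' := L.dir_symm (G.faceNext.symm d)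
  have e1 := L.inner_edge_dir rfl hg
  have e2 := L.inner_edge_dir hface hg
  have f1 := L.x_snd d
  have f2 := L.y_snd d
  have f3 := L.x_snd (G.faceNext.symm d)
  have f4 := L.y_snd (G.faceNext.symm d)
  rw [dart_symm_fst] at e1 e2
  rw [faceNext_symm_snd] at e2 f3 f4
  rw [hc] at f3 f4 hp'
  rw [hp'] at e2
  rw [hd] at e1
  -- A side with a vertex in its middle has length at least 2, so the half-perimeter is at least 3.
  have hlen : ¬ G.degree (G.leftFace d.symm) / 2 < 3 := by
    generalize L.dir d = k at *
    interval_cases k <;> simp only [dirX, dirY] at f1 f2 f3 f4 <;>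
      norm_num at e1 e2 f1 f2 f3 f4 <;> omega
  rcases hsmall.resolve_left hlen with hn | hn
  · left
    refine ⟨(leftFace_faceNext d).trans ho, ?_⟩
    rw [Equiv.symm_apply_apply]
    intro heq
    have g1 : G.faceNext.symm d.symm = (G.faceNext d).symm := by
      rw [rot_faceNext] at hn
      rw [faceNext_symm_apply, hn]
    have g2 := L.inner_edge_dir (leftFace_faceNext_symm d.symm) hg
    have g3 := L.dir_symm (G.faceNext d)
    have g4 : (G.faceNext d).symm.fst = (G.faceNext d).snd := rfl
    rw [g1, g3, g4, L.x_snd, L.y_snd, ← heq, faceNext_fst] at g2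
    generalize L.dir d = k at *
    interval_cases k <;> simp only [dirX, dirY] at f1 f2 f3 f4 g2 <;>
      norm_num at e1 e2 f1 f2 f3 f4 g2 <;> omega
  · right
    refine ⟨hp, ?_⟩
    set c := G.faceNext.symm d with hcdef
    intro heq
    have g1 : G.faceNext c.symm = (G.faceNext.symm c).symm := by
      rw [faceNext_symm_apply, SimpleGraph.Dart.symm_symm, faceNext_symm_eq, Equiv.symm_apply_eq, hn]
    have g2 := L.inner_edge_dir ((leftFace_faceNext c.symm).trans hface) hg
    have g3 := L.dir_symm (G.faceNext.symm c)
    have g4 : (G.faceNext.symm c).symm.fst = c.fst := faceNext_symm_snd c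
    rw [g1, g3, g4, heq, hc] at g2
    generalize L.dir d = k at *
    interval_cases k <;> simp only [dirX, dirY] at f1 f2 f3 f4 g2 <;>
      norm_num at e1 e2 f1 f2 f3 f4 g2 <;> omega

/-- Each of at most 4 corners accounts for itself and its two neighbours on the walk. -/
theorem card_smallCandidates_le (S : Finset G.graph.Dart)
    (hS : ∀ d ∈ S, IsSmallCandidate L.outer d) : S.card ≤ 12 := by
  classical
  let C : Finset G.graph.Dart := Finset.univ.filter L.IsCorner
  have hC : C.card ≤ 4 := L.card_corners_le C fun d hd => (Finset.mem_filter.1 hd).2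
  have hsub : S ⊆ C ∪ C.image G.faceNext.symm ∪ C.image G.faceNext := by
    intro d hd
    simp only [Finset.mem_union, Finset.mem_image, C, Finset.mem_filter, Finset.mem_univ, true_and]
    rcases L.isCorner_of_isSmallCandidate (hS d hd) with h | h | h
    · exact Or.inl (Or.inl h)
    · exact Or.inl (Or.inr ⟨_, h, G.faceNext.symm_apply_apply d⟩)
    · exact Or.inr ⟨_, h, G.faceNext.apply_symm_apply d⟩
  have h1 := Finset.card_le_card hsub
  have h2 := Finset.card_union_le (C ∪ C.image G.faceNext.symm) (C.image G.faceNext)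
  have h3 := Finset.card_union_le C (C.image G.faceNext.symm)
  have h4 := Finset.card_image_le (s := C) (f := G.faceNext.symm)
  have h5 := Finset.card_image_le (s := C) (f := G.faceNext)
  omega

end RectLayout

end PlanarEmbeddedGraph

/-! ## The program -/

notation "rN" => (0 : ℕ)
notation "rK" => (1 : ℕ)
notation "rZero" => (3 : ℕ)
notation "rI" => (4 : ℕ)
notation "rRes" => (6 : ℕ)
notation "rQuad" => (7 : ℕ)
notation "rCnt" => (8 : ℕ)
notation "rSum" => (9 : ℕ)
notation "rD" => (10 : ℕ)
notation "rE" => (11 : ℕ)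
notation "rMax" => (12 : ℕ)
notation "rF" => (13 : ℕ)
notation "rNc" => (14 : ℕ)
notation "rNs" => (15 : ℕ)
notation "rA" => (16 : ℕ)
notation "rB" => (17 : ℕ)
notation "rH" => (18 : ℕ)
notation "rW" => (19 : ℕ)
notation "rHead" => (20 : ℕ)
notation "rTail" => (21 : ℕ)
notation "rBad" => (22 : ℕ)
notation "rP" => (23 : ℕ)
notation "rQ" => (24 : ℕ)
notation "rTwo" => (26 : ℕ)
notation "rThree" => (27 : ℕ)
notation "rTwelve" => (28 : ℕ)
notation "uQ" => (29 : ℕ)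
notation "uD" => (30 : ℕ)
notation "uX" => (31 : ℕ)
notation "uY" => (32 : ℕ)
notation "u0" => (33 : ℕ)
notation "u1" => (34 : ℕ)
notation "u2" => (35 : ℕ)
notation "u3" => (36 : ℕ)
notation "u4" => (37 : ℕ)
notation "u5" => (38 : ℕ)
notation "u6" => (39 : ℕ)
notation "u7" => (40 : ℕ)
notation "u8" => (41 : ℕ)
notation "u9" => (42 : ℕ)
notation "v0" => (43 : ℕ)
notation "v1" => (44 : ℕ)
notation "v2" => (45 : ℕ)
notation "v3" => (46 : ℕ)
notation "v4" => (47 : ℕ)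
notation "v5" => (48 : ℕ)

notation "aFst" => (0 : ℕ)
notation "aSym" => (1 : ℕ)
notation "aRot" => (2 : ℕ)
notation "aNxt" => (3 : ℕ)
notation "aFid" => (4 : ℕ)
notation "aHf" => (5 : ℕ)
notation "aHc" => (6 : ℕ)
notation "aMark" => (7 : ℕ)
notation "aCand" => (8 : ℕ)
notation "aK" => (9 : ℕ)
notation "aD" => (10 : ℕ)
notation "aX" => (11 : ℕ)
notation "aY" => (12 : ℕ)
notation "aB" => (13 : ℕ)
notation "aL" => (14 : ℕ)
notation "aR" => (15 : ℕ)
notation "aX0" => (16 : ℕ)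
notation "aX1" => (17 : ℕ)
notation "aY0" => (18 : ℕ)
notation "aH" => (19 : ℕ)
notation "aQ" => (20 : ℕ)

namespace Code

/-- Constants. -/
def constants : Code := const rTwo 2 ;; const rThree 3 ;; const rTwelve 12

/-- `rQuad := 4 * rN` -/
def quadruple : Code :=
  loop rI rN (inc rQuad rQuad ;; inc rQuad rQuad ;; inc rQuad rQuad ;; inc rQuad rQuad)

/-- Count the vertices that are not isolated in `rCnt`, and add twice their number to `rSum`. -/
def markVertices : Code :=
  loop rI rK (load u0 aFst rI ;; load u1 aMark u0 ;;
    guard [.lt u1 rOne]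
      (store aMark u0 rOne ;; inc rCnt rCnt ;; inc rSum rSum ;; inc rSum rSum))

/-- The next dart on the boundary walk of each face. -/
def nextDarts : Code :=
  loop rI rK (load u0 aRot rI ;; load u0 aSym u0 ;; store aNxt u0 rI)

/-- One step of the traversal of the faces: go on along the present face, or look for a dart on a
new face. -/
def traverseStep : Code :=
  guard [.lt rD rK] (load u0 aFid rE ;; ite u0 rOne
    (inc u1 rD ;; store aFid rE u1 ;; load u2 aHf u1 ;; load u3 aHc u1 ;; inc u2 u2 ;;
      store aHf u1 u3 ;; store aHc u1 u2 ;; guard [.eq rE rD] (inc rSum rSum ;; inc rSum rSum) ;;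
      load rE aNxt rE)
    (inc rD rD ;; move rE rD))

/-- Number the faces, find the halves of their degrees, rounded down and up, and add twice their
number to `rSum`. -/
def traverseFaces : Code := loop rI rK (traverseStep ;; traverseStep)

/-- A face of maximum degree. -/
def maxFace : Code :=
  loop rI rK (load u0 aFid rI ;; load u1 aHf u0 ;;
    guard [.lt rMax u1] (move rMax u1 ;; move rF u0))

/-- `rx := 1` if the start vertex of the dart `ry` has degree at most `2`. -/
def testDegree (rx ry : ℕ) : Code :=
  load v0 aRot ry ;; load v0 aRot v0 ;; guard [.eq v0 ry] (move rx rOne)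

/-- The data of the dart `rI` that decide whether it is a candidate. -/
def candidateData : Code :=
  load u0 aFid rI ;; load u1 aRot rI ;; load u1 aRot u1 ;; load u2 aSym rI ;; load u2 aFid u2 ;;
    load u3 aHf u2 ;; load u4 aNxt rI ;; load u5 aRot rI ;; load u5 aSym u5 ;;
    move u6 rZero ;; guard [.lt u3 rThree] (move u6 rOne) ;; testDegree u6 u4 ;; testDegree u6 u5

/-- Add the dart `rI` to the list if it is a candidate. -/
def candidateTest : Code :=
  move u7 rZero ;;
    guard [.eq u0 rF, .eq u1 rI, .le u3 rThree, .eq u6 rOne, .lt rNs rTwelve]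
      (inc rNs rNs ;; move u7 rOne) ;;
    guard [.eq u0 rF, .eq u1 rI, .lt rThree u3, .lt u2 rF] (move u7 rOne) ;;
    guard [.eq u0 rF, .eq u1 rI, .lt rThree u3, .lt rF u2] (move u7 rOne) ;;
    guard [.eq u7 rOne] (store aCand rNc rI ;; inc rNc rNc)

/-- List the candidates for the darts at the corners of the outer face. -/
def candidates : Code := loop rI rK (candidateData ;; candidateTest)

/-- Forget all labels. -/
def clear : Code :=
  loop rI rK (store aK rI rZero ;; store aB rI rZero ;; inc u0 rI ;; store aL u0 rZero ;;
    store aR u0 rZero) ;; move rHead rZero ;; move rTail rZero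

/-- From the start of a dart with direction `uD` to its end. -/
def step : Code :=
  guard [.eq uD rZero] (inc uX uX) ;; guard [.eq uD rOne] (inc uY uY) ;;
    guard [.eq uD rTwo] (sub uX uX rOne) ;; guard [.eq uD rThree] (sub uY uY rOne)

/-- `rx := ry + 1` modulo `4` -/
def incMod (rx ry : ℕ) : Code := inc rx ry ;; guard [.lt rThree rx] (move rx rZero)

/-- Append a dart to the queue. -/
def push (r : ℕ) : Code := store aQ rTail r ;; inc rTail rTail

/-- Label the dart `uQ` with its direction and the position of its start vertex. -/
def label : Code :=
  store aD uQ uD ;; store aX uQ uX ;; store aY uQ uY ;; store aK uQ rOne ;; push uQ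

/-- The direction of the dart `rE` of the outer face from that of its predecessor. -/
def turnOuter : Code :=
  guard [.eq rE rA] (move uD rOne) ;;
    guard [.eq rE rB] (move uD rZero ;; move rH uY ;; sub rW rMax uY) ;;
    guard [.eq uD rZero, .eq uX rW] (move uD rThree) ;;
    guard [.eq uD rThree, .eq uY rZero] (move uD rTwo) ;;
    load u1 aK rE ;; move uQ rE

/-- Label the darts of the outer face, with corners at `rA` and `rB`. -/
def labelOuter : Code :=
  (move rE rA ;; move uD rOne ;; move uX rZero ;; move uY rZero) ;;
    loop rI rK (turnOuter ;; guard [.lt u1 rOne] label ;; step ;; load rE aNxt rE)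

/-- The label of the reversal of a labelled dart. -/
def symmData : Code :=
  (load uQ aSym rE ;; load u1 aK rE ;; load u2 aK uQ ;; load uD aD rE ;; load uX aX rE ;;
    load uY aY rE) ;; step ;; incMod uD uD ;; incMod uD uD

/-- Label the reversal of a labelled dart. -/
def labelSymm : Code := symmData ;; guard [.eq u1 rOne, .lt u2 rOne] label

/-- The label of a dart between two opposite darts. -/
def betweenData : Code :=
  load uQ aRot rE ;; load u0 aRot uQ ;; load u1 aK rE ;; load u2 aK u0 ;; load u3 aK uQ ;;
    load uD aD rE ;; load u4 aD u0 ;; load uX aX rE ;; load uY aY rE ;; incMod uD uD ;;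
    incMod u5 uD

/-- Label the dart between two labelled opposite darts. -/
def labelBetween : Code :=
  betweenData ;; guard [.eq u1 rOne, .eq u2 rOne, .lt u3 rOne, .eq u4 u5] label

/-- The directions of two consecutive darts of a face. -/
def cornerData : Code :=
  load u0 aRot rE ;; load u0 aSym u0 ;; load u1 aK rE ;; load u2 aD rE ;; load u3 aK u0 ;;
    load u4 aD u0 ;; load u5 aFid rE ;; load uX aX rE ;; load uY aY rE

/-- Store the position of `rE` if it is at a lower corner of a face. -/
def storeCorners : Code :=
    guard [.eq u1 rOne, .eq u2 rZero, .eq u3 rOne, .eq u4 rThree]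
      (store aL u5 rOne ;; store aX0 u5 uX ;; store aY0 u5 uY) ;;
    guard [.eq u1 rOne, .eq u2 rOne, .eq u3 rOne, .eq u4 rZero]
      (store aR u5 rOne ;; store aX1 u5 uX)

/-- Is the start of `rE` the lower left or the lower right corner of a face? -/
def findCorners : Code := cornerData ;; storeCorners

/-- What is known about the face of `rE`. -/
def beginData : Code :=
  load u1 aK rE ;; load u5 aFid rE ;; load u0 aL u5 ;; load u2 aR u5 ;; load u3 aB rE ;;
    load u6 aX1 u5 ;; load u7 aX0 u5 ;; sub u6 u6 u7 ;; load u7 aHf u5 ;; sub u6 u7 u6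

/-- If both lower corners of a face are known, begin to go around it. -/
def beginFace : Code :=
  beginData ;; guard [.eq u1 rOne, .eq u0 rOne, .eq u2 rOne, .lt u3 rOne]
    (store aH u5 u6 ;; store aB rE rOne ;; push rE)

/-- The direction of the next dart on the rectangle. -/
def turn : Code :=
  load u3 aX0 u5 ;; load u4 aX1 u5 ;; load u6 aY0 u5 ;; load u7 aH u5 ;; sub u8 uY u6 ;;
    move u9 uD ;; guard [.eq uD rZero, .eq uX u4] (move u9 rOne) ;;
    guard [.eq uD rOne, .eq u8 u7] (move u9 rTwo) ;;
    guard [.eq uD rTwo, .eq uX u3] (move u9 rThree) ;;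
    guard [.eq uD rThree, .eq uY u6] (move u9 rZero) ;; move uD u9

/-- The label of the next dart. -/
def nextData : Code :=
  (load uQ aNxt rE ;; load u1 aB rE ;; load u2 aB uQ ;; load uD aD rE ;; load uX aX rE ;;
    load uY aY rE ;; load u5 aFid rE) ;; step ;; turn

/-- Go on around a face. -/
def labelNext : Code :=
  nextData ;; guard [.eq u1 rOne, .lt u2 rOne] (store aB uQ rOne ;; label)

/-- All rules at the dart `rE`. -/
def rules : Code := labelSymm ;; labelBetween ;; (findCorners ;; beginFace) ;; labelNext

/-- Take a dart from the queue and apply all rules in which it takes part. -/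
def popQueue : Code :=
  guard [.lt rHead rTail] (load rD aQ rHead ;; inc rHead rHead ;; move rE rD ;; rules ;;
    load rE aNxt rD ;; rules ;;
    load rE aSym rD ;; load rE aNxt rE ;; load rE aSym rE ;; load rE aNxt rE ;; rules)

/-- Label all darts. -/
def labelAll : Code := loop rI rK (popQueue ;; popQueue)

/-- The rectangle of the outer face. -/
def outerRectangle : Code :=
  store aX0 rF rZero ;; store aX1 rF rW ;; store aY0 rF rZero ;; store aH rF rH

/-- Is the dart `rI` on the boundary of the rectangle of its face? -/
def checkEdge : Code :=
  load u0 aSym rI ;; load u5 aFid rI ;; move uQ rI ;; move u1 u0 ;;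
    guard [.eq u5 rF] (move uQ u0 ;; move u1 rI) ;;
    load uX aX uQ ;; load uY aY uQ ;; load u2 aX u1 ;; load u3 aY u1 ;; load u4 aX0 u5 ;;
    load u6 aX1 u5 ;; load u7 aY0 u5 ;; load u8 aH u5 ;; move u9 rZero ;; sub v0 uY u7 ;;
    sub v1 u3 u7 ;; inc v2 uX ;; inc v3 uY ;; inc v4 u2 ;; inc v5 u3 ;;
    guard [.eq uY u7, .eq u3 u7, .eq u2 v2, .le u4 uX, .le u2 u6] (move u9 rOne) ;;
    guard [.eq uX u6, .eq u2 u6, .eq u3 v3, .le u7 uY, .le v1 u8] (move u9 rOne) ;;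
    guard [.eq uY u3, .eq v0 u8, .le u7 uY, .eq uX v4, .le u4 u2, .le uX u6] (move u9 rOne) ;;
    guard [.eq uX u4, .eq u2 u4, .eq uY v5, .le u7 u3, .le v0 u8] (move u9 rOne) ;;
    guard [.lt u9 rOne] (move rBad rOne)

/-- Does the rectangle of the face have the right size, and does the next dart in cyclic order
start at the same position? -/
def checkFace : Code :=
  load u5 aFid rI ;; load u0 aRot rI ;; load uX aX rI ;; load uY aY rI ;; load u2 aX u0 ;;
    load u3 aY u0 ;; load u4 aX0 u5 ;; load u6 aX1 u5 ;; load u8 aH u5 ;; load u7 aHf u5 ;;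
    load u1 aHc u5 ;; sub v0 u6 u4 ;; sub v1 u7 v0 ;; move u9 rZero ;;
    guard [.eq uX u2, .eq uY u3, .eq u7 u1, .lt u4 u6, .lt rZero u8, .eq u8 v1] (move u9 rOne) ;;
    guard [.lt u9 rOne] (move rBad rOne)

/-- Check all labels. -/
def checkAll : Code :=
  move rBad rZero ;; loop rI rK (checkEdge ;; checkFace) ;;
    guard [.lt rBad rOne] (move rRes rOne)

/-- Look for a layout in which the darts `rA` and `rB` are at two corners. -/
def tryCorners : Code :=
  clear ;; labelOuter ;; labelAll ;; outerRectangle ;; checkAll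

/-- Try all pairs of candidates. -/
def tryAll : Code :=
  loop rP rNc (loop rQ rNc (load rA aCand rP ;; load rB aCand rQ ;; tryCorners))

/-- The search for a layout of a connected graph. -/
def search : Code := maxFace ;; candidates ;; tryAll

/-- The part of the program for graphs without isolated vertices. -/
def numberFaces : Code :=
  traverseFaces ;; inc u0 rK ;; inc u0 u0 ;; inc u0 u0 ;; inc u0 u0 ;; inc u0 u0 ;;
    ite rSum u0 search skip

/-- The part of the program for graphs with at most `4 * rN` darts. -/
def readGraph : Code := markVertices ;; nextDarts ;; ite rCnt rN skip numberFaces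

/-- The program, without the initialization of `rOne`. -/
def decide : Code :=
  constants ;; quadruple ;; ite rQuad rK skip readGraph ;; move rN rRes

-- This and the next two are syntactic properties of one fixed program and are settled by
-- evaluation.
set_option maxRecDepth 20000 in
theorem decide_wellFormed : decide.wellFormed = true := by rfl

set_option maxRecDepth 20000 in
theorem decide_writes_one : decide.writes rOne = false := by rfl

set_option maxRecDepth 20000 in
theorem decide_maxConst : decide.maxConst = 12 := by rfl

/-! ### Running time -/

/-- The maximal number of nested loops. -/
def depth : Code → ℕ
  | seq P Q => max P.depth Q.depth
  | ite _ _ P Q => max P.depth Q.depth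
  | loop _ _ B => B.depth + 1
  | _ => 0

/-- The length of the program. -/
def size : Code → ℕ
  | seq P Q => P.size + Q.size
  | ite _ _ P Q => P.size + Q.size + 1
  | loop _ _ B => B.size + 2
  | _ => 1

/-- The registers that bound loops. -/
def boundRegs : Code → List ℕ
  | seq P Q => P.boundRegs ++ Q.boundRegs
  | ite _ _ P Q => P.boundRegs ++ Q.boundRegs
  | loop _ y B => y :: B.boundRegs
  | _ => []

theorem mem_boundRegs {P : Code} {y : ℕ} (h : P.bounds y = true) : y ∈ P.boundRegs := by
  induction P with
  | seq P Q hP hQ =>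
    simp only [bounds, Bool.or_eq_true] at h
    exact List.mem_append.2 (h.imp hP hQ)
  | ite _ _ P Q hP hQ =>
    simp only [bounds, Bool.or_eq_true] at h
    exact List.mem_append.2 (h.imp hP hQ)
  | loop _ z B hB =>
    simp only [bounds, Bool.or_eq_true, beq_iff_eq] at h
    exact List.mem_cons.2 (h.imp Eq.symm hB)
  | _ => simp [bounds] at h

/-- Each level of nesting multiplies the time by at most `m + 1`; the size of the program absorbs
the overhead of the loops. -/
theorem costBound_le {P : Code} {f : ℕ → ℕ} {m : ℕ} (hf : ∀ y ∈ P.boundRegs, f y ≤ m) :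
    P.costBound f ≤ P.size * (m + 1) ^ P.depth := by
  have hpow : ∀ i, 1 ≤ (m + 1) ^ i := fun i => Nat.one_le_pow _ _ (by omega)
  induction P with
  | seq P Q hP hQ =>
    simp only [boundRegs, List.mem_append] at hf
    rw [costBound, size, depth, add_mul]
    exact add_le_add
      ((hP fun y hy => hf y (Or.inl hy)).trans
        (Nat.mul_le_mul_left _ (Nat.pow_le_pow_right (by omega) (le_max_left _ _))))
      ((hQ fun y hy => hf y (Or.inr hy)).trans
        (Nat.mul_le_mul_left _ (Nat.pow_le_pow_right (by omega) (le_max_right _ _))))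
  | ite x y P Q hP hQ =>
    simp only [boundRegs, List.mem_append] at hf
    have h1 := (hP fun y hy => hf y (Or.inl hy)).trans (Nat.mul_le_mul_left _
      (Nat.pow_le_pow_right (n := m + 1) (by omega) (le_max_left P.depth Q.depth)))
    have h2 := (hQ fun y hy => hf y (Or.inr hy)).trans (Nat.mul_le_mul_left _
      (Nat.pow_le_pow_right (n := m + 1) (by omega) (le_max_right P.depth Q.depth)))
    have h3 := hpow (max P.depth Q.depth)
    rw [costBound, size, depth, add_mul, add_mul]
    omega
  | loop x y B hB =>
    simp only [boundRegs, List.forall_mem_cons] at hf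
    rw [costBound, size, depth, pow_succ]
    have h1 := hB hf.2
    have h2 := Nat.mul_le_mul_right (B.costBound f + 2) hf.1
    have h3 := hpow B.depth
    nlinarith [Nat.mul_le_mul_left m h1, Nat.mul_le_mul_left m h3]
  | _ => simp [costBound, size, hpow]

theorem cost_le_size {P : Code} {R : List ℕ} {m : ℕ} {s : RAMState}
    (hP : (P.boundRegs.all fun y => R.contains y && !P.writes y) = true)
    (hs : ∀ y ∈ R, s.reg y ≤ m) : P.cost s ≤ P.size * (m + 1) ^ P.depth := by
  simp only [List.all_eq_true, Bool.and_eq_true, List.contains_iff_mem, Bool.not_eq_true'] at hP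
  exact (cost_le (f := s.reg) fun y hy => ⟨le_rfl, (hP y (mem_boundRegs hy)).2⟩).trans
    (costBound_le fun y hy => hs y (hP y hy).1)

end Code

/-! ## Reading the graph -/

namespace Code

/-- Does the program leave the registers in `R` and the arrays in `A` unchanged? -/
def keeps (P : Code) (R A : List ℕ) : Bool := R.all (!P.writes ·) && A.all (!P.writesArr ·)

theorem keeps_reg {P : Code} {R A : List ℕ} (h : P.keeps R A = true) (s : RAMState) :
    ∀ r ∈ R, (P.ev s).reg r = s.reg r := by
  intro r hr
  simp only [keeps, Bool.and_eq_true, List.all_eq_true, Bool.not_eq_true'] at h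
  exact ev_reg (h.1 r hr) s

theorem keeps_arr {P : Code} {R A : List ℕ} (h : P.keeps R A = true) (s : RAMState) :
    ∀ a ∈ A, (P.ev s).arr a = s.arr a := by
  intro a ha
  simp only [keeps, Bool.and_eq_true, List.all_eq_true, Bool.not_eq_true'] at h
  exact ev_arr (h.2 a ha) s

/-- Induction on the number of iterations of a loop; the loop counter may be changed freely. -/
theorem loop_induction {x y : ℕ} {B : Code} {s : RAMState} (I : ℕ → RAMState → Prop)
    (hx : ∀ j s' v, I j s' → I j (s'.setReg x v)) (h0 : I 0 s)
    (h : ∀ j < s.reg y, ∀ s', s'.reg x = j → I j s' → I (j + 1) (B.ev s')) :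
    I (s.reg y) ((loop x y B).ev s) := by
  rw [ev]
  refine hx _ _ _ (iter_induction I h0 fun j hj s' hs' => h j hj _ ?_ (hx _ _ _ hs'))
  rw [setReg_reg, if_pos rfl]

end Code

namespace PlanarEmbeddedGraph

open Code

variable {n k : ℕ} {G : PlanarEmbeddedGraph n} (e : Fin k ≃ G.graph.Dart)

/-- The number of a dart. -/
def idx (d : G.graph.Dart) : ℕ := e.symm d

theorem idx_lt (d : G.graph.Dart) : idx e d < k := (e.symm d).isLt

theorem idx_inj {d d' : G.graph.Dart} : idx e d = idx e d' ↔ d = d' := by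
  unfold idx
  rw [← Fin.ext_iff, e.symm.injective.eq_iff]

theorem exists_idx {i : ℕ} (h : i < k) : ∃ d, idx e d = i := ⟨e ⟨i, h⟩, by simp [idx]⟩

/-- The registers with constants. -/
def constRegs : List ℕ := [rN, rK, rOne, rZero, rTwo, rThree, rTwelve]

/-- The arrays that describe the graph. -/
def inputArrs : List ℕ := [aFst, aSym, aRot]

/-- The input and the constants are in their places. -/
structure InputEnv (s : RAMState) : Prop where
  n : s.reg rN = n
  k : s.reg rK = k
  one : s.reg rOne = 1
  zero : s.reg rZero = 0
  two : s.reg rTwo = 2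
  three : s.reg rThree = 3
  twelve : s.reg rTwelve = 12
  fst : ∀ d : G.graph.Dart, s.arr aFst (idx e d) = d.fst
  sym : ∀ d : G.graph.Dart, s.arr aSym (idx e d) = idx e d.symm
  rot : ∀ d : G.graph.Dart, s.arr aRot (idx e d) = idx e (G.rot d)

variable {e}

theorem InputEnv.congr {s s' : RAMState} (h : InputEnv e s)
    (hr : ∀ r ∈ constRegs, s'.reg r = s.reg r) (ha : ∀ a ∈ inputArrs, s'.arr a = s.arr a) :
    InputEnv e s' := by
  simp only [constRegs, inputArrs, List.forall_mem_cons, List.not_mem_nil, false_imp_iff,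
    implies_true, and_true] at hr ha
  obtain ⟨h0, h1, h2, h3, h4, h5, h6⟩ := hr
  obtain ⟨ha0, ha1, ha2⟩ := ha
  exact ⟨h0.trans h.n, h1.trans h.k, h2.trans h.one, h3.trans h.zero, h4.trans h.two,
    h5.trans h.three, h6.trans h.twelve, fun d => by rw [ha0, h.fst], fun d => by rw [ha1, h.sym],
    fun d => by rw [ha2, h.rot]⟩

/-- The hypothesis is a Boolean computation on a concrete program, so its proof is always `rfl`. The
later environments have the same kind of frame lemma. -/
theorem InputEnv.ev {s : RAMState} (h : InputEnv e s) {P : Code}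
    (hP : P.keeps constRegs inputArrs = true) : InputEnv e (P.ev s) :=
  h.congr (keeps_reg hP s) (keeps_arr hP s)

theorem InputEnv.setReg {s : RAMState} (h : InputEnv e s) {r v : ℕ} (hr : r ∉ constRegs) :
    InputEnv e (s.setReg r v) :=
  h.congr (fun q hq => by rw [setReg_reg, if_neg]; rintro rfl; exact hr hq) fun _ _ => rfl

theorem constants_spec : InputEnv e (constants.ev ((G.input e).setReg rOne 1)) := by
  have hlt := idx_lt e
  constructor <;>
    simp [constants, Code.ev, PlanarEmbeddedGraph.input, hlt] <;> simp [idx]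

theorem quadruple_spec {s : RAMState} (h : InputEnv e s) (h0 : s.reg rQuad = 0) :
    (quadruple.ev s).reg rQuad = 4 * n := by
  have := loop_induction (x := rI) (y := rN) (B := inc rQuad rQuad ;; inc rQuad rQuad ;;
    inc rQuad rQuad ;; inc rQuad rQuad) (s := s) (fun j s' => s'.reg rQuad = 4 * j)
    (fun j s' v hs' => by simpa using hs') (by simpa using h0) (fun j _ s' _ hs' => by
      simp [Code.ev, hs']; omega)
  rw [h.n] at this
  exact this

/-- The vertices at which one of the first `j` darts starts. -/
noncomputable def startVertices (e : Fin k ≃ G.graph.Dart) (j : ℕ) : Finset (Fin n) :=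
  (Finset.univ.filter fun d => idx e d < j).image fun d => d.fst

theorem startVertices_succ (d : G.graph.Dart) :
    startVertices e (idx e d + 1) = insert d.fst (startVertices e (idx e d)) := by
  unfold startVertices
  ext v
  simp only [Finset.mem_image, Finset.mem_filter, Finset.mem_univ, true_and, Finset.mem_insert]
  constructor
  · rintro ⟨d', h, rfl⟩
    by_cases hd : d' = d
    · exact Or.inl (hd ▸ rfl)
    · rw [← idx_inj e] at hd
      exact Or.inr ⟨d', by omega, rfl⟩
  · rintro (rfl | ⟨d', h, rfl⟩)
    · exact ⟨d, by omega, rfl⟩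
    · exact ⟨d', by omega, rfl⟩

/-- `aMark` serves as the characteristic function of the vertices seen so far. The double count in
`rSum` begins the computation for Euler's formula. -/
theorem markVertices_spec {s : RAMState} (h : InputEnv e s) (h0 : s.reg rCnt = 0)
    (h1 : s.reg rSum = 0) (h2 : ∀ v, s.arr aMark v = 0) :
    (markVertices.ev s).reg rCnt = (startVertices e k).card ∧
      (markVertices.ev s).reg rSum = 2 * (startVertices e k).card := by
  have := loop_induction (x := rI) (y := rK) (s := s) (B := load u0 aFst rI ;; load u1 aMark u0 ;;
    guard [.lt u1 rOne]
      (store aMark u0 rOne ;; inc rCnt rCnt ;; inc rSum rSum ;; inc rSum rSum))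
    (fun j s' => InputEnv e s' ∧ (∀ v : Fin n, s'.arr aMark v = if v ∈ startVertices e j then 1 else 0) ∧
      s'.reg rCnt = (startVertices e j).card ∧ s'.reg rSum = 2 * (startVertices e j).card)
    (fun j s' v hs' => ⟨hs'.1.setReg (by simp [constRegs]), by simpa using hs'.2⟩)
    ⟨h, by simp [startVertices, h2], by simp [startVertices, h0], by simp [startVertices, h1]⟩ ?_
  · rw [h.k] at this
    exact this.2.2
  · rintro j hj s' hI ⟨hE, hm, hc, hs⟩
    rw [h.k] at hj
    obtain ⟨d, rfl⟩ := exists_idx e hj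
    refine ⟨hE.ev rfl, ?_⟩
    have hval := hm d.fst
    rw [startVertices_succ]
    by_cases hd : d.fst ∈ startVertices e (idx e d)
    · rw [if_pos hd] at hval
      rw [Finset.insert_eq_of_mem hd]
      simpa [Code.ev, ev_guard, hI, hE.fst, hE.one, hval] using ⟨hm, hc, hs⟩
    · rw [if_neg hd] at hval
      rw [Finset.card_insert_of_notMem hd]
      simp only [Code.ev, ev_guard]
      simp [hI, hE.fst, hE.one, hval, hc, hs]
      refine ⟨fun v => ?_, by omega⟩
      by_cases hv : v = d.fst
      · simp [hv]
      · have : (v : ℕ) ≠ d.fst := fun h => hv (Fin.ext h)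
        simp [hv, this, hm]

/-- The program fills the array from the side of the successor: the predecessor of `d` on its facial
walk is the reversal of `rot d`. -/
theorem nextDarts_spec {s : RAMState} (h : InputEnv e s) (d : G.graph.Dart) :
    (nextDarts.ev s).arr aNxt (idx e d) = idx e (G.faceNext d) := by
  have := loop_induction (x := rI) (y := rK) (s := s)
    (B := load u0 aRot rI ;; load u0 aSym u0 ;; store aNxt u0 rI)
    (fun j s' => InputEnv e s' ∧ ∀ d, idx e d < j → s'.arr aNxt (idx e (G.rot d).symm) = idx e d)
    (fun j s' v hs' => ⟨hs'.1.setReg (by simp [constRegs]), by simpa using hs'.2⟩)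
    ⟨h, fun d hd => by omega⟩ ?_
  · rw [h.k] at this
    have := this.2 (G.faceNext d) (idx_lt e _)
    rwa [rot_faceNext, SimpleGraph.Dart.symm_symm] at this
  · rintro j hj s' hI ⟨hE, hm⟩
    rw [h.k] at hj
    obtain ⟨c, rfl⟩ := exists_idx e hj
    refine ⟨hE.ev rfl, fun d hd => ?_⟩
    simp only [Code.ev]
    simp only [setArr_arr_apply, setReg_reg, setReg_arr, hI, hE.rot]
    by_cases hdc : d = c
    · simp [hdc, hE.sym]
    · have h1 : idx e (G.rot d).symm ≠ idx e (G.rot c).symm := by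
        rw [Ne, idx_inj, SimpleGraph.Dart.symm_involutive.injective.eq_iff,
          G.rot.injective.eq_iff]
        exact hdc
      have h2 : idx e d ≠ idx e c := by rwa [Ne, idx_inj]
      simp [h1, hE.sym]
      exact hm d (by omega)

end PlanarEmbeddedGraph

/-! ## The faces of the graph -/

namespace PlanarEmbeddedGraph

open Code

variable {n k : ℕ} {G : PlanarEmbeddedGraph n} {e : Fin k ≃ G.graph.Dart}

/-- The number of darts `d` with `F d = i`. -/
noncomputable def classSize (F : G.graph.Dart → ℕ) (i : ℕ) : ℕ :=
  (Finset.univ.filter fun d => F d = i).card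

/-- The number of darts `d` with `F d ≠ 0`. -/
noncomputable def assigned (F : G.graph.Dart → ℕ) : ℕ := (Finset.univ.filter fun d => F d ≠ 0).card

/-- The number of darts `d` with `F d = idx e d + 1`. -/
noncomputable def repCount (e : Fin k ≃ G.graph.Dart) (F : G.graph.Dart → ℕ) : ℕ :=
  (Finset.univ.filter fun d => F d = idx e d + 1).card

theorem card_filter_succ {α : Type*} [Fintype α] {p q : α → Prop} [DecidablePred p]
    [DecidablePred q] (c : α) (hc : ¬ p c) (h : ∀ d, q d ↔ p d ∨ d = c) :
    (Finset.univ.filter q).card = (Finset.univ.filter p).card + 1 := by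
  classical
  rw [← Finset.card_insert_of_notMem (a := c) (s := Finset.univ.filter p) (by simpa using hc)]
  congr 1
  ext d
  simp [h, or_comm]

section
variable {F F' : G.graph.Dart → ℕ} {c : G.graph.Dart} {v : ℕ}

theorem assigned_succ (hF : ∀ d, F' d = if d = c then v else F d) (hc : F c = 0) (hv : v ≠ 0) :
    assigned F' = assigned F + 1 := by
  refine card_filter_succ c (by simpa using hc) fun d => ?_
  rw [hF]
  by_cases hd : d = c <;> simp [hd, hv]

theorem classSize_succ (hF : ∀ d, F' d = if d = c then v else F d) (hc : F c = 0) (hv : v ≠ 0) :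
    classSize F' v = classSize F v + 1 := by
  refine card_filter_succ c (by omega) fun d => ?_
  rw [hF]
  by_cases hd : d = c <;> simp [hd]

theorem classSize_of_ne (hF : ∀ d, F' d = if d = c then v else F d) (hc : F c = 0) {i : ℕ}
    (hi : i ≠ 0) (hiv : i ≠ v) : classSize F' i = classSize F i := by
  unfold classSize
  congr 1
  ext d
  rw [Finset.mem_filter, Finset.mem_filter, hF]
  by_cases hd : d = c <;> simp [hd, hc, hi.symm, hiv.symm]

theorem repCount_succ (hF : ∀ d, F' d = if d = c then v else F d) (hc : F c = 0) :
    repCount e F' = repCount e F + if v = idx e c + 1 then 1 else 0 := by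
  split_ifs with hv
  · refine card_filter_succ c (by omega) fun d => ?_
    rw [hF]
    by_cases hd : d = c <;> simp [hd, hv]
  · unfold repCount
    rw [add_zero]
    congr 1
    ext d
    rw [Finset.mem_filter, Finset.mem_filter, hF]
    by_cases hd : d = c <;> simp [hd, hc, hv]

theorem assigned_le (e : Fin k ≃ G.graph.Dart) : assigned F ≤ k := by
  refine (Finset.card_le_univ _).trans ?_
  rw [Fintype.card_congr e.symm, Fintype.card_fin]

end

/-- The state during the traversal of the faces, after at least `j` steps. -/
structure Traversed (e : Fin k ≃ G.graph.Dart) (c0 j : ℕ) (s : RAMState) : Prop where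
  env : InputEnv e s
  nxt : ∀ d, s.arr aNxt (idx e d) = idx e (G.faceNext d)
  le : s.reg rD ≤ k
  current : s.reg rD < k → ∃ c d, idx e c = s.reg rE ∧ idx e d = s.reg rD ∧
    G.leftFace c = G.leftFace d ∧ (s.arr aFid (idx e d) = 0 → c = d) ∧
    (s.arr aFid (idx e d) ≠ 0 → s.arr aFid (idx e c) = 0 → s.arr aFid (idx e d) = s.reg rD + 1)
  done : ∀ d, idx e d < s.reg rD → s.arr aFid (idx e d) ≠ 0
  rep : ∀ d, s.arr aFid (idx e d) ≠ 0 → ∃ c, s.arr aFid (idx e d) = idx e c + 1 ∧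
    G.leftFace c = G.leftFace d ∧ s.arr aFid (idx e c) = s.arr aFid (idx e d)
  closed : ∀ d, s.arr aFid (idx e d) ≠ 0 →
    s.arr aFid (idx e (G.faceNext d)) = s.arr aFid (idx e d) ∨
    (idx e (G.faceNext d) = s.reg rE ∧ s.arr aFid (idx e (G.faceNext d)) = 0 ∧
      s.arr aFid (idx e d) = s.reg rD + 1)
  half : ∀ i ≠ 0, s.arr aHf i + s.arr aHc i =
      classSize (fun d => s.arr aFid (idx e d)) i ∧
    s.arr aHf i ≤ s.arr aHc i ∧ s.arr aHc i ≤ s.arr aHf i + 1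
  sum : s.reg rSum =
    c0 + 2 * repCount e (fun d => s.arr aFid (idx e d))
  progress : s.reg rD = k ∨
    j ≤ s.reg rD + assigned (fun d => s.arr aFid (idx e d))

theorem pow_of_leftFace_eq {c d : G.graph.Dart} (h : G.leftFace c = G.leftFace d) :
    ∃ i : ℕ, (G.faceNext ^ i) c = d := by
  obtain ⟨i, -, hi⟩ := (leftFace_eq_iff.1 h).exists_pow_eq'
  exact ⟨i, hi⟩

/-- The walk has come back to a numbered dart, so the face is complete and the search moves to the
next dart in the input order. -/
theorem Traversed.advance {c0 j : ℕ} {s : RAMState} (h : Traversed e c0 j s) (hlt : s.reg rD < k)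
    (h0 : s.arr aFid (s.reg rE) ≠ 0) : Traversed e c0 (j + 1) (traverseStep.ev s) := by
  have hev : traverseStep.ev s =
      ((s.setReg u0 (s.arr aFid (s.reg rE))).setReg rD (s.reg rD + 1)).setReg rE (s.reg rD + 1) := by
    rw [traverseStep, ev_guard, if_pos (by simpa [h.env.k] using hlt)]
    have : ¬ s.arr aFid (s.reg rE) < 1 := by omega
    simp [Code.ev, h.env.one, this]
  -- The only exception in `closed` is an unnumbered dart in `rE`.
  have hcl : ∀ d, s.arr aFid (idx e d) ≠ 0 →
      s.arr aFid (idx e (G.faceNext d)) = s.arr aFid (idx e d) := by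
    intro d hd
    rcases h.closed d hd with h1 | ⟨h1, h2, -⟩
    · exact h1
    · rw [h1] at h2; exact absurd h2 h0
  have henv := h.env.ev (P := traverseStep) rfl
  rw [hev] at henv ⊢
  refine ⟨henv, h.nxt, ?_, ?_, ?_, h.rep, fun d hd => Or.inl (hcl d hd), h.half, ?_, ?_⟩
  · simpa using hlt
  · intro hlt'
    obtain ⟨d, hd⟩ := exists_idx e (i := s.reg rD + 1) (by simpa using hlt')
    exact ⟨d, d, by simpa using hd, by simpa using hd, rfl, fun _ => rfl,
      fun h1 h2 => absurd h2 h1⟩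
  · intro d hd
    obtain ⟨c, d', hc, hd', -, h1, -⟩ := h.current hlt
    by_cases hdd : d = d'
    · subst hdd
      intro h2
      rw [← hc, h1 h2] at h0
      exact h0 h2
    · refine h.done d ?_
      rw [← idx_inj e] at hdd
      simp only [setReg_reg] at hd
      norm_num at hd
      omega
  · simpa using h.sum
  · have := h.progress
    simp only [setReg_reg, setReg_arr]
    norm_num
    omega

/-- The dart in `rE` gets the number of its face, one more than the index of the first dart found on
it. Replacing the pair of halves `(h, c)` by `(c, h + 1)` increases the sum by one and keeps it
balanced, which divides the degree by two without a division. -/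
theorem Traversed.assign {c0 j : ℕ} {s : RAMState} (h : Traversed e c0 j s) (hlt : s.reg rD < k)
    (h0 : s.arr aFid (s.reg rE) = 0) : Traversed e c0 (j + 1) (traverseStep.ev s) := by
  obtain ⟨c, d, hc, hd, hcd, h1, h2⟩ := h.current hlt
  have henv := h.env.ev (P := traverseStep) rfl
  have hnxt : (traverseStep.ev s).arr aNxt = s.arr aNxt := ev_arr rfl s
  have hac : ∀ a, (idx e a = s.reg rE) = (a = c) := fun a => by rw [← hc, idx_inj]
  have hDE : (s.reg rE = s.reg rD) = (c = d) := by rw [← hc, ← hd, idx_inj]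
  have hev : (traverseStep.ev s).reg rD = s.reg rD ∧
      (traverseStep.ev s).reg rE = s.arr aNxt (s.reg rE) ∧
      (traverseStep.ev s).reg rSum = s.reg rSum + (if c = d then 2 else 0) ∧
      (∀ a, (traverseStep.ev s).arr aFid (idx e a) =
        if a = c then s.reg rD + 1 else s.arr aFid (idx e a)) ∧
      (∀ i, (traverseStep.ev s).arr aHf i =
        if i = s.reg rD + 1 then s.arr aHc i else s.arr aHf i) ∧
      (∀ i, (traverseStep.ev s).arr aHc i =
        if i = s.reg rD + 1 then s.arr aHf i + 1 else s.arr aHc i) := by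
    rw [traverseStep, ev_guard, if_pos (by simpa [h.env.k] using hlt)]
    by_cases hcd' : c = d
    · simp [Code.ev, ev_guard, h.env.one, h0, hDE, hcd', hac]
      constructor <;> intro i <;> split_ifs with hi <;> simp [hi]
    · simp [Code.ev, ev_guard, h.env.one, h0, hDE, hcd', hac]
      constructor <;> intro i <;> split_ifs with hi <;> simp [hi]
  obtain ⟨hD, hE, hS, hF, hhf, hhc⟩ := hev
  rw [← hc] at h0
  generalize traverseStep.ev s = s' at *
  have hFd : s.arr aFid (idx e d) = 0 ∨ s.arr aFid (idx e d) = s.reg rD + 1 := by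
    by_cases h3 : s.arr aFid (idx e d) = 0
    · exact Or.inl h3
    · exact Or.inr (h2 h3 h0)
  have hF'd : s'.arr aFid (idx e d) = s.reg rD + 1 := by
    rw [hF]
    split_ifs with hdc
    · rfl
    · exact hFd.resolve_left fun h3 => hdc (h1 h3).symm
  refine ⟨henv, fun a => by rw [hnxt, h.nxt], hD ▸ h.le, fun _ => ?_, fun a ha => ?_, fun a ha => ?_,
    fun a ha => ?_, fun i hi => ?_, ?_, ?_⟩
  · refine ⟨G.faceNext c, d, by rw [hE, ← hc, h.nxt], by rw [hD, hd],
      (leftFace_faceNext c).trans hcd, fun h3 => ?_, fun _ _ => by rw [hD, hF'd]⟩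
    rw [hF'd] at h3
    exact absurd h3 (by omega)
  · rw [hF]
    split_ifs
    · omega
    · exact h.done a (hD ▸ ha)
  · rw [hF] at ha ⊢
    split_ifs at ha ⊢ with hac
    · subst hac
      exact ⟨d, by rw [hd], hcd.symm, hF'd⟩
    · obtain ⟨b, hb1, hb2, hb3⟩ := h.rep a ha
      refine ⟨b, hb1, hb2, ?_⟩
      rw [hF, if_neg, hb3]
      rintro rfl
      omega
  · rw [hF] at ha
    rw [hF a, hE, hD, ← hc, h.nxt]
    split_ifs at ha ⊢ with hac
    · subst hac
      by_cases h3 : s'.arr aFid (idx e (G.faceNext a)) = 0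
      · exact Or.inr ⟨rfl, h3, rfl⟩
      -- If the next dart had another number, that number would persist along the whole face up to
      -- `a`, which had none before this step.
      left
      by_contra hne
      have hne' : G.faceNext a ≠ a := by
        intro h4
        rw [h4, hF, if_pos rfl] at hne
        exact hne rfl
      rw [hF, if_neg hne'] at hne h3
      obtain ⟨i, hi⟩ := pow_of_leftFace_eq (leftFace_faceNext a)
      have : ∀ i : ℕ, s.arr aFid (idx e ((G.faceNext ^ i) (G.faceNext a))) =
          s.arr aFid (idx e (G.faceNext a)) := by
        intro i
        induction i with
        | zero => rfl
        | succ i ih =>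
          rw [pow_succ', Equiv.Perm.mul_apply]
          rcases h.closed ((G.faceNext ^ i) (G.faceNext a)) (by rwa [ih]) with h5 | ⟨-, -, h5⟩
          · rw [h5, ih]
          · exact absurd (ih.symm.trans h5) hne
      have h6 := this i
      rw [hi, h0] at h6
      exact h3 h6.symm
    · left
      rw [hF]
      rcases h.closed a ha with h5 | ⟨h5, h6, h7⟩
      · rw [if_neg, h5]
        rintro h6
        rw [h6, h0] at h5
        exact ha h5.symm
      · rw [if_pos, h7]
        rwa [← hc, idx_inj] at h5
  · have hh := h.half i hi
    rw [hhf, hhc]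
    by_cases hiv : i = s.reg rD + 1
    · subst hiv
      rw [if_pos rfl, if_pos rfl, classSize_succ hF h0 (by omega)]
      omega
    · rw [if_neg hiv, if_neg hiv, classSize_of_ne hF h0 hi hiv]
      exact hh
  · rw [hS, h.sum, repCount_succ hF h0]
    have : (s.reg rD + 1 = idx e c + 1) = (c = d) := by
      rw [← hd, Nat.add_right_cancel_iff, idx_inj]; exact propext eq_comm
    simp only [this]
    split_ifs <;> omega
  · rw [assigned_succ hF h0 (by omega), hD]
    have := h.progress
    omega

theorem Traversed.step {c0 j : ℕ} {s : RAMState} (h : Traversed e c0 j s) :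
    Traversed e c0 (j + 1) (traverseStep.ev s) := by
  by_cases hlt : s.reg rD < k
  · by_cases h0 : s.arr aFid (s.reg rE) = 0
    · exact h.assign hlt h0
    · exact h.advance hlt h0
  · rw [traverseStep, ev_guard, if_neg (by simpa [h.env.k] using hlt)]
    exact { h with progress := Or.inl (by have := h.le; omega) }

/-- The faces are numbered, and the halves of their degrees are known. -/
structure FaceEnv (e : Fin k ≃ G.graph.Dart) (φ : G.Face → ℕ) (s : RAMState) : Prop where
  input : InputEnv e s
  inj : Function.Injective φ
  pos : ∀ f, 1 ≤ φ f
  le : ∀ f, φ f ≤ k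
  nxt : ∀ d, s.arr aNxt (idx e d) = idx e (G.faceNext d)
  fid : ∀ d, s.arr aFid (idx e d) = φ (G.leftFace d)
  half : ∀ f, s.arr aHf (φ f) = G.degree f / 2
  half' : ∀ f, s.arr aHc (φ f) = (G.degree f + 1) / 2

/-- The arrays that are not changed after the numbering of the faces. -/
def faceArrs : List ℕ := [aFst, aSym, aRot, aNxt, aFid, aHf, aHc]

theorem FaceEnv.congr {φ : G.Face → ℕ} {s s' : RAMState} (h : FaceEnv e φ s)
    (hr : ∀ r ∈ constRegs, s'.reg r = s.reg r) (ha : ∀ a ∈ faceArrs, s'.arr a = s.arr a) :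
    FaceEnv e φ s' := by
  have ha' := ha
  simp only [faceArrs, List.forall_mem_cons, List.not_mem_nil, false_imp_iff,
    implies_true, and_true] at ha'
  obtain ⟨h0, h1, h2, h3, h4, h5, h6⟩ := ha'
  exact ⟨h.input.congr hr fun a h' => ha a (by simp [inputArrs] at h'; simp [faceArrs]; tauto),
    h.inj, h.pos, h.le, fun d => by rw [h3, h.nxt], fun d => by rw [h4, h.fid],
    fun f => by rw [h5, h.half], fun f => by rw [h6, h.half']⟩

theorem FaceEnv.ev {φ : G.Face → ℕ} {s : RAMState} (h : FaceEnv e φ s) {P : Code}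
    (hP : P.keeps constRegs faceArrs = true) : FaceEnv e φ (P.ev s) :=
  h.congr (keeps_reg hP s) (keeps_arr hP s)

theorem FaceEnv.setReg {φ : G.Face → ℕ} {s : RAMState} (h : FaceEnv e φ s) {r v : ℕ}
    (hr : r ∉ constRegs) : FaceEnv e φ (s.setReg r v) :=
  h.congr (fun q hq => by rw [setReg_reg, if_neg]; rintro rfl; exact hr hq) fun _ _ => rfl

/-- Every step numbers a dart or advances `rD`, and each can happen at most `k` times; so two steps
in each of `k` rounds are enough. -/
theorem traverseFaces_spec {s : RAMState} (h : InputEnv e s)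
    (hn : ∀ d, s.arr aNxt (idx e d) = idx e (G.faceNext d)) (hD : s.reg rD = 0)
    (hE : s.reg rE = 0) (hF : ∀ i, s.arr aFid i = 0) (h1 : ∀ i, s.arr aHf i = 0)
    (h2 : ∀ i, s.arr aHc i = 0) :
    (traverseFaces.ev s).reg rSum = s.reg rSum + 2 * Nat.card G.Face ∧
      ∃ φ, FaceEnv e φ (traverseFaces.ev s) := by
  have hT := loop_induction (x := rI) (y := rK) (s := s) (B := traverseStep ;; traverseStep)
    (fun j s' => Traversed e (s.reg rSum) (2 * j) s') (fun j s' v hs' =>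
      ⟨hs'.env.setReg (by simp [constRegs]), hs'.nxt, hs'.le, hs'.current, hs'.done, hs'.rep,
        hs'.closed, hs'.half, hs'.sum, hs'.progress⟩)
    ⟨h, hn, by omega, fun hlt => by
      obtain ⟨d, hd⟩ := exists_idx e (i := 0) (by omega)
      exact ⟨d, d, by rw [hd, hE], by rw [hd, hD], rfl, fun _ => rfl, fun h3 => by simp [hF] at h3⟩,
      fun d hd => by omega, fun d hd => by simp [hF] at hd, fun d hd => by simp [hF] at hd,
      fun i hi => by simp [h1, h2, classSize, hF, hi.symm], by simp [repCount, hF], by omega⟩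
    (fun j _ s' _ hs' => hs'.step.step)
  rw [h.k] at hT
  change Traversed e (s.reg rSum) (2 * k) (traverseFaces.ev s) at hT
  generalize traverseFaces.ev s = s' at hT ⊢
  have hk : s'.reg rD = k := by
    have := hT.progress
    have := assigned_le (F := fun d => s'.arr aFid (idx e d)) e
    have := hT.le
    omega
  have hne : ∀ d, s'.arr aFid (idx e d) ≠ 0 := fun d => hT.done d (by rw [hk]; exact idx_lt e d)
  have hnext : ∀ d, s'.arr aFid (idx e (G.faceNext d)) = s'.arr aFid (idx e d) := fun d =>
    (hT.closed d (hne d)).resolve_right fun h3 => hne _ h3.2.1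
  have hface : ∀ c d, G.leftFace c = G.leftFace d → s'.arr aFid (idx e c) = s'.arr aFid (idx e d) := by
    intro c d hcd
    obtain ⟨i, rfl⟩ := pow_of_leftFace_eq hcd
    clear hcd
    induction i with
    | zero => rfl
    | succ i ih => rw [pow_succ', Equiv.Perm.mul_apply, hnext, ih]
  have hface' : ∀ c d, s'.arr aFid (idx e c) = s'.arr aFid (idx e d) → G.leftFace c = G.leftFace d := by
    intro c d hcd
    obtain ⟨a, ha1, ha2, -⟩ := hT.rep c (hne c)
    obtain ⟨b, hb1, hb2, -⟩ := hT.rep d (hne d)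
    have : a = b := (idx_inj e).1 (by omega)
    rw [← ha2, ← hb2, this]
  choose g hg using exists_leftFace (G := G)
  let φ : G.Face → ℕ := fun f => s'.arr aFid (idx e (g f))
  have hφ : ∀ d, s'.arr aFid (idx e d) = φ (G.leftFace d) := fun d => hface _ _ (hg _).symm
  have hclass : ∀ f, classSize (fun d => s'.arr aFid (idx e d)) (φ f) = G.degree f := by
    intro f
    rw [degree_eq_card, classSize, faceDarts]
    congr 1
    ext d
    simp only [Finset.mem_filter, Finset.mem_univ, true_and]
    exact ⟨fun h3 => (hface' _ _ h3).trans (hg f), fun h3 => hface _ _ (h3.trans (hg f).symm)⟩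
  have hhalf : ∀ f, s'.arr aHf (φ f) = G.degree f / 2 ∧ s'.arr aHc (φ f) = (G.degree f + 1) / 2 := by
    intro f
    have := hT.half (φ f) (hne _)
    rw [hclass] at this
    omega
  constructor
  · rw [hT.sum, Nat.card_eq_fintype_card]
    congr 2
    rw [← Finset.card_univ]
    -- Each face has exactly one dart whose index is one less than the number of the face.
    refine Finset.card_bij (fun d _ => G.leftFace d) (fun _ _ => Finset.mem_univ _) ?_ ?_
    · intro c hc d hd hcd
      simp only [Finset.mem_filter, Finset.mem_univ, true_and] at hc hd
      have := hface c d hcd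
      exact (idx_inj e).1 (by omega)
    · intro f _
      obtain ⟨a, ha1, ha2, ha3⟩ := hT.rep (g f) (hne _)
      exact ⟨a, by simp [ha3, ha1], ha2.trans (hg f)⟩
  · refine ⟨φ, hT.env, fun f f' hff => ?_, fun f => Nat.one_le_iff_ne_zero.2 (hne _), fun f => ?_,
      hT.nxt, hφ, fun f => (hhalf f).1, fun f => (hhalf f).2⟩
    · rw [← hg f, ← hg f']
      exact hface' _ _ hff
    · obtain ⟨a, ha1, -⟩ := hT.rep (g f) (hne _)
      have := idx_lt e a
      change s'.arr aFid (idx e (g f)) ≤ k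
      omega

end PlanarEmbeddedGraph

/-! ## The candidates for the corners -/

namespace Code

/-- Moving conditionals from states to values lets `simp` compute the result of a sequence of
guarded assignments without case distinctions. -/
theorem ite_setReg (c : Prop) [Decidable c] (s t : RAMState) (r v : ℕ) :
    (if c then t.setReg r v else s) = (if c then t else s).setReg r (if c then v else s.reg r) := by
  split_ifs
  · rfl
  · simp [RAMState.setReg]

theorem ite_setArr (c : Prop) [Decidable c] (s t : RAMState) (a i v : ℕ) :
    (if c then t.setArr a i v else s) =
      (if c then t else s).setArr a i (if c then v else s.arr a i) := by
  split_ifs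
  · rfl
  · simp [RAMState.setArr]

end Code

namespace PlanarEmbeddedGraph

open Code

variable {n k : ℕ} {G : PlanarEmbeddedGraph n} {e : Fin k ≃ G.graph.Dart} {φ : G.Face → ℕ}

/-- If all halves are 0, no face is ever selected; this case has to be carried along until the check
fails. -/
theorem maxFace_spec {s : RAMState} (h : FaceEnv e φ s) (h0 : s.reg rMax = 0) :
    (∀ f, G.degree f / 2 ≤ (maxFace.ev s).reg rMax) ∧ ((maxFace.ev s).reg rMax = 0 ∨
      ∃ f, φ f = (maxFace.ev s).reg rF ∧ (maxFace.ev s).reg rMax = G.degree f / 2) := by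
  have := loop_induction (x := rI) (y := rK) (s := s) (B := load u0 aFid rI ;; load u1 aHf u0 ;;
    guard [.lt rMax u1] (move rMax u1 ;; move rF u0))
    (fun j s' => FaceEnv e φ s' ∧ (∀ d, idx e d < j → G.degree (G.leftFace d) / 2 ≤ s'.reg rMax) ∧
      (s'.reg rMax = 0 ∨ ∃ f, φ f = s'.reg rF ∧ s'.reg rMax = G.degree f / 2))
    (fun j s' v hs' => ⟨hs'.1.setReg (by simp [constRegs]), by simpa using hs'.2⟩)
    ⟨h, fun d hd => by omega, Or.inl h0⟩ ?_
  · rw [h.input.k] at this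
    refine ⟨fun f => ?_, this.2.2⟩
    obtain ⟨d, rfl⟩ := exists_leftFace f
    exact this.2.1 d (idx_lt e d)
  · rintro j hj s' hI ⟨hE, h1, h2⟩
    rw [h.input.k] at hj
    obtain ⟨d, rfl⟩ := exists_idx e hj
    refine ⟨hE.ev rfl, ?_⟩
    have h3 : ∀ d', idx e d' ≤ idx e d → d' = d ∨ idx e d' < idx e d := by
      intro d' hd'
      rw [← idx_inj e]
      omega
    simp only [Code.ev, ev_guard, ite_setReg, ite_self]
    simp [hI, hE.fid, hE.half]
    by_cases hlt : s'.reg rMax < G.degree (G.leftFace d) / 2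
    · simp only [if_pos hlt]
      refine ⟨fun d' hd' => ?_, Or.inr ⟨_, rfl, rfl⟩⟩
      rcases h3 d' hd' with rfl | h4
      · exact le_rfl
      · exact (h1 d' h4).trans hlt.le
    · simp only [if_neg hlt]
      refine ⟨fun d' hd' => ?_, h2⟩
      rcases h3 d' hd' with rfl | h4
      · exact not_lt.1 hlt
      · exact h1 d' h4

/-- The condition on the neighbours in `IsSmallCandidate`. -/
def SmallCondition (d : G.graph.Dart) : Prop :=
  G.degree (G.leftFace d.symm) / 2 < 3 ∨ G.rot (G.rot (G.faceNext d)) = G.faceNext d ∨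
    G.rot (G.rot (G.faceNext.symm d)) = G.faceNext.symm d

open Classical in
theorem candidateData_spec {s : RAMState} (h : FaceEnv e φ s) {d : G.graph.Dart}
    (hI : s.reg rI = idx e d) :
    (candidateData.ev s).reg u0 = φ (G.leftFace d) ∧
      (candidateData.ev s).reg u1 = idx e (G.rot (G.rot d)) ∧
      (candidateData.ev s).reg u2 = φ (G.leftFace d.symm) ∧
      (candidateData.ev s).reg u3 = G.degree (G.leftFace d.symm) / 2 ∧
      (candidateData.ev s).reg u6 = if SmallCondition d then 1 else 0 := by
  unfold SmallCondition
  rw [faceNext_symm_apply]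
  simp only [candidateData, testDegree, Code.ev, ev_guard, ite_setReg, ite_self]
  simp [hI, h.fid, h.half, h.input.rot, h.input.sym, h.input.one, h.input.zero, h.input.three,
    h.nxt, idx_inj]
  split_ifs <;> first | rfl | (exfalso; tauto)

open Classical in
theorem candidateTest_spec {s : RAMState} (h : FaceEnv e φ s) {small big : Prop}
    (hs : small ↔ s.reg u0 = s.reg rF ∧ s.reg u1 = s.reg rI ∧ s.reg u3 ≤ 3 ∧ s.reg u6 = 1 ∧
      s.reg rNs < 12)
    (hb : big ↔ s.reg u0 = s.reg rF ∧ s.reg u1 = s.reg rI ∧ 3 < s.reg u3 ∧ s.reg u2 ≠ s.reg rF) :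
    (candidateTest.ev s).reg rNs = (if small then s.reg rNs + 1 else s.reg rNs) ∧
    (candidateTest.ev s).reg rNc = (if small ∨ big then s.reg rNc + 1 else s.reg rNc) ∧
    ∀ i, (candidateTest.ev s).arr aCand i =
      if i = s.reg rNc ∧ (small ∨ big) then s.reg rI else s.arr aCand i := by
  simp only [candidateTest, Code.ev, ev_guard, ite_setReg, ite_setArr, ite_self]
  simp [h.input.one, h.input.zero, h.input.three, h.input.twelve]
  refine ⟨if_congr hs.symm rfl rfl, ?_, fun i => ?_⟩
  · refine if_congr ?_ rfl rfl
    rw [hs, hb]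
    omega
  · by_cases hi : i = s.reg rNc
    · subst hi
      simp only [if_true, true_and]
      refine if_congr ?_ rfl rfl
      rw [hs, hb]
      omega
    · simp [hi]

/-- The darts that the program lists when `f0` is the face of maximum degree. -/
def IsCandidate (f0 : G.Face) (d : G.graph.Dart) : Prop :=
  IsSmallCandidate f0 d ∨ (G.leftFace d = f0 ∧ G.rot (G.rot d) = d ∧
    3 < G.degree (G.leftFace d.symm) / 2 ∧ G.leftFace d.symm ≠ f0)

/-- The cap of 12 bounds the list also for graphs without a layout. It loses nothing if `f0` has at
most 12 small candidates, as holds when `f0` is the outer face of a layout. Candidates next to large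
faces other than `f0` are listed without a cap. -/
theorem candidates_spec {s : RAMState} (h : FaceEnv e φ s) (hc : s.reg rNc = 0)
    (hs : s.reg rNs = 0) :
    FaceEnv e φ (candidates.ev s) ∧ (candidates.ev s).reg rNc ≤ k ∧
    ((∀ d, φ (G.leftFace d) = s.reg rF → 3 < G.degree (G.leftFace d.symm) / 2 →
      φ (G.leftFace d.symm) = s.reg rF) → (candidates.ev s).reg rNc ≤ 12) ∧
    ∀ f0, φ f0 = s.reg rF →
      (∀ S : Finset G.graph.Dart, (∀ d ∈ S, IsSmallCandidate f0 d) → S.card ≤ 12) →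
      ∀ d, IsCandidate f0 d → ∃ i < (candidates.ev s).reg rNc,
        (candidates.ev s).arr aCand i = idx e d := by
  classical
  -- The invariant exhibits a set of `rNs` small candidates already seen; it shows that the cap has
  -- not been reached when another one appears.
  have := loop_induction (x := rI) (y := rK) (s := s) (B := candidateData ;; candidateTest)
    (fun j s' => FaceEnv e φ s' ∧ s'.reg rF = s.reg rF ∧ s'.reg rNc ≤ j ∧ s'.reg rNs ≤ 12 ∧
      ((∀ d, φ (G.leftFace d) = s.reg rF → 3 < G.degree (G.leftFace d.symm) / 2 →
        φ (G.leftFace d.symm) = s.reg rF) → s'.reg rNc = s'.reg rNs) ∧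
      ∀ f0, φ f0 = s.reg rF →
        (∃ S : Finset G.graph.Dart, (∀ d ∈ S, IsSmallCandidate f0 d ∧ idx e d < j) ∧
          S.card = s'.reg rNs) ∧
        ((∀ S : Finset G.graph.Dart, (∀ d ∈ S, IsSmallCandidate f0 d) → S.card ≤ 12) →
          ∀ d, IsCandidate f0 d → idx e d < j → ∃ i < s'.reg rNc, s'.arr aCand i = idx e d))
    (fun j s' v hs' => ⟨hs'.1.setReg (by simp [constRegs]), by simpa using hs'.2⟩)
    ⟨h, rfl, by omega, by omega, fun _ => by omega,
      fun f0 _ => ⟨⟨∅, by simp, by simp [hs]⟩, fun _ d _ hd => by omega⟩⟩ ?_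
  · rw [h.input.k] at this
    obtain ⟨h1, -, h2, h3, h4, h5⟩ := this
    refine ⟨h1, h2, fun hb => ?_, fun f0 hf hS d hd => (h5 f0 hf).2 hS d hd (idx_lt e d)⟩
    have := h4 hb
    unfold candidates
    omega
  · rintro j hj s' hI ⟨hE, h1, h2, h3, h4, h5⟩
    rw [h.input.k] at hj
    obtain ⟨d, rfl⟩ := exists_idx e hj
    have hE' : FaceEnv e φ (candidateData.ev s') := hE.ev rfl
    obtain ⟨hu0, hu1, hu2, hu3, hu6⟩ := candidateData_spec hE hI
    have hF : (candidateData.ev s').reg rF = s.reg rF := (ev_reg rfl s').trans h1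
    have hF' : (candidateTest.ev (candidateData.ev s')).reg rF = s.reg rF :=
      (ev_reg rfl _).trans hF
    have hNc : (candidateData.ev s').reg rNc = s'.reg rNc := ev_reg rfl s'
    have hNs : (candidateData.ev s').reg rNs = s'.reg rNs := ev_reg rfl s'
    have hI' : (candidateData.ev s').reg rI = idx e d := (ev_reg rfl s').trans hI
    have hA : (candidateData.ev s').arr aCand = s'.arr aCand := ev_arr rfl s'
    have h6 : (if SmallCondition d then 1 else 0) = 1 ↔ SmallCondition d := by
      split_ifs with hh <;> simp [hh]
    obtain ⟨small, hsmall⟩ : ∃ p, p ↔ φ (G.leftFace d) = s.reg rF ∧ G.rot (G.rot d) = d ∧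
      G.degree (G.leftFace d.symm) / 2 ≤ 3 ∧ SmallCondition d ∧ s'.reg rNs < 12 := ⟨_, Iff.rfl⟩
    obtain ⟨big, hbig⟩ : ∃ p, p ↔ φ (G.leftFace d) = s.reg rF ∧ G.rot (G.rot d) = d ∧
      3 < G.degree (G.leftFace d.symm) / 2 ∧ φ (G.leftFace d.symm) ≠ s.reg rF := ⟨_, Iff.rfl⟩
    obtain ⟨ht1, ht2, ht3⟩ := candidateTest_spec hE' (small := small) (big := big)
      (by simp only [hu0, hu1, hu3, hu6, hF, hNs, hI', idx_inj, h6]; exact hsmall)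
      (by simp only [hu0, hu1, hu2, hu3, hF, hI', idx_inj]; exact hbig)
    rw [hNs] at ht1
    rw [hNc] at ht2
    rw [hNc, hI', hA] at ht3
    have hE'' : FaceEnv e φ (candidateTest.ev (candidateData.ev s')) := hE'.ev rfl
    rw [show (candidateData ;; candidateTest).ev s' = candidateTest.ev (candidateData.ev s') from rfl]
    refine ⟨hE'', hF', ?_, ?_, ?_, fun f0 hf0 => ⟨?_, ?_⟩⟩
    · simp only [ht2]
      split_ifs <;> omega
    · simp only [ht1]
      split_ifs with hh
      · exact (hsmall.1 hh).2.2.2.2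
      · exact h3
    · intro hb
      have h7 : ¬ big := fun hh => by
        rw [hbig] at hh
        exact hh.2.2.2 (hb d hh.1 hh.2.2.1)
      simp only [ht1, ht2, h4 hb, h7, or_false]
    · obtain ⟨S, hS, hcard⟩ := (h5 f0 hf0).1
      simp only [ht1]
      split_ifs with hh
      · replace hh := hsmall.1 hh
        refine ⟨insert d S, fun d' hd' => ?_, ?_⟩
        · rcases Finset.mem_insert.1 hd' with rfl | hd'
          · exact ⟨⟨hE.inj (hh.1.trans hf0.symm), hh.2.1, hh.2.2.1, hh.2.2.2.1⟩, Nat.lt_succ_self _⟩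
          · exact ⟨(hS d' hd').1, (hS d' hd').2.trans (Nat.lt_succ_self _)⟩
        · rw [Finset.card_insert_of_notMem fun hd => (hS d hd).2.false, hcard]
      · exact ⟨S, fun d' hd' => ⟨(hS d' hd').1, (hS d' hd').2.trans (Nat.lt_succ_self _)⟩, hcard⟩
    · intro hmax d' hd' hlt
      have hold : idx e d' < idx e d → ∃ i < (candidateTest.ev (candidateData.ev s')).reg rNc,
          (candidateTest.ev (candidateData.ev s')).arr aCand i = idx e d' := by
        intro hlt'
        obtain ⟨i, hi, hi'⟩ := (h5 f0 hf0).2 hmax d' hd' hlt'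
        refine ⟨i, hi.trans_le ?_, ?_⟩
        · rw [ht2]
          split_ifs <;> omega
        · rw [ht3, if_neg (fun hh => by omega), hi']
      rcases Nat.lt_succ_iff_lt_or_eq.1 hlt with hlt' | heq
      · exact hold hlt'
      · obtain rfl := (idx_inj e).1 heq
        have hor : small ∨ big := by
          rw [hsmall, hbig]
          rcases hd' with hd' | hd'
          · refine Or.inl ⟨by rw [hd'.1, hf0], hd'.2.1, hd'.2.2.1, hd'.2.2.2, ?_⟩
            obtain ⟨S, hS, hcard⟩ := (h5 f0 hf0).1
            -- The new candidate together with those counted before still gives at most 12, so the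
            -- counter is below 12.
            have := hmax (insert d' S) fun d hd => by
              rcases Finset.mem_insert.1 hd with rfl | hd
              · exact hd'
              · exact (hS d hd).1
            rw [Finset.card_insert_of_notMem fun hd => (hS d' hd).2.false, hcard] at this
            exact this
          · exact Or.inr ⟨by rw [hd'.1, hf0], hd'.2.1, hd'.2.2.1,
              fun hh => hd'.2.2.2 (hE.inj (hh.trans hf0.symm))⟩
        refine ⟨s'.reg rNc, ?_, ?_⟩
        · rw [ht2, if_pos hor]
          exact Nat.lt_succ_self _
        · rw [ht3, if_pos ⟨rfl, hor⟩]

end PlanarEmbeddedGraph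

/-! ## The labels of the darts -/

namespace PlanarEmbeddedGraph

open Code

variable {n k : ℕ} {G : PlanarEmbeddedGraph n} {e : Fin k ≃ G.graph.Dart} {φ : G.Face → ℕ}

/-- The dart has a label. -/
def Known (e : Fin k ≃ G.graph.Dart) (s : RAMState) (d : G.graph.Dart) : Prop :=
  s.arr aK (idx e d) = 1

/-- The dart has been reached by going around its face. -/
def Walked (e : Fin k ≃ G.graph.Dart) (s : RAMState) (d : G.graph.Dart) : Prop :=
  s.arr aB (idx e d) = 1

/-- The dart is waiting in the queue. -/
def InQueue (e : Fin k ≃ G.graph.Dart) (s : RAMState) (d : G.graph.Dart) : Prop :=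
  ∃ i, s.reg rHead ≤ i ∧ i < s.reg rTail ∧ s.arr aQ i = idx e d

/-- The label of the dart is right. -/
def HasLabel (L : G.RectLayout) (e : Fin k ≃ G.graph.Dart) (s : RAMState) (d : G.graph.Dart) :
    Prop :=
  s.arr aD (idx e d) = L.dir d ∧ (s.arr aX (idx e d) : ℤ) = L.x d.fst ∧
    (s.arr aY (idx e d) : ℤ) = L.y d.fst

/-- The registers hold the label of the dart. -/
def RegLabel (L : G.RectLayout) (s : RAMState) (d : G.graph.Dart) : Prop :=
  s.reg uD = L.dir d ∧ (s.reg uX : ℤ) = L.x d.fst ∧ (s.reg uY : ℤ) = L.y d.fst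

/-- The rule cannot be applied at the dart. -/
def Saturated (L : G.RectLayout) (e : Fin k ≃ G.graph.Dart) (φ : G.Face → ℕ) (s : RAMState) :
    Fin 4 → G.graph.Dart → Prop
  | 0, d => Known e s d → Known e s d.symm
  | 1, d => Known e s d → Known e s (G.rot (G.rot d)) →
      L.dir (G.rot (G.rot d)) = (L.dir d + 2) % 4 → Known e s (G.rot d)
  | 2, d => (Known e s d → L.dir d = 0 → Known e s (G.faceNext.symm d) →
      L.dir (G.faceNext.symm d) = 3 → s.arr aL (φ (G.leftFace d)) = 1) ∧
      (Known e s d → L.dir d = 1 → Known e s (G.faceNext.symm d) →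
      L.dir (G.faceNext.symm d) = 0 → s.arr aR (φ (G.leftFace d)) = 1)
  | 3, d => Walked e s d → Walked e s (G.faceNext d)

/-- All labels are right, and every rule that can be applied at a dart, except those in `Z`, is
waiting for a dart in the queue. Going around a face has begun, except possibly for faces in `E`, as
soon as its lower corners are known. All darts in `S` have labels. -/
structure LabelInv (L : G.RectLayout) (e : Fin k ≃ G.graph.Dart) (φ : G.Face → ℕ)
    (S : G.graph.Dart → Prop) (Z : Fin 4 → G.graph.Dart → Prop) (E : G.Face → Prop)
    (s : RAMState) : Prop where
  env : FaceEnv e φ s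
  base : ∀ d, S d → Known e s d
  known_le : ∀ d, s.arr aK (idx e d) ≤ 1
  walked_le : ∀ d, s.arr aB (idx e d) ≤ 1
  label : ∀ d, Known e s d → HasLabel L e s d
  left : ∀ f, s.arr aL (φ f) = 1 →
    f ≠ L.outer ∧ (s.arr aX0 (φ f) : ℤ) = L.l f ∧ (s.arr aY0 (φ f) : ℤ) = L.b f
  right : ∀ f, s.arr aR (φ f) = 1 → f ≠ L.outer ∧ (s.arr aX1 (φ f) : ℤ) = L.r f
  walked : ∀ d, Walked e s d → Known e s d ∧ s.arr aL (φ (G.leftFace d)) = 1 ∧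
    s.arr aR (φ (G.leftFace d)) = 1 ∧
    (s.arr aH (φ (G.leftFace d)) : ℤ) = L.t (G.leftFace d) - L.b (G.leftFace d)
  start : ∀ f, E f ∨ (s.arr aL (φ f) = 1 → s.arr aR (φ f) = 1 →
    ∃ d, G.leftFace d = f ∧ Walked e s d)
  head_le : s.reg rHead ≤ s.reg rTail
  tail_le : s.reg rTail ≤ {d | Known e s d}.ncard + {d | Walked e s d}.ncard
  queue : ∀ i < s.reg rTail, ∃ d, s.arr aQ i = idx e d
  pending : ∀ i d, Z i d ∨ Saturated L e φ s i d ∨ InQueue e s d ∨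
    InQueue e s (G.faceNext.symm d) ∨ InQueue e s (G.rot (G.rot d))

/-- The registers on which `LabelInv` depends. -/
def labelRegs : List ℕ := rHead :: rTail :: constRegs

/-- The arrays on which `LabelInv` depends. -/
def labelArrs : List ℕ :=
  aK :: aD :: aX :: aY :: aB :: aL :: aR :: aX0 :: aX1 :: aY0 :: aH :: aQ :: faceArrs

namespace LabelInv

variable {L : G.RectLayout} {S : G.graph.Dart → Prop}
  {Z : Fin 4 → G.graph.Dart → Prop} {E : G.Face → Prop} {s s' : RAMState}

theorem congr (h : LabelInv L e φ S Z E s) (hr : ∀ r ∈ labelRegs, s'.reg r = s.reg r)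
    (ha : ∀ a ∈ labelArrs, s'.arr a = s.arr a) : LabelInv L e φ S Z E s' := by
  simp only [labelRegs, labelArrs, List.forall_mem_cons] at hr ha
  obtain ⟨r1, r2, hr⟩ := hr
  obtain ⟨a1, a2, a3, a4, a5, a6, a7, a8, a9, a10, a11, a12, ha⟩ := ha
  have hK : Known e s' = Known e s := by unfold Known; rw [a1]
  have hB : Walked e s' = Walked e s := by unfold Walked; rw [a5]
  have hQ : InQueue e s' = InQueue e s := by unfold InQueue; rw [r1, r2, a12]
  have hL : HasLabel L e s' = HasLabel L e s := by unfold HasLabel; rw [a2, a3, a4]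
  have hS : Saturated L e φ s' = Saturated L e φ s := by
    funext i d
    match i with
    | 0 => simp only [Saturated, hK]
    | 1 => simp only [Saturated, hK]
    | 2 => simp only [Saturated, hK, a6, a7]
    | 3 => simp only [Saturated, hB]
  refine ⟨h.env.congr hr ha, ?_, ?_, ?_, ?_, ?_, ?_, ?_, ?_, ?_, ?_, ?_, ?_⟩
  · rw [hK]; exact h.base
  · rw [a1]; exact h.known_le
  · rw [a5]; exact h.walked_le
  · rw [hK, hL]; exact h.label
  · rw [a6, a8, a10]; exact h.left
  · rw [a7, a9]; exact h.right
  · rw [hB, hK, a6, a7, a11]; exact h.walked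
  · rw [hB, a6, a7]; exact h.start
  · rw [r1, r2]; exact h.head_le
  · rw [hK, hB, r2]; exact h.tail_le
  · rw [r2, a12]; exact h.queue
  · rw [hS, hQ]; exact h.pending

theorem ev (h : LabelInv L e φ S Z E s) {P : Code} (hP : P.keeps labelRegs labelArrs = true) :
    LabelInv L e φ S Z E (P.ev s) :=
  h.congr (keeps_reg hP s) (keeps_arr hP s)

theorem setReg (h : LabelInv L e φ S Z E s) {r v : ℕ} (hr : r ∉ labelRegs) :
    LabelInv L e φ S Z E (s.setReg r v) :=
  h.congr (fun q hq => by rw [setReg_reg, if_neg]; rintro rfl; exact hr hq) fun _ _ => rfl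

theorem mono (h : LabelInv L e φ S Z E s) {Z' : Fin 4 → G.graph.Dart → Prop} {E' : G.Face → Prop}
    (hZ : ∀ i d, Z i d → Saturated L e φ s i d ∨ Z' i d)
    (hE : ∀ f, E f → E' f ∨ (s.arr aL (φ f) = 1 → s.arr aR (φ f) = 1 →
      ∃ d, G.leftFace d = f ∧ Walked e s d)) : LabelInv L e φ S Z' E' s :=
  { h with
    start := fun f => by
      rcases h.start f with h1 | h1
      · exact hE f h1
      · exact Or.inr h1
    pending := fun i d => by
      rcases h.pending i d with h1 | h1
      · rcases hZ i d h1 with h2 | h2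
        · exact Or.inr (Or.inl h2)
        · exact Or.inl h2
      · exact Or.inr h1 }

theorem mono_base (h : LabelInv L e φ S Z E s) {S' : G.graph.Dart → Prop}
    (hS : ∀ d, S' d → Known e s d) : LabelInv L e φ S' Z E s :=
  { h with base := hS }

/-- Applying a rule at a dart removes it from the exempted rules. -/
theorem resolve (h : LabelInv L e φ S Z E s) {i : Fin 4} {d : G.graph.Dart}
    (hs : Saturated L e φ s i d) :
    LabelInv L e φ S (fun j d' => Z j d' ∧ ¬ (j = i ∧ d' = d)) E s := by
  refine h.mono (fun j d' hz => ?_) fun f hf => Or.inl hf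
  by_cases hh : j = i ∧ d' = d
  · obtain ⟨rfl, rfl⟩ := hh
    exact Or.inl hs
  · exact Or.inr ⟨hz, hh⟩

/-- The effect of storing corners of faces. -/
theorem corner (h : LabelInv L e φ S Z E s) {E' : G.Face → Prop}
    (hr : ∀ r ∈ labelRegs, s'.reg r = s.reg r)
    (ha : ∀ a ∈ aK :: aD :: aX :: aY :: aB :: aH :: aQ :: faceArrs, s'.arr a = s.arr a)
    (hL : ∀ f, s.arr aL (φ f) = 1 → s'.arr aL (φ f) = 1)
    (hR : ∀ f, s.arr aR (φ f) = 1 → s'.arr aR (φ f) = 1)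
    (hleft : ∀ f, s'.arr aL (φ f) = 1 →
      f ≠ L.outer ∧ (s'.arr aX0 (φ f) : ℤ) = L.l f ∧ (s'.arr aY0 (φ f) : ℤ) = L.b f)
    (hright : ∀ f, s'.arr aR (φ f) = 1 → f ≠ L.outer ∧ (s'.arr aX1 (φ f) : ℤ) = L.r f)
    (hE : ∀ f, E f → E' f)
    (hE' : ∀ f, E' f ∨ (s'.arr aL (φ f) = s.arr aL (φ f) ∧ s'.arr aR (φ f) = s.arr aR (φ f))) :
    LabelInv L e φ S Z E' s' := by
  simp only [labelRegs, List.forall_mem_cons] at hr ha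
  obtain ⟨r1, r2, hr⟩ := hr
  obtain ⟨a1, a2, a3, a4, a5, a11, a12, ha⟩ := ha
  have hK : Known e s' = Known e s := by unfold Known; rw [a1]
  have hB : Walked e s' = Walked e s := by unfold Walked; rw [a5]
  have hQ : InQueue e s' = InQueue e s := by unfold InQueue; rw [r1, r2, a12]
  have hLab : HasLabel L e s' = HasLabel L e s := by unfold HasLabel; rw [a2, a3, a4]
  refine ⟨h.env.congr hr ha, ?_, ?_, ?_, ?_, hleft, hright, ?_, ?_, ?_, ?_, ?_, ?_⟩
  · rw [hK]; exact h.base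
  · rw [a1]; exact h.known_le
  · rw [a5]; exact h.walked_le
  · rw [hK, hLab]; exact h.label
  · rw [hB, hK, a11]
    intro d hd
    obtain ⟨h1, h2, h3, h4⟩ := h.walked d hd
    exact ⟨h1, hL _ h2, hR _ h3, h4⟩
  · intro f
    rcases hE' f with h1 | ⟨h1, h2⟩
    · exact Or.inl h1
    · rw [hB, h1, h2]
      exact (h.start f).imp (hE f) id
  · rw [r1, r2]; exact h.head_le
  · rw [hK, hB, r2]; exact h.tail_le
  · rw [r2, a12]; exact h.queue
  · rw [hQ]
    intro i d
    refine (h.pending i d).imp id fun h1 => h1.imp (fun h2 => ?_) id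
    match i with
    | 0 => simpa only [Saturated, hK] using h2
    | 1 => simpa only [Saturated, hK] using h2
    | 2 =>
      simp only [Saturated, hK] at h2 ⊢
      exact ⟨fun x1 x2 x3 x4 => hL _ (h2.1 x1 x2 x3 x4), fun x1 x2 x3 x4 => hR _ (h2.2 x1 x2 x3 x4)⟩
    | 3 => simpa only [Saturated, hB] using h2

/-- Common to all ways of appending a dart to the queue. The flag `b` says whether the dart also
counts as walked. By `hnew` the dart becomes newly known or newly walked, which pays for the place
in the queue. -/
theorem push (h : LabelInv L e φ S Z E s) {q : G.graph.Dart} {b : Prop} [Decidable b]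
    (henv : FaceEnv e φ s')
    (hK : ∀ i, s'.arr aK i = if i = idx e q then 1 else s.arr aK i)
    (hB : ∀ i, s'.arr aB i = if i = idx e q ∧ b then 1 else s.arr aB i)
    (hD : ∀ i, i ≠ idx e q → s'.arr aD i = s.arr aD i)
    (hX : ∀ i, i ≠ idx e q → s'.arr aX i = s.arr aX i)
    (hY : ∀ i, i ≠ idx e q → s'.arr aY i = s.arr aY i)
    (hlab : HasLabel L e s' q)
    (hQ : ∀ i, s'.arr aQ i = if i = s.reg rTail then idx e q else s.arr aQ i)
    (htail : s'.reg rTail = s.reg rTail + 1) (hhead : s'.reg rHead = s.reg rHead)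
    (hL : s'.arr aL = s.arr aL) (hR : s'.arr aR = s.arr aR) (hX0 : s'.arr aX0 = s.arr aX0)
    (hX1 : s'.arr aX1 = s.arr aX1) (hY0 : s'.arr aY0 = s.arr aY0)
    (hH : ∀ f, s.arr aL (φ f) = 1 → s.arr aR (φ f) = 1 →
      (s.arr aH (φ f) : ℤ) = L.t f - L.b f → (s'.arr aH (φ f) : ℤ) = L.t f - L.b f)
    (hb : b → s.arr aL (φ (G.leftFace q)) = 1 ∧ s.arr aR (φ (G.leftFace q)) = 1 ∧
      (s'.arr aH (φ (G.leftFace q)) : ℤ) = L.t (G.leftFace q) - L.b (G.leftFace q))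
    (hnew : ¬ Known e s q ∨ (b ∧ ¬ Walked e s q)) : LabelInv L e φ S Z E s' := by
  have kK : ∀ d, Known e s' d ↔ d = q ∨ Known e s d := by
    intro d
    unfold Known
    simp only [hK, idx_inj]
    split_ifs with hd <;> simp [hd]
  have kB : ∀ d, Walked e s' d ↔ (d = q ∧ b) ∨ Walked e s d := by
    intro d
    unfold Walked
    simp only [hB, idx_inj]
    split_ifs with hd <;> simp [hd]
  have kQ : ∀ d, d = q ∨ InQueue e s d → InQueue e s' d := by
    rintro d (rfl | ⟨i, h1, h2, h3⟩)
    · exact ⟨s.reg rTail, by rw [hhead]; exact h.head_le, by omega, by rw [hQ, if_pos rfl]⟩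
    · exact ⟨i, by omega, by omega, by rw [hQ, if_neg (by omega), h3]⟩
  refine ⟨henv, fun d hd => (kK d).2 (Or.inr (h.base d hd)), ?_, ?_, ?_, ?_, ?_, ?_, ?_, ?_, ?_, ?_, ?_⟩
  · intro d
    rw [hK]
    split_ifs
    · exact le_rfl
    · exact h.known_le d
  · intro d
    rw [hB]
    split_ifs
    · exact le_rfl
    · exact h.walked_le d
  · intro d hd
    by_cases hdq : d = q
    · exact hdq ▸ hlab
    · have h1 : idx e d ≠ idx e q := fun h2 => hdq ((idx_inj e).1 h2)
      unfold HasLabel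
      rw [hD _ h1, hX _ h1, hY _ h1]
      exact h.label d (((kK d).1 hd).resolve_left hdq)
  · rw [hL, hX0, hY0]; exact h.left
  · rw [hR, hX1]; exact h.right
  · intro d hd
    rw [hL, hR, kK]
    rcases (kB d).1 hd with ⟨rfl, h1⟩ | h1
    · exact ⟨Or.inl rfl, hb h1⟩
    · obtain ⟨h2, h3, h4, h5⟩ := h.walked d h1
      exact ⟨Or.inr h2, h3, h4, hH _ h3 h4 h5⟩
  · intro f
    rw [hL, hR]
    refine (h.start f).imp id fun h1 h2 h3 => ?_
    obtain ⟨d, hd, hd'⟩ := h1 h2 h3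
    exact ⟨d, hd, (kB d).2 (Or.inr hd')⟩
  · have := h.head_le
    omega
  · have h1 : {d | Known e s d} ⊆ {d | Known e s' d} := fun d hd => (kK d).2 (Or.inr hd)
    have h2 : {d | Walked e s d} ⊆ {d | Walked e s' d} := fun d hd => (kB d).2 (Or.inr hd)
    have h3 := h.tail_le
    rw [htail]
    rcases hnew with hnew | ⟨hbb, hnew⟩
    · have h4 := Set.ncard_lt_ncard (h1.ssubset_of_mem_notMem ((kK q).2 (Or.inl rfl)) hnew)
      have h5 := Set.ncard_le_ncard h2
      omega
    · have h4 := Set.ncard_lt_ncard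
        (h2.ssubset_of_mem_notMem ((kB q).2 (Or.inl ⟨rfl, hbb⟩)) hnew)
      have h5 := Set.ncard_le_ncard h1
      omega
  · intro i hi
    rw [hQ]
    split_ifs with h1
    · exact ⟨q, rfl⟩
    · exact h.queue i (by omega)
  · intro i d
    rcases h.pending i d with h1 | h1 | h1 | h1 | h1
    · exact Or.inl h1
    · refine Or.inr ?_
      by_cases hd : d = q
      · exact Or.inr (Or.inl (kQ d (Or.inl hd)))
      by_cases hd1 : G.faceNext.symm d = q
      · exact Or.inr (Or.inr (Or.inl (kQ _ (Or.inl hd1))))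
      by_cases hd2 : G.rot (G.rot d) = q
      · exact Or.inr (Or.inr (Or.inr (kQ _ (Or.inl hd2))))
      refine Or.inl ?_
      match i with
      | 0 =>
        simp only [Saturated, kK, hd, false_or] at h1 ⊢
        exact fun h2 => Or.inr (h1 h2)
      | 1 =>
        simp only [Saturated, kK, hd, hd2, false_or] at h1 ⊢
        exact fun h2 h3 h4 => Or.inr (h1 h2 h3 h4)
      | 2 =>
        simp only [Saturated, kK, hd, hd1, false_or, hL, hR] at h1 ⊢
        exact h1
      | 3 =>
        simp only [Saturated, kB, hd, false_and, false_or] at h1 ⊢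
        exact fun h2 => Or.inr (h1 h2)
    · exact Or.inr (Or.inr (Or.inl (kQ _ (Or.inr h1))))
    · exact Or.inr (Or.inr (Or.inr (Or.inl (kQ _ (Or.inr h1)))))
    · exact Or.inr (Or.inr (Or.inr (Or.inr (kQ _ (Or.inr h1)))))

end LabelInv

end PlanarEmbeddedGraph

/-! ## The labelling rules -/

namespace PlanarEmbeddedGraph

open Code

variable {n k : ℕ} {G : PlanarEmbeddedGraph n} {e : Fin k ≃ G.graph.Dart} {φ : G.Face → ℕ}

namespace RectLayout

variable (L : G.RectLayout)

/-- With the lower left corner at the origin, the truncated subtraction of the machine never cuts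
off a coordinate of the layout. -/
theorem x_nonneg (h : L.l L.outer = 0) (v : Fin n) : 0 ≤ L.x v := by
  obtain ⟨d, rfl⟩ := L.exists_dart v
  by_cases hd : G.leftFace d = L.outer
  · have := L.outer_edge_dir hd
    have := L.l_lt L.outer
    omega
  · have := L.inner_edge_dir rfl hd
    have := L.inner_le (G.leftFace d)
    have := L.l_lt (G.leftFace d)
    omega

theorem y_nonneg (h : L.b L.outer = 0) (v : Fin n) : 0 ≤ L.y v := by
  obtain ⟨d, rfl⟩ := L.exists_dart v
  by_cases hd : G.leftFace d = L.outer
  · have := L.outer_edge_dir hd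
    have := L.b_lt L.outer
    omega
  · have := L.inner_edge_dir rfl hd
    have := L.inner_le (G.leftFace d)
    have := L.b_lt (G.leftFace d)
    omega

end RectLayout

theorem step_spec {L : G.RectLayout} (hl : L.l L.outer = 0) (hb : L.b L.outer = 0) {s : RAMState}
    (h : InputEnv e s) {d : G.graph.Dart} (hd : RegLabel L s d) :
    (step.ev s).reg uD = L.dir d ∧ ((step.ev s).reg uX : ℤ) = L.x d.snd ∧
      ((step.ev s).reg uY : ℤ) = L.y d.snd := by
  obtain ⟨h1, h2, h3⟩ := hd
  refine ⟨(ev_reg rfl s).trans h1, ?_⟩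
  have h4 := L.x_nonneg hl d.snd
  have h5 := L.y_nonneg hb d.snd
  have h6 := L.dir_lt d
  rw [L.x_snd, ← h2] at h4 ⊢
  rw [L.y_snd, ← h3] at h5 ⊢
  simp only [step, Code.ev, ev_guard, ite_setReg, ite_self]
  simp [h.one, h.zero, h.two, h.three, h1]
  generalize L.dir d = j at *
  interval_cases j <;> simp [dirX, dirY] at * <;> omega

theorem incMod_spec (x y : ℕ) {s : RAMState} (h : InputEnv e s) (hx : x ∉ constRegs)
    (hy : s.reg y < 4) : ((incMod x y).ev s).reg x = (s.reg y + 1) % 4 := by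
  have hx3 : rThree ≠ x := by rintro rfl; exact hx (by simp [constRegs])
  have hx0 : rZero ≠ x := by rintro rfl; exact hx (by simp [constRegs])
  simp only [incMod, Code.ev, ev_guard, ite_setReg, ite_self]
  simp [h.zero, h.three, hx3, hx0]
  split_ifs <;> omega

open Classical in
theorem storeCorners_spec {t : RAMState} (h : InputEnv e t) {C1 C2 : Prop}
    (j1 : (t.reg u1 = 1 ∧ t.reg u2 = 0 ∧ t.reg u3 = 1 ∧ t.reg u4 = 3) ↔ C1)
    (j2 : (t.reg u1 = 1 ∧ t.reg u2 = 1 ∧ t.reg u3 = 1 ∧ t.reg u4 = 0) ↔ C2) :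
    (∀ i, (storeCorners.ev t).arr aL i = if C1 ∧ i = t.reg u5 then 1 else t.arr aL i) ∧
    (∀ i, (storeCorners.ev t).arr aX0 i = if C1 ∧ i = t.reg u5 then t.reg uX else t.arr aX0 i) ∧
    (∀ i, (storeCorners.ev t).arr aY0 i = if C1 ∧ i = t.reg u5 then t.reg uY else t.arr aY0 i) ∧
    (∀ i, (storeCorners.ev t).arr aR i = if C2 ∧ i = t.reg u5 then 1 else t.arr aR i) ∧
    (∀ i, (storeCorners.ev t).arr aX1 i = if C2 ∧ i = t.reg u5 then t.reg uX else t.arr aX1 i) := by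
  have ho := h.one
  have hz := h.zero
  have ht := h.three
  refine ⟨fun i => ?_, fun i => ?_, fun i => ?_, fun i => ?_, fun i => ?_⟩ <;>
  · by_cases hi : i = t.reg u5
    · subst hi
      by_cases c1 : C1 <;> by_cases c2 : C2 <;>
      simp [storeCorners, Code.ev, ev_guard, ho, hz, ht, j1, j2, c1, c2]
    · simp [storeCorners, Code.ev, ev_guard, ite_setArr, ho, hz, ht, j1, j2, hi]

namespace LabelInv

variable {L : G.RectLayout} {S : G.graph.Dart → Prop}
  {Z : Fin 4 → G.graph.Dart → Prop} {E : G.Face → Prop} {s : RAMState}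

theorem label_spec (h : LabelInv L e φ S Z E s) {q : G.graph.Dart} (hq : s.reg uQ = idx e q)
    (hreg : RegLabel L s q) (hn : ¬ Known e s q) :
    LabelInv L e φ S Z E (Code.label.ev s) ∧
      ∀ d, Known e (Code.label.ev s) d ↔ d = q ∨ Known e s d := by
  have h1 := h.env.input.one
  refine ⟨h.push (q := q) (b := False) (h.env.ev rfl) ?_ ?_ ?_ ?_ ?_ ?_ ?_ ?_ ?_
    (ev_arr rfl s) (ev_arr rfl s) (ev_arr rfl s) (ev_arr rfl s) (ev_arr rfl s) ?_ ?_ (Or.inl hn), ?_⟩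
  case refine_12 =>
    intro d
    unfold Known
    simp [Code.label, Code.push, Code.ev, hq, h1, idx_inj]
    tauto
  all_goals try unfold HasLabel
  all_goals try unfold RegLabel at hreg
  all_goals simp [Code.label, Code.push, Code.ev, hq, h1, hreg]
  all_goals intros
  all_goals simp_all

theorem symmData_spec (hl : L.l L.outer = 0) (hb : L.b L.outer = 0) (h : LabelInv L e φ S Z E s)
    {d : G.graph.Dart} (hd : s.reg rE = idx e d) :
    (symmData.ev s).reg uQ = idx e d.symm ∧ (symmData.ev s).reg u1 = s.arr aK (idx e d) ∧
      (symmData.ev s).reg u2 = s.arr aK (idx e d.symm) ∧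
      (Known e s d → RegLabel L (symmData.ev s) d.symm) := by
  obtain ⟨t, ht⟩ : ∃ t, t = (load uQ aSym rE ;; load u1 aK rE ;; load u2 aK uQ ;; load uD aD rE ;;
    load uX aX rE ;; load uY aY rE).ev s := ⟨_, rfl⟩
  have h1 : t.reg uQ = idx e d.symm ∧ t.reg u1 = s.arr aK (idx e d) ∧
      t.reg u2 = s.arr aK (idx e d.symm) ∧ t.reg uD = s.arr aD (idx e d) ∧
      t.reg uX = s.arr aX (idx e d) ∧ t.reg uY = s.arr aY (idx e d) ∧ InputEnv e t := by
    rw [ht]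
    refine ⟨?_, ?_, ?_, ?_, ?_, ?_, h.env.input.ev rfl⟩ <;> simp [Code.ev, hd, h.env.input.sym]
  have h2 : symmData.ev s = (step ;; incMod uD uD ;; incMod uD uD).ev t := by rw [ht]; rfl
  rw [h2]
  obtain ⟨g1, g2, g3, g4, g5, g6, g7⟩ := h1
  refine ⟨(ev_reg rfl t).trans g1, (ev_reg rfl t).trans g2, (ev_reg rfl t).trans g3, fun hK => ?_⟩
  obtain ⟨l1, l2, l3⟩ := h.label d hK
  obtain ⟨m1, m2, m3⟩ := step_spec hl hb g7 (d := d) ⟨g4.trans l1, by rw [g5, l2], by rw [g6, l3]⟩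
  rw [show (step ;; incMod uD uD ;; incMod uD uD).ev t =
    (incMod uD uD).ev ((incMod uD uD).ev (step.ev t)) from rfl]
  have g8 : InputEnv e (step.ev t) := g7.ev rfl
  have g9 : InputEnv e ((incMod uD uD).ev (step.ev t)) := g8.ev rfl
  have h3 := L.dir_lt d
  have h4 := L.dir_symm d
  have h5 := incMod_spec uD uD g8 (by simp [constRegs]) (by rw [m1]; exact h3)
  have h6 := incMod_spec uD uD g9 (by simp [constRegs]) (by rw [h5]; omega)
  refine ⟨?_, ?_, ?_⟩
  · rw [h6, h5, m1, h4]; omega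
  · rw [ev_reg rfl, ev_reg rfl, m2]; rfl
  · rw [ev_reg rfl, ev_reg rfl, m3]; rfl

theorem labelSymm_spec (hl : L.l L.outer = 0) (hb : L.b L.outer = 0) (h : LabelInv L e φ S Z E s)
    {d : G.graph.Dart} (hd : s.reg rE = idx e d) :
    LabelInv L e φ S (fun j d' => Z j d' ∧ ¬ (j = 0 ∧ d' = d)) E (labelSymm.ev s) := by
  obtain ⟨h1, h2, h3, h4⟩ := h.symmData_spec hl hb hd
  have h5 : LabelInv L e φ S Z E (symmData.ev s) := h.ev rfl
  have h6 : (symmData.ev s).arr aK = s.arr aK := ev_arr rfl s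
  rw [show labelSymm.ev s = (guard [.eq u1 rOne, .lt u2 rOne] Code.label).ev (symmData.ev s) from
    rfl]
  generalize symmData.ev s = t at *
  simp only [ev_guard, List.forall_mem_cons, List.not_mem_nil, false_imp_iff, implies_true,
    and_true, Test.holds_eq, Test.holds_lt, h2, h3, h5.env.input.one]
  split_ifs with hc
  · obtain ⟨h7, h8⟩ := h5.label_spec h1 (h4 hc.1) (by unfold Known; rw [h6]; omega)
    exact h7.resolve fun _ => (h8 _).2 (Or.inl rfl)
  · refine h5.resolve fun hK => ?_
    unfold Known at hK ⊢
    rw [h6] at hK ⊢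
    have := h.known_le d.symm
    omega

/-- By `dir_rot_of_opposite` the middle dart has the direction of the first one plus a quarter turn.
-/
theorem labelBetween_spec (h : LabelInv L e φ S Z E s) {d : G.graph.Dart} (hd : s.reg rE = idx e d) :
    LabelInv L e φ S (fun j d' => Z j d' ∧ ¬ (j = 1 ∧ d' = d)) E (labelBetween.ev s) := by
  obtain ⟨t, ht⟩ : ∃ t, t = (load uQ aRot rE ;; load u0 aRot uQ ;; load u1 aK rE ;; load u2 aK u0 ;;
    load u3 aK uQ ;; load uD aD rE ;; load u4 aD u0 ;; load uX aX rE ;; load uY aY rE).ev s :=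
    ⟨_, rfl⟩
  have h1 : t.reg uQ = idx e (G.rot d) ∧ t.reg u1 = s.arr aK (idx e d) ∧
      t.reg u2 = s.arr aK (idx e (G.rot (G.rot d))) ∧ t.reg u3 = s.arr aK (idx e (G.rot d)) ∧
      t.reg uD = s.arr aD (idx e d) ∧ t.reg u4 = s.arr aD (idx e (G.rot (G.rot d))) ∧
      t.reg uX = s.arr aX (idx e d) ∧ t.reg uY = s.arr aY (idx e d) := by
    rw [ht]
    refine ⟨?_, ?_, ?_, ?_, ?_, ?_, ?_, ?_⟩ <;> simp [Code.ev, hd, h.env.input.rot]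
  have g0 : LabelInv L e φ S Z E t := by rw [ht]; exact h.ev rfl
  have gK : t.arr aK = s.arr aK := by rw [ht]; exact ev_arr rfl s
  rw [show labelBetween.ev s = (guard [.eq u1 rOne, .eq u2 rOne, .lt u3 rOne, .eq u4 u5]
    Code.label).ev ((incMod u5 uD).ev ((incMod uD uD).ev t)) by rw [ht]; rfl]
  clear ht
  obtain ⟨g1, g2, g3, g4, g5, g6, g7, g8⟩ := h1
  have i1 : LabelInv L e φ S Z E ((incMod uD uD).ev t) := g0.ev rfl
  have i2 : LabelInv L e φ S Z E ((incMod u5 uD).ev ((incMod uD uD).ev t)) := i1.ev rfl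
  have hlt : s.arr aK (idx e d) = 1 → L.dir d = t.reg uD := fun hK => by
    rw [g5, (h.label d hK).1]
  have hD : s.arr aK (idx e d) = 1 → ((incMod u5 uD).ev ((incMod uD uD).ev t)).reg uD =
      (L.dir d + 1) % 4 := fun hK => by
    rw [ev_reg rfl, incMod_spec uD uD g0.env.input (by simp [constRegs])
      (by rw [← hlt hK]; exact L.dir_lt d), hlt hK]
  have h5 : s.arr aK (idx e d) = 1 → ((incMod u5 uD).ev ((incMod uD uD).ev t)).reg u5 =
      (L.dir d + 2) % 4 := fun hK => by
    have := hD hK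
    rw [ev_reg rfl] at this
    rw [incMod_spec u5 uD i1.env.input (by simp [constRegs]) (by omega), this]
    omega
  have e1 : ∀ r, r ≠ uD → r ≠ u5 → ((incMod u5 uD).ev ((incMod uD uD).ev t)).reg r = t.reg r := by
    intro r hr hr'
    have w : ∀ x, r ≠ x → (incMod x uD).writes r = false := by
      intro x hx
      simp [incMod, Code.guard, writes, Ne.symm hx]
    rw [ev_reg (w _ hr'), ev_reg (w _ hr)]
  have hK' : ((incMod u5 uD).ev ((incMod uD uD).ev t)).arr aK = s.arr aK := by
    rw [ev_arr rfl, ev_arr rfl, gK]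
  have e2 := e1 uQ (by decide) (by decide)
  have e3 := e1 u1 (by decide) (by decide)
  have e4 := e1 u2 (by decide) (by decide)
  have e5 := e1 u3 (by decide) (by decide)
  have e6 := e1 u4 (by decide) (by decide)
  have e7 := e1 uX (by decide) (by decide)
  have e8 := e1 uY (by decide) (by decide)
  clear e1 i1
  generalize (incMod u5 uD).ev ((incMod uD uD).ev t) = t' at *
  simp only [ev_guard, List.forall_mem_cons, List.not_mem_nil, false_imp_iff, implies_true,
    and_true, Test.holds_eq, Test.holds_lt, e3, e4, e5, e6, g2, g3, g4, g6, i2.env.input.one]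
  split_ifs with hc
  · obtain ⟨c1, c2, c3, c4⟩ := hc
    rw [h5 c1, (h.label _ c2).1] at c4
    obtain ⟨-, l2, l3⟩ := h.label d c1
    obtain ⟨h7, h8⟩ := i2.label_spec (e2.trans g1) ⟨by rw [hD c1, L.dir_rot_of_opposite c4],
      by rw [e7, g7, l2, G.rot_fst], by rw [e8, g8, l3, G.rot_fst]⟩ (by unfold Known; rw [hK']; omega)
    exact h7.resolve fun _ _ _ => (h8 _).2 (Or.inl rfl)
  · refine i2.resolve fun k1 k2 k3 => ?_
    unfold Known at k1 k2 ⊢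
    rw [hK'] at k1 k2 ⊢
    have := h.known_le (G.rot d)
    have := h5 k1
    have := (h.label _ k2).1
    omega

/-- Storing a corner can complete the data of the face of `d` before its walk has begun; the face is
therefore exempted until `beginFace`. -/
theorem findCorners_spec (h : LabelInv L e φ S Z E s) {d : G.graph.Dart} (hd : s.reg rE = idx e d) :
    LabelInv L e φ S (fun j d' => Z j d' ∧ ¬ (j = 2 ∧ d' = d))
      (fun f => E f ∨ (f = G.leftFace d ∧ Known e s d)) (findCorners.ev s) := by
  have h1 : (cornerData.ev s).reg u1 = s.arr aK (idx e d) ∧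
      (cornerData.ev s).reg u2 = s.arr aD (idx e d) ∧
      (cornerData.ev s).reg u3 = s.arr aK (idx e (G.faceNext.symm d)) ∧
      (cornerData.ev s).reg u4 = s.arr aD (idx e (G.faceNext.symm d)) ∧
      (cornerData.ev s).reg u5 = φ (G.leftFace d) ∧
      (cornerData.ev s).reg uX = s.arr aX (idx e d) ∧
      (cornerData.ev s).reg uY = s.arr aY (idx e d) := by
    rw [faceNext_symm_apply]
    refine ⟨?_, ?_, ?_, ?_, ?_, ?_, ?_⟩ <;>
      simp [cornerData, Code.ev, hd, h.env.input.rot, h.env.input.sym, h.env.fid]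
  have i1 : LabelInv L e φ S Z E (cornerData.ev s) := h.ev rfl
  have hA : ∀ a, (cornerData.ev s).arr a = s.arr a := fun a => ev_arr rfl s
  rw [show findCorners.ev s = storeCorners.ev (cornerData.ev s) from rfl]
  obtain ⟨g1, g2, g3, g4, g5, g6, g7⟩ := h1
  generalize cornerData.ev s = t at *
  obtain ⟨t', ht'⟩ : ∃ t', t' = storeCorners.ev t := ⟨_, rfl⟩
  have key : LabelInv L e φ S Z (fun f => E f ∨ (f = G.leftFace d ∧ Known e s d)) t' ∧
      Saturated L e φ t' 2 d := by
    obtain ⟨C1, hC1⟩ : ∃ C, C ↔ Known e s d ∧ L.dir d = 0 ∧ Known e s (G.faceNext.symm d) ∧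
      L.dir (G.faceNext.symm d) = 3 := ⟨_, Iff.rfl⟩
    obtain ⟨C2, hC2⟩ : ∃ C, C ↔ Known e s d ∧ L.dir d = 1 ∧ Known e s (G.faceNext.symm d) ∧
      L.dir (G.faceNext.symm d) = 0 := ⟨_, Iff.rfl⟩
    have j1 : (t.reg u1 = 1 ∧ t.reg u2 = 0 ∧ t.reg u3 = 1 ∧
        t.reg u4 = 3) ↔ C1 := by
      rw [hC1, g1, g2, g3, g4]
      constructor
      · rintro ⟨k1, k2, k3, k4⟩
        exact ⟨k1, (h.label d k1).1 ▸ k2, k3, (h.label _ k3).1 ▸ k4⟩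
      · rintro ⟨k1, k2, k3, k4⟩
        exact ⟨k1, (h.label d k1).1.trans k2, k3, (h.label _ k3).1.trans k4⟩
    have j2 : (t.reg u1 = 1 ∧ t.reg u2 = 1 ∧ t.reg u3 = 1 ∧
        t.reg u4 = 0) ↔ C2 := by
      rw [hC2, g1, g2, g3, g4]
      constructor
      · rintro ⟨k1, k2, k3, k4⟩
        exact ⟨k1, (h.label d k1).1 ▸ k2, k3, (h.label _ k3).1 ▸ k4⟩
      · rintro ⟨k1, k2, k3, k4⟩
        exact ⟨k1, (h.label d k1).1.trans k2, k3, (h.label _ k3).1.trans k4⟩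
    obtain ⟨e1, e2, e3, e4, e5⟩ := storeCorners_spec i1.env.input j1 j2
    rw [← ht', g5] at e1 e2 e3 e4 e5
    simp only [g6, g7, hA] at e1 e2 e3 e4 e5
    have e6 : ∀ r ∈ labelRegs, t'.reg r = t.reg r := by
      rw [ht']; exact keeps_reg (A := []) rfl t
    have e7 : ∀ a ∈ aK :: aD :: aX :: aY :: aB :: aH :: aQ :: faceArrs, t'.arr a = t.arr a := by
      rw [ht']; exact keeps_arr (R := []) rfl t
    have eK : Known e t' = Known e s := by
      unfold Known; rw [e7 aK (by simp), hA]
    clear ht'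
    constructor
    · refine i1.corner e6 e7 ?_ ?_ ?_ ?_ (fun f => Or.inl) ?_
      · intro f hf
        rw [hA] at hf
        rw [e1, hf, ite_self]
      · intro f hf
        rw [hA] at hf
        rw [e4, hf, ite_self]
      · intro f hf
        rw [e1] at hf
        rw [e2, e3]
        split_ifs at hf ⊢ with hc
        · obtain ⟨hc, hc'⟩ := hc
          obtain rfl := h.env.inj hc'
          obtain ⟨k1, k2, k3, k4⟩ := hC1.1 hc
          obtain ⟨l1, l2, l3⟩ := h.label d k1
          obtain ⟨m1, m2, m3⟩ := L.corner_left k2 k4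
          exact ⟨m1, l2.trans m2, l3.trans m3⟩
        · exact h.left f hf
      · intro f hf
        rw [e4] at hf
        rw [e5]
        split_ifs at hf ⊢ with hc
        · obtain ⟨hc, hc'⟩ := hc
          obtain rfl := h.env.inj hc'
          obtain ⟨k1, k2, k3, k4⟩ := hC2.1 hc
          obtain ⟨l1, l2, l3⟩ := h.label d k1
          obtain ⟨m1, m2⟩ := L.corner_right k2 k4
          exact ⟨m1, l2.trans m2⟩
        · exact h.right f hf
      · intro f
        rw [e1, e4, hA, hA]
        by_cases hf : f = G.leftFace d ∧ Known e s d
        · exact Or.inl (Or.inr hf)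
        · refine Or.inr ⟨if_neg fun hc => hf ⟨h.env.inj hc.2, (hC1.1 hc.1).1⟩,
            if_neg fun hc => hf ⟨h.env.inj hc.2, (hC2.1 hc.1).1⟩⟩
    · simp only [Saturated, eK, e1, e4]
      exact ⟨fun k1 k2 k3 k4 => if_pos ⟨hC1.2 ⟨k1, k2, k3, k4⟩, rfl⟩,
        fun k1 k2 k3 k4 => if_pos ⟨hC2.2 ⟨k1, k2, k3, k4⟩, rfl⟩⟩
  rw [← ht']
  exact key.1.resolve key.2

/-- The walk may start at any known dart of the face, so `d` itself is used, and the exemption of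
its face ends. -/
theorem beginFace_spec {d : G.graph.Dart}
    (h : LabelInv L e φ S Z (fun f => E f ∨ (f = G.leftFace d ∧ Known e s d)) s)
    (hd : s.reg rE = idx e d) : LabelInv L e φ S Z E (beginFace.ev s) := by
  have h1 : (beginData.ev s).reg u1 = s.arr aK (idx e d) ∧
      (beginData.ev s).reg u0 = s.arr aL (φ (G.leftFace d)) ∧
      (beginData.ev s).reg u2 = s.arr aR (φ (G.leftFace d)) ∧
      (beginData.ev s).reg u3 = s.arr aB (idx e d) ∧
      (beginData.ev s).reg u5 = φ (G.leftFace d) ∧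
      (beginData.ev s).reg u6 = G.degree (G.leftFace d) / 2 -
        (s.arr aX1 (φ (G.leftFace d)) - s.arr aX0 (φ (G.leftFace d))) := by
    refine ⟨?_, ?_, ?_, ?_, ?_, ?_⟩ <;>
      simp [beginData, Code.ev, hd, h.env.fid, h.env.half]
  have i1 : LabelInv L e φ S Z (fun f => E f ∨ (f = G.leftFace d ∧ Known e s d)) (beginData.ev s) :=
    h.ev rfl
  have hA : ∀ a, (beginData.ev s).arr a = s.arr a := fun a => ev_arr rfl s
  have hE : (beginData.ev s).reg rE = idx e d := (ev_reg rfl s).trans hd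
  rw [show beginFace.ev s = (guard [.eq u1 rOne, .eq u0 rOne, .eq u2 rOne, .lt u3 rOne]
    (store aH u5 u6 ;; store aB rE rOne ;; Code.push rE)).ev (beginData.ev s) from rfl]
  obtain ⟨g1, g2, g3, g4, g5, g6⟩ := h1
  generalize beginData.ev s = t at *
  have ho := i1.env.input.one
  simp only [ev_guard, List.forall_mem_cons, List.not_mem_nil, false_imp_iff, implies_true,
    and_true, Test.holds_eq, Test.holds_lt, g1, g2, g3, g4, ho]
  split_ifs with hc
  · obtain ⟨c1, c2, c3, c4⟩ := hc
    -- The height is half the perimeter minus the width.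
    have hdeg : ((G.degree (G.leftFace d) / 2 -
        (s.arr aX1 (φ (G.leftFace d)) - s.arr aX0 (φ (G.leftFace d))) : ℕ) : ℤ) =
        L.t (G.leftFace d) - L.b (G.leftFace d) := by
      have := L.degree_eq (G.leftFace d)
      have := h.left _ c2
      have := h.right _ c3
      have := L.l_lt (G.leftFace d)
      have := L.b_lt (G.leftFace d)
      omega
    have key : LabelInv L e φ S Z (fun f => E f ∨ (f = G.leftFace d ∧ Known e s d))
        ((store aH u5 u6 ;; store aB rE rOne ;; Code.push rE).ev t) := by
      refine i1.push (q := d) (b := True) (i1.env.ev rfl) ?_ ?_ (fun i _ => congrFun (ev_arr rfl t) i)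
        (fun i _ => congrFun (ev_arr rfl t) i) (fun i _ => congrFun (ev_arr rfl t) i) ?_ ?_ ?_
        (ev_reg rfl t) (ev_arr rfl t) (ev_arr rfl t) (ev_arr rfl t) (ev_arr rfl t) (ev_arr rfl t)
        ?_ (fun _ => ?_) (Or.inr ⟨trivial, ?_⟩)
      · intro i
        rw [ev_arr rfl, hA]
        split_ifs with hi
        · rw [hi, c1]
        · rfl
      · intro i
        simp [Code.ev, Code.push, hE, ho]
      · unfold HasLabel
        rw [ev_arr rfl, ev_arr rfl, ev_arr rfl, hA, hA, hA]
        exact h.label d c1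
      · intro i
        simp [Code.ev, Code.push, hE]
      · simp [Code.ev, Code.push]
      · intro f _ _ hf
        by_cases hfd : f = G.leftFace d
        · subst hfd
          simp [Code.ev, Code.push, g5, g6]
          exact_mod_cast hdeg
        · have : φ f ≠ φ (G.leftFace d) := fun hh => hfd (h.env.inj hh)
          simp [Code.ev, Code.push, g5, this]
          exact hf
      · rw [hA, hA]
        refine ⟨c2, c3, ?_⟩
        simp [Code.ev, Code.push, g5, g6]
        exact_mod_cast hdeg
      · unfold Walked
        rw [hA]
        omega
    refine key.mono (fun i d hz => Or.inr hz) fun f hf => ?_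
    rcases hf with hf | ⟨rfl, -⟩
    · exact Or.inl hf
    · refine Or.inr fun _ _ => ⟨d, rfl, ?_⟩
      unfold Walked
      simp [Code.ev, Code.push, hE, ho]
  · refine i1.mono (fun i d hz => Or.inr hz) fun f hf => ?_
    rcases hf with hf | ⟨rfl, hK⟩
    · exact Or.inl hf
    · refine Or.inr fun k1 k2 => ⟨d, rfl, ?_⟩
      rw [hA] at k1 k2
      unfold Known at hK
      unfold Walked
      rw [hA]
      have := h.walked_le d
      omega

/-- A walked dart belongs to a face whose rectangle is fully recorded, so the next direction is
obtained by comparing the end of `d` with the corner in front. -/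
theorem turn_spec (h : LabelInv L e φ S Z E s) {d : G.graph.Dart} (hW : Walked e s d)
    (h5 : s.reg u5 = φ (G.leftFace d)) (hD : s.reg uD = L.dir d) (hX : (s.reg uX : ℤ) = L.x d.snd)
    (hY : (s.reg uY : ℤ) = L.y d.snd) : (turn.ev s).reg uD = L.dir (G.faceNext d) := by
  obtain ⟨-, w1, w2, w3⟩ := h.walked d hW
  obtain ⟨hf, a1, a2⟩ := h.left _ w1
  obtain ⟨-, a3⟩ := h.right _ w2
  have h1 := L.inner_edge_dir rfl hf
  have h2 := L.dir_faceNext rfl hf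
  have h3 := L.x_snd d
  have h4 := L.y_snd d
  simp only [turn, Code.ev, ev_guard, ite_setReg, ite_self]
  simp [h5, hD, h.env.input.one, h.env.input.zero, h.env.input.two, h.env.input.three]
  rw [h2]
  rcases h1 with ⟨h1, h6⟩ | ⟨h1, h6⟩ | ⟨h1, h6⟩ | ⟨h1, h6⟩ <;> rw [h1] at h3 h4 ⊢ <;>
    simp only [dirX, dirY] at h3 h4 <;> norm_num at h3 h4 ⊢ <;> split_ifs <;> omega

theorem labelNext_spec (hl : L.l L.outer = 0) (hb : L.b L.outer = 0) (h : LabelInv L e φ S Z E s)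
    {d : G.graph.Dart} (hd : s.reg rE = idx e d) :
    LabelInv L e φ S (fun j d' => Z j d' ∧ ¬ (j = 3 ∧ d' = d)) E (labelNext.ev s) := by
  obtain ⟨t, ht⟩ : ∃ t, t = (load uQ aNxt rE ;; load u1 aB rE ;; load u2 aB uQ ;; load uD aD rE ;;
    load uX aX rE ;; load uY aY rE ;; load u5 aFid rE).ev s := ⟨_, rfl⟩
  have h1 : t.reg uQ = idx e (G.faceNext d) ∧ t.reg u1 = s.arr aB (idx e d) ∧
      t.reg u2 = s.arr aB (idx e (G.faceNext d)) ∧ t.reg uD = s.arr aD (idx e d) ∧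
      t.reg uX = s.arr aX (idx e d) ∧ t.reg uY = s.arr aY (idx e d) ∧
      t.reg u5 = φ (G.leftFace d) := by
    rw [ht]
    refine ⟨?_, ?_, ?_, ?_, ?_, ?_, ?_⟩ <;> simp [Code.ev, hd, h.env.nxt, h.env.fid]
  have g0 : LabelInv L e φ S Z E t := by rw [ht]; exact h.ev rfl
  have gA : ∀ a, t.arr a = s.arr a := fun a => by rw [ht]; exact ev_arr rfl s
  rw [show labelNext.ev s = (guard [.eq u1 rOne, .lt u2 rOne] (store aB uQ rOne ;; Code.label)).ev
    (turn.ev (step.ev t)) by rw [ht]; rfl]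
  clear ht
  obtain ⟨g1, g2, g3, g4, g5, g6, g7⟩ := h1
  have i1 : LabelInv L e φ S Z E (step.ev t) := g0.ev rfl
  have i2 : LabelInv L e φ S Z E (turn.ev (step.ev t)) := i1.ev rfl
  have iA1 : ∀ a, (step.ev t).arr a = s.arr a := fun a => (ev_arr rfl t).trans (gA a)
  have iA : ∀ a, (turn.ev (step.ev t)).arr a = s.arr a := fun a => (ev_arr rfl _).trans (iA1 a)
  have hreg : Walked e s d → RegLabel L (turn.ev (step.ev t)) (G.faceNext d) := by
    intro hW
    obtain ⟨l1, l2, l3⟩ := h.label d (h.walked d hW).1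
    obtain ⟨m1, m2, m3⟩ := step_spec hl hb g0.env.input (d := d)
      ⟨g4.trans l1, by rw [g5, l2], by rw [g6, l3]⟩
    refine ⟨i1.turn_spec (by unfold Walked; rw [iA1]; exact hW) ((ev_reg rfl t).trans g7) m1 m2 m3,
      ?_, ?_⟩
    · rw [ev_reg rfl, m2, faceNext_fst]
    · rw [ev_reg rfl, m3, faceNext_fst]
  have e1 : (turn.ev (step.ev t)).reg uQ = idx e (G.faceNext d) := by
    rw [ev_reg rfl, ev_reg rfl, g1]
  have e2 : (turn.ev (step.ev t)).reg u1 = s.arr aB (idx e d) := by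
    rw [ev_reg rfl, ev_reg rfl, g2]
  have e3 : (turn.ev (step.ev t)).reg u2 = s.arr aB (idx e (G.faceNext d)) := by
    rw [ev_reg rfl, ev_reg rfl, g3]
  clear i1 iA1
  generalize turn.ev (step.ev t) = t' at *
  have ho := i2.env.input.one
  simp only [ev_guard, List.forall_mem_cons, List.not_mem_nil, false_imp_iff, implies_true,
    and_true, Test.holds_eq, Test.holds_lt, e2, e3, ho]
  split_ifs with hc
  · obtain ⟨c1, c2⟩ := hc
    obtain ⟨r1, r2, r3⟩ := hreg c1
    obtain ⟨-, w1, w2, w3⟩ := h.walked d c1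
    have key : LabelInv L e φ S Z E ((store aB uQ rOne ;; Code.label).ev t') := by
      refine i2.push (q := G.faceNext d) (b := True) (i2.env.ev rfl) ?_ ?_ ?_ ?_ ?_ ?_ ?_ ?_
        (ev_reg rfl t') (ev_arr rfl t') (ev_arr rfl t') (ev_arr rfl t') (ev_arr rfl t')
        (ev_arr rfl t') (fun f _ _ hf => ?_) (fun _ => ?_) (Or.inr ⟨trivial, ?_⟩)
      · intro i; simp [Code.ev, Code.label, Code.push, e1, ho]
      · intro i; simp [Code.ev, Code.label, Code.push, e1, ho]
      · intro i hi; simp [Code.ev, Code.label, Code.push, e1, hi]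
      · intro i hi; simp [Code.ev, Code.label, Code.push, e1, hi]
      · intro i hi; simp [Code.ev, Code.label, Code.push, e1, hi]
      · unfold HasLabel
        simp [Code.ev, Code.label, Code.push, e1, r1, r2, r3]
      · intro i; simp [Code.ev, Code.label, Code.push, e1]
      · simp [Code.ev, Code.label, Code.push]
      · rw [ev_arr rfl]
        exact hf
      · rw [ev_arr rfl, iA, iA, iA, leftFace_faceNext]
        exact ⟨w1, w2, w3⟩
      · unfold Walked
        rw [iA]
        omega
    refine key.resolve fun _ => ?_
    unfold Walked
    simp [Code.ev, Code.label, Code.push, e1, ho]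
  · refine i2.resolve fun hW => ?_
    unfold Walked at hW ⊢
    rw [iA] at hW ⊢
    have := h.walked_le (G.faceNext d)
    omega

theorem rules_spec (hl : L.l L.outer = 0) (hb : L.b L.outer = 0) (h : LabelInv L e φ S Z E s)
    {d : G.graph.Dart} (hd : s.reg rE = idx e d) :
    LabelInv L e φ S (fun j d' => Z j d' ∧ d' ≠ d) E (rules.ev s) := by
  have h1 := h.labelSymm_spec hl hb hd
  have h2 := h1.labelBetween_spec ((ev_reg rfl s).trans hd)
  have d2 : (labelBetween.ev (labelSymm.ev s)).reg rE = idx e d := by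
    rw [ev_reg rfl, ev_reg rfl, hd]
  have h3 := h2.findCorners_spec d2
  have d3 : (findCorners.ev (labelBetween.ev (labelSymm.ev s))).reg rE = idx e d := by
    rw [ev_reg rfl, d2]
  have hK : Known e (findCorners.ev (labelBetween.ev (labelSymm.ev s))) =
      Known e (labelBetween.ev (labelSymm.ev s)) := by
    unfold Known
    rw [ev_arr rfl]
  rw [← hK] at h3
  have h4 := h3.beginFace_spec d3
  have h5 := h4.labelNext_spec hl hb ((ev_reg rfl _).trans d3)
  rw [show rules.ev s = labelNext.ev (beginFace.ev (findCorners.ev (labelBetween.ev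
    (labelSymm.ev s)))) by simp only [rules, Code.ev]]
  refine h5.mono (fun j d' hz => Or.inr ?_) fun f hf => Or.inl hf
  obtain ⟨⟨⟨⟨z0, z1⟩, z2⟩, z3⟩, z4⟩ := hz
  refine ⟨z0, fun hh => ?_⟩
  fin_cases j
  · exact z1 ⟨rfl, hh⟩
  · exact z2 ⟨rfl, hh⟩
  · exact z3 ⟨rfl, hh⟩
  · exact z4 ⟨rfl, hh⟩

end LabelInv

end PlanarEmbeddedGraph

/-! ## The labels of all darts -/

namespace PlanarEmbeddedGraph

open Code

variable {n k : ℕ} {G : PlanarEmbeddedGraph n} {e : Fin k ≃ G.graph.Dart} {φ : G.Face → ℕ}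

namespace LabelInv

variable {L : G.RectLayout} {S : G.graph.Dart → Prop}
  {Z : Fin 4 → G.graph.Dart → Prop} {E : G.Face → Prop} {s s' : RAMState}

/-- When `q` leaves the queue, exactly the rules that waited for it become exempt: those at `q`, at
its successor on the face, and at the dart two places before it around its vertex. -/
theorem pop (h : LabelInv L e φ S Z E s) (hlt : s.reg rHead < s.reg rTail) {q : G.graph.Dart}
    (hq : s.arr aQ (s.reg rHead) = idx e q) (hhead : s'.reg rHead = s.reg rHead + 1)
    (hr : ∀ r ∈ rTail :: constRegs, s'.reg r = s.reg r) (ha : s'.arr = s.arr) :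
    LabelInv L e φ S (fun i d => Z i d ∨ d = q ∨ G.faceNext.symm d = q ∨ G.rot (G.rot d) = q) E s' := by
  simp only [List.forall_mem_cons] at hr
  obtain ⟨r2, hr⟩ := hr
  have hK : Known e s' = Known e s := by unfold Known; rw [ha]
  have hB : Walked e s' = Walked e s := by unfold Walked; rw [ha]
  have hL : HasLabel L e s' = HasLabel L e s := by unfold HasLabel; rw [ha]
  have hQ : ∀ d, InQueue e s d → d = q ∨ InQueue e s' d := by
    rintro d ⟨i, h1, h2, h3⟩
    rcases h1.eq_or_lt with rfl | h1
    · exact Or.inl ((idx_inj e).1 (h3.symm.trans hq))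
    · exact Or.inr ⟨i, by omega, by omega, by rw [ha, h3]⟩
  have hS : Saturated L e φ s' = Saturated L e φ s := by
    funext i d
    match i with
    | 0 => simp only [Saturated, hK]
    | 1 => simp only [Saturated, hK]
    | 2 => simp only [Saturated, hK, ha]
    | 3 => simp only [Saturated, hB]
  refine ⟨h.env.congr hr fun a _ => by rw [ha], by rw [hK]; exact h.base, ?_, ?_, ?_, ?_, ?_, ?_, ?_, ?_, ?_, ?_, ?_⟩
  · rw [ha]; exact h.known_le
  · rw [ha]; exact h.walked_le
  · rw [hK, hL]; exact h.label
  · rw [ha]; exact h.left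
  · rw [ha]; exact h.right
  · rw [hB, hK, ha]; exact h.walked
  · rw [hB, ha]; exact h.start
  · omega
  · rw [hK, hB, r2]; exact h.tail_le
  · rw [r2, ha]; exact h.queue
  · rw [hS]
    intro i d
    rcases h.pending i d with h1 | h1 | h1 | h1 | h1
    · exact Or.inl (Or.inl h1)
    · exact Or.inr (Or.inl h1)
    · rcases hQ d h1 with h2 | h2
      · exact Or.inl (Or.inr (Or.inl h2))
      · exact Or.inr (Or.inr (Or.inl h2))
    · rcases hQ _ h1 with h2 | h2
      · exact Or.inl (Or.inr (Or.inr (Or.inl h2)))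
      · exact Or.inr (Or.inr (Or.inr (Or.inl h2)))
    · rcases hQ _ h1 with h2 | h2
      · exact Or.inl (Or.inr (Or.inr (Or.inr h2)))
      · exact Or.inr (Or.inr (Or.inr (Or.inr h2)))

theorem popQueue_spec (hl : L.l L.outer = 0) (hb : L.b L.outer = 0)
    (h : LabelInv L e φ S (fun _ _ => False) E s) :
    LabelInv L e φ S (fun _ _ => False) E (popQueue.ev s) ∧ ∀ j, s.reg rHead = s.reg rTail ∨
      j ≤ s.reg rHead → (popQueue.ev s).reg rHead = (popQueue.ev s).reg rTail ∨
        j + 1 ≤ (popQueue.ev s).reg rHead := by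
  rw [popQueue, ev_guard]
  simp only [List.forall_mem_cons, List.not_mem_nil, false_imp_iff, implies_true, and_true,
    Test.holds_lt]
  split_ifs with hlt
  · obtain ⟨q, hq⟩ := h.queue _ hlt
    obtain ⟨s1, hs1⟩ : ∃ s1, s1 = (load rD aQ rHead ;; inc rHead rHead ;; move rE rD).ev s :=
      ⟨_, rfl⟩
    have i1 := h.pop hlt (s' := s1) hq (by rw [hs1]; simp [Code.ev])
      (by rw [hs1]; exact keeps_reg (A := []) rfl s) (by rw [hs1]; funext a; exact ev_arr rfl s)
    have d1 : s1.reg rE = idx e q := by rw [hs1]; simp [Code.ev, hq]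
    have q1 : s1.reg rD = idx e q := by rw [hs1]; simp [Code.ev, hq]
    have h1 : s1.reg rHead = s.reg rHead + 1 := by rw [hs1]; simp [Code.ev]
    obtain ⟨s2, hs2⟩ : ∃ s2, s2 = rules.ev s1 := ⟨_, rfl⟩
    have i2 := i1.rules_spec hl hb d1
    rw [← hs2] at i2
    have q2 : s2.reg rD = idx e q := by rw [hs2, ev_reg rfl, q1]
    have h2 : s2.reg rHead = s.reg rHead + 1 := by rw [hs2, ev_reg rfl, h1]
    obtain ⟨s3, hs3⟩ : ∃ s3, s3 = (load rE aNxt rD).ev s2 := ⟨_, rfl⟩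
    have d3 : s3.reg rE = idx e (G.faceNext q) := by
      rw [hs3]; simp [Code.ev, q2, i2.env.nxt]
    have q3 : s3.reg rD = idx e q := by rw [hs3, ev_reg rfl, q2]
    have h3 : s3.reg rHead = s.reg rHead + 1 := by rw [hs3, ev_reg rfl, h2]
    have i3 := i2.ev (P := load rE aNxt rD) rfl
    rw [← hs3] at i3
    obtain ⟨s4, hs4⟩ : ∃ s4, s4 = rules.ev s3 := ⟨_, rfl⟩
    have i4 := i3.rules_spec hl hb d3
    rw [← hs4] at i4
    have q4 : s4.reg rD = idx e q := by rw [hs4, ev_reg rfl, q3]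
    have h4 : s4.reg rHead = s.reg rHead + 1 := by rw [hs4, ev_reg rfl, h3]
    -- Reversal followed by `faceNext` is the inverse of `rot`; twice this reaches the third dart.
    obtain ⟨s5, hs5⟩ : ∃ s5, s5 = (load rE aSym rD ;; load rE aNxt rE ;; load rE aSym rE ;;
      load rE aNxt rE).ev s4 := ⟨_, rfl⟩
    have d5 : s5.reg rE = idx e (G.rot.symm (G.rot.symm q)) := by
      rw [hs5]
      simp [Code.ev, q4, i4.env.nxt, i4.env.input.sym, RectLayout.faceNext_symm_eq]
    have h5 : s5.reg rHead = s.reg rHead + 1 := by rw [hs5, ev_reg rfl, h4]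
    have i5 := i4.ev (P := load rE aSym rD ;; load rE aNxt rE ;; load rE aSym rE ;;
      load rE aNxt rE) rfl
    rw [← hs5] at i5
    obtain ⟨s6, hs6⟩ : ∃ s6, s6 = rules.ev s5 := ⟨_, rfl⟩
    have i6 := i5.rules_spec hl hb d5
    rw [← hs6] at i6
    have h6 : s6.reg rHead = s.reg rHead + 1 := by rw [hs6, ev_reg rfl, h5]
    have heq : (load rD aQ rHead ;; inc rHead rHead ;; move rE rD ;; rules ;;
        load rE aNxt rD ;; rules ;; load rE aSym rD ;; load rE aNxt rE ;; load rE aSym rE ;;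
        load rE aNxt rE ;; rules).ev s = s6 := by
      rw [hs6, hs5, hs4, hs3, hs2, hs1]
      simp only [Code.ev]
    rw [heq]
    refine ⟨i6.mono (fun i d hz => Or.inr ?_) fun f hf => Or.inl hf, fun j hj => Or.inr (by omega)⟩
    obtain ⟨⟨⟨z1, z2⟩, z3⟩, z4⟩ := hz
    rcases z1 with z1 | z1 | z1 | z1
    · exact z1
    · exact z2 z1
    · exact z3 (by rw [← z1, Equiv.apply_symm_apply])
    · exact z4 (by rw [← z1, Equiv.symm_apply_apply, Equiv.symm_apply_apply])
  · refine ⟨h, fun j hj => Or.inl ?_⟩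
    have := h.head_le
    omega

/-- With an empty queue no rule is waiting, so every rule is saturated at every dart. -/
theorem isClosed (h : LabelInv L e φ S (fun _ _ => False) (fun _ => False) s)
    (hq : s.reg rHead = s.reg rTail) (ho : ∀ d, G.leftFace d = L.outer → S d) :
    L.IsClosed (Known e s) (Walked e s) (fun f => s.arr aL (φ f) = 1)
      (fun f => s.arr aR (φ f) = 1) := by
  have hQ : ∀ d, ¬ InQueue e s d := by
    rintro d ⟨i, h1, h2, -⟩
    omega
  have hS : ∀ i d, Saturated L e φ s i d := by
    intro i d
    rcases h.pending i d with h1 | h1 | h1 | h1 | h1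
    · exact h1.elim
    · exact h1
    all_goals exact (hQ _ h1).elim
  exact ⟨fun d hd => h.base d (ho d hd), hS 0, hS 1, fun d => (hS 2 d).1, fun d => (hS 2 d).2,
    fun f => (h.start f).resolve_left id, hS 3, fun d hd => (h.walked d hd).1⟩

theorem labelAll_spec (hl : L.l L.outer = 0) (hb : L.b L.outer = 0)
    (h : LabelInv L e φ S (fun _ _ => False) (fun _ => False) s)
    (ho : ∀ d, G.leftFace d = L.outer → S d) :
    LabelInv L e φ S (fun _ _ => False) (fun _ => False) (labelAll.ev s) ∧
      (∀ d, Known e (labelAll.ev s) d) ∧ ∀ d, G.leftFace d ≠ L.outer → Walked e (labelAll.ev s) d := by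
  have := loop_induction (x := rI) (y := rK) (s := s) (B := popQueue ;; popQueue)
    (fun j s' => LabelInv L e φ S (fun _ _ => False) (fun _ => False) s' ∧
      (s'.reg rHead = s'.reg rTail ∨ 2 * j ≤ s'.reg rHead))
    (fun j s' v hs' => ⟨hs'.1.setReg (by decide), by simpa using hs'.2⟩)
    ⟨h, Or.inr (by omega)⟩ ?_
  · rw [h.env.input.k] at this
    change LabelInv L e φ S (fun _ _ => False) (fun _ => False) (labelAll.ev s) ∧ _ at this
    obtain ⟨i1, h1⟩ := this
    have h2 := i1.head_le
    have h3 := i1.tail_le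
    have hk : Nat.card G.graph.Dart = k := by rw [← Nat.card_congr e, Nat.card_fin]
    have h4 := Set.ncard_le_card {d | Known e (labelAll.ev s) d}
    have h5 := Set.ncard_le_card {d | Walked e (labelAll.ev s) d}
    -- After `2 * k` attempts the queue is empty, or `2 * k` darts have been taken from it. At most
    -- one entry is paid for by each known and each walked dart, so there were no more.
    have hc := i1.isClosed (by
      change (labelAll.ev s).reg rHead = (labelAll.ev s).reg rTail ∨
        2 * k ≤ (labelAll.ev s).reg rHead at h1
      omega) ho
    exact ⟨i1, hc.all_known, fun d hd => (hc.finished L hd).2.2 d rfl⟩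
  · rintro j - s' - ⟨i1, h1⟩
    obtain ⟨i2, h2⟩ := i1.popQueue_spec hl hb
    obtain ⟨i3, h3⟩ := i2.popQueue_spec hl hb
    rw [show (popQueue ;; popQueue).ev s' = popQueue.ev (popQueue.ev s') from rfl]
    exact ⟨i3, h3 _ (h2 _ h1)⟩

end LabelInv

/-- Face numbers run from 1 to `k`, hence the shift by one for `aL` and `aR`. The other arrays need
no clearing, as they are trusted only where these marks are set. -/
theorem clear_spec (L : G.RectLayout) {s : RAMState} (h : FaceEnv e φ s) :
    LabelInv L e φ (fun _ => False) (fun _ _ => False) (fun _ => False) (Code.clear.ev s) := by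
  have := loop_induction (x := rI) (y := rK) (s := s) (B := store aK rI rZero ;;
    store aB rI rZero ;; inc u0 rI ;; store aL u0 rZero ;; store aR u0 rZero)
    (fun j s' => FaceEnv e φ s' ∧ ∀ i < j, s'.arr aK i = 0 ∧ s'.arr aB i = 0 ∧
      s'.arr aL (i + 1) = 0 ∧ s'.arr aR (i + 1) = 0)
    (fun j s' v hs' => ⟨hs'.1.setReg (by simp [constRegs]), hs'.2⟩)
    ⟨h, fun i hi => by omega⟩ ?_
  · obtain ⟨h1, h2⟩ := this
    rw [h.input.k] at h2
    obtain ⟨t, ht⟩ : ∃ t, t = (loop rI rK (store aK rI rZero ;; store aB rI rZero ;; inc u0 rI ;;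
      store aL u0 rZero ;; store aR u0 rZero)).ev s := ⟨_, rfl⟩
    rw [← ht] at h1 h2
    have hc : Code.clear.ev s = (move rHead rZero ;; move rTail rZero).ev t := by rw [ht]; rfl
    rw [hc]
    have i1 : FaceEnv e φ ((move rHead rZero ;; move rTail rZero).ev t) := h1.ev rfl
    have hA : ∀ a, ((move rHead rZero ;; move rTail rZero).ev t).arr a = t.arr a :=
      fun a => ev_arr rfl t
    have hh : ((move rHead rZero ;; move rTail rZero).ev t).reg rHead = 0 := by
      simp [Code.ev, h1.input.zero]
    have htl : ((move rHead rZero ;; move rTail rZero).ev t).reg rTail = 0 := by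
      simp [Code.ev, h1.input.zero]
    clear hc ht
    generalize (move rHead rZero ;; move rTail rZero).ev t = t' at *
    have hK : ∀ d, ¬ Known e t' d := by
      intro d hd
      unfold Known at hd
      rw [hA, (h2 _ (idx_lt e d)).1] at hd
      omega
    have hB : ∀ d, ¬ Walked e t' d := by
      intro d hd
      unfold Walked at hd
      rw [hA, (h2 _ (idx_lt e d)).2.1] at hd
      omega
    have hLR : ∀ f, t'.arr aL (φ f) = 0 ∧ t'.arr aR (φ f) = 0 := by
      intro f
      have h3 := h.pos f
      have h4 := h.le f
      have := h2 (φ f - 1) (by omega)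
      rw [Nat.sub_add_cancel h3] at this
      rw [hA, hA]
      exact this.2.2
    refine ⟨i1, fun d hd => hd.elim, fun d => ?_, fun d => ?_, fun d hd => (hK d hd).elim, fun f hf => ?_,
      fun f hf => ?_, fun d hd => (hB d hd).elim, fun f => Or.inr fun hf => ?_, by omega, by omega,
      fun i hi => by omega, fun i d => Or.inr (Or.inl ?_)⟩
    · rw [hA, (h2 _ (idx_lt e d)).1]; omega
    · rw [hA, (h2 _ (idx_lt e d)).2.1]; omega
    · rw [(hLR f).1] at hf; omega
    · rw [(hLR f).2] at hf; omega
    · rw [(hLR f).1] at hf; omega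
    · match i with
      | 0 => exact fun h1 => (hK _ h1).elim
      | 1 => exact fun h1 => (hK _ h1).elim
      | 2 => exact ⟨fun h1 => (hK _ h1).elim, fun h1 => (hK _ h1).elim⟩
      | 3 => exact fun h1 => (hB _ h1).elim
  · rintro j hj s' hI ⟨h1, h2⟩
    refine ⟨h1.ev rfl, fun i hi => ?_⟩
    rcases Nat.lt_succ_iff_lt_or_eq.1 hi with hi | rfl
    · simp [Code.ev, hI, h1.input.zero, h2 i hi]
    · simp [Code.ev, hI, h1.input.zero]

/-! ### The labels of the outer face -/

/-- Everything that the program knows about the outer face when it is at the dart `j` steps after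
the first. -/
structure OuterInv (L : G.RectLayout) (e : Fin k ≃ G.graph.Dart) (φ : G.Face → ℕ)
    (a b : G.graph.Dart) (j : ℕ) (d : G.graph.Dart) (s : RAMState) : Prop where
  inv : LabelInv L e φ (fun d' => ∃ i < j, (G.faceNext ^ i) a = d') (fun _ _ => False) (fun _ => False) s
  first : s.reg rA = idx e a
  second : s.reg rB = idx e b
  half : s.reg rMax = G.degree L.outer / 2
  current : s.reg rE = idx e d
  x : (s.reg uX : ℤ) = L.x d.fst
  y : (s.reg uY : ℤ) = L.y d.fst
  dir : d = a ∨ s.reg uD = L.dir (G.faceNext.symm d)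
  size : ((s.reg rW : ℤ) = L.r L.outer ∧ (s.reg rH : ℤ) = L.t L.outer) ∨
    ((∀ i < j, (G.faceNext ^ i) a ≠ b) ∧ (d = a ∨ s.reg uD = 1))

/-- The first darts on the left and the upper side of the outer face, in clockwise direction. -/
structure IsStart (L : G.RectLayout) (a b : G.graph.Dart) : Prop where
  left : L.l L.outer = 0
  bottom : L.b L.outer = 0
  face_a : G.leftFace a = L.outer
  dir_a : L.dir a = 1
  x_a : L.x a.fst = 0
  y_a : L.y a.fst = 0
  face_b : G.leftFace b = L.outer
  dir_b : L.dir b = 0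
  x_b : L.x b.fst = 0
  y_b : L.y b.fst = L.t L.outer

/-- The walk starts at the lower left corner and goes north. At `b` it has reached the top: the
height is read off, the width is half the degree minus the height, and the other two corners are
found by comparison. Before `b` the width is unknown, but while going north it is not needed. -/
theorem turnOuter_spec {L : G.RectLayout} {a b d : G.graph.Dart} (hab : IsStart L a b) {j : ℕ}
    {s : RAMState} (h : OuterInv L e φ a b j d s) (hd : G.leftFace d = L.outer) :
    (turnOuter.ev s).reg uD = L.dir d ∧ (turnOuter.ev s).reg uQ = idx e d ∧
      (turnOuter.ev s).reg u1 = s.arr aK (idx e d) ∧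
      ((((turnOuter.ev s).reg rW : ℤ) = L.r L.outer ∧
        ((turnOuter.ev s).reg rH : ℤ) = L.t L.outer) ∨
        ((∀ i < j, (G.faceNext ^ i) a ≠ b) ∧ d ≠ b ∧ L.dir d = 1)) := by
  have ho := h.inv.env.input.one
  have hz := h.inv.env.input.zero
  have h2 := h.inv.env.input.two
  have h3 := h.inv.env.input.three
  have hE := h.current
  have hA := h.first
  have hB := h.second
  have hM := h.half
  have hX := h.x
  have hY := h.y
  have hdeg := L.degree_eq L.outer
  have hl := hab.left
  have hb := hab.bottom
  have hlr := L.l_lt L.outer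
  have hbt := L.b_lt L.outer
  have hne : a ≠ b := by
    rintro rfl
    have := hab.dir_a
    have := hab.dir_b
    omega
  have hQ : (turnOuter.ev s).reg uQ = idx e d := by
    simp [turnOuter, Code.ev, ev_guard, ite_setReg, hE]
  have hK : (turnOuter.ev s).reg u1 = s.arr aK (idx e d) := by
    simp [turnOuter, Code.ev, ev_guard, ite_setReg, hE]
  suffices key : (turnOuter.ev s).reg uD = L.dir d ∧
      ((((turnOuter.ev s).reg rW : ℤ) = L.r L.outer ∧
        ((turnOuter.ev s).reg rH : ℤ) = L.t L.outer) ∨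
        ((∀ i < j, (G.faceNext ^ i) a ≠ b) ∧ d ≠ b ∧ L.dir d = 1)) from
    ⟨key.1, hQ, hK, key.2⟩
  clear hQ hK
  simp only [turnOuter, Code.ev, ev_guard, ite_setReg, ite_self]
  by_cases hda : d = a
  · subst hda
    simp [hE, hA, hB, ho, hz, h3, idx_inj, hne, hab.dir_a]
    rcases h.size with hs | hs
    · exact Or.inl hs
    · exact Or.inr hs.1
  by_cases hdb : d = b
  · subst hdb
    rw [hab.x_b] at hX
    rw [hab.y_b] at hY
    have hX' : s.reg uX = 0 := by omega
    -- The width is positive, so at `b`, where the abscissa is 0, the test for the right side does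
    -- not fire.
    have h4 : ¬ (0 = G.degree L.outer / 2 - s.reg uY) := by omega
    simp [hE, hA, hB, hz, hM, idx_inj, hda, hab.dir_b, hX', h4]
    omega
  · have hp := h.dir.resolve_left hda
    have h6 := L.dir_faceNext_outer ((leftFace_faceNext_symm d).trans hd)
    have h7 := L.outer_edge_dir ((leftFace_faceNext_symm d).trans hd)
    have h8 := L.outer_edge_dir hd
    have h9 := L.x_snd (G.faceNext.symm d)
    have h10 := L.y_snd (G.faceNext.symm d)
    have hna : ¬ (L.x d.fst = 0 ∧ L.y d.fst = 0) := fun hh =>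
      hda (L.injOn (hd.trans hab.face_a.symm) (hh.1.trans hab.x_a.symm) (hh.2.trans hab.y_a.symm))
    have hnb : ¬ (L.x d.fst = 0 ∧ L.y d.fst = L.t L.outer) := fun hh =>
      hdb (L.injOn (hd.trans hab.face_b.symm) (hh.1.trans hab.x_b.symm) (hh.2.trans hab.y_b.symm))
    rw [Equiv.apply_symm_apply] at h6
    rw [faceNext_symm_snd] at h9 h10
    simp [hE, hA, hB, hz, h2, h3, idx_inj, hda, hdb]
    rw [hp]
    have hsize := h.size
    simp only [hda, false_or, hp] at hsize
    generalize L.dir (G.faceNext.symm d) = p at *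
    rcases h7 with ⟨rfl, h7⟩ | ⟨rfl, h7⟩ | ⟨rfl, h7⟩ | ⟨rfl, h7⟩ <;>
      simp only [dirX, dirY] at h9 h10 <;> norm_num at h6 h9 h10 hsize ⊢
    · refine ⟨?_, Or.inl hsize⟩
      split_ifs at h6 <;> omega
    · refine ⟨?_, Or.inl hsize⟩
      split_ifs at h6 ⊢ <;> omega
    · refine ⟨?_, Or.inl hsize⟩
      split_ifs at h6 ⊢ <;> omega
    · have h11 : L.dir d = 1 := by split_ifs at h6 <;> omega
      exact ⟨h11.symm, hsize.imp id fun h12 => ⟨h12, h11⟩⟩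

theorem labelOuter_spec {L : G.RectLayout} {a b : G.graph.Dart} (hab : IsStart L a b)
    {s : RAMState} (h : LabelInv L e φ (fun _ => False) (fun _ _ => False) (fun _ => False) s)
    (hA : s.reg rA = idx e a) (hB : s.reg rB = idx e b)
    (hM : s.reg rMax = G.degree L.outer / 2) :
    LabelInv L e φ (fun d => G.leftFace d = L.outer) (fun _ _ => False) (fun _ => False)
      (labelOuter.ev s) ∧ ((labelOuter.ev s).reg rW : ℤ) = L.r L.outer ∧
      ((labelOuter.ev s).reg rH : ℤ) = L.t L.outer := by
  obtain ⟨t, ht⟩ : ∃ t, t = (move rE rA ;; move uD rOne ;; move uX rZero ;; move uY rZero).ev s :=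
    ⟨_, rfl⟩
  have h0 : OuterInv L e φ a b 0 a t := by
    have hz := h.env.input.zero
    rw [ht]
    exact ⟨(h.ev rfl).mono_base (by simp), by simp [Code.ev, hA], by simp [Code.ev, hB],
      by simp [Code.ev, hM], by simp [Code.ev, hA], by simp [Code.ev, hz, hab.x_a],
      by simp [Code.ev, hz, hab.y_a], Or.inl rfl, Or.inr ⟨by simp, Or.inl rfl⟩⟩
  obtain ⟨t', ht'⟩ : ∃ t', t' = (loop rI rK (turnOuter ;; guard [.lt u1 rOne] Code.label ;; step ;;
    load rE aNxt rE)).ev t := ⟨_, rfl⟩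
  rw [show labelOuter.ev s = t' by rw [ht', ht]; rfl]
  have := loop_induction (x := rI) (y := rK) (s := t) (B := turnOuter ;;
    guard [.lt u1 rOne] Code.label ;; step ;; load rE aNxt rE)
    (fun j s' => OuterInv L e φ a b j ((G.faceNext ^ j) a) s')
    (fun j s' v hs' => ⟨hs'.inv.setReg (by decide), hs'.first, hs'.second, hs'.half, hs'.current,
      hs'.x, hs'.y, hs'.dir, hs'.size⟩) h0 ?_
  · rw [← ht', h0.inv.env.input.k] at this
    -- The outer walk has at most `k` darts, so `k` steps pass through all of them, among them `b`.
    have hcyc : ∀ d, G.leftFace d = L.outer → ∃ i < k, (G.faceNext ^ i) a = d := by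
      intro d hd
      have hon : G.faceNext.IsCycleOn (G.faceDarts L.outer) := by
        refine ⟨⟨fun x hx => ?_, G.faceNext.injective.injOn, fun x hx => ⟨G.faceNext.symm x, ?_, ?_⟩⟩,
          fun x hx y hy => leftFace_eq_iff.1 ((mem_faceDarts.1 hx).trans (mem_faceDarts.1 hy).symm)⟩
        · exact mem_faceDarts.2 ((leftFace_faceNext x).trans (mem_faceDarts.1 hx))
        · exact mem_faceDarts.2 ((leftFace_faceNext_symm x).trans (mem_faceDarts.1 hx))
        · exact Equiv.apply_symm_apply _ _
      obtain ⟨i, hi, hi'⟩ := hon.exists_pow_eq (mem_faceDarts.2 hab.face_a) (mem_faceDarts.2 hd)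
      refine ⟨i, hi.trans_le ((Finset.card_le_univ _).trans ?_), hi'⟩
      rw [← Fintype.card_congr e, Fintype.card_fin]
    refine ⟨this.inv.mono_base fun d hd => this.inv.base d (hcyc d hd), ?_⟩
    refine this.size.resolve_right fun hh => ?_
    obtain ⟨i, hi, hi'⟩ := hcyc b hab.face_b
    exact hh.1 i hi hi'
  · rintro j - s' - hI
    obtain ⟨d, hd⟩ : ∃ d, d = (G.faceNext ^ j) a := ⟨_, rfl⟩
    have hout : G.leftFace d = L.outer := by
      rw [hd, ← hab.face_a]
      exact (leftFace_eq_iff.2 ⟨j, by simp⟩).symm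
    rw [← hd] at hI
    rw [show (G.faceNext ^ (j + 1)) a = G.faceNext d by rw [hd, pow_succ', Equiv.Perm.mul_apply]]
    obtain ⟨r1, r2, r3, r4⟩ := turnOuter_spec hab hI hout
    rw [show (turnOuter ;; guard [.lt u1 rOne] Code.label ;; step ;; load rE aNxt rE).ev s' =
      (load rE aNxt rE).ev (step.ev ((guard [.lt u1 rOne] Code.label).ev (turnOuter.ev s')))
      by simp only [Code.ev]]
    have i1 : LabelInv L e φ (fun d' => ∃ i < j, (G.faceNext ^ i) a = d') (fun _ _ => False)
        (fun _ => False) (turnOuter.ev s') := hI.inv.ev rfl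
    have x1 : ((turnOuter.ev s').reg uX : ℤ) = L.x d.fst := by rw [ev_reg rfl]; exact hI.x
    have y1 : ((turnOuter.ev s').reg uY : ℤ) = L.y d.fst := by rw [ev_reg rfl]; exact hI.y
    have a1 : (turnOuter.ev s').reg rA = idx e a := by rw [ev_reg rfl]; exact hI.first
    have b1 : (turnOuter.ev s').reg rB = idx e b := by rw [ev_reg rfl]; exact hI.second
    have m1 : (turnOuter.ev s').reg rMax = G.degree L.outer / 2 := by rw [ev_reg rfl]; exact hI.half
    have e1 : (turnOuter.ev s').reg rE = idx e d := by rw [ev_reg rfl]; exact hI.current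
    have k1 : (turnOuter.ev s').arr aK = s'.arr aK := ev_arr rfl s'
    generalize turnOuter.ev s' = s1 at *
    obtain ⟨s2, hs2⟩ : ∃ s2, s2 = (guard [.lt u1 rOne] Code.label).ev s1 := ⟨_, rfl⟩
    have i2 : LabelInv L e φ (fun d' => ∃ i < j + 1, (G.faceNext ^ i) a = d') (fun _ _ => False)
        (fun _ => False) s2 := by
      rw [hs2]
      simp only [ev_guard, List.forall_mem_cons, List.not_mem_nil, false_imp_iff, implies_true,
        and_true, Test.holds_lt, r3, i1.env.input.one]
      split_ifs with hc
      · obtain ⟨i3, i4⟩ := i1.label_spec r2 ⟨r1, x1, y1⟩ (by unfold Known; rw [k1]; omega)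
        refine i3.mono_base ?_
        rintro d' ⟨i, hi, rfl⟩
        rcases Nat.lt_succ_iff_lt_or_eq.1 hi with hi | rfl
        · exact i3.base _ ⟨i, hi, rfl⟩
        · exact (i4 _).2 (Or.inl hd.symm)
      · refine i1.mono_base ?_
        rintro d' ⟨i, hi, rfl⟩
        rcases Nat.lt_succ_iff_lt_or_eq.1 hi with hi | rfl
        · exact i1.base _ ⟨i, hi, rfl⟩
        · have := i1.known_le d
          rw [← hd]
          unfold Known
          rw [k1] at this ⊢
          omega
    have g : ∀ r ∈ [rA, rB, rMax, rE, uX, uY, uD, rW, rH], s2.reg r = s1.reg r := by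
      rw [hs2]; exact keeps_reg (A := []) rfl s1
    rw [← hs2]
    clear hs2
    simp only [List.forall_mem_cons, List.not_mem_nil, false_imp_iff, implies_true,
        and_true] at g
    obtain ⟨g1, g2, g3, g4, g5, g6, g7, g8, g9⟩ := g
    obtain ⟨n1, n2, n3⟩ := step_spec hab.left hab.bottom i2.env.input (d := d)
      ⟨g7.trans r1, by rw [g5, x1], by rw [g6, y1]⟩
    have i3 : LabelInv L e φ (fun d' => ∃ i < j + 1, (G.faceNext ^ i) a = d') (fun _ _ => False)
        (fun _ => False) (step.ev s2) := i2.ev rfl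
    have w : ∀ r ∈ [rA, rB, rMax, rE, rW, rH], (step.ev s2).reg r = s2.reg r :=
      keeps_reg (A := []) rfl s2
    generalize step.ev s2 = s3 at *
    simp only [List.forall_mem_cons, List.not_mem_nil, false_imp_iff, implies_true,
        and_true] at w
    obtain ⟨w1, w2, w3, w4, w5, w6⟩ := w
    have i4 : LabelInv L e φ (fun d' => ∃ i < j + 1, (G.faceNext ^ i) a = d') (fun _ _ => False)
        (fun _ => False) ((load rE aNxt rE).ev s3) := i3.ev rfl
    refine ⟨i4, ?_, ?_, ?_, ?_, ?_, ?_, Or.inr ?_, ?_⟩ <;> clear i4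
    · simp [Code.ev, w1, g1, a1]
    · simp [Code.ev, w2, g2, b1]
    · simp [Code.ev, w3, g3, m1]
    · simp [Code.ev, w4, g4, e1, i3.env.nxt]
    · simp [Code.ev, n2, faceNext_fst]
    · simp [Code.ev, n3, faceNext_fst]
    · simp [Code.ev, n1]
    · simp only [Code.ev, setReg_reg, if_neg (show ¬ rW = rE by decide),
        if_neg (show ¬ rH = rE by decide), if_neg (show ¬ uD = rE by decide), w5, w6, g8, g9, n1]
      refine r4.imp id fun h4 => ⟨fun i hi => ?_, Or.inr h4.2.2⟩
      rcases Nat.lt_succ_iff_lt_or_eq.1 hi with hi | rfl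
      · exact h4.1 i hi
      · rw [← hd]; exact h4.2.1

/-- The labels are right, and the rectangles of all inner faces are known. -/
structure Labelled (L : G.RectLayout) (e : Fin k ≃ G.graph.Dart) (φ : G.Face → ℕ) (s : RAMState) :
    Prop where
  env : FaceEnv e φ s
  x : ∀ d, (s.arr aX (idx e d) : ℤ) = L.x d.fst
  y : ∀ d, (s.arr aY (idx e d) : ℤ) = L.y d.fst
  l : ∀ f, (s.arr aX0 (φ f) : ℤ) = L.l f
  r : ∀ f, (s.arr aX1 (φ f) : ℤ) = L.r f
  b : ∀ f, (s.arr aY0 (φ f) : ℤ) = L.b f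
  h : ∀ f, (s.arr aH (φ f) : ℤ) = L.t f - L.b f

/-- Completeness: for the right outer face and the right pair of corners, the labels computed are
the layout itself. -/
theorem labelled_of_isStart {L : G.RectLayout} {a b : G.graph.Dart} (hab : IsStart L a b)
    {s : RAMState} (h : FaceEnv e φ s) (hA : s.reg rA = idx e a) (hB : s.reg rB = idx e b)
    (hM : s.reg rMax = G.degree L.outer / 2) (hF : s.reg rF = φ L.outer) :
    Labelled L e φ ((Code.clear ;; labelOuter ;; labelAll ;; outerRectangle).ev s) := by
  rw [show (Code.clear ;; labelOuter ;; labelAll ;; outerRectangle).ev s =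
    outerRectangle.ev (labelAll.ev (labelOuter.ev (Code.clear.ev s))) by simp only [Code.ev]]
  have i1 := clear_spec L h
  obtain ⟨i2, hW, hH⟩ := labelOuter_spec hab i1 (by rw [ev_reg rfl, hA]) (by rw [ev_reg rfl, hB])
    (by rw [ev_reg rfl, hM])
  have f1 : (labelAll.ev (labelOuter.ev (Code.clear.ev s))).reg rF = φ L.outer := by
    rw [ev_reg rfl, ev_reg rfl, ev_reg rfl, hF]
  obtain ⟨i3, hK, hB⟩ := i2.labelAll_spec hab.left hab.bottom fun d hd => hd
  have f2 := ev_reg (P := labelAll) (q := rW) rfl (labelOuter.ev (Code.clear.ev s))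
  have f3 := ev_reg (P := labelAll) (q := rH) rfl (labelOuter.ev (Code.clear.ev s))
  rw [← f2] at hW
  rw [← f3] at hH
  clear f2 f3 i2
  generalize labelAll.ev (labelOuter.ev (Code.clear.ev s)) = t at *
  have hz := i3.env.input.zero
  have i4 : FaceEnv e φ (outerRectangle.ev t) := i3.env.ev rfl
  have key : ∀ f, f ≠ L.outer → (t.arr aX0 (φ f) : ℤ) = L.l f ∧ (t.arr aX1 (φ f) : ℤ) = L.r f ∧
      (t.arr aY0 (φ f) : ℤ) = L.b f ∧ (t.arr aH (φ f) : ℤ) = L.t f - L.b f := by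
    intro f hf
    obtain ⟨d, rfl⟩ := exists_leftFace f
    obtain ⟨-, w1, w2, w3⟩ := i3.walked d (hB d hf)
    exact ⟨(i3.left _ w1).2.1, (i3.right _ w2).2, (i3.left _ w1).2.2, w3⟩
  refine ⟨i4, fun d => ?_, fun d => ?_, fun f => ?_, fun f => ?_, fun f => ?_, fun f => ?_⟩
  · rw [ev_arr rfl]; exact (i3.label d (hK d)).2.1
  · rw [ev_arr rfl]; exact (i3.label d (hK d)).2.2
  all_goals
    by_cases hf : f = L.outer
    · subst hf
      simp [outerRectangle, Code.ev, f1, hz, hab.left, hab.bottom, hW, hH]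
    · have hf' : φ f ≠ φ L.outer := fun hh => hf (h.inj hh)
      have := key f hf
      simp [outerRectangle, Code.ev, f1, hf', this]

end PlanarEmbeddedGraph

/-! ## The check of the labels -/

namespace PlanarEmbeddedGraph

open Code

variable {n k : ℕ} {G : PlanarEmbeddedGraph n} {e : Fin k ≃ G.graph.Dart} {φ : G.Face → ℕ}

/-- The edge from `q` to `q'` is on the boundary of the rectangle with number `f`. -/
def EdgeAt (e : Fin k ≃ G.graph.Dart) (A : ℕ → ℕ → ℕ) (f : ℕ) (q q' : G.graph.Dart) : Prop :=
  RectEdge (A aX0 f) (A aX1 f) (A aY0 f) (A aY0 f + A aH f) (A aX (idx e q)) (A aY (idx e q))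
    (A aX (idx e q')) (A aY (idx e q'))

/-- The dart passes the check of its edge; the outer face has the number `o`. -/
def EdgeOk (e : Fin k ≃ G.graph.Dart) (φ : G.Face → ℕ) (A : ℕ → ℕ → ℕ) (o : ℕ)
    (d : G.graph.Dart) : Prop :=
  (φ (G.leftFace d) ≠ o → EdgeAt e A (φ (G.leftFace d)) d d.symm) ∧
    (φ (G.leftFace d) = o → EdgeAt e A (φ (G.leftFace d)) d.symm d)

/-- The dart passes the check of its position and of its face. -/
def FaceOk (e : Fin k ≃ G.graph.Dart) (φ : G.Face → ℕ) (A : ℕ → ℕ → ℕ) (d : G.graph.Dart) :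
    Prop :=
  A aX (idx e d) = A aX (idx e (G.rot d)) ∧ A aY (idx e d) = A aY (idx e (G.rot d)) ∧
    G.degree (G.leftFace d) / 2 = (G.degree (G.leftFace d) + 1) / 2 ∧
    A aX0 (φ (G.leftFace d)) < A aX1 (φ (G.leftFace d)) ∧ 0 < A aH (φ (G.leftFace d)) ∧
    A aH (φ (G.leftFace d)) = G.degree (G.leftFace d) / 2 -
      (A aX1 (φ (G.leftFace d)) - A aX0 (φ (G.leftFace d)))

theorem ite_chain_eq_zero_iff {c₁ c₂ c₃ c₄ : Prop} [Decidable c₁] [Decidable c₂] [Decidable c₃]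
    [Decidable c₄] (r : ℕ) :
    (if (if c₄ then 1 else if c₃ then 1 else if c₂ then 1 else if c₁ then 1 else 0) = 0 then 1
      else r) = 0 ↔ r = 0 ∧ (c₁ ∨ c₂ ∨ c₃ ∨ c₄) := by
  by_cases h₁ : c₁ <;> by_cases h₂ : c₂ <;> by_cases h₃ : c₃ <;> by_cases h₄ : c₄ <;>
    simp [h₁, h₂, h₃, h₄]

theorem checkEdge_spec {s : RAMState} (h : FaceEnv e φ s) {d : G.graph.Dart}
    (hd : s.reg rI = idx e d) : (checkEdge.ev s).reg rBad = 0 ↔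
      s.reg rBad = 0 ∧ EdgeOk e φ s.arr (s.reg rF) d := by
  have ho := h.input.one
  have hz := h.input.zero
  simp only [checkEdge, Code.ev, ev_guard, ite_setReg, ite_self]
  by_cases hF : φ (G.leftFace d) = s.reg rF
  · simp [hd, ho, hz, h.fid, h.input.sym, hF]
    unfold EdgeOk EdgeAt RectEdge
    simp only [hF, ne_eq, not_true_eq_false, false_imp_iff, true_imp_iff, true_and]
    rw [ite_chain_eq_zero_iff]
    refine and_congr Iff.rfl (or_congr ?_ (or_congr ?_ (or_congr ?_ ?_))) <;> omega
  · simp [hd, ho, hz, h.fid, h.input.sym, hF]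
    unfold EdgeOk EdgeAt RectEdge
    simp only [hF, ne_eq, not_false_eq_true, false_imp_iff, true_imp_iff, and_true]
    rw [ite_chain_eq_zero_iff]
    refine and_congr Iff.rfl (or_congr ?_ (or_congr ?_ (or_congr ?_ ?_))) <;> omega

theorem checkFace_spec {s : RAMState} (h : FaceEnv e φ s) {d : G.graph.Dart}
    (hd : s.reg rI = idx e d) : (checkFace.ev s).reg rBad = 0 ↔
      s.reg rBad = 0 ∧ FaceOk e φ s.arr d := by
  have ho := h.input.one
  have hz := h.input.zero
  simp only [checkFace, Code.ev, ev_guard, ite_setReg, ite_self]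
  simp [hd, ho, hz, h.fid, h.input.rot, h.half, h.half']
  by_cases hc : FaceOk e φ s.arr d
  · rw [if_neg fun hn => ?_]
    · simp [hc]
    · obtain ⟨c1, c2, c3, c4, c5, c6⟩ := hc
      exact hn c1 c2 c3 c4 c5 c6
  · rw [if_pos fun c1 c2 c3 c4 c5 c6 => hc ⟨c1, c2, c3, c4, c5, c6⟩]
    simp [hc]

/-- `rRes` is never reset, so one successful check among all pairs decides the answer. -/
theorem checkAll_spec {s : RAMState} (h : FaceEnv e φ s) :
    (checkAll.ev s).reg rRes = 1 ∧ (∀ d, EdgeOk e φ s.arr (s.reg rF) d ∧ FaceOk e φ s.arr d) ∨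
      (checkAll.ev s).reg rRes = s.reg rRes ∧
      ¬ ∀ d, EdgeOk e φ s.arr (s.reg rF) d ∧ FaceOk e φ s.arr d := by
  have h1 : FaceEnv e φ ((move rBad rZero).ev s) := h.ev rfl
  have := loop_induction (x := rI) (y := rK) (s := (move rBad rZero).ev s)
    (B := checkEdge ;; checkFace)
    (fun j s' => FaceEnv e φ s' ∧ s'.reg rF = s.reg rF ∧ s'.arr = s.arr ∧
      s'.reg rRes = s.reg rRes ∧ (s'.reg rBad = 0 ↔
        ∀ d, idx e d < j → EdgeOk e φ s.arr (s.reg rF) d ∧ FaceOk e φ s.arr d))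
    (fun j s' v hs' => ⟨hs'.1.setReg (by simp [constRegs]), by simpa using hs'.2⟩)
    ⟨h1, rfl, rfl, rfl, by simp [Code.ev, h.input.zero]⟩ ?_
  · rw [h1.input.k] at this
    rw [show checkAll.ev s = (guard [.lt rBad rOne] (move rRes rOne)).ev
      ((loop rI rK (checkEdge ;; checkFace)).ev ((move rBad rZero).ev s)) from rfl]
    generalize (loop rI rK (checkEdge ;; checkFace)).ev ((move rBad rZero).ev s) = t at *
    obtain ⟨i1, -, -, i2, i3⟩ := this
    simp only [idx_lt, true_imp_iff] at i3
    simp only [ev_guard, List.forall_mem_cons, List.not_mem_nil, false_imp_iff, implies_true,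
      and_true, Test.holds_lt, i1.input.one, Nat.lt_one_iff]
    by_cases hc : t.reg rBad = 0
    · refine Or.inl ⟨?_, i3.1 hc⟩
      simp [hc, Code.ev, i1.input.one]
    · refine Or.inr ⟨?_, fun hh => hc (i3.2 hh)⟩
      simp [hc, i2]
  · rintro j hj s' hI ⟨i1, i2, i3, i4, i5⟩
    rw [h1.input.k] at hj
    obtain ⟨d, rfl⟩ := exists_idx e hj
    have k1 := checkEdge_spec i1 hI
    have k2 := checkFace_spec (s := checkEdge.ev s') (d := d) (i1.ev rfl) ((ev_reg rfl s').trans hI)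
    have a1 : (checkEdge.ev s').arr = s.arr := by
      rw [← i3]; funext a; exact ev_arr rfl s'
    have a2 : (checkFace.ev (checkEdge.ev s')).arr = s.arr := by
      rw [← a1]; funext a; exact ev_arr rfl _
    have i6 : FaceEnv e φ (checkEdge.ev s') := i1.ev rfl
    have i7 : FaceEnv e φ (checkFace.ev (checkEdge.ev s')) := i6.ev rfl
    have f1 : (checkFace.ev (checkEdge.ev s')).reg rF = s.reg rF := by
      rw [ev_reg rfl, ev_reg rfl, i2]
    have f2 : (checkFace.ev (checkEdge.ev s')).reg rRes = s.reg rRes := by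
      rw [ev_reg rfl, ev_reg rfl, i4]
    rw [a1] at k2
    rw [i3, i2] at k1
    rw [show (checkEdge ;; checkFace).ev s' = checkFace.ev (checkEdge.ev s') from rfl]
    refine ⟨i7, f1, a2, f2, ?_⟩
    rw [k2, k1, i5]
    constructor
    · rintro ⟨⟨g1, g2⟩, g3⟩ d' hd'
      rcases Nat.lt_succ_iff_lt_or_eq.1 hd' with hd' | hd'
      · exact g1 d' hd'
      · rw [(idx_inj e).1 hd']
        exact ⟨g2, g3⟩
    · intro g
      exact ⟨⟨fun d' hd' => g d' (hd'.trans (Nat.lt_succ_self _)), (g d (Nat.lt_succ_self _)).1⟩,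
        (g d (Nat.lt_succ_self _)).2⟩

theorem rectEdge_natCast {l r b t x y x' y' : ℕ} :
    RectEdge (l : ℤ) r b t x y x' y' ↔ RectEdge l r b t x y x' y' := by
  unfold RectEdge
  refine or_congr ?_ (or_congr ?_ (or_congr ?_ ?_)) <;> omega

/-- The labels of a layout pass the check. -/
theorem Labelled.ok {L : G.RectLayout} {s : RAMState} (h : Labelled L e φ s) (d : G.graph.Dart) :
    EdgeOk e φ s.arr (φ L.outer) d ∧ FaceOk e φ s.arr d := by
  have hl := L.l_lt (G.leftFace d)
  have hb := L.b_lt (G.leftFace d)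
  have hdeg := L.degree_eq (G.leftFace d)
  have h1 := h.l (G.leftFace d)
  have h2 := h.r (G.leftFace d)
  have h3 := h.b (G.leftFace d)
  have h4 := h.h (G.leftFace d)
  have h5 := h.x d
  have h6 := h.y d
  have h7 := h.x d.symm
  have h8 := h.y d.symm
  have h9 := h.x (G.rot d)
  have h10 := h.y (G.rot d)
  rw [dart_symm_fst] at h7 h8
  rw [G.rot_fst] at h9 h10
  have h11 : ((s.arr aY0 (φ (G.leftFace d)) + s.arr aH (φ (G.leftFace d)) : ℕ) : ℤ) =
      L.t (G.leftFace d) := by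
    push_cast
    omega
  refine ⟨⟨fun hf => ?_, fun hf => ?_⟩, ?_⟩
  · unfold EdgeAt
    rw [← rectEdge_natCast, h11, h1, h2, h3, h5, h6, h7, h8]
    exact L.inner_edge d fun hh => hf (by rw [hh])
  · have hf' := h.env.inj hf
    have := L.outer_edge d hf'
    rw [← hf'] at this
    unfold EdgeAt
    rw [← rectEdge_natCast, h11, h1, h2, h3, h5, h6, h7, h8]
    exact this
  · unfold FaceOk
    refine ⟨?_, ?_, ?_, ?_, ?_, ?_⟩ <;> omega

/-- Labels that pass the check give a layout. -/
theorem nonempty_rectLayout_of_ok {s : RAMState} (h : FaceEnv e φ s) {f0 : G.Face}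
    (hd : ∀ v, ∃ d : G.graph.Dart, d.fst = v)
    (hok : ∀ d, EdgeOk e φ s.arr (φ f0) d ∧ FaceOk e φ s.arr d) : Nonempty G.RectLayout := by
  choose δ hδ using hd
  -- Positions are checked only between a dart and the next one around its start vertex; the
  -- cyclicity of `rot` extends the equality to all darts there.
  have hcyc : ∀ d d' : G.graph.Dart, d.fst = d'.fst → s.arr aX (idx e d) = s.arr aX (idx e d') ∧
      s.arr aY (idx e d) = s.arr aY (idx e d') := by
    intro d d' hdd
    obtain ⟨i, -, rfl⟩ := (G.rot_cyclic d d' hdd).exists_pow_eq'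
    clear hdd
    induction i with
    | zero => simp
    | succ i ih =>
      rw [pow_succ', Equiv.Perm.mul_apply]
      have := (hok ((G.rot ^ i) d)).2
      exact ⟨ih.1.trans this.1, ih.2.trans this.2.1⟩
  have hx : ∀ d : G.graph.Dart, s.arr aX (idx e (δ d.fst)) = s.arr aX (idx e d) := fun d => (hcyc _ d (hδ _)).1
  have hy : ∀ d : G.graph.Dart, s.arr aY (idx e (δ d.fst)) = s.arr aY (idx e d) := fun d => (hcyc _ d (hδ _)).2
  have hx' : ∀ d : G.graph.Dart, s.arr aX (idx e (δ d.snd)) = s.arr aX (idx e d.symm) := fun d => hx d.symm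
  have hy' : ∀ d : G.graph.Dart, s.arr aY (idx e (δ d.snd)) = s.arr aY (idx e d.symm) := fun d => hy d.symm
  refine ⟨⟨fun v => s.arr aX (idx e (δ v)), fun v => s.arr aY (idx e (δ v)), f0,
    fun f => s.arr aX0 (φ f), fun f => s.arr aX1 (φ f), fun f => s.arr aY0 (φ f),
    fun f => s.arr aY0 (φ f) + s.arr aH (φ f), fun f => ?_, fun f => ?_, fun d hf => ?_,
    fun d hf => ?_, fun f => ?_, fun v => ⟨δ v, hδ v⟩⟩⟩
  · obtain ⟨d, rfl⟩ := exists_leftFace f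
    have := (hok d).2
    unfold FaceOk at this
    omega
  · obtain ⟨d, rfl⟩ := exists_leftFace f
    have := (hok d).2
    unfold FaceOk at this
    omega
  · have := (hok d).1.1 fun hh => hf (h.inj hh)
    rw [hx, hy, hx', hy', ← Nat.cast_add, rectEdge_natCast]
    exact this
  · have := (hok d).1.2 (by rw [hf])
    rw [hf] at this
    rw [hx, hy, hx', hy', ← Nat.cast_add, rectEdge_natCast]
    exact this
  · obtain ⟨d, rfl⟩ := exists_leftFace f
    have := (hok d).2
    unfold FaceOk at this
    omega

end PlanarEmbeddedGraph

/-! ## The search -/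

namespace PlanarEmbeddedGraph

open Code

variable {n k : ℕ} {G : PlanarEmbeddedGraph n} {e : Fin k ≃ G.graph.Dart} {φ : G.Face → ℕ}

/-- A layout in standard position has a start. -/
theorem RectLayout.exists_isStart (L : G.RectLayout) (hl : L.l L.outer = 0)
    (hb : L.b L.outer = 0) : ∃ a b, IsStart L a b ∧ L.IsCorner a ∧ L.IsCorner b := by
  have hlr := L.l_lt L.outer
  have hbt := L.b_lt L.outer
  obtain ⟨a, ha, ha1, ha2, ha3, ha4⟩ := L.exists_outer_edge (u := 0) (v := 1) (u' := 0) (v' := 0)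
    (by unfold RectEdge; omega)
  obtain ⟨b, hb', hb1, hb2, hb3, hb4⟩ := L.exists_outer_edge (u := 1) (v := L.t L.outer) (u' := 0)
    (v' := L.t L.outer) (by unfold RectEdge; omega)
  have key : ∀ d, G.leftFace d = L.outer → ∀ j, L.dir d = j → (L.x d.snd = L.x d.fst + dirX j) ∧
      (L.y d.snd = L.y d.fst + dirY j) ∧ (L.dir (G.faceNext.symm d) = j →
        L.x d.fst = L.x (G.faceNext.symm d).fst + dirX j ∧
        L.y d.fst = L.y (G.faceNext.symm d).fst + dirY j) := by
    rintro d hd j rfl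
    refine ⟨L.x_snd d, L.y_snd d, fun h => ?_⟩
    rw [← h, ← L.x_snd, ← L.y_snd, faceNext_symm_snd]
    exact ⟨rfl, rfl⟩
  have hda : L.dir a = 1 := by
    have h1 := L.outer_edge_dir ha
    have h2 := L.x_snd a
    have h3 := L.y_snd a
    rcases h1 with ⟨h1, h4⟩ | ⟨h1, h4⟩ | ⟨h1, h4⟩ | ⟨h1, h4⟩ <;> rw [h1] at h2 h3 <;>
      simp only [dirX, dirY] at h2 h3 <;> norm_num at h2 h3 <;> omega
  have hdb : L.dir b = 0 := by
    have h1 := L.outer_edge_dir hb'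
    have h2 := L.x_snd b
    have h3 := L.y_snd b
    rcases h1 with ⟨h1, h4⟩ | ⟨h1, h4⟩ | ⟨h1, h4⟩ | ⟨h1, h4⟩ <;> rw [h1] at h2 h3 <;>
      simp only [dirX, dirY] at h2 h3 <;> norm_num at h2 h3 <;> omega
  refine ⟨a, b, ⟨hl, hb, ha, hda, ha3, ha4, hb', hdb, hb3, hb4⟩, ⟨ha, fun h => ?_⟩, ⟨hb', fun h => ?_⟩⟩
  · have h1 := (key a ha 1 hda).2.2 (h.trans hda)
    have h2 := L.outer_edge_dir ((leftFace_faceNext_symm a).trans ha)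
    rw [h, hda] at h2
    simp [dirY] at h1
    omega
  · have h1 := (key b hb' 0 hdb).2.2 (h.trans hdb)
    have h2 := L.outer_edge_dir ((leftFace_faceNext_symm b).trans hb')
    rw [h, hdb] at h2
    simp [dirX] at h1
    omega

theorem tryCorners_eq (s : RAMState) : tryCorners.ev s =
    checkAll.ev ((Code.clear ;; labelOuter ;; labelAll ;; outerRectangle).ev s) := by
  simp only [tryCorners, Code.ev]

theorem tryCorners_of_isStart {L : G.RectLayout} {a b : G.graph.Dart} (hab : IsStart L a b)
    {s : RAMState} (h : FaceEnv e φ s) (hA : s.reg rA = idx e a) (hB : s.reg rB = idx e b)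
    (hM : s.reg rMax = G.degree L.outer / 2) (hF : s.reg rF = φ L.outer) :
    (tryCorners.ev s).reg rRes = 1 := by
  have h1 := labelled_of_isStart hab h hA hB hM hF
  have h2 := ev_reg (P := Code.clear ;; labelOuter ;; labelAll ;; outerRectangle) (q := rF) rfl s
  rw [tryCorners_eq]
  generalize (Code.clear ;; labelOuter ;; labelAll ;; outerRectangle).ev s = t at *
  rcases checkAll_spec h1.env with h3 | h3
  · exact h3.1
  · exact (h3.2 fun d => by rw [h2, hF]; exact h1.ok d).elim

/-- Soundness needs nothing about how the labels arose: labels that pass the check are a layout. If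
`rF` is not the number of a face, some face has half-degree 0 and fails the check, as its height
cannot be positive. -/
theorem tryCorners_spec {s : RAMState} (h : FaceEnv e φ s)
    (hd : ∀ v, ∃ d : G.graph.Dart, d.fst = v)
    (hF : (∃ f, φ f = s.reg rF) ∨ ∃ d : G.graph.Dart, G.degree (G.leftFace d) / 2 = 0) :
    (tryCorners.ev s).reg rRes = s.reg rRes ∨
      ((tryCorners.ev s).reg rRes = 1 ∧ Nonempty G.RectLayout) := by
  have h1 : FaceEnv e φ ((Code.clear ;; labelOuter ;; labelAll ;; outerRectangle).ev s) := h.ev rfl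
  have h2 := ev_reg (P := Code.clear ;; labelOuter ;; labelAll ;; outerRectangle) (q := rF) rfl s
  have h3 := ev_reg (P := Code.clear ;; labelOuter ;; labelAll ;; outerRectangle) (q := rRes) rfl s
  rw [tryCorners_eq]
  generalize (Code.clear ;; labelOuter ;; labelAll ;; outerRectangle).ev s = t at *
  rcases checkAll_spec h1 with ⟨h4, h5⟩ | ⟨h4, -⟩
  · refine Or.inr ⟨h4, ?_⟩
    rcases hF with ⟨f, hf⟩ | ⟨d, hd0⟩
    · exact nonempty_rectLayout_of_ok (f0 := f) h1 hd fun d => by rw [hf, ← h2]; exact h5 d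
    · have := (h5 d).2
      unfold FaceOk at this
      omega
  · exact Or.inl (h4.trans h3)

/-- The candidates with numbers `p` and `q` are the start of a layout. -/
def Good (e : Fin k ≃ G.graph.Dart) (φ : G.Face → ℕ) (s : RAMState) (p q : ℕ) : Prop :=
  ∃ (L : G.RectLayout) (a b : G.graph.Dart), IsStart L a b ∧ s.reg rMax = G.degree L.outer / 2 ∧
    s.reg rF = φ L.outer ∧ s.arr aCand p = idx e a ∧ s.arr aCand q = idx e b

/-- The search is going on, and has not changed the data from the state `s`. -/
structure Searching (e : Fin k ≃ G.graph.Dart) (φ : G.Face → ℕ) (s s' : RAMState) : Prop where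
  env : FaceEnv e φ s'
  face : s'.reg rF = s.reg rF
  half : s'.reg rMax = s.reg rMax
  count : s'.reg rNc = s.reg rNc
  cand : s'.arr aCand = s.arr aCand
  res : s'.reg rRes = 0 ∨ s'.reg rRes = 1 ∧ Nonempty G.RectLayout

theorem Searching.setReg {s s' : RAMState} (h : Searching e φ s s') {r v : ℕ}
    (hr : r = rP ∨ r = rQ) : Searching e φ s (s'.setReg r v) := by
  rcases hr with rfl | rfl
  · exact ⟨h.env.setReg (by decide), h.face, h.half, h.count, h.cand, h.res⟩
  · exact ⟨h.env.setReg (by decide), h.face, h.half, h.count, h.cand, h.res⟩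

theorem Searching.tryPair {s s' : RAMState} (h : Searching e φ s s')
    (hd : ∀ v, ∃ d : G.graph.Dart, d.fst = v)
    (hF : (∃ f, φ f = s.reg rF) ∨ ∃ d : G.graph.Dart, G.degree (G.leftFace d) / 2 = 0) :
    Searching e φ s ((load rA aCand rP ;; load rB aCand rQ ;; tryCorners).ev s') ∧
      (s'.reg rRes = 1 → ((load rA aCand rP ;; load rB aCand rQ ;; tryCorners).ev s').reg rRes = 1) ∧
      (Good e φ s (s'.reg rP) (s'.reg rQ) →
        ((load rA aCand rP ;; load rB aCand rQ ;; tryCorners).ev s').reg rRes = 1) := by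
  rw [show (load rA aCand rP ;; load rB aCand rQ ;; tryCorners).ev s' =
    tryCorners.ev ((load rA aCand rP ;; load rB aCand rQ).ev s') by simp only [Code.ev]]
  have h1 : FaceEnv e φ ((load rA aCand rP ;; load rB aCand rQ).ev s') := h.env.ev rfl
  have h2 : ((load rA aCand rP ;; load rB aCand rQ).ev s').reg rA = s'.arr aCand (s'.reg rP) := by
    simp [Code.ev]
  have h3 : ((load rA aCand rP ;; load rB aCand rQ).ev s').reg rB = s'.arr aCand (s'.reg rQ) := by
    simp [Code.ev]
  have h4 : ∀ r ∈ [rF, rMax, rNc, rRes],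
      ((load rA aCand rP ;; load rB aCand rQ).ev s').reg r = s'.reg r := keeps_reg (A := []) rfl s'
  have h5 : ((load rA aCand rP ;; load rB aCand rQ).ev s').arr aCand = s'.arr aCand := ev_arr rfl s'
  generalize (load rA aCand rP ;; load rB aCand rQ).ev s' = t at *
  simp only [List.forall_mem_cons, List.not_mem_nil, false_imp_iff, implies_true, and_true] at h4
  obtain ⟨g1, g2, g3, g4⟩ := h4
  have h6 : FaceEnv e φ (tryCorners.ev t) := h1.ev rfl
  have h7 := tryCorners_spec h1 hd (by rw [g1, h.face]; exact hF)
  refine ⟨⟨h6, ?_, ?_, ?_, ?_, ?_⟩, fun hr => ?_, ?_⟩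
  · rw [ev_reg rfl, g1, h.face]
  · rw [ev_reg rfl, g2, h.half]
  · rw [ev_reg rfl, g3, h.count]
  · rw [ev_arr rfl, h5, h.cand]
  · rcases h7 with h7 | h7
    · rw [h7, g4]; exact h.res
    · exact Or.inr h7
  · rcases h7 with h7 | h7
    · rw [h7, g4, hr]
    · exact h7.1
  · rintro ⟨L, a, b, hab, k1, k2, k3, k4⟩
    exact tryCorners_of_isStart hab h1 (by rw [h2, h.cand, k3]) (by rw [h3, h.cand, k4])
      (by rw [g2, h.half, k1]) (by rw [g1, h.face, k2])

theorem tryAll_spec {s : RAMState} (h : FaceEnv e φ s) (h0 : s.reg rRes = 0)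
    (hd : ∀ v, ∃ d : G.graph.Dart, d.fst = v)
    (hF : (∃ f, φ f = s.reg rF) ∨ ∃ d : G.graph.Dart, G.degree (G.leftFace d) / 2 = 0) :
    Searching e φ s (tryAll.ev s) ∧ ∀ p < s.reg rNc, ∀ q < s.reg rNc, Good e φ s p q →
      (tryAll.ev s).reg rRes = 1 := by
  refine loop_induction (x := rP) (y := rNc) (s := s)
    (B := loop rQ rNc (load rA aCand rP ;; load rB aCand rQ ;; tryCorners))
    (fun j s' => Searching e φ s s' ∧ ∀ p < j, ∀ q < s.reg rNc, Good e φ s p q → s'.reg rRes = 1)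
    (fun j s' v hs' => ⟨hs'.1.setReg (Or.inl rfl), by simpa using hs'.2⟩)
    ⟨⟨h, rfl, rfl, rfl, rfl, Or.inl h0⟩, fun p hp => by omega⟩ ?_
  rintro j - s' hI ⟨h1, h2⟩
  have := loop_induction (x := rQ) (y := rNc) (s := s')
    (B := load rA aCand rP ;; load rB aCand rQ ;; tryCorners)
    (fun i s'' => Searching e φ s s'' ∧ s''.reg rP = j ∧
      (∀ p < j, ∀ q < s.reg rNc, Good e φ s p q → s''.reg rRes = 1) ∧
      ∀ q < i, Good e φ s j q → s''.reg rRes = 1)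
    (fun i s'' v hs' => ⟨hs'.1.setReg (Or.inr rfl), by simpa using hs'.2⟩)
    ⟨h1, hI, h2, fun p hp => by omega⟩ ?_
  · rw [h1.count] at this
    refine ⟨this.1, fun p hp q hq hg => ?_⟩
    rcases Nat.lt_succ_iff_lt_or_eq.1 hp with hp | rfl
    · exact this.2.2.1 p hp q hq hg
    · exact this.2.2.2 q hq hg
  · rintro i - s'' hQ ⟨k1, k2, k3, k4⟩
    obtain ⟨m1, m2, m3⟩ := k1.tryPair hd hF
    have m4 := ev_reg (P := load rA aCand rP ;; load rB aCand rQ ;; tryCorners) (q := rP) rfl s''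
    rw [k2, hQ] at m3
    generalize (load rA aCand rP ;; load rB aCand rQ ;; tryCorners).ev s'' = t at *
    refine ⟨m1, m4.trans k2, fun p hp q hq hg => m2 (k3 p hp q hq hg), fun q hq hg => ?_⟩
    rcases Nat.lt_succ_iff_lt_or_eq.1 hq with hq | rfl
    · exact m2 (k4 q hq hg)
    · exact m3 hg

/-- Degrees in a layout are even, so a face with the largest half-degree has maximum degree and can
be taken as the outer face. -/
theorem search_spec {s : RAMState} (h : FaceEnv e φ s) (h0 : s.reg rRes = 0)
    (hd : ∀ v, ∃ d : G.graph.Dart, d.fst = v) (hM : s.reg rMax = 0) (hc : s.reg rNc = 0)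
    (hs : s.reg rNs = 0) :
    (search.ev s).reg rRes = 1 ↔ Nonempty G.RectLayout := by
  rw [show search.ev s = tryAll.ev (candidates.ev (maxFace.ev s)) from rfl]
  obtain ⟨h1, h2⟩ := maxFace_spec h hM
  have e1 : FaceEnv e φ (maxFace.ev s) := h.ev rfl
  have c1 : (maxFace.ev s).reg rNc = 0 := by rw [ev_reg rfl, hc]
  have s1 : (maxFace.ev s).reg rNs = 0 := by rw [ev_reg rfl, hs]
  have r1 : (maxFace.ev s).reg rRes = 0 := by rw [ev_reg rfl, h0]
  generalize maxFace.ev s = t at *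
  obtain ⟨e2, k1, -, k2⟩ := candidates_spec e1 c1 s1
  have r2 : (candidates.ev t).reg rRes = 0 := by rw [ev_reg rfl, r1]
  have m2 : (candidates.ev t).reg rMax = t.reg rMax := ev_reg rfl t
  have f2 : (candidates.ev t).reg rF = t.reg rF := ev_reg rfl t
  generalize candidates.ev t = t' at *
  by_cases hne : Nonempty G.graph.Dart
  · obtain ⟨d0⟩ := hne
    have hF : (∃ f, φ f = t'.reg rF) ∨ ∃ d : G.graph.Dart, G.degree (G.leftFace d) / 2 = 0 := by
      rcases h2 with h2 | ⟨f, hf, -⟩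
      · have := h1 (G.leftFace d0)
        exact Or.inr ⟨d0, by omega⟩
      · exact Or.inl ⟨f, by rw [f2, hf]⟩
    obtain ⟨j1, j2⟩ := tryAll_spec e2 r2 hd hF
    constructor
    · intro hr
      rcases j1.res with hr' | hr'
      · omega
      · exact hr'.2
    · rintro ⟨L⟩
      have hL := fun f => L.degree_eq f
      have hout : 2 ≤ G.degree L.outer / 2 := by
        have := hL L.outer
        have := L.l_lt L.outer
        have := L.b_lt L.outer
        omega
      rcases h2 with h2 | ⟨f0, hf, hdeg⟩
      · have := h1 L.outer
        omega
      -- The given layout may have another outer face than the one chosen by the program; it is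
      -- exchanged for one that agrees.
      obtain ⟨L', rfl, hl, hb⟩ := L.exists_outer_eq (f := f0) fun g => by
        have := h1 g
        have := hL g
        have := hL f0
        omega
      obtain ⟨a, b, hab, ha, hb'⟩ := L'.exists_isStart hl hb
      have hcand : ∀ d, L'.IsCorner d → IsCandidate L'.outer d := by
        intro d hd
        rcases hd.candidate with h3 | h3
        · exact Or.inr ⟨hd.1, hd.rot_rot, h3, L'.leftFace_symm_ne_outer hd.1⟩
        · exact Or.inl h3
      have hS := L'.card_smallCandidates_le
      obtain ⟨p, hp, hp'⟩ := k2 _ hf hS a (hcand a ha)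
      obtain ⟨q, hq, hq'⟩ := k2 _ hf hS b (hcand b hb')
      exact j2 p hp q hq ⟨L', a, b, hab, by rw [m2, hdeg], by rw [f2, hf], hp', hq'⟩
  · have hk : k = 0 := by
      by_contra hk
      exact hne ⟨e ⟨0, by omega⟩⟩
    have hc0 : t'.reg rNc = 0 := by omega
    constructor
    · intro hr
      simp [tryAll, Code.ev, hc0, Code.iter, r2] at hr
    · rintro ⟨L⟩
      obtain ⟨d, -⟩ := exists_leftFace L.outer
      exact (hne ⟨d⟩).elim

end PlanarEmbeddedGraph

/-! ## The running time -/

namespace Code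

/-- The part of the program that tries two candidates. -/
def tryPair : Code := load rA aCand rP ;; load rB aCand rQ ;; tryCorners

/-- The two loops over candidates contribute the square; everything inside is bounded by loops of
`rK` rounds that are not nested in each other. -/
theorem tryAll_cost_le {s : RAMState} {m : ℕ} (hk : s.reg rK ≤ m) :
    tryAll.cost s ≤ (tryPair.size + 4) * (s.reg rNc + 1) ^ 2 * (m + 1) := by
  have h1 : tryAll.cost s ≤ tryAll.costBound s.reg := by
    refine cost_le fun y hy => ⟨le_rfl, ?_⟩
    have h2 : (tryAll.boundRegs.all fun y => !tryAll.writes y) = true := by rfl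
    simp only [List.all_eq_true, Bool.not_eq_true'] at h2
    exact h2 y (mem_boundRegs hy)
  have h3 : tryPair.costBound s.reg ≤ tryPair.size * (m + 1) ^ tryPair.depth := by
    refine costBound_le fun y hy => ?_
    have h2 : (tryPair.boundRegs.all fun y => y == rK) = true := by rfl
    simp only [List.all_eq_true, beq_iff_eq] at h2
    rw [h2 y hy]
    exact hk
  rw [show tryPair.depth = 1 from rfl, pow_one] at h3
  have h4 : tryAll.costBound s.reg =
      s.reg rNc * ((s.reg rNc * (tryPair.costBound s.reg + 2) + 2) + 2) + 2 := by
    simp only [tryAll, tryPair, costBound]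
  rw [h4] at h1
  generalize tryPair.costBound s.reg = b at *
  generalize tryPair.size = c at *
  generalize s.reg rNc = r at *
  refine h1.trans ?_
  calc r * ((r * (b + 2) + 2) + 2) + 2 ≤ (b + 4) * (r + 1) ^ 2 := by nlinarith
    _ ≤ ((c + 4) * (m + 1)) * (r + 1) ^ 2 := Nat.mul_le_mul_right _ (by nlinarith)
    _ = (c + 4) * (r + 1) ^ 2 * (m + 1) := by ring

theorem search_cost_le {s : RAMState} :
    search.cost s ≤ (maxFace.size + candidates.size + tryPair.size + 4) *
      ((candidates.ev (maxFace.ev s)).reg rNc + 1) ^ 2 * (s.reg rK + 1) := by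
  have h1 : maxFace.cost s ≤ maxFace.size * (s.reg rK + 1) ^ maxFace.depth :=
    cost_le_size (R := [rK]) rfl (by simp)
  have h2 : candidates.cost (maxFace.ev s) ≤ candidates.size * (s.reg rK + 1) ^ candidates.depth :=
    cost_le_size (R := [rK]) rfl (by
      simp only [List.forall_mem_cons, List.not_mem_nil, false_imp_iff, implies_true, and_true]
      rw [ev_reg rfl])
  have h3 : tryAll.cost (candidates.ev (maxFace.ev s)) ≤ _ :=
    tryAll_cost_le (m := s.reg rK) (by rw [ev_reg rfl, ev_reg rfl])
  rw [show maxFace.depth = 1 from rfl, pow_one] at h1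
  rw [show candidates.depth = 1 from rfl, pow_one] at h2
  rw [show search.cost s = maxFace.cost s + (candidates.cost (maxFace.ev s) +
    tryAll.cost (candidates.ev (maxFace.ev s))) from rfl]
  generalize (candidates.ev (maxFace.ev s)).reg rNc = r at *
  have h4 : 1 ≤ (r + 1) ^ 2 := Nat.one_le_pow _ _ (by omega)
  calc _ ≤ maxFace.size * (s.reg rK + 1) * (r + 1) ^ 2 + (candidates.size * (s.reg rK + 1) *
        (r + 1) ^ 2 + (tryPair.size + 4) * (r + 1) ^ 2 * (s.reg rK + 1)) := by
        gcongr
        · exact h1.trans (Nat.le_mul_of_pos_right _ h4)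
        · exact h2.trans (Nat.le_mul_of_pos_right _ h4)
    _ = _ := by ring

end Code

namespace PlanarEmbeddedGraph

open Code

variable {n k : ℕ} {G : PlanarEmbeddedGraph n} {e : Fin k ≃ G.graph.Dart} {φ : G.Face → ℕ}

theorem card_connectedComponent_le_one_iff :
    Nat.card G.graph.ConnectedComponent ≤ 1 ↔ G.graph.Preconnected := by
  rw [Finite.card_le_one_iff_subsingleton]
  constructor
  · intro h u v
    exact SimpleGraph.ConnectedComponent.exact (Subsingleton.elim _ _)
  · intro h
    refine ⟨fun a b => ?_⟩
    induction a using SimpleGraph.ConnectedComponent.ind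
    induction b using SimpleGraph.ConnectedComponent.ind
    exact SimpleGraph.ConnectedComponent.sound (h _ _)

theorem card_dart (e : Fin k ≃ G.graph.Dart) : k = 2 * Nat.card G.graph.edgeSet := by
  classical
  rw [Nat.card_eq_fintype_card, ← SimpleGraph.edgeFinset_card,
    ← SimpleGraph.dart_card_eq_twice_card_edges, ← Fintype.card_fin k]
  convert Fintype.card_congr e

/-- Without isolated vertices, twice Euler's formula contains only numbers that the program can
count. It follows that `2 * n + 2 * F < k + 5`, for `F` faces, exactly when there is at most one
component. -/
theorem euler_of_exists_dart (e : Fin k ≃ G.graph.Dart)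
    (hd : ∀ v, ∃ d : G.graph.Dart, d.fst = v) :
    2 * n + 2 * Nat.card G.Face = k + 4 * Nat.card G.graph.ConnectedComponent := by
  have h1 := card_dart e
  have h2 : n + (Nat.card G.Face + Nat.card {v : Fin n // ∀ w, ¬ G.graph.Adj v w}) = _ := G.euler
  have h3 : Nat.card {v : Fin n // ∀ w, ¬ G.graph.Adj v w} = 0 := by
    rw [Nat.card_eq_zero]
    left
    refine ⟨fun v => ?_⟩
    obtain ⟨d, hd⟩ := hd v.1
    exact v.2 d.snd (hd ▸ d.adj)
  omega

theorem URFE.connected (h : G.URFE) : G.graph.Connected := by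
  obtain ⟨p, hp⟩ := h
  exact hp.exists_layout.1

/-- Half-degree above 3 means degree above 6. If only one face is that large, it is the selected
face of maximum half-degree, so no candidate next to another large face is listed. -/
theorem card_candidates_le {s : RAMState} (h : FaceEnv e φ s) (hM : s.reg rMax = 0)
    (hc : s.reg rNc = 0) (hs : s.reg rNs = 0) :
    (candidates.ev (maxFace.ev s)).reg rNc ≤ k ∧
      ((∀ f g : G.Face, 6 < G.degree f → 6 < G.degree g → f = g) →
        (candidates.ev (maxFace.ev s)).reg rNc ≤ 12) := by
  obtain ⟨h1, h2⟩ := maxFace_spec h hM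
  obtain ⟨-, k1, k2, -⟩ := candidates_spec (s := maxFace.ev s) (h.ev rfl)
    (by rw [ev_reg rfl, hc]) (by rw [ev_reg rfl, hs])
  refine ⟨k1, fun hH => k2 fun d hd hdeg => ?_⟩
  rcases h2 with h2 | ⟨f, hf, h2⟩
  · have := h1 (G.leftFace d.symm)
    omega
  · have h3 : f = G.leftFace d := h.inj (hf.trans hd.symm)
    have h4 := h1 (G.leftFace d.symm)
    rw [← hd, ← h3, hH f (G.leftFace d.symm) (by omega) (by omega)]

/-- The search runs only if there is at most one component. The factor 169 is the square of 12 + 1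
and comes from the pairs of at most 12 candidates. -/
theorem numberFaces_spec {s : RAMState} (h : InputEnv e s)
    (hn : ∀ d, s.arr aNxt (idx e d) = idx e (G.faceNext d))
    (h0 : ∀ r ∈ [rD, rE, rRes, rMax, rNc, rNs], s.reg r = 0)
    (hF : ∀ a ∈ [aFid, aHf, aHc], ∀ i, s.arr a i = 0)
    (hd : ∀ v, ∃ d : G.graph.Dart, d.fst = v) (hsum : s.reg rSum = 2 * n) :
    ((numberFaces.ev s).reg rRes = 1 ↔ G.URFE) ∧
      numberFaces.cost s ≤ (traverseFaces.size + maxFace.size + candidates.size + tryPair.size + 12) *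
        (k + 1) ^ 3 ∧
      ((G.graph.Connected → ∀ f g : G.Face, 6 < G.degree f → 6 < G.degree g → f = g) →
        numberFaces.cost s ≤ (traverseFaces.size + maxFace.size + candidates.size + tryPair.size + 12) *
          169 * (k + 1)) := by
  simp only [List.forall_mem_cons, List.not_mem_nil, false_imp_iff, implies_true, and_true] at h0 hF
  obtain ⟨hD, hE, hR, hM, hc, hs⟩ := h0
  obtain ⟨hF1, hF2, hF3⟩ := hF
  obtain ⟨h1, φ, h2⟩ := traverseFaces_spec h hn hD hE hF1 hF2 hF3
  have hcost : traverseFaces.cost s ≤ traverseFaces.size * (k + 1) ^ traverseFaces.depth :=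
    cost_le_size (R := [rK]) rfl (by simp [h.k])
  rw [show traverseFaces.depth = 1 from rfl, pow_one] at hcost
  obtain ⟨t, ht⟩ : ∃ t, t = (inc u0 rK ;; inc u0 u0 ;; inc u0 u0 ;; inc u0 u0 ;; inc u0 u0).ev
    (traverseFaces.ev s) := ⟨_, rfl⟩
  have i1 : FaceEnv e φ t := by rw [ht]; exact h2.ev rfl
  have iu : t.reg u0 = k + 5 := by rw [ht]; simp [Code.ev, h2.input.k]
  have is : t.reg rSum = 2 * n + 2 * Nat.card G.Face := by rw [ht, ev_reg rfl, h1, hsum]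
  have iR : t.reg rRes = 0 := by rw [ht, ev_reg rfl, ev_reg rfl, hR]
  have iM : t.reg rMax = 0 := by rw [ht, ev_reg rfl, ev_reg rfl, hM]
  have ic : t.reg rNc = 0 := by rw [ht, ev_reg rfl, ev_reg rfl, hc]
  have ins : t.reg rNs = 0 := by rw [ht, ev_reg rfl, ev_reg rfl, hs]
  have heuler := euler_of_exists_dart e hd
  have hev : (numberFaces.ev s).reg rRes = ((ite rSum u0 search skip).ev t).reg rRes := by
    rw [ht]; rfl
  have hco : numberFaces.cost s = traverseFaces.cost s + (1 + (1 + (1 + (1 + (1 +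
      (ite rSum u0 search skip).cost t))))) := by
    rw [ht]; rfl
  rw [hev, hco]
  clear hev hco ht
  by_cases hlt : t.reg rSum < t.reg u0
  · rw [Code.ev, if_pos hlt, Code.cost, if_pos hlt]
    have hcomp : Nat.card G.graph.ConnectedComponent ≤ 1 := by omega
    have hcard := card_candidates_le i1 iM ic ins
    have hsc : search.cost t ≤ _ := search_cost_le
    rw [i1.input.k] at hsc
    refine ⟨(search_spec i1 iR hd iM ic ins).trans urfe_iff_nonempty_rectLayout.symm, ?_, ?_⟩
    · have h5 : (maxFace.size + candidates.size + tryPair.size + 4) *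
          ((candidates.ev (maxFace.ev t)).reg rNc + 1) ^ 2 * (k + 1) ≤
          (maxFace.size + candidates.size + tryPair.size + 4) * (k + 1) ^ 2 * (k + 1) := by
        gcongr
        exact hcard.1
      have h6 := hsc.trans h5
      have h8 : traverseFaces.size * (k + 1) ≤ traverseFaces.size * (k + 1) ^ 3 :=
        Nat.mul_le_mul_left _ (Nat.le_self_pow (by norm_num) _)
      have h9 : 1 ≤ (k + 1) ^ 3 := Nat.one_le_pow _ _ (by omega)
      rw [mul_assoc, ← pow_succ, show 2 + 1 = 3 from rfl] at h6
      calc _ ≤ traverseFaces.size * (k + 1) ^ 3 + (maxFace.size + candidates.size + tryPair.size +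
            4) * (k + 1) ^ 3 + 8 * (k + 1) ^ 3 := by omega
        _ = _ := by ring
    · intro hH
      have h6 : (candidates.ev (maxFace.ev t)).reg rNc ≤ 12 := by
        -- The empty graph has at most one component but is not connected in the sense of
        -- `Connected`, so it is treated separately.
        rcases Nat.eq_zero_or_pos n with hn0 | hn0
        · have : k = 0 := by
            by_contra hk
            have := (e ⟨0, by omega⟩).fst.isLt
            omega
          omega
        · have : Nonempty (Fin n) := ⟨⟨0, hn0⟩⟩
          exact hcard.2 (hH ⟨card_connectedComponent_le_one_iff.1 hcomp⟩)
      have h5 : (maxFace.size + candidates.size + tryPair.size + 4) *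
          ((candidates.ev (maxFace.ev t)).reg rNc + 1) ^ 2 * (k + 1) ≤
          (maxFace.size + candidates.size + tryPair.size + 4) * 13 ^ 2 * (k + 1) := by
        gcongr
        omega
      have h6 := hsc.trans h5
      have h9 : traverseFaces.size * (k + 1) ≤ traverseFaces.size * (k + 1) * 169 := by omega
      calc _ ≤ traverseFaces.size * (k + 1) * 169 + (maxFace.size + candidates.size + tryPair.size +
            4) * 13 ^ 2 * (k + 1) + 8 * 169 * (k + 1) := by omega
        _ = _ := by ring
  · rw [Code.ev, if_neg hlt, Code.cost, if_neg hlt, show skip.cost t = 1 from rfl]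
    have hU : ¬ G.URFE := fun hU => by
      have := card_connectedComponent_le_one_iff.2 hU.connected.preconnected
      omega
    refine ⟨by simp [Code.ev, iR, hU], ?_, fun _ => ?_⟩
    · calc _ ≤ (traverseFaces.size + 12) * (k + 1) := by rw [add_mul]; omega
        _ ≤ (traverseFaces.size + 12) * (k + 1) ^ 3 :=
          Nat.mul_le_mul_left _ (Nat.le_self_pow (by norm_num) _)
        _ ≤ _ := by gcongr; omega
    · calc _ ≤ (traverseFaces.size + 12) * (k + 1) := by rw [add_mul]; omega
        _ ≤ _ := Nat.mul_le_mul_right _ (by omega)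

end PlanarEmbeddedGraph

/-! ### The complete program -/

namespace PlanarEmbeddedGraph

open Code

variable {n k : ℕ} {G : PlanarEmbeddedGraph n} {e : Fin k ≃ G.graph.Dart}

theorem card_startVertices_lt_iff :
    (startVertices e k).card < n ↔ ¬ ∀ v, ∃ d : G.graph.Dart, d.fst = v := by
  have h := Finset.card_lt_iff_ne_univ (startVertices e k)
  rw [Fintype.card_fin, ne_eq, Finset.eq_univ_iff_forall] at h
  rw [h]
  simp [startVertices, idx_lt]

theorem URFE.exists_dart (h : G.URFE) (v : Fin n) : ∃ d : G.graph.Dart, d.fst = v := by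
  obtain ⟨L⟩ := urfe_iff_nonempty_rectLayout.1 h
  exact L.exists_dart v

theorem URFE.le_of_equiv (h : G.URFE) (e : Fin k ≃ G.graph.Dart) : k ≤ 4 * n := by
  obtain ⟨L⟩ := urfe_iff_nonempty_rectLayout.1 h
  have := L.card_dart_le
  rwa [← Fintype.card_congr e, Fintype.card_fin] at this

theorem readGraph_spec {s : RAMState} (h : InputEnv e s)
    (h0 : ∀ r ∈ [rRes, rCnt, rSum, rD, rE, rMax, rNc, rNs], s.reg r = 0)
    (hA : ∀ a ∈ [aFid, aHf, aHc, aMark], ∀ i, s.arr a i = 0) :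
    ((readGraph.ev s).reg rRes = 1 ↔ G.URFE) ∧
      readGraph.cost s ≤ (markVertices.size + nextDarts.size + traverseFaces.size + maxFace.size +
        candidates.size + tryPair.size + 14) * (k + 1) ^ 3 ∧
      ((G.graph.Connected → ∀ f g : G.Face, 6 < G.degree f → 6 < G.degree g → f = g) →
        readGraph.cost s ≤ (markVertices.size + nextDarts.size + traverseFaces.size + maxFace.size +
          candidates.size + tryPair.size + 14) * 169 * (k + 1)) := by
  simp only [List.forall_mem_cons, List.not_mem_nil, false_imp_iff, implies_true, and_true] at h0 hA
  obtain ⟨hR, hCnt, hSum, hD, hE, hM, hc, hs⟩ := h0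
  obtain ⟨hA1, hA2, hA3, hA4⟩ := hA
  obtain ⟨m1, m2⟩ := markVertices_spec h hCnt hSum fun v => hA4 v
  have i1 : InputEnv e (markVertices.ev s) := h.ev rfl
  have c1 : markVertices.cost s ≤ markVertices.size * (k + 1) ^ markVertices.depth :=
    cost_le_size (R := [rK]) rfl (by simp [h.k])
  have c2 : nextDarts.cost (markVertices.ev s) ≤ nextDarts.size * (k + 1) ^ nextDarts.depth :=
    cost_le_size (R := [rK]) rfl (by simp [i1.k])
  rw [show markVertices.depth = 1 from rfl, pow_one] at c1
  rw [show nextDarts.depth = 1 from rfl, pow_one] at c2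
  obtain ⟨t, ht⟩ : ∃ t, t = nextDarts.ev (markVertices.ev s) := ⟨_, rfl⟩
  have i2 : InputEnv e t := by rw [ht]; exact i1.ev rfl
  have hn : ∀ d, t.arr aNxt (idx e d) = idx e (G.faceNext d) := by
    rw [ht]; exact nextDarts_spec i1
  have hr : ∀ r ∈ [rD, rE, rRes, rMax, rNc, rNs], t.reg r = 0 := by
    simp only [List.forall_mem_cons, List.not_mem_nil, false_imp_iff, implies_true, and_true]
    rw [ht]
    refine ⟨?_, ?_, ?_, ?_, ?_, ?_⟩ <;> rw [ev_reg rfl, ev_reg rfl] <;> assumption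
  have ha : ∀ a ∈ [aFid, aHf, aHc], ∀ i, t.arr a i = 0 := by
    simp only [List.forall_mem_cons, List.not_mem_nil, false_imp_iff, implies_true, and_true]
    rw [ht]
    refine ⟨?_, ?_, ?_⟩ <;> rw [ev_arr rfl, ev_arr rfl] <;> assumption
  have hcnt : t.reg rCnt = (startVertices e k).card := by rw [ht, ev_reg rfl, m1]
  have hsum : t.reg rSum = 2 * (startVertices e k).card := by rw [ht, ev_reg rfl, m2]
  have hev : readGraph.ev s = (ite rCnt rN skip numberFaces).ev t := by rw [ht]; rfl
  have hco : readGraph.cost s = markVertices.cost s + (nextDarts.cost (markVertices.ev s) +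
      (ite rCnt rN skip numberFaces).cost t) := by rw [ht]; rfl
  rw [hev, hco]
  clear hev hco ht
  have hlt : t.reg rCnt < t.reg rN ↔ ¬ ∀ v, ∃ d : G.graph.Dart, d.fst = v := by
    rw [hcnt, i2.n, card_startVertices_lt_iff]
  by_cases hd : ∀ v, ∃ d : G.graph.Dart, d.fst = v
  · have hlt' : ¬ t.reg rCnt < t.reg rN := by rw [hlt]; exact not_not_intro hd
    rw [Code.ev, if_neg hlt', Code.cost, if_neg hlt']
    have hcard : (startVertices e k).card = n :=
      le_antisymm (by simpa using Finset.card_le_univ (startVertices e k))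
        (by rwa [hcnt, i2.n, not_lt] at hlt')
    obtain ⟨n1, n2, n3⟩ := numberFaces_spec i2 hn hr ha hd (by rw [hsum, hcard])
    refine ⟨n1, ?_, fun hH => ?_⟩
    · calc _ ≤ markVertices.size * (k + 1) + (nextDarts.size * (k + 1) + ((traverseFaces.size +
            maxFace.size + candidates.size + tryPair.size + 12) * (k + 1) ^ 3 + (k + 1))) := by
            gcongr
            omega
        _ ≤ markVertices.size * (k + 1) ^ 3 + (nextDarts.size * (k + 1) ^ 3 +
            ((traverseFaces.size + maxFace.size + candidates.size + tryPair.size + 12) *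
              (k + 1) ^ 3 + 2 * (k + 1) ^ 3)) := by
            have : k + 1 ≤ (k + 1) ^ 3 := Nat.le_self_pow (by norm_num) _
            gcongr
            omega
        _ = _ := by ring
    · have := n3 hH
      calc _ ≤ markVertices.size * (k + 1) * 169 + (nextDarts.size * (k + 1) * 169 +
            ((traverseFaces.size + maxFace.size + candidates.size + tryPair.size + 12) * 169 *
              (k + 1) + 2 * 169 * (k + 1))) := by omega
        _ = _ := by ring
  · have hlt' : t.reg rCnt < t.reg rN := hlt.2 hd
    rw [Code.ev, if_pos hlt', Code.cost, if_pos hlt', show skip.cost t = 1 from rfl]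
    have hU : ¬ G.URFE := fun hU => hd hU.exists_dart
    have hR' : t.reg rRes = 0 := hr rRes (by simp)
    have hk : markVertices.cost s + (nextDarts.cost (markVertices.ev s) + (1 + 1)) ≤
        (markVertices.size + nextDarts.size + 2) * (k + 1) := by
      rw [add_mul, add_mul]
      omega
    refine ⟨by simp [Code.ev, hR', hU], hk.trans ?_, fun _ => hk.trans ?_⟩
    · exact Nat.mul_le_mul (by omega) (Nat.le_self_pow (by norm_num) _)
    · exact Nat.mul_le_mul_right _ (by omega)

/-- Graphs with more than `4 * n` darts are rejected after `O(n)` steps, before any array is read,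
so afterwards bounds in `k` become bounds in `n`. -/
theorem decide_spec : ∃ C : ℕ, ∀ {n k : ℕ} (G : PlanarEmbeddedGraph n) (e : Fin k ≃ G.graph.Dart),
    ((decide.ev ((G.input e).setReg rOne 1)).reg rN = 1 ↔ G.URFE) ∧
      decide.cost ((G.input e).setReg rOne 1) ≤ C * (n + 1) ^ 3 ∧
      ((G.graph.Connected → ∀ f g : G.Face, 6 < G.degree f → 6 < G.degree g → f = g) →
        decide.cost ((G.input e).setReg rOne 1) ≤ C * (n + 1)) := by
  obtain ⟨c, hc⟩ : ∃ c, c = markVertices.size + nextDarts.size + traverseFaces.size +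
    maxFace.size + candidates.size + tryPair.size + 14 := ⟨_, rfl⟩
  -- The constant is 676 = 4 * 169, from `k + 1 ≤ 4 * (n + 1)` in the linear bound; it also exceeds
  -- the 64 = 4 ^ 3 of the cubic bound.
  refine ⟨quadruple.size + c * 676 + 6, fun {n k} G e => ?_⟩
  obtain ⟨s, hs⟩ : ∃ s, s = constants.ev ((G.input e).setReg rOne 1) := ⟨_, rfl⟩
  have i1 : InputEnv e s := by rw [hs]; exact constants_spec
  have hr : ∀ r ∈ [rRes, rCnt, rSum, rD, rE, rMax, rNc, rNs, rQuad], s.reg r = 0 := by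
    simp only [List.forall_mem_cons, List.not_mem_nil, false_imp_iff, implies_true, and_true]
    rw [hs]
    refine ⟨?_, ?_, ?_, ?_, ?_, ?_, ?_, ?_, ?_⟩ <;> rw [ev_reg rfl] <;> rfl
  have ha : ∀ a ∈ [aFid, aHf, aHc, aMark], ∀ i, s.arr a i = 0 := by
    simp only [List.forall_mem_cons, List.not_mem_nil, false_imp_iff, implies_true, and_true]
    rw [hs]
    refine ⟨?_, ?_, ?_, ?_⟩ <;> rw [ev_arr rfl] <;> simp [PlanarEmbeddedGraph.input]
  have cq : quadruple.cost s ≤ quadruple.size * (n + 1) ^ quadruple.depth :=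
    cost_le_size (R := [rN]) rfl (by simp [i1.n])
  rw [show quadruple.depth = 1 from rfl, pow_one] at cq
  obtain ⟨t, ht⟩ : ∃ t, t = quadruple.ev s := ⟨_, rfl⟩
  have i2 : InputEnv e t := by rw [ht]; exact i1.ev rfl
  have hq : t.reg rQuad = 4 * n := by rw [ht, quadruple_spec i1 (hr rQuad (by simp))]
  have hr' : ∀ r ∈ [rRes, rCnt, rSum, rD, rE, rMax, rNc, rNs], t.reg r = 0 := by
    simp only [List.forall_mem_cons, List.not_mem_nil, false_imp_iff, implies_true,
      and_true] at hr ⊢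
    rw [ht]
    refine ⟨?_, ?_, ?_, ?_, ?_, ?_, ?_, ?_⟩ <;> rw [ev_reg rfl] <;> tauto
  have ha' : ∀ a ∈ [aFid, aHf, aHc, aMark], ∀ i, t.arr a i = 0 := by
    simp only [List.forall_mem_cons, List.not_mem_nil, false_imp_iff, implies_true,
      and_true] at ha ⊢
    rw [ht]
    refine ⟨?_, ?_, ?_, ?_⟩ <;> rw [ev_arr rfl] <;> tauto
  have hev : (decide.ev ((G.input e).setReg rOne 1)).reg rN =
      ((ite rQuad rK skip readGraph).ev t).reg rRes := by
    rw [ht, hs]; rfl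
  have hco : decide.cost ((G.input e).setReg rOne 1) = 1 + (1 + 1) + (quadruple.cost s +
      ((ite rQuad rK skip readGraph).cost t + 1)) := by
    rw [ht, hs]; rfl
  rw [hev, hco]
  clear hev hco ht hs
  by_cases hk : 4 * n < k
  · have hlt : t.reg rQuad < t.reg rK := by rwa [hq, i2.k]
    rw [Code.ev, if_pos hlt, Code.cost, if_pos hlt, show skip.cost t = 1 from rfl]
    have hU : ¬ G.URFE := fun hU => by
      have := hU.le_of_equiv e
      omega
    have hR : t.reg rRes = 0 := hr' rRes (by simp)
    have h1 : 1 + (1 + 1) + (quadruple.cost s + (1 + 1 + 1)) ≤ (quadruple.size + 6) * (n + 1) := by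
      rw [add_mul]
      omega
    refine ⟨by simp [Code.ev, hR, hU], h1.trans ?_, fun _ => h1.trans ?_⟩
    · exact Nat.mul_le_mul (by omega) (Nat.le_self_pow (by norm_num) _)
    · exact Nat.mul_le_mul_right _ (by omega)
  · have hlt : ¬ t.reg rQuad < t.reg rK := by rwa [hq, i2.k]
    rw [Code.ev, if_neg hlt, Code.cost, if_neg hlt]
    obtain ⟨r1, r2, r3⟩ := readGraph_spec i2 hr' ha'
    rw [← hc] at r2 r3
    refine ⟨r1, ?_, fun hH => ?_⟩
    · have h2 : c * (k + 1) ^ 3 ≤ c * (4 * (n + 1)) ^ 3 :=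
        Nat.mul_le_mul_left _ (Nat.pow_le_pow_left (by omega) _)
      have h3 : c * (4 * (n + 1)) ^ 3 = 64 * (c * (n + 1) ^ 3) := by ring
      have h4 : n + 1 ≤ (n + 1) ^ 3 := Nat.le_self_pow (by norm_num) _
      have h5 : quadruple.size * (n + 1) ≤ quadruple.size * (n + 1) ^ 3 :=
        Nat.mul_le_mul_left _ h4
      have h6 : c * 676 * (n + 1) ^ 3 = 676 * (c * (n + 1) ^ 3) := by ring
      rw [add_mul, add_mul, h6]
      omega
    · have h1 := r3 hH
      have h2 : c * 169 * (k + 1) ≤ c * 169 * (4 * (n + 1)) := Nat.mul_le_mul_left _ (by omega)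
      have h3 : c * 169 * (4 * (n + 1)) = c * 676 * (n + 1) := by ring
      rw [add_mul, add_mul]
      omega

theorem card_dart_le_mul (e : Fin k ≃ G.graph.Dart) : k ≤ n * n := by
  have := Fintype.card_le_of_injective _
    ((SimpleGraph.Dart.toProd_injective (G := G.graph)).comp e.injective)
  simpa using this

/-- The number of darts may be quadratic before the program has tested it; the summand 12 covers the
constants of the program. -/
theorem bounded_input (e : Fin k ≃ G.graph.Dart) : Bounded (n * n + n + 12) (G.input e) := by
  have hk := card_dart_le_mul e
  constructor
  · intro r
    simp only [PlanarEmbeddedGraph.input]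
    split_ifs <;> omega
  · intro a i
    simp only [PlanarEmbeddedGraph.input]
    split_ifs with h
    · have := (e ⟨i, h⟩).fst.isLt
      omega
    · have := (e.symm (e ⟨i, h⟩).symm).isLt
      omega
    · have := (e.symm (G.rot (e ⟨i, h⟩))).isLt
      omega
    all_goals omega

end PlanarEmbeddedGraph

/-- The initial bound and the time are together at most `C + 13` times a cube, and a power with
exponent `C + 20` of a number that is at least 2 exceeds the factor. -/
theorem mul_self_add_lt_pow (C n : ℕ) :
    n * n + n + 12 + C * (n + 1) ^ 3 < (n + 2) ^ (C + 23) := by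
  have h3 : n * n + n + 12 ≤ 13 * (n + 2) ^ 3 := by ring_nf; nlinarith
  have h1 : C + 13 < (n + 2) ^ (C + 20) :=
    lt_of_lt_of_le ((show C + 13 < C + 20 by omega).trans Nat.lt_two_pow_self)
      (Nat.pow_le_pow_left (by omega) _)
  have h2 : C * (n + 1) ^ 3 ≤ C * (n + 2) ^ 3 :=
    Nat.mul_le_mul_left _ (Nat.pow_le_pow_left (by omega) _)
  have h5 : (n + 2) ^ (C + 23) = (n + 2) ^ (C + 20) * (n + 2) ^ 3 := by
    rw [← pow_add]
  rw [h5]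
  refine lt_of_le_of_lt ?_ (mul_lt_mul_of_pos_right h1 (Nat.pow_pos (Nat.succ_pos _)))
  rw [add_mul, add_comm]
  exact Nat.add_le_add h2 h3

/-- There is a single program (for a random access machine with words of `O(log n)` bits) that
decides URFE for all planar embedded graphs in cubic time, and in linear time if all but at most one
face have degree at most `6` (for a disconnected graph: always in linear time). Moreover, in every
unit-length rectangular embedding-preserving drawing of a planar embedded graph other than a simple
even cycle, the outer face is the unique face of maximum degree. -/
theorem theorem5 :
    (∃ (P : RAMProg) (K C : ℕ), ∀ (n k : ℕ) (G : PlanarEmbeddedGraph n) (e : Fin k ≃ G.graph.Dart),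
      ∃ (t : ℕ) (s : RAMState),
        RAMExec ((n + 2) ^ K) P (G.input e) t s ∧
        (s.reg 0 = 1 ↔ G.URFE) ∧
        t ≤ C * (n + 1) ^ 3 ∧
        ((G.graph.Connected →
            ∀ f g : G.Face, 6 < G.degree f → 6 < G.degree g → f = g) →
          t ≤ C * (n + 1))) ∧
    (∀ (n : ℕ) (G : PlanarEmbeddedGraph n) (p : Fin n → ℂ), G.IsUnitRectangularDrawing p →
      G.IsEvenCycle ∨
        ∃ f : G.Face, (∀ g : G.Face, G.IsOuterFace p g ↔ g = f) ∧
          ∀ g : G.Face, g ≠ f → G.degree g < G.degree f) := by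
  refine ⟨?_, fun n G p hp => hp.isEvenCycle_or⟩
  obtain ⟨C, hC⟩ := PlanarEmbeddedGraph.decide_spec
  -- One more step puts 1 into `rOne`, on which all increments rely; hence `C + 1`.
  refine ⟨.seq (.const rOne 1) Code.decide.compile, C + 23, C + 1, fun n k G e => ?_⟩
  obtain ⟨h1, h2, h3⟩ := hC G e
  have hpow := mul_self_add_lt_pow C n
  have hb : Code.Bounded (n * n + n + 12) ((G.input e).setReg rOne 1) :=
    (PlanarEmbeddedGraph.bounded_input e).setReg (by omega)
  have hM : Code.decide.maxConst ≤ n * n + n + 12 :=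
    Code.decide_maxConst.trans_le (Nat.le_add_left _ _)
  have hone : ((G.input e).setReg rOne 1).reg rOne = 1 := by simp only [Code.setReg_reg, if_pos]
  have hex := (Code.ramExec Code.decide_wellFormed Code.decide_writes_one hone hb hM
    ((Nat.add_le_add_left h2 _).trans_lt hpow)).1
  refine ⟨_, _, .seq (.const _ _ _ (Nat.one_lt_pow (by omega) (by omega))) hex, h1, ?_,
    fun hH => ?_⟩
  · have := Nat.one_le_pow 3 (n + 1) (by omega)
    rw [add_mul, one_mul, add_comm]
    exact Nat.add_le_add h2 this
  · rw [add_mul, one_mul, add_comm]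
    exact Nat.add_le_add (h3 hH) (Nat.le_add_left _ _)
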